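/- Let $\mathbb F$ be $\mathbb R$ or $\mathbb C$, let $n\ge 1$ and $d\ge 2$ be integers, let $\delta\in(0,1)$, and let $\mathcal X\subseteq \mathcal V=\mathbb F^n$ be an irreducible conic variety cut out by $p=\delta\binom{n+d-1}{d}$ linearly independent homogeneous degree-$d$ polynomials $f_1,\dots,f_p$. Suppose that $\mathcal X$ is non-degenerate of order $d-1$, i.e. no nonzero homogeneous polynomial of degree $d-1$ vanishes on $\mathcal X$. Let $\mathcal W$ be a finite-dimensional $\mathbb F$-vector space. *Definitions.* An $(\mathcal X,\mathcal W)$-decomposition of length $R$ of $T\in\mathcal V\otimes\mathcal W$ is an expression $T=\sum_{a=1}^R v_a\otimes w_a$ with $v_a\in\mathcal X$, $w_a\in\mathcal W$. It is the unique $(\mathcal X,\mathcal W)$-rank decomposition of $T$ if no decomposition of $T$ is shorter and every decomposition of length $R$ arises from it by permuting the $R$ summands. A property holds for generically chosen $v_1,\dots,v_R\in\mathcal X$ if it holds on a Zariski open dense subset of $\mathcal X^{\times R}$. *Algorithm 1*, on input a basis $u_1,\dots,u_k$ of a subspace $\mathcal U\subseteq\mathcal V$ and $f_1,\dots,f_p$,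 computes a basis $P_1,\dots,P_s$ of $S^d(\mathcal U)\cap I_d^\perp$, where $I_d=\mathrm{span}\{f_1,\dots,f_p\}\subseteq S^d(\mathcal V^*)$. If $s=0$ it outputs "$\mathcal U$ trivially intersects $\mathcal X$"; if $s>k$ it outputs "Fail"; otherwise it runs the simultaneous diagonalization algorithm, with random functionals $\varphi,\psi\in(\mathbb F^s)^*$ (drawn from any distribution absolutely continuous with respect to Lebesgue measure), on $\sum_i e_i\otimes P_i\in\mathbb F^s\otimes\mathcal V\otimes\mathcal V^{\otimes(d-1)}$. If this yields a decomposition $\sum_{i=1}^s z_i\otimes v_i^{\otimes d}$ with $z_1,\dots,z_s$ linearly independent and $v_1,\dots,v_s$ linearly independent, it outputs "the only elements of $\mathcal U\cap\mathcal X$ are $\{v_1,\dots,v_s\}$ (up to scale)"; otherwise it outputs "Fail". To decompose a tensor $T$, run Algorithm 1 on a basis of $\mathcal U=T(\mathcal W^*)$. If it finds $v_1,\dots,v_r$ with $r=\dim\mathcal U$, output $\sum_a v_a\otimes T(g_a)$, where $g_1,\dots,g_r\in\mathcal V^*$ are dual to $v_1,\dots,v_r$ (for $T=0$, output the empty decomposition);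 otherwise output "Fail". **Theorem.** (1) (Running time and certification.) This procedure is carried out by one uniform program, for a random access machine with exact arithmetic over $\mathbb F$ (including conjugation) and an oracle that diagonalizes matrices. There is an absolute constant $C$ such that on every input $(f_1,\dots,f_p,T)$ as above and for every random choice the program halts in time at most $n^{Cd}+(\dim\mathcal W)^{C}$ with at most $C$ oracle calls. Hence the time is $n^{O(d)}$, apart from a term polynomial in $\dim\mathcal W$ for handling the coordinates of $T$. Whenever its output is not "Fail", that output is the unique $(\mathcal X,\mathcal W)$-rank decomposition of $T$. (2) (Uniqueness and recovery.) Let $$R\le\min\Big\{\frac{\delta}{d!}(n+d-1),\ \dim\mathcal W\Big\}.$$ For generically chosen $v_1,\dots,v_R\in\mathcal X$ and for all linearly independent $w_1,\dots,w_R\in\mathcal W$, the expression $T=\sum_{a=1}^R v_a\otimes w_a$ is the unique $(\mathcal X,\mathcal W)$-rank decomposition of $T$. Moreover, Algorithm 1, on any basis of $T(\mathcal W^*)$ and with any choice of the basis $P_1,\dots,P_s$, outputs with probability one $v_1,\dots,v_R$ up to order and nonzero scalars ("trivially intersects" if $R=0$), and the program of (1) outputs with probability one the decomposition $\sum_{a}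 v_a\otimes w_a$ up to permuting its summands. -/

import Mathlib

open scoped TensorProduct

/-! ### The Zariski topology -/

/-- The common zero set in `F^σ` of a set of polynomials. -/
def polyZeros {F : Type*} [Field F] {σ : Type*} (S : Set (MvPolynomial σ F)) : Set (σ → F) :=
  {x | ∀ g ∈ S, MvPolynomial.eval x g = 0}

/-- The Zariski topology on affine space `F^σ`: the closed sets are the varieties. -/
@[reducible]
def zariskiTopology (F : Type*) [Field F] (σ : Type*) : TopologicalSpace (σ → F) :=
  TopologicalSpace.ofClosed {Z | ∃ S : Set (MvPolynomial σ F), Z = polyZeros S}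
    ⟨{1}, by ext x; simp [polyZeros]⟩
    (by
      intro A hA
      refine ⟨{g | ∃ Z ∈ A, ∀ x ∈ Z, MvPolynomial.eval x g = 0}, ?_⟩
      ext x
      constructor
      · rintro hx g ⟨Z, hZ, hg⟩
        exact hg x (hx Z hZ)
      · intro hx Z hZ
        obtain ⟨S, rfl⟩ := hA hZ
        intro g hg
        exact hx g ⟨_, hZ, fun y hy => hy g hg⟩)
    (by
      rintro A ⟨S, rfl⟩ B ⟨T, rfl⟩
      refine ⟨{g | ∃ a ∈ S, ∃ b ∈ T, g = a * b}, ?_⟩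
      ext x
      constructor
      · rintro (hx | hx) g ⟨a, ha, b, hb, rfl⟩
        · simp [hx a ha]
        · simp [hx b hb]
      · intro hx
        by_contra hcon
        simp only [Set.mem_union, polyZeros, Set.mem_ofPred_eq, not_or, not_forall] at hcon
        obtain ⟨⟨a, ha, ha0⟩, b, hb, hb0⟩ := hcon
        have h := hx (a * b) ⟨a, ha, b, hb, rfl⟩
        rw [map_mul, mul_eq_zero] at h
        exact h.elim ha0 hb0)

/-- The Zariski topology on the space `V^{×R}` of `R`-tuples of vectors of `V = F^n`, seen as the
affine space of dimension `R n` (it is finer than the product of the Zariski topologies). -/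
@[reducible]
def zariskiTuples (F : Type*) [Field F] (R n : ℕ) : TopologicalSpace (Fin R → Fin n → F) :=
  TopologicalSpace.induced Function.uncurry (zariskiTopology F (Fin R × Fin n))

/-- Irreducibility of a subset of `F^n` in the Zariski topology. -/
def ZariskiIrreducible {F : Type*} [Field F] {n : ℕ} (X : Set (Fin n → F)) : Prop :=
  @IsIrreducible _ (zariskiTopology F (Fin n)) X

/-- `P` holds for generically chosen `v_1, …, v_R ∈ X`: there is a Zariski open dense subset
`A = O ∩ X^{×R}` of `X^{×R}` all of whose elements satisfy `P`. -/
def ForGenericTuple {F : Type*} [Field F] {n : ℕ} (X : Set (Fin n → F)) (R : ℕ)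
    (P : (Fin R → Fin n → F) → Prop) : Prop :=
  ∃ O : Set (Fin R → Fin n → F), @IsOpen _ (zariskiTuples F R n) O ∧
    {v | ∀ a, v a ∈ X} ⊆ @closure _ (zariskiTuples F R n) (O ∩ {v | ∀ a, v a ∈ X}) ∧
    ∀ v ∈ O ∩ {v | ∀ a, v a ∈ X}, P v

/-- `X` is non-degenerate of order `e`: no nonzero form of degree `e` vanishes on `X`. -/
def NonDegenerateOfOrder {F : Type*} [Field F] {n : ℕ} (X : Set (Fin n → F)) (e : ℕ) : Prop :=
  ∀ g : MvPolynomial (Fin n) F, g.IsHomogeneous e →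
    (∀ v ∈ X, MvPolynomial.eval v g = 0) → g = 0

/-! ### Decompositions over a variety -/

section Decompositions

variable {F : Type*} [Field F] {n : ℕ} {W : Type*} [AddCommGroup W] [Module F W]

/-- `T = ∑ v_a ⊗ w_a` is an `(X, W)`-decomposition of `T`. -/
structure IsXWDecomposition (X : Set (Fin n → F)) (T : (Fin n → F) ⊗[F] W) {R : ℕ}
    (v : Fin R → Fin n → F) (w : Fin R → W) : Prop where
  mem : ∀ a, v a ∈ X
  sum : T = ∑ a, v a ⊗ₜ[F] w a

/-- The two lists `v_a ⊗ w_a` and `v'_a ⊗ w'_a` of summands agree up to a permutation. -/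
def SameSummands {R : ℕ} (v : Fin R → Fin n → F) (w : Fin R → W)
    (v' : Fin R → Fin n → F) (w' : Fin R → W) : Prop :=
  ∃ τ : Equiv.Perm (Fin R), ∀ a, v' a ⊗ₜ[F] w' a = v (τ a) ⊗ₜ[F] w (τ a)

/-- `T = ∑ v_a ⊗ w_a` is the unique `(X, W)`-rank decomposition of `T`: its length is the
`(X, W)`-rank of `T`, and the others of this length arise by permuting its summands. -/
structure IsUniqueXWRankDecomposition (X : Set (Fin n → F)) (T : (Fin n → F) ⊗[F] W) {R : ℕ}
    (v : Fin R → Fin n → F) (w : Fin R → W) : Prop where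
  isDecomposition : IsXWDecomposition X T v w
  minimal : ∀ (R' : ℕ) (v' : Fin R' → Fin n → F) (w' : Fin R' → W),
    IsXWDecomposition X T v' w' → R ≤ R'
  unique : ∀ (v' : Fin R → Fin n → F) (w' : Fin R → W),
    IsXWDecomposition X T v' w' → SameSummands v w v' w'

/-- `T ∈ V ⊗ W` as a linear map `W* → V`. -/
noncomputable def tensorToV (T : (Fin n → F) ⊗[F] W) : Module.Dual F W →ₗ[F] (Fin n → F) where
  toFun g := TensorProduct.rid F (Fin n → F) (LinearMap.lTensor (Fin n → F) g T)
  map_add' g h := by simp [LinearMap.lTensor_add]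
  map_smul' c g := by simp [LinearMap.lTensor_smul]

/-- `T ∈ V ⊗ W` as a map `V* → W`. -/
noncomputable def tensorToW (T : (Fin n → F) ⊗[F] W) (g : Module.Dual F (Fin n → F)) : W :=
  TensorProduct.lid F W (LinearMap.rTensor W g T)

end Decompositions

/-! ### Symmetric tensors -/

section Symmetric

variable {F : Type*} [Field F] {n : ℕ}

/-- Elements of `V^{⊗d}` for `V = F^n`, in coordinates. -/
abbrev TensorPow (F : Type*) (n d : ℕ) : Type _ := (Fin d → Fin n) → F

/-- `u_1 ⊗ ⋯ ⊗ u_d`. -/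
def pureTensor {d : ℕ} (u : Fin d → Fin n → F) : TensorPow F n d := fun i => ∏ k, u k (i k)

/-- `v^{⊗d}`. -/
def tensorPower (d : ℕ) (v : Fin n → F) : TensorPow F n d := pureTensor fun _ => v

/-- `S^d(U) ⊆ V^{⊗d}`: the tensors in `U^{⊗d}` that are invariant under permuting the factors. -/
def symPower (d : ℕ) (U : Submodule F (Fin n → F)) : Submodule F (TensorPow F n d) :=
  Submodule.span F {t | ∃ u : Fin d → Fin n → F, (∀ k, u k ∈ U) ∧ t = pureTensor u} ⊓
  { carrier := {t | ∀ (τ : Equiv.Perm (Fin d)) (i : Fin d → Fin n), t (i ∘ τ) = t i}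
    add_mem' := fun {a b} ha hb τ i => by simp [ha τ i, hb τ i]
    zero_mem' := fun _ _ => rfl
    smul_mem' := fun c a ha τ i => by simp [ha τ i] }

/-- The exponent of the monomial `x_{i_1} ⋯ x_{i_d}`. -/
noncomputable def monomialExponent {d : ℕ} (i : Fin d → Fin n) : Fin n →₀ ℕ :=
  ∑ k, Finsupp.single (i k) 1

open Classical in
/-- The pairing between a form of degree `d`, as an element of `S^d(V*)`, and a symmetric tensor
`t ∈ S^d(V)`: the monomial `x_{i_1} ⋯ x_{i_d}`, `i_1 ≤ ⋯ ≤ i_d`, pairs with `t` to the coordinate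
`t (i_1, …, i_d)`. In particular `g` pairs with `v^{⊗d}` to `g(v)`. -/
noncomputable def formPairing {d : ℕ} (g : MvPolynomial (Fin n) F) (t : TensorPow F n d) : F :=
  ∑ i ∈ Finset.univ.filter (fun i : Fin d → Fin n => Monotone i),
    g.coeff (monomialExponent i) * t i

/-- The annihilator in `V^{⊗d}` of the forms `f_1, …, f_p`; its intersection with `S^d(V)` is
`I_d^⊥`, where `I_d = span {f_1, …, f_p}`. -/
noncomputable def formAnnihilator {p : ℕ} (d : ℕ) (f : Fin p → MvPolynomial (Fin n) F) :
    Submodule F (TensorPow F n d) where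
  carrier := {t | ∀ l, formPairing (f l) t = 0}
  add_mem' := fun {a b} ha hb l => by
    have h1 := ha l
    have h2 := hb l
    simp only [formPairing] at h1 h2 ⊢
    simp [mul_add, Finset.sum_add_distrib, h1, h2]
  zero_mem' := fun l => by simp [formPairing]
  smul_mem' := fun c a ha l => by
    have h1 := ha l
    simp only [formPairing] at h1 ⊢
    simp only [Pi.smul_apply, smul_eq_mul, mul_left_comm _ c, ← Finset.mul_sum, h1, mul_zero]

/-- An element of `V^{⊗d}` regarded as an element of `V ⊗ V^{⊗(d-1)}` (for `d ≥ 1`). -/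
def splitFirst {d : ℕ} (t : TensorPow F n d) : Matrix (Fin n) (Fin (d - 1) → Fin n) F :=
  fun i j => t fun k => if h : (k : ℕ) = 0 then i else j ⟨k - 1, by have := k.isLt; omega⟩

end Symmetric

/-! ### The simultaneous diagonalization algorithm -/

section SimDiag

variable {F : Type*} [RCLike F]

/-- `B` is the Moore-Penrose pseudoinverse of `A` (the four Penrose equations, which determine
`B`). -/
structure IsPseudoinverse {ι κ : Type*} [Fintype ι] [Fintype κ]
    (A : Matrix ι κ F) (B : Matrix κ ι F) : Prop where
  left : A * B * A = A
  right : B * A * B = B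
  hermitian_left : (A * B).IsHermitian
  hermitian_right : (B * A).IsHermitian

/-- `T(φ) = ∑ φ_i T_i`, where a tensor `T ∈ F^s ⊗ F^ι ⊗ F^κ` is given by its slices
`T_i ∈ F^ι ⊗ F^κ`. -/
def sliceCombination {s : ℕ} {ι κ : Type*} (T : Fin s → Matrix ι κ F) (φ : Fin s → F) :
    Matrix ι κ F := ∑ i, φ i • T i

/-- On input `T ∈ F^s ⊗ F^ι ⊗ F^κ`, with random choices `φ, ψ ∈ (F^s)*`, the simultaneous
diagonalization algorithm may output the decomposition `{x_a ⊗ y_a ⊗ z_a : a ∈ [r]}`. It outputs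
"Fail" if and only if no such output exists. The eigenvectors `y_a`, `z_a` are determined up to
scale; the functionals `h_a` are any that are dual to the `y_a ⊗ z_a`. -/
def SimDiagOutput {s : ℕ} {ι κ : Type*} [Fintype ι] [DecidableEq ι] [Fintype κ] [DecidableEq κ]
    (T : Fin s → Matrix ι κ F) (φ ψ : Fin s → F)
    (r : ℕ) (x : Fin r → Fin s → F) (y : Fin r → ι → F) (z : Fin r → κ → F) : Prop :=
  ∃ (A B : Matrix κ ι F) (lam : Fin r → F) (h : Fin r → ι → κ → F),
    IsPseudoinverse (sliceCombination T φ) A ∧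
    IsPseudoinverse (sliceCombination T ψ) B ∧
    -- the nonzero eigenvalues of `T(φ) T(ψ)⁺` are `lam_1, …, lam_r`, without repetition,
    -- with eigenvectors `y_1, …, y_r`
    (sliceCombination T φ * B).rank = r ∧
    Function.Injective lam ∧ (∀ a, lam a ≠ 0) ∧
    (∀ a, y a ≠ 0 ∧ (sliceCombination T φ * B).mulVec (y a) = lam a • y a) ∧
    -- the nonzero eigenvalues of `T(φ)⁺ T(ψ)` are their inverses, with eigenvectors
    -- `z_1, …, z_r` (on `F^κ`, where it acts by the transpose)
    (A * sliceCombination T ψ).charpoly =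
      Polynomial.X ^ (Fintype.card κ - r) *
        ∏ a, (Polynomial.X - Polynomial.C (lam a)⁻¹) ∧
    (∀ a, z a ≠ 0 ∧ (A * sliceCombination T ψ).transpose.mulVec (z a) = (lam a)⁻¹ • z a) ∧
    -- the functionals `h_a` are dual to the `y_a ⊗ z_a`, and `x_a = T(h_a)`
    (∀ a b, ∑ i, ∑ j, h a i j * (y b i * z b j) = if a = b then 1 else 0) ∧
    (∀ a l, x a l = ∑ i, ∑ j, h a i j * T l i j) ∧
    (∀ a b, a ≠ b → x a ∉ Submodule.span F {x b})

end SimDiag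

/-! ### The algorithm for computing the intersection of a subspace and a variety -/

section IntersectionAlgorithm

variable {F : Type*} [RCLike F] {n : ℕ}

/-- The possible outputs: "`U` trivially intersects `X`", "The only elements of `U ∩ X` are
`{v_1, …, v_s}` (up to scale)", "Fail". -/
inductive IntersectionOutput (F : Type*) (n : ℕ) : Type _ where
  | trivial : IntersectionOutput F n
  | only (s : ℕ) (v : Fin s → Fin n → F) : IntersectionOutput F n
  | fail : IntersectionOutput F n

/-- `u_1, …, u_R` is a basis of the subspace `U`. -/
def IsBasisOf {E : Type*} [AddCommGroup E] [Module F E] {R : ℕ} (u : Fin R → E)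
    (U : Submodule F E) : Prop :=
  LinearIndependent F u ∧ Submodule.span F (Set.range u) = U

/-- First step, on input a basis `u` of `U` and forms `f` of degree `d`: `P_1, …, P_s` is a basis
of `S^d(U) ∩ I_d^⊥`. -/
def IsStepOneBasis {p R s : ℕ} (d : ℕ) (f : Fin p → MvPolynomial (Fin n) F)
    (u : Fin R → Fin n → F) (P : Fin s → TensorPow F n d) : Prop :=
  IsBasisOf P (symPower d (Submodule.span F (Set.range u)) ⊓ formAnnihilator d f)

/-- The first `s` entries of a vector of `F^n` (the cases of interest have `s ≤ n`). -/
def firstEntries (s : ℕ) (ω : Fin n → F) : Fin s → F :=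
  fun i => if h : (i : ℕ) < n then ω ⟨i, h⟩ else 0

/-- Second step: on the tensor `∑ e_i ⊗ P_i ∈ F^s ⊗ V ⊗ V^{⊗(d-1)}`, with random choices `φ, ψ`,
the simultaneous diagonalization algorithm outputs a decomposition of that tensor of the form
`{z_i ⊗ v_i^{⊗d} : i ∈ [s]}` with `z` and `v` linearly independent. -/
def StepTwoAccepts {d s : ℕ} (P : Fin s → TensorPow F n d) (φ ψ : Fin s → F)
    (v : Fin s → Fin n → F) : Prop :=
  ∃ (x : Fin s → Fin s → F) (y : Fin s → Fin n → F) (c : Fin s → (Fin (d - 1) → Fin n) → F)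
    (z : Fin s → Fin s → F),
    SimDiagOutput (fun l => splitFirst (P l)) φ ψ s x y c ∧
    (∀ a l i j, x a l * y a i * c a j = z a l * v a i * tensorPower (d - 1) (v a) j) ∧
    (∀ l, P l = ∑ a, z a l • tensorPower d (v a)) ∧
    LinearIndependent F z ∧ LinearIndependent F v

/-- On input a basis `u` of `U` and forms `f` of degree `d` that cut out `X`, having chosen the
basis `P` in the first step and having drawn `φ, ψ ∈ (F^s)*` as the first `s` entries of the
random vectors `ω 0, ω 1 ∈ F^n`, the algorithm may give the output `o`. -/
def IntersectionAlgorithm {p R s d : ℕ} (f : Fin p → MvPolynomial (Fin n) F)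
    (u : Fin R → Fin n → F) (P : Fin s → TensorPow F n d) (ω : Fin 2 → Fin n → F)
    (o : IntersectionOutput F n) : Prop :=
  IsStepOneBasis d f u P ∧
  ((s = 0 ∧ o = .trivial) ∨
   (s ≠ 0 ∧ R < s ∧ o = .fail) ∨
   (s ≠ 0 ∧ s ≤ R ∧
     ((∃ v, StepTwoAccepts P (firstEntries s (ω 0)) (firstEntries s (ω 1)) v ∧ o = .only s v) ∨
      ((¬ ∃ v, StepTwoAccepts P (firstEntries s (ω 0)) (firstEntries s (ω 1)) v) ∧
        o = .fail))))

/-- The result of decomposing `T` by running the algorithm on some basis `u` of `U = T(W*)`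
(`none` stands for "Fail"): if it finds as many elements `v_1, …, v_r` of `U ∩ X` as the dimension
of `U`, the result is `∑ v_a ⊗ w_a` with `w_a = T(g_a)`, where the functionals `g_a ∈ V*` are dual
to the `v_a`; otherwise it is "Fail". -/
def DecompositionResult {p : ℕ} {W : Type*} [AddCommGroup W] [Module F W] (d : ℕ)
    (f : Fin p → MvPolynomial (Fin n) F) (T : (Fin n → F) ⊗[F] W) (ω : Fin 2 → Fin n → F)
    (result : Option (Σ r : ℕ, (Fin r → Fin n → F) × (Fin r → W))) : Prop :=
  ∃ (R s : ℕ) (u : Fin R → Fin n → F) (P : Fin s → TensorPow F n d)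
    (o : IntersectionOutput F n),
    IsBasisOf u (LinearMap.range (tensorToV T)) ∧ IntersectionAlgorithm f u P ω o ∧
    ((∃ (v : Fin R → Fin n → F) (w : Fin R → W) (g : Fin R → Module.Dual F (Fin n → F)),
        ((R = 0 ∧ o = .trivial) ∨ o = .only R v) ∧
        (∀ a b, g a (v b) = if a = b then 1 else 0) ∧ (∀ a, w a = tensorToW T (g a)) ∧
        result = some ⟨R, v, w⟩) ∨
     ((o = .fail ∨ (R ≠ 0 ∧ o = .trivial) ∨ ∃ s' v, s' ≠ R ∧ o = .only s' v) ∧ result = none))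

end IntersectionAlgorithm

/-! ### A random access machine over `F` with a diagonalization oracle

Programs are written in a small imperative language. They have registers holding natural numbers,
used for counters and addresses, and arrays of elements of `F`. Operations in `F` have unit cost.
Operations on natural numbers are charged the size of the operands and of the result (in unary),
so that no work can be hidden in them. Programs contain no constants from `F` other than natural
numbers, and do not depend on the size of the input. -/

section Machine

/-- Expressions for natural numbers. -/
inductive NatExp : Type where
  | const (c : ℕ)
  | reg (r : ℕ)
  | add (e₁ e₂ : NatExp)
  | sub (e₁ e₂ : NatExp)
  | mul (e₁ e₂ : NatExp)
  | div (e₁ e₂ : NatExp)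
  | mod (e₁ e₂ : NatExp)

/-- The value of an expression, given the contents of the registers. -/
def NatExp.val (ρ : ℕ → ℕ) : NatExp → ℕ
  | const c => c
  | reg r => ρ r
  | add e₁ e₂ => e₁.val ρ + e₂.val ρ
  | sub e₁ e₂ => e₁.val ρ - e₂.val ρ
  | mul e₁ e₂ => e₁.val ρ * e₂.val ρ
  | div e₁ e₂ => e₁.val ρ / e₂.val ρ
  | mod e₁ e₂ => e₁.val ρ % e₂.val ρ

/-- The cost of evaluating an expression. -/
def NatExp.cost (ρ : ℕ → ℕ) : NatExp → ℕ
  | const c => c + 1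
  | reg r => ρ r + 1
  | add e₁ e₂ => e₁.cost ρ + e₂.cost ρ + (e₁.val ρ + e₂.val ρ) + 1
  | sub e₁ e₂ => e₁.cost ρ + e₂.cost ρ + 1
  | mul e₁ e₂ => e₁.cost ρ + e₂.cost ρ + e₁.val ρ * e₂.val ρ + 1
  | div e₁ e₂ => e₁.cost ρ + e₂.cost ρ + 1
  | mod e₁ e₂ => e₁.cost ρ + e₂.cost ρ + 1

/-- The state of the machine: registers, and arrays `mem 0, mem 1, …` over `F`. -/
structure MachineState (F : Type*) where
  reg : ℕ → ℕ
  mem : ℕ → ℕ → F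

/-- Expressions for elements of `F`; `cell a e` is the entry of the array `a` at address `e`. -/
inductive FieldExp : Type where
  | cell (a : ℕ) (e : NatExp)
  | const (c : ℕ)
  | add (x₁ x₂ : FieldExp)
  | sub (x₁ x₂ : FieldExp)
  | mul (x₁ x₂ : FieldExp)
  | div (x₁ x₂ : FieldExp)
  | conj (x : FieldExp)

variable {F : Type*} [RCLike F]

/-- The value of an expression (division by zero gives zero). -/
noncomputable def FieldExp.val (σ : MachineState F) : FieldExp → F
  | cell a e => σ.mem a (e.val σ.reg)
  | const c => (c : F)
  | add x₁ x₂ => x₁.val σ + x₂.val σ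
  | sub x₁ x₂ => x₁.val σ - x₂.val σ
  | mul x₁ x₂ => x₁.val σ * x₂.val σ
  | div x₁ x₂ => x₁.val σ / x₂.val σ
  | conj x => star (x.val σ)

/-- The cost of evaluating an expression. -/
def FieldExp.cost (σ : MachineState F) : FieldExp → ℕ
  | cell _ e => e.cost σ.reg + 1
  | const c => c + 1
  | add x₁ x₂ => x₁.cost σ + x₂.cost σ + 1
  | sub x₁ x₂ => x₁.cost σ + x₂.cost σ + 1
  | mul x₁ x₂ => x₁.cost σ + x₂.cost σ + 1
  | div x₁ x₂ => x₁.cost σ + x₂.cost σ + 1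
  | conj x => x.cost σ + 1

/-- Tests: `e₁ ≤ e₂` for natural numbers, `x = 0` for elements of `F`, and negation. -/
inductive MachineTest : Type where
  | le (e₁ e₂ : NatExp)
  | isZero (x : FieldExp)
  | not (b : MachineTest)

/-- The test succeeds. -/
def MachineTest.holds (σ : MachineState F) : MachineTest → Prop
  | le e₁ e₂ => e₁.val σ.reg ≤ e₂.val σ.reg
  | isZero x => x.val σ = 0
  | not b => ¬ b.holds σ

/-- The cost of a test. -/
def MachineTest.cost (σ : MachineState F) : MachineTest → ℕ
  | le e₁ e₂ => e₁.cost σ.reg + e₂.cost σ.reg + 1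
  | isZero x => x.cost σ + 1
  | not b => b.cost σ + 1

/-- Programs. `diagonalize flag a b c e` asks the oracle to diagonalize the square matrix of size
`e` stored in the array `a`; on success, the eigenvalues are written to the array `b`, a matrix
of eigenvectors to the array `c`, and the register `flag` is set to 1, otherwise to 0. -/
inductive MachineProgram : Type where
  | skip
  | setReg (r : ℕ) (e : NatExp)
  | setCell (a : ℕ) (e : NatExp) (x : FieldExp)
  | seq (c₁ c₂ : MachineProgram)
  | ite (b : MachineTest) (c₁ c₂ : MachineProgram)
  | while (b : MachineTest) (c : MachineProgram)
  | diagonalize (flag a b c : ℕ) (e : NatExp)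

/-- The `k × k` matrix stored row by row in an array. -/
def loadMatrix (k : ℕ) (m : ℕ → F) : Matrix (Fin k) (Fin k) F := fun i j => m (i * k + j)

/-- Overwrite the first `k` entries of an array. -/
def storeVector {k : ℕ} (D : Fin k → F) (m : ℕ → F) : ℕ → F :=
  fun x => if h : x < k then D ⟨x, h⟩ else m x

/-- Overwrite the first `k * k` entries of an array by a matrix, stored row by row. -/
def storeMatrix {k : ℕ} (Q : Matrix (Fin k) (Fin k) F) (m : ℕ → F) : ℕ → F :=
  fun x => if h : x < k * k then
    Q (Fin.divNat (⟨x, h⟩ : Fin (k * k))) (Fin.modNat (⟨x, h⟩ : Fin (k * k))) else m x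

/-- `D`, `Q` diagonalize `M` over `F`: `M = Q diag(D) Q⁻¹`. -/
def Diagonalizes {k : ℕ} (M : Matrix (Fin k) (Fin k) F) (D : Fin k → F)
    (Q : Matrix (Fin k) (Fin k) F) : Prop :=
  IsUnit Q.det ∧ M * Q = Q * Matrix.diagonal D

/-- Functions that take a square matrix and answer with eigenvalues and eigenvectors, or with
`none`. -/
abbrev DiagFunction (F : Type*) : Type _ :=
  (k : ℕ) → Matrix (Fin k) (Fin k) F → Option ((Fin k → F) × Matrix (Fin k) (Fin k) F)

/-- A diagonalization oracle: it diagonalizes every matrix that is diagonalizable over `F`, and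
answers `none` on the others. -/
def IsDiagOracle (O : DiagFunction F) : Prop :=
  ∀ (k : ℕ) (M : Matrix (Fin k) (Fin k) F),
    (∀ D Q, O k M = some (D, Q) → Diagonalizes M D Q) ∧
    (O k M = none → ¬ ∃ D Q, Diagonalizes M D Q)

/-- `Exec O c σ σ' t q`: with the oracle `O`, the program `c` started in the state `σ` halts in the
state `σ'`, after running for time `t` and making `q` calls to the oracle. -/
inductive Exec (O : DiagFunction F) :
    MachineProgram → MachineState F → MachineState F → ℕ → ℕ → Prop where
  | skip (σ) : Exec O .skip σ σ 1 0
  | setReg (σ r e) :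
      Exec O (.setReg r e) σ ⟨Function.update σ.reg r (e.val σ.reg), σ.mem⟩ (e.cost σ.reg + 1) 0
  | setCell (σ a e x) :
      Exec O (.setCell a e x) σ
        ⟨σ.reg, Function.update σ.mem a
          (Function.update (σ.mem a) (e.val σ.reg) (x.val σ))⟩
        (e.cost σ.reg + x.cost σ + 1) 0
  | seq {c₁ c₂ σ σ' σ'' t t' q q'} (h₁ : Exec O c₁ σ σ' t q) (h₂ : Exec O c₂ σ' σ'' t' q') :
      Exec O (.seq c₁ c₂) σ σ'' (t + t') (q + q')
  | ite_true {b c₁ c₂ σ σ' t q} (hb : b.holds σ) (h : Exec O c₁ σ σ' t q) :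
      Exec O (.ite b c₁ c₂) σ σ' (b.cost σ + t) q
  | ite_false {b c₁ c₂ σ σ' t q} (hb : ¬ b.holds σ) (h : Exec O c₂ σ σ' t q) :
      Exec O (.ite b c₁ c₂) σ σ' (b.cost σ + t) q
  | while_true {b c σ σ' σ'' t t' q q'} (hb : b.holds σ) (h₁ : Exec O c σ σ' t q)
      (h₂ : Exec O (.while b c) σ' σ'' t' q') :
      Exec O (.while b c) σ σ'' (b.cost σ + t + t') (q + q')
  | while_false {b c σ} (hb : ¬ b.holds σ) : Exec O (.while b c) σ σ (b.cost σ) 0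
  | diag_some {σ flag a b c e D Q}
      (h : O (e.val σ.reg) (loadMatrix (e.val σ.reg) (σ.mem a)) = some (D, Q)) :
      Exec O (.diagonalize flag a b c e) σ
        ⟨Function.update σ.reg flag 1,
          Function.update (Function.update σ.mem b (storeVector D (σ.mem b))) c
            (storeMatrix Q (σ.mem c))⟩
        (e.cost σ.reg + e.val σ.reg * e.val σ.reg + 1) 1
  | diag_none {σ flag a b c e}
      (h : O (e.val σ.reg) (loadMatrix (e.val σ.reg) (σ.mem a)) = none) :
      Exec O (.diagonalize flag a b c e) σ ⟨Function.update σ.reg flag 0, σ.mem⟩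
        (e.cost σ.reg + e.val σ.reg * e.val σ.reg + 1) 1

/-- The input. Registers 0 to 3 hold `n`, `d`, `p` and `m = dim W`. Array 0 holds the coefficients
of the forms: the entry at `l n^d + code(i)` is the coefficient in `f_l` of the monomial
`x_{i_1} ⋯ x_{i_d}`, where `code` lists the `n^d` tuples `i`. Array 1 holds the coordinates of `T`
with respect to the standard basis of `V` and the basis `b` of `W`, row by row. Array 2 holds the
random vectors `ω 0`, `ω 1`. All the rest is zero. -/
noncomputable def inputState {n p m : ℕ} {W : Type*} [AddCommGroup W] [Module F W] (d : ℕ)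
    (f : Fin p → MvPolynomial (Fin n) F) (b : Module.Basis (Fin m) F W)
    (T : (Fin n → F) ⊗[F] W) (ω : Fin 2 → Fin n → F) : MachineState F where
  reg r := if r = 0 then n else if r = 1 then d else if r = 2 then p else if r = 3 then m else 0
  mem a x :=
    if a = 0 then
      if h : x < p * n ^ d then
        (f (Fin.divNat (⟨x, h⟩ : Fin (p * n ^ d)))).coeff (monomialExponent
          (finFunctionFinEquiv.symm (Fin.modNat (⟨x, h⟩ : Fin (p * n ^ d)))))
      else 0
    else if a = 1 then
      if h : x < n * m then
        ((Pi.basisFun F (Fin n)).tensorProduct b).repr T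
          (Fin.divNat (⟨x, h⟩ : Fin (n * m)), Fin.modNat (⟨x, h⟩ : Fin (n * m)))
      else 0
    else if a = 2 then
      if h : x < 2 * n then
        ω (Fin.divNat (⟨x, h⟩ : Fin (2 * n))) (Fin.modNat (⟨x, h⟩ : Fin (2 * n)))
      else 0
    else 0

/-- The output. If register 0 holds `0`, the output is "Fail" (`none`). Otherwise it is
the list of pairs `(v_a, w_a)` whose length is in register 1, with the `v_a` stored row by row in
array 3 and the coordinates of the `w_a` with respect to the basis `b` in array 4. -/
noncomputable def outputOf {m : ℕ} {W : Type*} [AddCommGroup W] [Module F W] (n : ℕ)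
    (b : Module.Basis (Fin m) F W) (σ : MachineState F) :
    Option (Σ r : ℕ, (Fin r → Fin n → F) × (Fin r → W)) :=
  if σ.reg 0 = 0 then none
  else some ⟨σ.reg 1, fun a i => σ.mem 3 (a * n + i),
    fun a => ∑ j : Fin m, σ.mem 4 (a * m + j) • b j⟩

end Machine

/-! ### Cost bounds and frames for programs -/

/-! Write U for the span of v_1, …, v_R. The whole theorem rests on one identity: for generic v_a in
X, the space S^d(U) ∩ I_d^⊥ is spanned by the powers v_a^{⊗d}. Given this identity and linear
independence of the v_a, any point of X in U has its d-th power in that span. A comparison of mixed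
coordinates shows that it is then a multiple of some v_a (`exists_eq_smul_of_tensorPower_mem_span`),
which gives uniqueness (`isUniqueXWRankDecomposition_of_span`). Moreover the slices P_l are
combinations of the v_a^{⊗d} with an invertible coefficient matrix, so simultaneous diagonalization
succeeds for almost all φ, ψ (`ae_separatesPowers`).

The identity (`symPower_inf_formAnnihilator_eq`) is dual to a statement about forms: when the forms
of I_d are restricted to U, in the coordinates t_a, all coefficients at monomials other than the
pure powers t_a^d can be prescribed (`SurjCoeff`). This is proved for spaces J of forms of any
degree k ≤ d by induction on the number of points (`exists_surjCoeff`). By Taylor's formula the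
coefficient of t_0^j in q(∑ t_a v_a) is D_x^j q / j!, restricted to the span of the other points,
where x = v_0. The system is triangular in j, so it suffices to treat the spaces D_x^j(J ∩ ker
D_x^{j+1}) with one point fewer (`SurjCoeff.cons`). Their dimension is the drop from dim D_x^j J to
dim D_x^{j+1} J. The latter is at most the dimension of a space of forms. For the former,
non-degeneracy of order j gives at most C(n+j-1, j) points of X that no nonzero form of degree j
vanishes on. A form q in J with D_x^j q = 0 at all these points is zero, so some point x of X gives
rank at least dim J / C(n+j-1, j) (`exists_rank_iterDeriv`). Only j < d occurs, because exponents d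
are excluded, so order d-1 suffices. The induction closes if dim J ≥ (k-1)! R C(n+k-2, k-1)
(`coeffBound_step`), and for k = d this is the hypothesis on R (`rank_bound`). Each condition is the
non-vanishing of a polynomial, and irreducibility of X lets finitely many of them hold together,
also on X^{×R} (`PolyPrime.tupleSet`).

The program uses Gram-Schmidt orthogonalization for all its linear algebra except one oracle call.
Unit vectors appended to a list of rows turn into a spanning set of the orthogonal complement; extra
entries appended to the rows record the coefficients of the reduction. In this way it finds the
range of T, a basis P of the first step, and a matrix M = T(φ)C with C a generalized inverse of T(ψ)
(`isPairMatrix_pairGS`). It diagonalizes M and accepts if the nonzero eigenvalues are distinct,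
their number equals both dim U and the length of P, and the forms vanish at the eigenvectors. This
test is equivalent to acceptance by the pseudoinverse algorithm: both amount to `SeparatesPowers`
(`stepTwoAccepts_iff`, `SeparatesPowers.accept`, `separatesPowers_of_accept`). Hence each output
other than "Fail" comes with the identity for S^d(U) ∩ I_d^⊥ and is the unique rank decomposition.

For the running time, all registers stay below B = 8(n^d + m). The time is then at most B to a power
read off from the program text, and `time_bound` splits this power into n^{Cd} + m^C. -/

section ProgramLogic

/-- An exponent `k` such that value and cost of the expression are at most `B ^ k`, if all
registers are at most `B`. -/
def NatExp.deg : NatExp → ℕ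
  | const c => c + 1
  | reg _ => 2
  | add e₁ e₂ => e₁.deg + e₂.deg + 3
  | sub e₁ e₂ => e₁.deg + e₂.deg + 3
  | mul e₁ e₂ => e₁.deg + e₂.deg + 3
  | div e₁ e₂ => e₁.deg + e₂.deg + 3
  | mod e₁ e₂ => e₁.deg + e₂.deg + 3

/-- Like `NatExp.deg`, for the cost of a field expression. -/
def FieldExp.deg : FieldExp → ℕ
  | cell _ e => e.deg + 1
  | const c => c + 1
  | add x₁ x₂ => x₁.deg + x₂.deg + 2
  | sub x₁ x₂ => x₁.deg + x₂.deg + 2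
  | mul x₁ x₂ => x₁.deg + x₂.deg + 2
  | div x₁ x₂ => x₁.deg + x₂.deg + 2
  | conj x => x.deg + 1

/-- Like `NatExp.deg`, for the cost of a test. -/
def MachineTest.deg : MachineTest → ℕ
  | le e₁ e₂ => e₁.deg + e₂.deg + 2
  | isZero x => x.deg + 1
  | not b => b.deg + 1

/-- Like `NatExp.deg`, for the running time of a program whose loops are repeated at most `B`
times. -/
def MachineProgram.deg : MachineProgram → ℕ
  | skip => 0
  | setReg _ e => e.deg + 1
  | setCell _ e x => e.deg + x.deg + 2
  | seq c₁ c₂ => c₁.deg + c₂.deg + 1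
  | ite b c₁ c₂ => b.deg + c₁.deg + c₂.deg + 1
  | .while b c => b.deg + c.deg + 3
  | diagonalize _ _ _ _ e => 2 * e.deg + 2

/-- The number of oracle instructions of a program. -/
def MachineProgram.calls : MachineProgram → ℕ
  | seq c₁ c₂ => c₁.calls + c₂.calls
  | ite _ c₁ c₂ => c₁.calls + c₂.calls
  | .while _ c => c.calls
  | diagonalize _ _ _ _ _ => 1
  | _ => 0

/-- Does the program contain an instruction that writes to the register `s`? -/
def MachineProgram.writesReg (s : ℕ) : MachineProgram → Bool
  | setReg r _ => s == r
  | seq c₁ c₂ => c₁.writesReg s || c₂.writesReg s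
  | ite _ c₁ c₂ => c₁.writesReg s || c₂.writesReg s
  | .while _ c => c.writesReg s
  | diagonalize flag _ _ _ _ => s == flag
  | _ => false

/-- Does the program contain an instruction that writes to the array `s`? -/
def MachineProgram.writesMem (s : ℕ) : MachineProgram → Bool
  | setCell a _ _ => s == a
  | seq c₁ c₂ => c₁.writesMem s || c₂.writesMem s
  | ite _ c₁ c₂ => c₁.writesMem s || c₂.writesMem s
  | .while _ c => c.writesMem s
  | diagonalize _ _ b c _ => s == b || s == c
  | _ => false

/-- Since B ≥ 2, the factor 3 is absorbed by B^2. Constants in the cost model are absorbed by larger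
exponents in the same way below, which is why all the bounds are pure powers of B. -/
lemma three_mul_pow_le {B : ℕ} (hB : 2 ≤ B) {x y z a b c k : ℕ} (hx : x ≤ B ^ a) (hy : y ≤ B ^ b)
    (hz : z ≤ B ^ c) (ha : a + 2 ≤ k) (hb : b + 2 ≤ k) (hc : c + 2 ≤ k) : x + y + z ≤ B ^ k := by
  obtain ⟨k, rfl⟩ := Nat.exists_eq_add_of_le' (show 2 ≤ k by omega)
  have h1 := hx.trans (Nat.pow_le_pow_right (by omega) (show a ≤ k by omega))
  have h2 := hy.trans (Nat.pow_le_pow_right (by omega) (show b ≤ k by omega))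
  have h3 := hz.trans (Nat.pow_le_pow_right (by omega) (show c ≤ k by omega))
  rw [pow_add]
  have : 4 ≤ B ^ 2 := by nlinarith
  nlinarith [Nat.zero_le (B ^ k)]

lemma NatExp.val_le {B : ℕ} (hB : 2 ≤ B) {ρ : ℕ → ℕ} (h : ∀ r, ρ r ≤ B) (e : NatExp) :
    e.val ρ ≤ B ^ e.deg := by
  have hp : ∀ {a b : ℕ}, a ≤ b → B ^ a ≤ B ^ b := fun h => Nat.pow_le_pow_right (by omega) h
  induction e with
  | const c =>
    exact (Nat.lt_pow_self (by omega)).le.trans (hp (Nat.le_succ c))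
  | reg r => exact (h r).trans (by show B ≤ B ^ 2; nlinarith)
  | add a b ha hb =>
    exact three_mul_pow_le hB ha hb (Nat.zero_le (B ^ 0)) (k := (add a b).deg)
      (by simp [deg]; omega) (by simp [deg]; omega) (by simp [deg])
  | sub a b ha hb => exact ((Nat.sub_le _ _).trans ha).trans (hp (by simp [deg]; omega))
  | mul a b ha hb =>
    exact (Nat.mul_le_mul ha hb).trans (by rw [← pow_add]; exact hp (by simp [deg]))
  | div a b ha hb => exact ((Nat.div_le_self _ _).trans ha).trans (hp (by simp [deg]; omega))
  | mod a b ha hb => exact ((Nat.mod_le _ _).trans ha).trans (hp (by simp [deg]; omega))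

lemma NatExp.cost_le {B : ℕ} (hB : 2 ≤ B) {ρ : ℕ → ℕ} (h : ∀ r, ρ r ≤ B) (e : NatExp) :
    e.cost ρ ≤ B ^ e.deg := by
  have h1 : ∀ k, 1 ≤ B ^ k := fun k => Nat.one_le_pow _ _ (by omega)
  -- Two operands, at most twice the common power for the value, and 1: together at most 5 ≤ 2^3
  -- times that power.
  have key : ∀ a b x y v : ℕ, x ≤ B ^ a → y ≤ B ^ b → v ≤ 2 * B ^ (a + b) →
      x + y + v + 1 ≤ B ^ (a + b + 3) := by
    intro a b x y v hx hy hv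
    have ha : B ^ a ≤ B ^ (a + b) := Nat.pow_le_pow_right (by omega) (by omega)
    have hb : B ^ b ≤ B ^ (a + b) := Nat.pow_le_pow_right (by omega) (by omega)
    have h8 : 8 ≤ B ^ 3 := Nat.pow_le_pow_left hB 3
    have := h1 (a + b)
    rw [pow_add _ _ 3]
    nlinarith
  induction e with
  | const c =>
    show c + 1 ≤ B ^ (c + 1)
    exact (Nat.lt_pow_self (by omega)).le
  | reg r =>
    have := h r
    show ρ r + 1 ≤ B ^ 2
    nlinarith
  | add a b ha hb =>
    refine key _ _ _ _ _ ha hb ?_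
    have h2 := a.val_le hB h
    have h3 := b.val_le hB h
    have ha : B ^ a.deg ≤ B ^ (a.deg + b.deg) := Nat.pow_le_pow_right (by omega) (by omega)
    have hb : B ^ b.deg ≤ B ^ (a.deg + b.deg) := Nat.pow_le_pow_right (by omega) (by omega)
    omega
  | sub a b ha hb => exact key _ _ _ _ 0 ha hb (Nat.zero_le _)
  | mul a b ha hb =>
    refine key _ _ _ _ _ ha hb ?_
    have := Nat.mul_le_mul (a.val_le hB h) (b.val_le hB h)
    rw [← pow_add] at this
    omega
  | div a b ha hb => exact key _ _ _ _ 0 ha hb (Nat.zero_le _)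
  | mod a b ha hb => exact key _ _ _ _ 0 ha hb (Nat.zero_le _)

variable {F : Type*} [RCLike F]

lemma FieldExp.cost_le {F : Type*} {B : ℕ} (hB : 2 ≤ B) {σ : MachineState F} (h : ∀ r, σ.reg r ≤ B)
    (x : FieldExp) : x.cost σ ≤ B ^ x.deg := by
  have h1 : ∀ k, 1 ≤ B ^ k := fun k => Nat.one_le_pow _ _ (by omega)
  have succ : ∀ k y : ℕ, y ≤ B ^ k → y + 1 ≤ B ^ (k + 1) := by
    intro k y hy
    have := h1 k
    rw [pow_succ]
    nlinarith
  have key : ∀ a b y z : ℕ, y ≤ B ^ a → z ≤ B ^ b → y + z + 1 ≤ B ^ (a + b + 2) := fun a b y z hy hz =>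
    three_mul_pow_le hB hy hz (h1 0) (by omega) (by omega) (by omega)
  induction x with
  | cell a e => exact succ _ _ (e.cost_le hB h)
  | const c => exact (Nat.lt_pow_self (by omega)).le
  | add x y hx hy => exact key _ _ _ _ hx hy
  | sub x y hx hy => exact key _ _ _ _ hx hy
  | mul x y hx hy => exact key _ _ _ _ hx hy
  | div x y hx hy => exact key _ _ _ _ hx hy
  | conj x hx => exact succ _ _ hx

lemma MachineTest.cost_le {F : Type*} {B : ℕ} (hB : 2 ≤ B) {σ : MachineState F} (h : ∀ r, σ.reg r ≤ B)
    (b : MachineTest) : b.cost σ ≤ B ^ b.deg := by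
  have h1 : ∀ k, 1 ≤ B ^ k := fun k => Nat.one_le_pow _ _ (by omega)
  have succ : ∀ k y : ℕ, y ≤ B ^ k → y + 1 ≤ B ^ (k + 1) := by
    intro k y hy
    have := h1 k
    rw [pow_succ]
    nlinarith
  induction b with
  | le e₁ e₂ =>
    exact three_mul_pow_le hB (e₁.cost_le hB h) (e₂.cost_le hB h) (h1 0)
      (by simp [deg]) (by simp [deg]) (by simp [deg])
  | isZero x => exact succ _ _ (x.cost_le hB h)
  | not b hb => exact succ _ _ hb

/-- `σ'` agrees with `σ` on all registers and arrays that `c` does not write to. -/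
structure Frame (c : MachineProgram) (σ σ' : MachineState F) : Prop where
  reg : ∀ r, c.writesReg r = false → σ'.reg r = σ.reg r
  mem : ∀ a, c.writesMem a = false → σ'.mem a = σ.mem a

/-- What a program may write is determined by its text, so for a concrete program the hypotheses of
`Frame` are checked by `rfl`. The specifications below therefore mention only what changes. -/
lemma Exec.frame {O : DiagFunction F} {c : MachineProgram} {σ σ' : MachineState F} {t q : ℕ}
    (h : Exec O c σ σ' t q) : Frame c σ σ' := by
  induction h with
  | skip σ => exact ⟨fun _ _ => rfl, fun _ _ => rfl⟩
  | setReg σ r e =>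
    refine ⟨fun s hs => ?_, fun _ _ => rfl⟩
    simp only [MachineProgram.writesReg, beq_eq_false_iff_ne] at hs
    simp [hs]
  | setCell σ a e x =>
    refine ⟨fun _ _ => rfl, fun s hs => ?_⟩
    simp only [MachineProgram.writesMem, beq_eq_false_iff_ne] at hs
    simp [hs]
  | seq _ _ h₁ h₂ =>
    refine ⟨fun s hs => ?_, fun s hs => ?_⟩
    · simp only [MachineProgram.writesReg, Bool.or_eq_false_iff] at hs
      rw [h₂.reg s hs.2, h₁.reg s hs.1]
    · simp only [MachineProgram.writesMem, Bool.or_eq_false_iff] at hs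
      rw [h₂.mem s hs.2, h₁.mem s hs.1]
  | ite_true _ _ h =>
    refine ⟨fun s hs => ?_, fun s hs => ?_⟩
    · simp only [MachineProgram.writesReg, Bool.or_eq_false_iff] at hs
      exact h.reg s hs.1
    · simp only [MachineProgram.writesMem, Bool.or_eq_false_iff] at hs
      exact h.mem s hs.1
  | ite_false _ _ h =>
    refine ⟨fun s hs => ?_, fun s hs => ?_⟩
    · simp only [MachineProgram.writesReg, Bool.or_eq_false_iff] at hs
      exact h.reg s hs.2
    · simp only [MachineProgram.writesMem, Bool.or_eq_false_iff] at hs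
      exact h.mem s hs.2
  | while_true _ _ _ h₁ h₂ =>
    refine ⟨fun s hs => ?_, fun s hs => ?_⟩
    · rw [h₂.reg s hs, h₁.reg s hs]
    · rw [h₂.mem s hs, h₁.mem s hs]
  | while_false _ => exact ⟨fun _ _ => rfl, fun _ _ => rfl⟩
  | diag_some _ =>
    refine ⟨fun s hs => ?_, fun s hs => ?_⟩
    · simp only [MachineProgram.writesReg, beq_eq_false_iff_ne] at hs
      simp [hs]
    · simp only [MachineProgram.writesMem, Bool.or_eq_false_iff, beq_eq_false_iff_ne] at hs
      simp [hs.1, hs.2]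
  | diag_none _ =>
    refine ⟨fun s hs => ?_, fun _ _ => rfl⟩
    simp only [MachineProgram.writesReg, beq_eq_false_iff_ne] at hs
    simp [hs]

/-- Started in the state `σ` with all registers at most `B`, the program halts within the time and
the number of oracle calls given by `deg` and `calls`, in a state that satisfies `Q`. -/
def Runs (O : DiagFunction F) (B : ℕ) (c : MachineProgram) (σ : MachineState F)
    (Q : MachineState F → Prop) : Prop :=
  (∀ r, σ.reg r ≤ B) → ∃ σ' t q, Exec O c σ σ' t q ∧ t ≤ B ^ c.deg ∧ q ≤ c.calls ∧
    (∀ r, σ'.reg r ≤ B) ∧ Q σ'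

variable {O : DiagFunction F} {B : ℕ} {σ : MachineState F}

lemma Runs.imp_frame {c : MachineProgram} {Q Q' : MachineState F → Prop} (h : Runs O B c σ Q)
    (hQ : ∀ σ', Frame c σ σ' → Q σ' → Q' σ') : Runs O B c σ Q' := fun hσ => by
  obtain ⟨σ', t, q, h1, h2, h3, h4, h5⟩ := h hσ
  exact ⟨σ', t, q, h1, h2, h3, h4, hQ σ' h1.frame h5⟩

lemma Runs.seq (hB : 2 ≤ B) {c₁ c₂ : MachineProgram} {Q Q' : MachineState F → Prop}
    (h₁ : Runs O B c₁ σ Q) (h₂ : ∀ σ', Frame c₁ σ σ' → Q σ' → Runs O B c₂ σ' Q') :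
    Runs O B (.seq c₁ c₂) σ Q' := fun hσ => by
  obtain ⟨σ', t, q, a1, a2, a3, a4, a5⟩ := h₁ hσ
  obtain ⟨σ'', t', q', b1, b2, b3, b4, b5⟩ := h₂ σ' a1.frame a5 a4
  refine ⟨σ'', _, _, .seq a1 b1, ?_, Nat.add_le_add a3 b3, b4, b5⟩
  have h1 : B ^ c₁.deg ≤ B ^ (c₁.deg + c₂.deg) := Nat.pow_le_pow_right (by omega) (by omega)
  have h2 : B ^ c₂.deg ≤ B ^ (c₁.deg + c₂.deg) := Nat.pow_le_pow_right (by omega) (by omega)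
  show _ ≤ B ^ (c₁.deg + c₂.deg + 1)
  rw [pow_succ]
  nlinarith

/-- The hypothesis `he` is the one place where a growing value has to be bounded: all cost bounds
depend on every register staying at most B, while field entries are not subject to any bound. -/
lemma Runs.setReg (hB : 2 ≤ B) {r : ℕ} {e : NatExp} {Q : MachineState F → Prop}
    (he : e.val σ.reg ≤ B) (hQ : Q ⟨Function.update σ.reg r (e.val σ.reg), σ.mem⟩) :
    Runs O B (.setReg r e) σ Q := fun hσ => by
  refine ⟨_, _, _, .setReg σ r e, ?_, le_rfl, ?_, hQ⟩
  · have h1 := e.cost_le hB hσ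
    have h2 : 1 ≤ B ^ e.deg := Nat.one_le_pow _ _ (by omega)
    show _ ≤ B ^ (e.deg + 1)
    rw [pow_succ]
    nlinarith
  · intro s
    by_cases hs : s = r
    · subst hs; simpa using he
    · simpa [hs] using hσ s

lemma Runs.setCell (hB : 2 ≤ B) {a : ℕ} {e : NatExp} {x : FieldExp} {Q : MachineState F → Prop}
    (hQ : Q ⟨σ.reg, Function.update σ.mem a
      (Function.update (σ.mem a) (e.val σ.reg) (x.val σ))⟩) :
    Runs O B (.setCell a e x) σ Q := fun hσ => by
  refine ⟨_, _, _, .setCell σ a e x, ?_, le_rfl, hσ, hQ⟩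
  exact three_mul_pow_le hB (e.cost_le hB hσ) (x.cost_le hB hσ)
    (Nat.one_le_pow 0 _ (by omega)) (by simp [MachineProgram.deg])
    (by simp [MachineProgram.deg]) (by simp [MachineProgram.deg])

lemma Runs.skip {Q : MachineState F → Prop} (hQ : Q σ) : Runs O B .skip σ Q := fun hσ =>
  ⟨_, _, _, .skip σ, by simp [MachineProgram.deg], le_rfl, hσ, hQ⟩

lemma Runs.ite (hB : 2 ≤ B) {b : MachineTest} {c₁ c₂ : MachineProgram}
    {Q : MachineState F → Prop} (h₁ : b.holds σ → Runs O B c₁ σ Q)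
    (h₂ : ¬ b.holds σ → Runs O B c₂ σ Q) : Runs O B (.ite b c₁ c₂) σ Q := fun hσ => by
  have h0 := b.cost_le hB hσ
  have h1 : B ^ c₁.deg ≤ B ^ (b.deg + c₁.deg + c₂.deg) :=
    Nat.pow_le_pow_right (by omega) (by omega)
  have h2 : B ^ c₂.deg ≤ B ^ (b.deg + c₁.deg + c₂.deg) :=
    Nat.pow_le_pow_right (by omega) (by omega)
  have h3 : B ^ b.deg ≤ B ^ (b.deg + c₁.deg + c₂.deg) :=
    Nat.pow_le_pow_right (by omega) (by omega)
  have h4 : B ^ (b.deg + c₁.deg + c₂.deg + 1) = B ^ (b.deg + c₁.deg + c₂.deg) * B := pow_succ _ _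
  by_cases hb : b.holds σ
  · obtain ⟨σ', t, q, a1, a2, a3, a4, a5⟩ := h₁ hb hσ
    refine ⟨σ', _, _, .ite_true hb a1, ?_, a3.trans (Nat.le_add_right _ _), a4, a5⟩
    show _ ≤ B ^ (b.deg + c₁.deg + c₂.deg + 1)
    nlinarith
  · obtain ⟨σ', t, q, a1, a2, a3, a4, a5⟩ := h₂ hb hσ
    refine ⟨σ', _, _, .ite_false hb a1, ?_, a3.trans (Nat.le_add_left _ _), a4, a5⟩
    show _ ≤ B ^ (b.deg + c₁.deg + c₂.deg + 1)
    nlinarith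

lemma Runs.diagonalize (hB : 2 ≤ B) {flag a b c : ℕ} {e : NatExp} {Q : MachineState F → Prop}
    (h₁ : ∀ D P, O (e.val σ.reg) (loadMatrix (e.val σ.reg) (σ.mem a)) = some (D, P) →
      Q ⟨Function.update σ.reg flag 1,
          Function.update (Function.update σ.mem b (storeVector D (σ.mem b))) c
            (storeMatrix P (σ.mem c))⟩)
    (h₂ : O (e.val σ.reg) (loadMatrix (e.val σ.reg) (σ.mem a)) = none →
      Q ⟨Function.update σ.reg flag 0, σ.mem⟩) :
    Runs O B (.diagonalize flag a b c e) σ Q := fun hσ => by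
  have ht : e.cost σ.reg + e.val σ.reg * e.val σ.reg + 1 ≤ B ^ (2 * e.deg + 2) := by
    refine three_mul_pow_le hB (e.cost_le hB hσ)
      (Nat.mul_le_mul (e.val_le hB hσ) (e.val_le hB hσ) |>.trans_eq (pow_add _ _ _).symm)
      (Nat.one_le_pow 0 _ (by omega)) ?_ ?_ ?_ <;> omega
  have hr : ∀ x ≤ B, ∀ r, Function.update σ.reg flag x r ≤ B := by
    intro x hx r
    by_cases h : r = flag
    · subst h; simpa using hx
    · simpa [h] using hσ r
  cases h : O (e.val σ.reg) (loadMatrix (e.val σ.reg) (σ.mem a)) with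
  | none => exact ⟨_, _, _, .diag_none h, ht, le_rfl, hr 0 (by omega), h₂ h⟩
  | some DQ => exact ⟨_, _, _, .diag_some h, ht, le_rfl, hr 1 (by omega), h₁ _ _ h⟩

/-- `for r < e do c` -/
def forLoop (r : ℕ) (e : NatExp) (c : MachineProgram) : MachineProgram :=
  .seq (.setReg r (.const 0)) (.while (.le (.add (.reg r) (.const 1)) e)
    (.seq c (.setReg r (.add (.reg r) (.const 1)))))

/-- The body must be free of oracle calls because `calls` counts instructions in the text, not
executions. -/
lemma Runs.while (hB : 2 ≤ B) {b : MachineTest} {c : MachineProgram} (N : ℕ)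
    (I : ℕ → MachineState F → Prop) (hN : N ≤ B) (hc : c.calls = 0) (h0 : I 0 σ)
    (hstep : ∀ i < N, ∀ σ', Frame c σ σ' → I i σ' → b.holds σ' ∧ Runs O B c σ' (I (i + 1)))
    (hend : ∀ σ', Frame c σ σ' → I N σ' → ¬ b.holds σ') :
    Runs O B (.while b c) σ (I N) := fun hσ => by
  -- Induction on the number j of remaining rounds, with the invariant at N - j.
  have main : ∀ j ≤ N, ∀ σ', Frame c σ σ' → (∀ r, σ'.reg r ≤ B) → I (N - j) σ' →
      ∃ σ'' t q, Exec O (.while b c) σ' σ'' t q ∧ t ≤ j * (B ^ b.deg + B ^ c.deg) + B ^ b.deg ∧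
        q = 0 ∧ (∀ r, σ''.reg r ≤ B) ∧ I N σ'' := by
    intro j
    induction j with
    | zero =>
      intro _ σ' hf hσ' hI
      exact ⟨σ', _, _, .while_false (hend σ' hf hI), by simpa using b.cost_le hB hσ', rfl, hσ', hI⟩
    | succ j ih =>
      intro hj σ' hf hσ' hI
      obtain ⟨hb, hrun⟩ := hstep _ (by omega) σ' hf hI
      obtain ⟨σ₁, t, q, a1, a2, a3, a4, a5⟩ := hrun hσ'
      have hf1 := a1.frame
      obtain ⟨σ₂, t', q', b1, b2, b3, b4, b5⟩ := ih (by omega) σ₁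
        ⟨fun r hr => (hf1.reg r hr).trans (hf.reg r hr),
          fun r hr => (hf1.mem r hr).trans (hf.mem r hr)⟩ a4
        (by rwa [show N - (j + 1) + 1 = N - j by omega] at a5)
      refine ⟨σ₂, _, _, .while_true hb a1 b1, ?_, by omega, b4, b5⟩
      have := b.cost_le hB hσ'
      rw [Nat.succ_mul]
      omega
  obtain ⟨σ'', t, q, h1, h2, h3, h4, h5⟩ := main N le_rfl σ ⟨fun _ _ => rfl, fun _ _ => rfl⟩ hσ
    (by simpa using h0)
  refine ⟨σ'', t, q, h1, h2.trans ?_, by omega, h4, h5⟩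
  have e1 : B ^ b.deg ≤ B ^ (b.deg + c.deg) := Nat.pow_le_pow_right (by omega) (by omega)
  have e2 : B ^ c.deg ≤ B ^ (b.deg + c.deg) := Nat.pow_le_pow_right (by omega) (by omega)
  have e3 : N * (B ^ b.deg + B ^ c.deg) ≤ B * (2 * B ^ (b.deg + c.deg)) :=
    Nat.mul_le_mul hN (by omega)
  -- At most B rounds of a test and the body, and a last test, make at most 3B times the common
  -- power.
  have e4 : 3 * B ≤ B ^ 3 := by nlinarith [Nat.mul_le_mul hB hB]
  show _ ≤ B ^ (b.deg + c.deg + 3)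
  rw [pow_add _ _ 3]
  nlinarith [Nat.mul_le_mul_left (B ^ (b.deg + c.deg)) e4]

/-- The invariant for i + 1 is demanded of the state in which the counter has already been advanced,
so that the increment never appears in applications. -/
lemma Runs.forLoop (hB : 2 ≤ B) {r : ℕ} {e : NatExp} {c : MachineProgram} (N : ℕ)
    (I : ℕ → MachineState F → Prop) (hN : N ≤ B) (hc : c.calls = 0) (hr : c.writesReg r = false)
    (he : ∀ σ', Frame (forLoop r e c) σ σ' → e.val σ'.reg = N)
    (h0 : I 0 ⟨Function.update σ.reg r 0, σ.mem⟩)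
    (hstep : ∀ i < N, ∀ σ', Frame (forLoop r e c) σ σ' → σ'.reg r = i → I i σ' →
      Runs O B c σ' fun σ'' => I (i + 1) ⟨Function.update σ''.reg r (i + 1), σ''.mem⟩) :
    Runs O B (forLoop r e c) σ (I N) := by
  have hfr : ∀ σ₁ σ' : MachineState F, Frame (.setReg r (.const 0)) σ σ₁ →
      Frame (.seq c (.setReg r (.add (.reg r) (.const 1)))) σ₁ σ' →
      Frame (_root_.forLoop r e c) σ σ' := by
    intro σ₁ σ' h1 h2
    refine ⟨fun s hs => ?_, fun s hs => ?_⟩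
    · simp only [_root_.forLoop, MachineProgram.writesReg, Bool.or_eq_false_iff] at hs
      rw [h2.reg s (by simp [MachineProgram.writesReg, hs]),
        h1.reg s (by simp [MachineProgram.writesReg, hs])]
    · simp only [_root_.forLoop, MachineProgram.writesMem, Bool.or_eq_false_iff] at hs
      rw [h2.mem s (by simp [MachineProgram.writesMem, hs]),
        h1.mem s (by simp [MachineProgram.writesMem])]
  refine Runs.seq hB (Q := fun σ' => σ' = ⟨Function.update σ.reg r 0, σ.mem⟩)
    (Runs.setReg hB (by simp [NatExp.val]) rfl) ?_
  rintro σ₁ hf1 rfl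
  refine (Runs.while hB N (fun i σ' => σ'.reg r = i ∧ I i σ') hN (by simp [MachineProgram.calls, hc])
    ⟨by simp, h0⟩ ?_ ?_).imp_frame fun _ _ h => h.2
  · rintro i hi σ' hf ⟨hri, hI⟩
    have hF := hfr _ _ hf1 hf
    refine ⟨?_, ?_⟩
    · simp only [MachineTest.holds, NatExp.val, he σ' hF, hri]
      omega
    · refine Runs.seq hB (hstep i hi σ' hF hri hI) fun σ'' hf' h => ?_
      have h2 : σ''.reg r = i := (hf'.reg r hr).trans hri
      exact Runs.setReg hB (by simp only [NatExp.val, h2]; omega) (by simpa [NatExp.val, h2] using h)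
  · rintro σ' hf ⟨hri, -⟩
    simp only [MachineTest.holds, NatExp.val, he σ' (hfr _ _ hf1 hf), hri]
    omega

end ProgramLogic


/-! ### Gram-Schmidt reduction -/

section GramSchmidt

variable {F : Type*} [RCLike F]

/-- The standard inner product of the first `L` entries. -/
noncomputable def rowInner (L : ℕ) (u v : ℕ → F) : F := ∑ x ∈ Finset.range L, star (u x) * v x

/-- Subtract from a row its components along `g 0, …, g (j - 1)`, one after the other. -/
noncomputable def reduceRow (L : ℕ) (g : ℕ → ℕ → F) : ℕ → (ℕ → F) → ℕ → F
  | 0, row => row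
  | j + 1, row => reduceRow L g j row -
      (rowInner L (g j) (reduceRow L g j row) / rowInner L (g j) (g j)) • g j

/-- Gram-Schmidt orthogonalization in which the row `i` is only reduced by the rows
`j < min i k`; the state after treating the first `i` rows. -/
noncomputable def gsRows (k L : ℕ) (a : ℕ → ℕ → F) : ℕ → ℕ → ℕ → F
  | 0 => a
  | i + 1 => Function.update (gsRows k L a i) i
      (reduceRow L (gsRows k L a i) (min i k) (gsRows k L a i i))

/-- The array `m` holds the first `K` rows of `r`, each of length `L`. -/
def HoldsRows (m : ℕ → F) (L K : ℕ) (r : ℕ → ℕ → F) : Prop :=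
  ∀ i < K, ∀ x < L, m (i * L + x) = r i x

lemma row_address_inj {L i x j y : ℕ} (hx : x < L) (hy : y < L) :
    i * L + x = j * L + y ↔ i = j ∧ x = y := by
  constructor
  · intro h
    have h1 : (i * L + x) / L = i := by
      rw [mul_comm, Nat.mul_add_div (by omega), Nat.div_eq_of_lt hx, add_zero]
    have h2 : (j * L + y) / L = j := by
      rw [mul_comm, Nat.mul_add_div (by omega), Nat.div_eq_of_lt hy, add_zero]
    have : i = j := by rw [← h1, ← h2, h]
    subst this
    exact ⟨rfl, by omega⟩
  · rintro ⟨rfl, rfl⟩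
    rfl

/-- Sizes stored in registers inherit their bounds from the hypothesis inside `Runs`. -/
lemma Runs.of_bdd {O : DiagFunction F} {B : ℕ} {c : MachineProgram} {σ : MachineState F}
    {Q : MachineState F → Prop} (h : (∀ r, σ.reg r ≤ B) → Runs O B c σ Q) : Runs O B c σ Q :=
  fun hσ => h hσ hσ

/-- The address of the entry `x` of the row `i`. -/
def rowAddr (i x L : NatExp) : NatExp := .add (.mul i L) x

/-- Reduce the row in register 24 of the array `A` by the row in register 25. -/
def reduceProg (A : ℕ) : MachineProgram :=
  .seq (.setCell 9 (.const 0) (.const 0))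
  (.seq (.setCell 9 (.const 1) (.const 0))
  (.seq (forLoop 26 (.reg 22)
    (.seq
      (.setCell 9 (.const 0) (.add (.cell 9 (.const 0))
        (.mul (.conj (.cell A (rowAddr (.reg 25) (.reg 26) (.reg 23))))
          (.cell A (rowAddr (.reg 24) (.reg 26) (.reg 23))))))
      (.setCell 9 (.const 1) (.add (.cell 9 (.const 1))
        (.mul (.conj (.cell A (rowAddr (.reg 25) (.reg 26) (.reg 23))))
          (.cell A (rowAddr (.reg 25) (.reg 26) (.reg 23))))))))
  (.seq (.setCell 9 (.const 2) (.div (.cell 9 (.const 0)) (.cell 9 (.const 1))))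
  (forLoop 26 (.reg 23)
    (.setCell A (rowAddr (.reg 24) (.reg 26) (.reg 23))
      (.sub (.cell A (rowAddr (.reg 24) (.reg 26) (.reg 23)))
        (.mul (.cell 9 (.const 2)) (.cell A (rowAddr (.reg 25) (.reg 26) (.reg 23))))))))))

/-- Gram-Schmidt orthogonalization of the rows in the array `A`. Registers 20 to 23 hold the number
of rows, the number of rows that are used to reduce the others, the length of the part of the rows
that is used in inner products and the length of the rows. -/
def gsProg (A : ℕ) : MachineProgram :=
  -- With truncated subtraction, i - (i - k) is the minimum of i and k.
  forLoop 24 (.reg 20) (forLoop 25 (.sub (.reg 24) (.sub (.reg 24) (.reg 21))) (reduceProg A))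

variable {O : DiagFunction F} {B : ℕ} {σ : MachineState F}

/-- Cells 0, 1, 2 of array 9 hold the two inner products and their quotient. The inner products see
only the first M entries but the subtraction acts on all L, so entries from M on can serve as a
record of the reduction. -/
lemma runs_reduceProg (hB : 2 ≤ B) {A K M L i j : ℕ} {r : ℕ → ℕ → F} (hA : A ≠ 9) (hML : M ≤ L)
    (h22 : σ.reg 22 = M) (h23 : σ.reg 23 = L) (h24 : σ.reg 24 = i) (h25 : σ.reg 25 = j)
    (hi : i < K) (hj : j < K) (hij : j ≠ i) (hr : HoldsRows (σ.mem A) L K r) :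
    Runs O B (reduceProg A) σ fun σ' => HoldsRows (σ'.mem A) L K
      (Function.update r i (r i - (rowInner M (r j) (r i) / rowInner M (r j) (r j)) • r j)) := by
  refine Runs.of_bdd fun hbd => ?_
  have hMB : M ≤ B := h22 ▸ hbd 22
  have hLB : L ≤ B := h23 ▸ hbd 23
  refine Runs.seq hB (Q := fun σ' => σ'.reg = σ.reg ∧ σ'.mem A = σ.mem A ∧ σ'.mem 9 0 = 0)
    (Runs.setCell hB ⟨rfl, by simp [hA], by simp [NatExp.val, FieldExp.val]⟩) ?_
  rintro σ1 - ⟨hr1, hm1, h90⟩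
  refine Runs.seq hB (Q := fun σ' => σ'.reg = σ.reg ∧ σ'.mem A = σ.mem A ∧ σ'.mem 9 0 = 0 ∧
    σ'.mem 9 1 = 0)
    (Runs.setCell hB ⟨hr1, by simp [hA, hm1], by simp [NatExp.val, h90],
      by simp [NatExp.val, FieldExp.val]⟩) ?_
  rintro σ2 - ⟨hr2, hm2, h90, h91⟩
  refine Runs.seq hB (Q := fun σ' => σ'.mem A = σ.mem A ∧ σ'.mem 9 0 = rowInner M (r j) (r i) ∧
    σ'.mem 9 1 = rowInner M (r j) (r j)) ?_ ?_
  · refine Runs.forLoop hB M (fun x σ' => σ'.mem A = σ.mem A ∧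
      σ'.mem 9 0 = rowInner x (r j) (r i) ∧ σ'.mem 9 1 = rowInner x (r j) (r j)) hMB rfl rfl
      (fun σ' hf => (hf.reg 22 rfl).trans (by rw [hr2, h22]))
      ⟨hm2, by simp [rowInner, h90], by simp [rowInner, h91]⟩ ?_
    rintro x hx σ' hf h26 ⟨hm, h90, h91⟩
    have e23 : σ'.reg 23 = L := (hf.reg 23 rfl).trans (by rw [hr2, h23])
    have e24 : σ'.reg 24 = i := (hf.reg 24 rfl).trans (by rw [hr2, h24])
    have e25 : σ'.reg 25 = j := (hf.reg 25 rfl).trans (by rw [hr2, h25])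
    have ei := hr i hi x (hx.trans_le hML)
    have ej := hr j hj x (hx.trans_le hML)
    refine Runs.seq hB (Q := fun σ'' => σ''.reg = σ'.reg ∧ σ''.mem A = σ.mem A ∧
      σ''.mem 9 0 = rowInner (x + 1) (r j) (r i) ∧ σ''.mem 9 1 = rowInner x (r j) (r j))
      (Runs.setCell hB ⟨rfl, by simp [hA, hm], ?_, by simp [NatExp.val, h91]⟩) ?_
    · simp [NatExp.val, FieldExp.val, rowAddr, e23, e24, e25, h26, hm, ei, ej, h90, rowInner,
        Finset.sum_range_succ]
    · rintro σ'' - ⟨hr3, hm3, h90, h91⟩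
      refine Runs.setCell hB ⟨by simp [hA, hm3], by simp [NatExp.val, h90], ?_⟩
      simp [NatExp.val, FieldExp.val, rowAddr, hr3, e23, e25, h26, hm3, ej, h91, rowInner,
        Finset.sum_range_succ]
  rintro σ3 hf3 ⟨hm3, h90, h91⟩
  have hreg3 : ∀ s, s ≠ 26 → σ3.reg s = σ.reg s := fun s hs => by
    rw [hf3.reg s (by simp [forLoop, MachineProgram.writesReg, hs]), hr2]
  refine Runs.seq hB (Q := fun σ' => σ'.reg = σ3.reg ∧ σ'.mem A = σ.mem A ∧
    σ'.mem 9 2 = rowInner M (r j) (r i) / rowInner M (r j) (r j))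
    (Runs.setCell hB ⟨rfl, by simp [hA, hm3], by simp [NatExp.val, FieldExp.val, h90, h91]⟩) ?_
  rintro σ4 - ⟨hr4, hm4, h92⟩
  set s := rowInner M (r j) (r i) / rowInner M (r j) (r j)
  -- The row is overwritten in place: after x rounds its first x entries are the new ones. The row j
  -- is untouched because j ≠ i.
  refine Runs.imp_frame (Runs.forLoop hB L (fun x σ' => ∀ i' < K, ∀ y < L, σ'.mem A (i' * L + y) =
    if i' = i ∧ y < x then r i y - s * r j y else r i' y) hLB rfl rfl
    (fun σ' hf => show σ'.reg 23 = L from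
      (hf.reg 23 rfl).trans (by rw [hr4, hreg3 23 (by simp), h23]))
    (fun i' hi' y hy => by simpa [hm4] using hr i' hi' y hy) ?_) ?_
  · intro x hx σ' hf h26 hI
    have e23 : σ'.reg 23 = L := (hf.reg 23 rfl).trans (by rw [hr4, hreg3 23 (by simp), h23])
    have e24 : σ'.reg 24 = i := (hf.reg 24 rfl).trans (by rw [hr4, hreg3 24 (by simp), h24])
    have e25 : σ'.reg 25 = j := (hf.reg 25 rfl).trans (by rw [hr4, hreg3 25 (by simp), h25])
    have e92 : σ'.mem 9 2 = s :=
      (congrFun (hf.mem 9 (by simp [forLoop, MachineProgram.writesMem, hA.symm])) 2).trans h92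
    refine Runs.setCell hB ?_
    intro i' hi' y hy
    have ei := hI i hi x hx
    have ej := hI j hj x hx
    simp only [lt_irrefl, and_false, if_false, hij] at ei ej
    simp only [Function.update_self, FieldExp.val, NatExp.val, rowAddr, e23, e24, e25, h26, e92,
      ei, ej]
    by_cases h : i' = i ∧ y = x
    · obtain ⟨rfl, rfl⟩ := h
      simp
    · rw [Function.update_of_ne (by rw [Ne, row_address_inj hy hx]; exact h), hI i' hi' y hy]
      congr 1
      simp only [eq_iff_iff]
      constructor
      · rintro ⟨h1, h2⟩; exact ⟨h1, by omega⟩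
      · rintro ⟨h1, h2⟩
        refine ⟨h1, ?_⟩
        have : y ≠ x := fun h3 => h ⟨h1, h3⟩
        omega
  · intro σ' _ h i' hi' y hy
    rw [h i' hi' y hy]
    by_cases h : i' = i
    · subst h; simp [hy]
    · simp [h]

lemma runs_gsProg (hB : 2 ≤ B) {A K k M L : ℕ} {a : ℕ → ℕ → F} (hA : A ≠ 9) (hML : M ≤ L)
    (h20 : σ.reg 20 = K) (h21 : σ.reg 21 = k)
    (h22 : σ.reg 22 = M) (h23 : σ.reg 23 = L) (ha : HoldsRows (σ.mem A) L K a) :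
    Runs O B (gsProg A) σ fun σ' => HoldsRows (σ'.mem A) L K (gsRows k M a K) := by
  refine Runs.of_bdd fun hbd => ?_
  have hKB : K ≤ B := h20 ▸ hbd 20
  refine Runs.forLoop hB K (fun i σ' => HoldsRows (σ'.mem A) L K (gsRows k M a i)) hKB rfl rfl
    (fun σ' hf => (hf.reg 20 rfl).trans h20) ha ?_
  intro i hi σ1 hf1 h24 hI
  have e21 : σ1.reg 21 = k := (hf1.reg 21 rfl).trans h21
  have e22 : σ1.reg 22 = M := (hf1.reg 22 rfl).trans h22
  have e23 : σ1.reg 23 = L := (hf1.reg 23 rfl).trans h23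
  set g := gsRows k M a i with hg
  refine Runs.forLoop hB (min i k) (fun j σ' => HoldsRows (σ'.mem A) L K
    (Function.update g i (reduceRow M g j (g i)))) ((min_le_left _ _).trans (by omega)) rfl rfl
    (fun σ' hf => ?_) (by simpa [reduceRow] using hI) ?_
  · have h1 : σ'.reg 24 = i := (hf.reg 24 rfl).trans h24
    have h2 : σ'.reg 21 = k := (hf.reg 21 rfl).trans e21
    simp only [NatExp.val, h1, h2]
    omega
  · intro j hj σ2 hf2 h25 hI2
    have hji : j < i := hj.trans_le (min_le_left _ _)
    refine (runs_reduceProg hB hA hML ((hf2.reg 22 rfl).trans e22) ((hf2.reg 23 rfl).trans e23)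
      ((hf2.reg 24 rfl).trans h24) h25 hi (hji.trans hi) hji.ne hI2).imp_frame ?_
    intro σ3 _ h3
    simpa [reduceRow, hji.ne] using h3

/-! ### Properties of the reduced rows -/

lemma rowInner_add (L : ℕ) (u v w : ℕ → F) :
    rowInner L u (v + w) = rowInner L u v + rowInner L u w := by
  simp [rowInner, mul_add, Finset.sum_add_distrib]

lemma rowInner_smul (L : ℕ) (c : F) (u v : ℕ → F) :
    rowInner L u (c • v) = c * rowInner L u v := by
  simp [rowInner, Finset.mul_sum, mul_left_comm]

/-- `rowInner` as a linear map in the second argument. -/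
noncomputable def rowInnerHom (L : ℕ) (u : ℕ → F) : (ℕ → F) →ₗ[F] F where
  toFun := rowInner L u
  map_add' := rowInner_add L u
  map_smul' c v := by simp [rowInner_smul]

lemma rowInner_sub (L : ℕ) (u v w : ℕ → F) :
    rowInner L u (v - w) = rowInner L u v - rowInner L u w := map_sub (rowInnerHom L u) v w

lemma star_rowInner (L : ℕ) (u v : ℕ → F) : star (rowInner L u v) = rowInner L v u := by
  simp [rowInner, mul_comm]

lemma rowInner_self_eq_zero {L : ℕ} {u : ℕ → F} : rowInner L u u = 0 ↔ ∀ x < L, u x = 0 := by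
  have h : rowInner L u u = ((∑ x ∈ Finset.range L, ‖u x‖ ^ 2 : ℝ) : F) := by
    simp only [rowInner, RCLike.ofReal_sum, RCLike.star_def, RCLike.conj_mul, RCLike.ofReal_pow]
  rw [h, RCLike.ofReal_eq_zero, Finset.sum_eq_zero_iff_of_nonneg (fun _ _ => by positivity)]
  simp

lemma rowInner_eq_zero_of_left {L : ℕ} {u : ℕ → F} (h : rowInner L u u = 0) (v : ℕ → F) :
    rowInner L u v = 0 :=
  Finset.sum_eq_zero fun x hx => by
    rw [rowInner_self_eq_zero.1 h x (Finset.mem_range.1 hx)]; simp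

lemma rowInner_comm_zero {L : ℕ} {u v : ℕ → F} (h : rowInner L u v = 0) : rowInner L v u = 0 := by
  rw [← star_rowInner, h, star_zero]

lemma gsRows_of_le {k L : ℕ} {a : ℕ → ℕ → F} {i : ℕ} : ∀ {K : ℕ}, K ≤ i →
    gsRows k L a K i = a i
  | 0, _ => rfl
  | K + 1, h => by
    rw [gsRows, Function.update_of_ne (by omega), gsRows_of_le (by omega)]

lemma gsRows_of_lt {k L : ℕ} {a : ℕ → ℕ → F} {i K : ℕ} (h : i < K) :
    gsRows k L a K i = gsRows k L a (i + 1) i := by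
  induction K, h using Nat.le_induction with
  | base => rfl
  | succ K hK ih =>
    rw [gsRows, Function.update_of_ne (by omega), ih]

lemma reduceRow_congr {L : ℕ} {g g' : ℕ → ℕ → F} {j : ℕ} (h : ∀ i < j, g i = g' i) (row : ℕ → F) :
    reduceRow L g j row = reduceRow L g' j row := by
  induction j with
  | zero => rfl
  | succ j ih =>
    rw [reduceRow, reduceRow, ih fun i hi => h i (by omega), h j (by omega)]

/-- A row is final once it has been treated, so the rows that reduce it may be taken from the final
state. -/
lemma gsRows_eq {k L : ℕ} {a : ℕ → ℕ → F} {i K : ℕ} (h : i < K) :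
    gsRows k L a K i = reduceRow L (gsRows k L a K) (min i k) (a i) := by
  rw [gsRows_of_lt h, gsRows, Function.update_self, gsRows_of_le le_rfl]
  refine reduceRow_congr (fun j hj => ?_) _
  have hj' : j < i := by omega
  rw [gsRows_of_lt hj', gsRows_of_lt (hj'.trans h)]

/-- A row of norm zero is never subtracted, because division by zero gives zero. This matters when
inner products use only part of a row: such a row may have nonzero later entries. -/
lemma sub_reduceRow_mem (L : ℕ) (g : ℕ → ℕ → F) (j : ℕ) (row : ℕ → F) :
    row - reduceRow L g j row ∈
      Submodule.span F {v | ∃ i < j, rowInner L (g i) (g i) ≠ 0 ∧ v = g i} := by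
  induction j with
  | zero => simp [reduceRow]
  | succ j ih =>
    have h1 : row - reduceRow L g (j + 1) row = (row - reduceRow L g j row) +
        (rowInner L (g j) (reduceRow L g j row) / rowInner L (g j) (g j)) • g j := by
      rw [reduceRow]; abel
    rw [h1]
    refine add_mem (Submodule.span_mono ?_ ih) ?_
    · rintro v ⟨i, hi, h⟩
      exact ⟨i, by omega, h⟩
    · by_cases h : rowInner L (g j) (g j) = 0
      · simp [h]
      · exact Submodule.smul_mem _ _ (Submodule.subset_span ⟨j, by omega, h, rfl⟩)

/-- Each subtraction removes one component and, by orthogonality of the `g i`, leaves the others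
alone. A row of norm zero is orthogonal to everything by definiteness. -/
lemma rowInner_reduceRow {L : ℕ} {g : ℕ → ℕ → F} {k : ℕ}
    (hg : ∀ i < k, ∀ j < k, i ≠ j → rowInner L (g i) (g j) = 0) (row : ℕ → F) :
    ∀ j ≤ k, ∀ i < j, rowInner L (g i) (reduceRow L g j row) = 0 := by
  intro j
  induction j with
  | zero => intro _ i hi; omega
  | succ j ih =>
    intro hj i hi
    rw [reduceRow, rowInner_sub, rowInner_smul]
    rcases eq_or_ne i j with rfl | hij
    · by_cases h : rowInner L (g i) (g i) = 0
      · simp [h, rowInner_eq_zero_of_left h]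
      · field_simp
        simp
    · rw [ih (by omega) i (by omega), hg i (by omega) j (by omega) hij]
      simp

/-- Strong induction: the rows that reduce row i are already orthogonal to each other. -/
lemma rowInner_gsRows {k L : ℕ} {a : ℕ → ℕ → F} {K : ℕ} :
    ∀ i < K, ∀ j < min i k, rowInner L (gsRows k L a K j) (gsRows k L a K i) = 0 := by
  intro i
  induction i using Nat.strong_induction_on with
  | _ i ih =>
    intro hi j hj
    rw [gsRows_eq hi]
    refine rowInner_reduceRow (k := min i k) (fun j1 h1 j2 h2 hne => ?_) _ _ le_rfl j hj
    rcases lt_or_gt_of_ne hne with h | h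
    · exact ih j2 (by omega) (by omega) j1 (by omega)
    · exact rowInner_comm_zero (ih j1 (by omega) (by omega) j2 (by omega))

lemma sub_gsRows_mem {k L : ℕ} {a : ℕ → ℕ → F} {K i : ℕ} (hi : i < K) :
    a i - gsRows k L a K i ∈ Submodule.span F {v | ∃ j < min i k,
      rowInner L (gsRows k L a K j) (gsRows k L a K j) ≠ 0 ∧ v = gsRows k L a K j} := by
  have h := sub_reduceRow_mem L (gsRows k L a K) (min i k) (a i)
  rwa [← gsRows_eq hi] at h

/-- With `mem_span_gsRows`, this says that the change of rows is triangular in both directions, so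
initial segments span the same spaces. -/
lemma gsRows_mem_span {k L : ℕ} {a : ℕ → ℕ → F} {K : ℕ} :
    ∀ i < K, gsRows k L a K i ∈ Submodule.span F {v | ∃ j ≤ i, v = a j} := by
  intro i
  induction i using Nat.strong_induction_on with
  | _ i ih =>
    intro hi
    have h1 := sub_gsRows_mem (k := k) (L := L) (a := a) hi
    have h2 : a i ∈ Submodule.span F {v | ∃ j ≤ i, v = a j} :=
      Submodule.subset_span ⟨i, le_rfl, rfl⟩
    have h3 : a i - gsRows k L a K i ∈ Submodule.span F {v | ∃ j ≤ i, v = a j} := by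
      refine Submodule.span_le.2 ?_ h1
      rintro v ⟨j, hj, -, rfl⟩
      refine Submodule.span_mono ?_ (ih j (by omega) (by omega))
      rintro v ⟨j', h, rfl⟩
      exact ⟨j', by omega, rfl⟩
    simpa using sub_mem h2 h3

lemma mem_span_gsRows {k L : ℕ} {a : ℕ → ℕ → F} {K i : ℕ} (hi : i < K) :
    a i ∈ Submodule.span F {v | ∃ j ≤ i, v = gsRows k L a K j} := by
  have h1 := sub_gsRows_mem (k := k) (L := L) (a := a) hi
  have h2 : gsRows k L a K i ∈ Submodule.span F {v | ∃ j ≤ i, v = gsRows k L a K j} :=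
    Submodule.subset_span ⟨i, le_rfl, rfl⟩
  have h3 : a i - gsRows k L a K i ∈ Submodule.span F {v | ∃ j ≤ i, v = gsRows k L a K j} := by
    refine Submodule.span_mono ?_ h1
    rintro v ⟨j, hj, -, rfl⟩
    exact ⟨j, by omega, rfl⟩
  simpa using add_mem h3 h2

end GramSchmidt


/-! ### Building blocks of the decomposition program -/

section Blocks

variable {F : Type*} [RCLike F]

/-- The indicator of `e₁ = e₂`, if array 5 holds `1, 0, 0, …`. -/
def indEq (e₁ e₂ : NatExp) : FieldExp := .cell 5 (.add (.sub e₁ e₂) (.sub e₂ e₁))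

/-- The indicator of `e₁ ≤ e₂`, if array 5 holds `1, 0, 0, …`. -/
def indLe (e₁ e₂ : NatExp) : FieldExp := .cell 5 (.sub e₁ e₂)

lemma val_indEq {σ : MachineState F} (h : σ.mem 5 = fun x => if x = 0 then 1 else 0)
    (e₁ e₂ : NatExp) : (indEq e₁ e₂).val σ = if e₁.val σ.reg = e₂.val σ.reg then 1 else 0 := by
  simp only [indEq, FieldExp.val, NatExp.val, h]
  congr 1
  simp only [eq_iff_iff]
  omega

lemma val_indLe {σ : MachineState F} (h : σ.mem 5 = fun x => if x = 0 then 1 else 0)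
    (e₁ e₂ : NatExp) : (indLe e₁ e₂).val σ = if e₁.val σ.reg ≤ e₂.val σ.reg then 1 else 0 := by
  simp only [indLe, FieldExp.val, NatExp.val, h]
  congr 1
  simp only [eq_iff_iff]
  omega

/-- The standing contents of registers 0 to 5 and arrays 0, 1, 2 and 5. -/
structure HasInput (n d p m : ℕ) (c t ω : ℕ → F) (σ : MachineState F) : Prop where
  r0 : σ.reg 0 = n
  r1 : σ.reg 1 = d
  r2 : σ.reg 2 = p
  r3 : σ.reg 3 = m
  r4 : σ.reg 4 = n ^ d
  r5 : σ.reg 5 = n ^ (d - 1)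
  m0 : σ.mem 0 = c
  m1 : σ.mem 1 = t
  m2 : σ.mem 2 = ω
  m5 : σ.mem 5 = fun x => if x = 0 then 1 else 0

/-- Does the program leave the data in `HasInput` alone? -/
def MachineProgram.keepsInput (c : MachineProgram) : Bool :=
  !(c.writesReg 0 || c.writesReg 1 || c.writesReg 2 || c.writesReg 3 || c.writesReg 4 ||
    c.writesReg 5 || c.writesMem 0 || c.writesMem 1 || c.writesMem 2 || c.writesMem 5)

/-- Carries the standing data through a step; `keepsInput` is evaluated by `rfl`. -/
lemma HasInput.frame {n d p m : ℕ} {c t ω : ℕ → F} {σ σ' : MachineState F}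
    (h : HasInput n d p m c t ω σ) {pr : MachineProgram} (hf : Frame pr σ σ')
    (hk : pr.keepsInput = true) : HasInput n d p m c t ω σ' := by
  simp only [MachineProgram.keepsInput, Bool.not_eq_true', Bool.or_eq_false_iff] at hk
  obtain ⟨⟨⟨⟨⟨⟨⟨⟨⟨h0, h1⟩, h2⟩, h3⟩, h4⟩, h5⟩, k0⟩, k1⟩, k2⟩, k5⟩ := hk
  exact ⟨(hf.reg 0 h0).trans h.r0, (hf.reg 1 h1).trans h.r1, (hf.reg 2 h2).trans h.r2,
    (hf.reg 3 h3).trans h.r3, (hf.reg 4 h4).trans h.r4, (hf.reg 5 h5).trans h.r5,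
    (hf.mem 0 k0).trans h.m0, (hf.mem 1 k1).trans h.m1, (hf.mem 2 k2).trans h.m2,
    (hf.mem 5 k5).trans h.m5⟩

/-- Fill `K` rows of length `L` of the array `A`, from row `o` on, with the values of `x`, which may
refer to the row in register 11 and the column in register 12. -/
def fillProg (A : ℕ) (o K L : NatExp) (x : FieldExp) : MachineProgram :=
  forLoop 11 K (forLoop 12 L (.setCell A (rowAddr (.add o (.reg 11)) (.reg 12) L) x))

variable {O : DiagFunction F} {B : ℕ} {σ : MachineState F}

/-- `σ'` differs from `σ` only in the registers 11, 12 and the array `A`. -/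
def AgreesOff (A : ℕ) (σ σ' : MachineState F) : Prop :=
  (∀ s, s ≠ 11 → s ≠ 12 → σ'.reg s = σ.reg s) ∧ ∀ a, a ≠ A → σ'.mem a = σ.mem a

/-- The expressions are assumed to have the right values in every state that differs from the
initial one only in registers 11, 12 and the array that is filled. The rows before `o` are kept, so
consecutive calls build one matrix out of blocks. -/
lemma runs_fillProg (hB : 2 ≤ B) {A : ℕ} {oe Ke Le : NatExp} {xe : FieldExp} {o K L : ℕ}
    {r : ℕ → ℕ → F} (hK : K ≤ B) (hL : L ≤ B)
    (ho : ∀ σ', AgreesOff A σ σ' → oe.val σ'.reg = o)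
    (hKe : ∀ σ', AgreesOff A σ σ' → Ke.val σ'.reg = K)
    (hLe : ∀ σ', AgreesOff A σ σ' → Le.val σ'.reg = L)
    (hx : ∀ i < K, ∀ j < L, ∀ σ', AgreesOff A σ σ' → σ'.reg 11 = i → σ'.reg 12 = j →
      xe.val σ' = r (o + i) j)
    (hr : HoldsRows (σ.mem A) L o r) :
    Runs O B (fillProg A oe Ke Le xe) σ fun σ' => HoldsRows (σ'.mem A) L (o + K) r := by
  have hf1 : ∀ σ' : MachineState F, Frame (fillProg A oe Ke Le xe) σ σ' → AgreesOff A σ σ' := by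
    refine fun σ' hf => ⟨fun s h1 h2 => hf.reg s ?_, fun a ha => hf.mem a ?_⟩
    · simp [fillProg, forLoop, MachineProgram.writesReg, h1, h2]
    · simp [fillProg, forLoop, MachineProgram.writesMem, ha]
  refine Runs.forLoop hB K (fun i σ' => HoldsRows (σ'.mem A) L (o + i) r) hK rfl rfl
    (fun σ' hf => hKe σ' (hf1 σ' hf)) (by simpa using hr) ?_
  intro i hi σ1 hfr h11 hI
  have ha1 := hf1 σ1 hfr
  have hf2 : ∀ σ' : MachineState F, Frame (forLoop 12 Le
      (.setCell A (rowAddr (.add oe (.reg 11)) (.reg 12) Le) xe)) σ1 σ' → AgreesOff A σ σ' := by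
    refine fun σ' hf => ⟨fun s h1 h2 => (hf.reg s ?_).trans (ha1.1 s h1 h2),
      fun a ha => (hf.mem a ?_).trans (ha1.2 a ha)⟩
    · simp [forLoop, MachineProgram.writesReg, h2]
    · simp [forLoop, MachineProgram.writesMem, ha]
  refine Runs.imp_frame (Runs.forLoop hB L (fun j σ' => HoldsRows (σ'.mem A) L (o + i) r ∧
    ∀ y < j, σ'.mem A ((o + i) * L + y) = r (o + i) y) hL rfl rfl
    (fun σ' hf => hLe σ' (hf2 σ' hf)) ⟨hI, by simp⟩ ?_) ?_
  · rintro j hj σ2 hfr2 h12 ⟨h1, h2⟩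
    have ha2 := hf2 σ2 hfr2
    have e11 : σ2.reg 11 = i := (hfr2.reg 11 rfl).trans h11
    have hv := hx i hi j hj σ2 ha2 e11 h12
    have haddr : (rowAddr (.add oe (.reg 11)) (.reg 12) Le).val σ2.reg = (o + i) * L + j := by
      simp only [rowAddr, NatExp.val, ho σ2 ha2, hLe σ2 ha2, e11, h12]
    refine Runs.setCell hB ⟨?_, ?_⟩
    · intro i' hi' y hy
      simp only [Function.update_self, haddr]
      rw [Function.update_of_ne, h1 i' hi' y hy]
      rw [Ne, row_address_inj hy hj]
      omega
    · intro y hy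
      simp only [Function.update_self, haddr, hv]
      rcases Nat.lt_succ_iff_lt_or_eq.1 hy with h | rfl
      · rw [Function.update_of_ne (by omega), h2 y h]
      · simp
  · rintro σ2 _ ⟨h1, h2⟩ i' hi' y hy
    rcases Nat.lt_succ_iff_lt_or_eq.1 hi' with h | rfl
    · exact h1 i' h y hy
    · exact h2 y hy

/-- Store the squared norm of a row of length `len` of the array `A` in the entry 0 of array 9. -/
def normProg (A : ℕ) (row len : NatExp) : MachineProgram :=
  .seq (.setCell 9 (.const 0) (.const 0)) (forLoop 12 len (.setCell 9 (.const 0)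
    (.add (.cell 9 (.const 0)) (.mul (.conj (.cell A (rowAddr row (.reg 12) len)))
      (.cell A (rowAddr row (.reg 12) len))))))

lemma runs_normProg (hB : 2 ≤ B) {A : ℕ} {re Le : NatExp} {K L i : ℕ} {r : ℕ → ℕ → F}
    (hA : A ≠ 9) (hL : L ≤ B) (hi : i < K) (hr : HoldsRows (σ.mem A) L K r)
    (hre : ∀ σ' : MachineState F, (∀ s, s ≠ 12 → σ'.reg s = σ.reg s) → re.val σ'.reg = i)
    (hLe : ∀ σ' : MachineState F, (∀ s, s ≠ 12 → σ'.reg s = σ.reg s) → Le.val σ'.reg = L) :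
    Runs O B (normProg A re Le) σ fun σ' => σ'.mem 9 0 = rowInner L (r i) (r i) := by
  refine Runs.seq hB (Q := fun σ' => σ'.reg = σ.reg ∧ σ'.mem A = σ.mem A ∧ σ'.mem 9 0 = 0)
    (Runs.setCell hB ⟨rfl, by simp [hA], by simp [NatExp.val, FieldExp.val]⟩) ?_
  rintro σ1 - ⟨hr1, hm1, h90⟩
  have hf1 : ∀ σ' : MachineState F, Frame (forLoop 12 Le (.setCell 9 (.const 0)
    (.add (.cell 9 (.const 0)) (.mul (.conj (.cell A (rowAddr re (.reg 12) Le)))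
      (.cell A (rowAddr re (.reg 12) Le)))))) σ1 σ' → (∀ s, s ≠ 12 → σ'.reg s = σ.reg s) := by
    refine fun σ' hf s hs => (hf.reg s ?_).trans (by rw [hr1])
    simp [forLoop, MachineProgram.writesReg, hs]
  refine Runs.forLoop hB L (fun x σ' => σ'.mem 9 0 = rowInner x (r i) (r i)) hL rfl rfl
    (fun σ' hf => hLe σ' (hf1 σ' hf)) (by simp [rowInner, h90]) ?_
  intro x hx σ2 hf h12 hI
  have hmA : σ2.mem A = σ.mem A :=
    (hf.mem A (by simp [forLoop, MachineProgram.writesMem, hA])).trans hm1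
  refine Runs.setCell hB ?_
  simp [NatExp.val, FieldExp.val, rowAddr, hre σ2 (hf1 σ2 hf), hLe σ2 (hf1 σ2 hf), h12, hmA,
    hr i hi x hx, hI, rowInner, Finset.sum_range_succ]

/-! ### Powers of `n` and the indicator of monotone tuples -/

/-- Compute `n ^ d`, `n ^ (d - 1)` and the contents of array 5. -/
def setupProg : MachineProgram :=
  .seq (.setCell 5 (.const 0) (.const 1)) (.seq (.setReg 4 (.const 1))
    (forLoop 11 (.reg 1) (.seq (.setReg 5 (.reg 4)) (.setReg 4 (.mul (.reg 4) (.reg 0))))))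

/-- Register 5 copies register 4 before each multiplication and so ends one power of n behind; for
this the loop must run at least once. -/
lemma runs_setupProg (hB : 2 ≤ B) {n d p m : ℕ} {c t ω : ℕ → F} (hd : 2 ≤ d) (hn : 0 < n)
    (hdB : d ≤ B) (hNB : n ^ d ≤ B)
    (h0 : σ.reg 0 = n) (h1 : σ.reg 1 = d) (h2 : σ.reg 2 = p) (h3 : σ.reg 3 = m)
    (m0 : σ.mem 0 = c) (m1 : σ.mem 1 = t) (m2 : σ.mem 2 = ω) (m5 : σ.mem 5 = 0) :
    Runs O B setupProg σ (HasInput n d p m c t ω) := by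
  have hpow : ∀ i ≤ d, n ^ i ≤ B := fun i hi => (Nat.pow_le_pow_right hn hi).trans hNB
  refine Runs.seq hB (Q := fun σ' => σ'.mem 5 = fun x => if x = 0 then 1 else 0)
    (Runs.setCell hB ?_) ?_
  · funext x
    simp [NatExp.val, FieldExp.val, m5, Function.update_apply]
  intro σ1 hf1 m5'
  refine Runs.seq hB (Q := fun σ' => σ'.reg 4 = 1)
    (Runs.setReg hB (by simp [NatExp.val]; omega) (by simp [NatExp.val])) ?_
  intro σ2 hf2 h4
  refine Runs.imp_frame (Runs.forLoop hB d (fun i σ' => σ'.reg 4 = n ^ i ∧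
    (i ≠ 0 → σ'.reg 5 = n ^ (i - 1))) hdB rfl rfl (fun σ' hf => ?_) ⟨by simpa using h4, by simp⟩ ?_) ?_
  · exact (hf.reg 1 rfl).trans ((hf2.reg 1 rfl).trans ((hf1.reg 1 rfl).trans h1))
  · rintro i hi σ3 hf3 - ⟨h4, -⟩
    have e0 : σ3.reg 0 = n := (hf3.reg 0 rfl).trans ((hf2.reg 0 rfl).trans ((hf1.reg 0 rfl).trans h0))
    refine Runs.seq hB (Q := fun σ' => σ'.reg 0 = n ∧ σ'.reg 4 = n ^ i ∧ σ'.reg 5 = n ^ i)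
      (Runs.setReg hB ?_ ⟨by simp [e0], by simp [h4], by simp [NatExp.val, h4]⟩) ?_
    · simp only [NatExp.val, h4]; exact hpow i hi.le
    · rintro σ4 - ⟨e0, e4, e5⟩
      refine Runs.setReg hB ?_ ⟨by simp [NatExp.val, e0, e4, pow_succ], by simp [e5]⟩
      simp only [NatExp.val, e0, e4, ← pow_succ]
      exact hpow _ hi
  · rintro σ3 hf3 ⟨e4, e5⟩
    have hr : ∀ s, s ≠ 4 → s ≠ 5 → s ≠ 11 → σ3.reg s = σ.reg s := fun s a b c => by
      rw [hf3.reg s (by simp [forLoop, MachineProgram.writesReg, a, b, c]),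
        hf2.reg s (by simp [MachineProgram.writesReg, a]), hf1.reg s rfl]
    have hm : ∀ s, s ≠ 5 → σ3.mem s = σ.mem s := fun s a => by
      rw [hf3.mem s rfl, hf2.mem s rfl, hf1.mem s (by simp [MachineProgram.writesMem, a])]
    exact ⟨(hr 0 (by simp) (by simp) (by simp)).trans h0,
      (hr 1 (by simp) (by simp) (by simp)).trans h1, (hr 2 (by simp) (by simp) (by simp)).trans h2,
      (hr 3 (by simp) (by simp) (by simp)).trans h3, e4, e5 (by omega),
      (hm 0 (by simp)).trans m0, (hm 1 (by simp)).trans m1, (hm 2 (by simp)).trans m2,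
      (hf3.mem 5 rfl).trans ((hf2.mem 5 rfl).trans m5')⟩

/-- The indicator of the numbers `x` whose `k` lowest digits in base `n` and the next one are
nondecreasing, starting with the lowest. -/
def monoCode (F : Type*) [RCLike F] (n k x : ℕ) : F :=
  ∏ j ∈ Finset.range k, if x / n ^ j % n ≤ x / n ^ (j + 1) % n then 1 else 0

/-- Store `monoCode` in array 6. -/
def monoProg : MachineProgram :=
  forLoop 11 (.reg 4) (.seq (.setCell 6 (.reg 11) (.const 1)) (.seq (.setReg 15 (.reg 11))
    (forLoop 12 (.sub (.reg 1) (.const 1)) (.seq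
      (.setCell 6 (.reg 11) (.mul (.cell 6 (.reg 11))
        (indLe (.mod (.reg 15) (.reg 0)) (.mod (.div (.reg 15) (.reg 0)) (.reg 0)))))
      (.setReg 15 (.div (.reg 15) (.reg 0)))))))

/-- Register 15 loses its lowest digit in each round, so the two digits to be compared are always
the two lowest. -/
lemma runs_monoProg (hB : 2 ≤ B) {n d p m : ℕ} {c t ω : ℕ → F} (hdB : d ≤ B)
    (hσ : HasInput n d p m c t ω σ) :
    Runs O B monoProg σ fun σ' => ∀ x < n ^ d, σ'.mem 6 x = monoCode F n (d - 1) x := by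
  refine Runs.of_bdd fun hbd => ?_
  have hNB : n ^ d ≤ B := hσ.r4 ▸ hbd 4
  refine Runs.forLoop hB (n ^ d) (fun i σ' => ∀ x < i, σ'.mem 6 x = monoCode F n (d - 1) x) hNB
    rfl rfl (fun σ' hf => (hf.reg 4 rfl).trans hσ.r4) (by simp) ?_
  intro i hi σ1 hf1 h11 hI
  have hσ1 := hσ.frame hf1 rfl
  refine Runs.seq hB (Q := fun σ' => σ'.reg = σ1.reg ∧ (∀ x < i, σ'.mem 6 x = monoCode F n (d - 1) x)
    ∧ σ'.mem 6 i = 1) (Runs.setCell hB ⟨rfl, ?_, by simp [NatExp.val, FieldExp.val, h11]⟩) ?_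
  · intro x hx
    simp only [NatExp.val, h11, Function.update_self]
    rw [Function.update_of_ne (by omega), hI x hx]
  rintro σ2 hf2 ⟨hr2, hI2, h6⟩
  have hσ2 := hσ1.frame hf2 rfl
  refine Runs.seq hB (Q := fun σ' => σ'.reg 15 = i)
    (Runs.setReg hB (by simp only [NatExp.val, hr2, h11]; omega) (by simp [NatExp.val, hr2, h11])) ?_
  intro σ3 hf3 h15
  have hσ3 := hσ2.frame hf3 rfl
  have e11 : σ3.reg 11 = i := (hf3.reg 11 rfl).trans (by rw [hr2, h11])
  have e6 : σ3.mem 6 = σ2.mem 6 := hf3.mem 6 rfl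
  refine Runs.imp_frame (Runs.forLoop hB (d - 1) (fun j σ' => σ'.reg 15 = i / n ^ j ∧
    (∀ x < i, σ'.mem 6 x = monoCode F n (d - 1) x) ∧ σ'.mem 6 i = monoCode F n j i) (by omega)
    rfl rfl (fun σ' hf => ?_) ⟨by simpa using h15, by simpa [e6] using hI2,
      by simp [e6, h6, monoCode]⟩ ?_) ?_
  · simp only [NatExp.val, (hf.reg 1 rfl).trans hσ3.r1]
  · rintro j hj σ4 hf4 - ⟨h15, hI4, h64⟩
    have hσ4 := hσ3.frame hf4 rfl
    have e11 : σ4.reg 11 = i := (hf4.reg 11 rfl).trans e11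
    refine Runs.seq hB (Q := fun σ' => σ'.reg = σ4.reg ∧
      (∀ x < i, σ'.mem 6 x = monoCode F n (d - 1) x) ∧ σ'.mem 6 i = monoCode F n (j + 1) i)
      (Runs.setCell hB ⟨rfl, ?_, ?_⟩) ?_
    · intro x hx
      simp only [NatExp.val, e11, Function.update_self]
      rw [Function.update_of_ne (by omega), hI4 x hx]
    · simp only [NatExp.val, FieldExp.val, e11, Function.update_self, h64, val_indLe hσ4.m5, h15,
        hσ4.r0, monoCode, Finset.prod_range_succ, Nat.div_div_eq_div_mul, ← pow_succ]
    · rintro σ5 - ⟨hr5, hI5, h65⟩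
      have e15 : (NatExp.div (.reg 15) (.reg 0)).val σ5.reg = i / n ^ (j + 1) := by
        simp only [NatExp.val, hr5, h15, hσ4.r0, Nat.div_div_eq_div_mul, ← pow_succ]
      refine Runs.setReg hB ?_ ⟨by simp [e15], by simpa using hI5, by simpa using h65⟩
      rw [e15]
      exact (Nat.div_le_self _ _).trans (by omega)
  · rintro σ4 _ ⟨-, h1, h2⟩ x hx
    rcases Nat.lt_succ_iff_lt_or_eq.1 hx with h | rfl
    · exact h1 x h
    · exact h2

end Blocks


/-! ### Programs for the range of the tensor, the basis of the first step and the two random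
combinations -/

section Subspaces

variable {F : Type*} [RCLike F] {O : DiagFunction F} {B : ℕ} {σ : MachineState F}

/-- Set the parameters of `gsProg` and run it. -/
def gsCall (A : ℕ) (K k M L : NatExp) : MachineProgram :=
  .seq (.setReg 20 K) (.seq (.setReg 21 k) (.seq (.setReg 22 M) (.seq (.setReg 23 L) (gsProg A))))

/-- The parameters are evaluated while registers 20 to 23 are being filled, so the expressions may
depend only on registers below 20. -/
lemma runs_gsCall (hB : 2 ≤ B) {A K k M L : ℕ} {Ke ke Me Le : NatExp} {a : ℕ → ℕ → F} (hA : A ≠ 9)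
    (hML : M ≤ L) (hKB : K ≤ B) (hkB : k ≤ B) (hLB : L ≤ B)
    (hK : ∀ σ' : MachineState F, (∀ s < 20, σ'.reg s = σ.reg s) → Ke.val σ'.reg = K)
    (hk : ∀ σ' : MachineState F, (∀ s < 20, σ'.reg s = σ.reg s) → ke.val σ'.reg = k)
    (hM : ∀ σ' : MachineState F, (∀ s < 20, σ'.reg s = σ.reg s) → Me.val σ'.reg = M)
    (hL : ∀ σ' : MachineState F, (∀ s < 20, σ'.reg s = σ.reg s) → Le.val σ'.reg = L)
    (ha : HoldsRows (σ.mem A) L K a) :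
    Runs O B (gsCall A Ke ke Me Le) σ fun σ' => HoldsRows (σ'.mem A) L K (gsRows k M a K) := by
  refine Runs.seq hB (Q := fun σ' => (∀ s < 20, σ'.reg s = σ.reg s) ∧ σ'.mem = σ.mem ∧
    σ'.reg 20 = K) (Runs.setReg hB (by rw [hK σ fun _ _ => rfl]; exact hKB)
      ⟨fun s hs => Function.update_of_ne (by omega) _ _, rfl, by simp [hK σ fun _ _ => rfl]⟩) ?_
  rintro σ1 - ⟨h1, m1, a1⟩
  refine Runs.seq hB (Q := fun σ' => (∀ s < 20, σ'.reg s = σ.reg s) ∧ σ'.mem = σ.mem ∧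
    σ'.reg 20 = K ∧ σ'.reg 21 = k) (Runs.setReg hB (by rw [hk σ1 h1]; exact hkB)
      ⟨fun s hs => (Function.update_of_ne (by omega) _ _).trans (h1 s hs), m1, by simp [a1],
        by simp [hk σ1 h1]⟩) ?_
  rintro σ2 - ⟨h2, m2, a2, b2⟩
  refine Runs.seq hB (Q := fun σ' => (∀ s < 20, σ'.reg s = σ.reg s) ∧ σ'.mem = σ.mem ∧
    σ'.reg 20 = K ∧ σ'.reg 21 = k ∧ σ'.reg 22 = M)
    (Runs.setReg hB (by rw [hM σ2 h2]; omega)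
      ⟨fun s hs => (Function.update_of_ne (by omega) _ _).trans (h2 s hs), m2, by simp [a2],
        by simp [b2], by simp [hM σ2 h2]⟩) ?_
  rintro σ3 - ⟨h3, m3, a3, b3, c3⟩
  refine Runs.seq hB (Q := fun σ' => σ'.mem = σ.mem ∧
    σ'.reg 20 = K ∧ σ'.reg 21 = k ∧ σ'.reg 22 = M ∧ σ'.reg 23 = L)
    (Runs.setReg hB (by rw [hL σ3 h3]; omega)
      ⟨m3, by simp [a3], by simp [b3], by simp [c3], by simp [hL σ3 h3]⟩) ?_
  rintro σ4 - ⟨m4, a4, b4, c4, d4⟩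
  exact runs_gsProg hB hA hML a4 b4 c4 d4 (by rw [m4]; exact ha)

/-! ### The range of the tensor -/

/-- The columns of the matrix `t` followed by the standard basis of `F ^ n`. -/
def spanRows (m : ℕ) (t : ℕ → F) (i x : ℕ) : F :=
  if i < m then t (x * m + i) else if x = i - m then 1 else 0

/-- `spanRows` after Gram-Schmidt. -/
noncomputable def spanGS (n m : ℕ) (t : ℕ → F) : ℕ → ℕ → F :=
  gsRows m n (spanRows m t) (m + n)

open Classical in
/-- The number of nonzero rows among the first `m` rows of `spanGS`. -/
noncomputable def spanRank (n m : ℕ) (t : ℕ → F) : ℕ :=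
  Nat.count (fun j => rowInner n (spanGS n m t j) (spanGS n m t j) ≠ 0) m

/-- Store `spanGS` in array 7 and its rank in register 6. -/
def spanProg : MachineProgram :=
  .seq (fillProg 7 (.const 0) (.reg 3) (.reg 0) (.cell 1 (rowAddr (.reg 12) (.reg 11) (.reg 3))))
  (.seq (fillProg 7 (.reg 3) (.reg 0) (.reg 0) (indEq (.reg 12) (.reg 11)))
  (.seq (gsCall 7 (.add (.reg 3) (.reg 0)) (.reg 3) (.reg 0) (.reg 0))
  (.seq (.setReg 6 (.const 0))
  (forLoop 11 (.reg 3) (.seq (normProg 7 (.reg 11) (.reg 0))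
    (.ite (.isZero (.cell 9 (.const 0))) .skip (.setReg 6 (.add (.reg 6) (.const 1)))))))))

/-- Unit vectors are reduced only by the columns of t, and so become their projections to the
orthogonal complement of the range. The first m rows are orthogonal, so the nonzero ones among them
are counted to get the rank. -/
lemma runs_spanProg (hB : 2 ≤ B) {n d p m : ℕ} {c t ω : ℕ → F} (hmn : m + n ≤ B)
    (hσ : HasInput n d p m c t ω σ) :
    Runs O B spanProg σ fun σ' => HoldsRows (σ'.mem 7) n (m + n) (spanGS n m t) ∧
      σ'.reg 6 = spanRank n m t := by
  classical
  refine Runs.seq hB (runs_fillProg (r := spanRows m t) (o := 0) (K := m) (L := n) hB (by omega)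
    (by omega) (fun _ _ => rfl) (fun σ' h => (h.1 3 (by simp) (by simp)).trans hσ.r3)
    (fun σ' h => (h.1 0 (by simp) (by simp)).trans hσ.r0) ?_ (fun i hi => by omega)) ?_
  · intro i hi j hj σ' h h11 h12
    have e3 := (h.1 3 (by simp) (by simp)).trans hσ.r3
    have m1 := (h.2 1 (by simp)).trans hσ.m1
    simp [FieldExp.val, NatExp.val, rowAddr, e3, h11, h12, m1, spanRows, hi]
  intro σ1 hf1 hI
  have hσ1 := hσ.frame hf1 rfl
  refine Runs.seq hB (runs_fillProg (r := spanRows m t) (o := m) (K := n) (L := n) hB (by omega)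
    (by omega) (fun σ' h => (h.1 3 (by simp) (by simp)).trans hσ1.r3)
    (fun σ' h => (h.1 0 (by simp) (by simp)).trans hσ1.r0)
    (fun σ' h => (h.1 0 (by simp) (by simp)).trans hσ1.r0) ?_ (by simpa using hI)) ?_
  · intro i hi j hj σ' h h11 h12
    rw [val_indEq ((h.2 5 (by simp)).trans hσ1.m5)]
    simp [NatExp.val, h11, h12, spanRows]
  intro σ2 hf2 hI
  have hσ2 := hσ1.frame hf2 rfl
  refine Runs.seq hB (runs_gsCall hB (K := m + n) (k := m) (M := n) (L := n) (by simp) le_rfl hmn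
    (by omega) (by omega) (fun σ' h => ?_) (fun σ' h => (h 3 (by simp)).trans hσ2.r3)
    (fun σ' h => (h 0 (by simp)).trans hσ2.r0) (fun σ' h => (h 0 (by simp)).trans hσ2.r0) hI) ?_
  · simp only [NatExp.val, h 3 (by simp), h 0 (by simp), hσ2.r3, hσ2.r0]
  intro σ3 hf3 hI
  have hσ3 := hσ2.frame hf3 rfl
  refine Runs.seq hB (Q := fun σ' => σ'.reg 6 = 0)
    (Runs.setReg hB (by simp [NatExp.val]) (by simp [NatExp.val])) ?_
  intro σ4 hf4 h6
  have hσ4 := hσ3.frame hf4 rfl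
  rw [← hf4.mem 7 rfl] at hI
  refine Runs.imp_frame (Runs.forLoop hB m (fun i σ' => σ'.reg 6 =
    Nat.count (fun j => rowInner n (spanGS n m t j) (spanGS n m t j) ≠ 0) i) (by omega) rfl rfl
    (fun σ' hf => (hf.reg 3 rfl).trans hσ4.r3) (by simpa using h6) ?_) ?_
  · intro i hi σ5 hf5 h11 h6
    have hσ5 := hσ4.frame hf5 rfl
    refine Runs.seq hB (runs_normProg hB (K := m + n) (L := n) (i := i) (r := spanGS n m t)
      (by simp) (by omega) (by omega) (by rw [hf5.mem 7 rfl]; exact hI)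
      (fun σ' h => (h 11 (by simp)).trans h11) (fun σ' h => (h 0 (by simp)).trans hσ5.r0)) ?_
    intro σ6 hf6 h9
    have h66 := (hf6.reg 6 rfl).trans h6
    refine Runs.ite hB (fun h => Runs.skip ?_) (fun h => Runs.setReg hB ?_ ?_)
    · simp only [MachineTest.holds, FieldExp.val, NatExp.val, h9] at h
      simp [Nat.count_succ, h, h66]
    · simp only [NatExp.val, h66]
      have := Nat.count_le (p := fun j => rowInner n (spanGS n m t j) (spanGS n m t j) ≠ 0) (n := i)
      omega
    · simp only [MachineTest.holds, FieldExp.val, NatExp.val, h9] at h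
      simp [Nat.count_succ, h, h66, NatExp.val]
  · intro σ5 hf5 h
    exact ⟨by rw [hf5.mem 7 rfl]; exact hI, h⟩

lemma spanRank_le (n m : ℕ) (t : ℕ → F) : spanRank n m t ≤ m := by
  classical
  exact Nat.count_le _

/-! ### Symmetric tensors over the range that are annihilated by the forms -/

/-- Rotate the digits of `x` in base `n`, if `L = n ^ (d - 1)`. -/
def rotCode (n L x : ℕ) : ℕ := x / n + x % n * L

/-- Swap the two lowest digits of `x` in base `n`. -/
def swapCode (n x : ℕ) : ℕ := x / n % n + x % n * n + x / (n * n) * (n * n)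

/-- The linear conditions on a symmetric tensor over the range of the tensor, followed by the
standard basis. -/
def symRows (n d p m : ℕ) (c : ℕ → F) (g : ℕ → ℕ → F) (i x : ℕ) : F :=
  -- Five blocks, where N = n^d: N conditions for invariance under rotating the factors, N for
  -- invariance under swapping the first two (these generate all permutations), p for vanishing on
  -- the forms, N for slices in the range, and N unit vectors. The forms are conjugated because the
  -- inner product is conjugate linear in its first argument.
  if i < n ^ d then (if x = i then 1 else 0) - (if x = rotCode n (n ^ (d - 1)) i then 1 else 0)
  else if i < 2 * n ^ d then
    (if x = i - n ^ d then 1 else 0) - (if x = swapCode n (i - n ^ d) then 1 else 0)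
  else if i < 2 * n ^ d + p then star (c ((i - 2 * n ^ d) * n ^ d + x)) * monoCode F n (d - 1) x
  else if i < 3 * n ^ d + p then
    -- The index within this block is a pair: the quotient by n^(d-1) selects a reduced unit vector,
    -- that is, a normal vector of the range, and the remainder selects a slice in the first
    -- direction.
    g (m + (i - (2 * n ^ d + p)) / n ^ (d - 1)) (x % n) *
      (if x / n = (i - (2 * n ^ d + p)) % n ^ (d - 1) then 1 else 0)
  else if x = i - (3 * n ^ d + p) then 1 else 0

section

variable {n d p m : ℕ} {c : ℕ → F} {g : ℕ → ℕ → F} {i : ℕ}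

lemma symRows_rot (h : i < n ^ d) (x : ℕ) : symRows n d p m c g i x =
    (if x = i then 1 else 0) - (if x = rotCode n (n ^ (d - 1)) i then 1 else 0) := by
  rw [symRows, if_pos h]

lemma symRows_swap (h : i < n ^ d) (x : ℕ) : symRows n d p m c g (n ^ d + i) x =
    (if x = i then 1 else 0) - (if x = swapCode n i then 1 else 0) := by
  rw [symRows, if_neg (by omega), if_pos (by omega), Nat.add_sub_cancel_left]

lemma symRows_form (h : i < p) (x : ℕ) : symRows n d p m c g (2 * n ^ d + i) x =
    star (c (i * n ^ d + x)) * monoCode F n (d - 1) x := by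
  rw [symRows, if_neg (by omega), if_neg (by omega), if_pos (by omega), Nat.add_sub_cancel_left]

lemma symRows_span (h : i < n ^ d) (x : ℕ) : symRows n d p m c g (2 * n ^ d + p + i) x =
    g (m + i / n ^ (d - 1)) (x % n) * (if x / n = i % n ^ (d - 1) then 1 else 0) := by
  rw [symRows, if_neg (by omega), if_neg (by omega), if_neg (by omega), if_pos (by omega),
    Nat.add_sub_cancel_left]

lemma symRows_basis (i x : ℕ) : symRows n d p m c g (3 * n ^ d + p + i) x =
    if x = i then 1 else 0 := by
  rw [symRows, if_neg (by omega), if_neg (by omega), if_neg (by omega), if_neg (by omega),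
    Nat.add_sub_cancel_left]

end

/-- `symRows` after Gram-Schmidt. -/
noncomputable def symGS (n d p m : ℕ) (c t : ℕ → F) : ℕ → ℕ → F :=
  gsRows (4 * n ^ d + p) (n ^ d) (symRows n d p m c (spanGS n m t)) (4 * n ^ d + p)

/-- The rows of `symGS` that span the solutions of the linear conditions. -/
noncomputable def solRows (n d p m : ℕ) (c t : ℕ → F) (x : ℕ) : ℕ → F :=
  symGS n d p m c t (3 * n ^ d + p + x)

/-- The row `x` of `solRows` is nonzero. -/
def SolRowNonzero (n d p m : ℕ) (c t : ℕ → F) (x : ℕ) : Prop :=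
  rowInner (n ^ d) (solRows n d p m c t x) (solRows n d p m c t x) ≠ 0

open Classical in
/-- The sum of the nonzero rows of `solRows`, with coefficients `w`. -/
noncomputable def sliceCode (n d p m : ℕ) (c t w : ℕ → F) (N z : ℕ) : F :=
  ∑ x ∈ Finset.range N, if SolRowNonzero n d p m c t x then
    w (Nat.count (SolRowNonzero n d p m c t) x) * solRows n d p m c t x z else 0

/-- Store `symGS` in array 8. -/
def symProg : MachineProgram :=
  .seq (fillProg 8 (.const 0) (.reg 4) (.reg 4) (.sub (indEq (.reg 12) (.reg 11))
    (indEq (.reg 12) (.add (.div (.reg 11) (.reg 0)) (.mul (.mod (.reg 11) (.reg 0)) (.reg 5))))))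
  (.seq (fillProg 8 (.reg 4) (.reg 4) (.reg 4) (.sub (indEq (.reg 12) (.reg 11))
    (indEq (.reg 12) (.add (.add (.mod (.div (.reg 11) (.reg 0)) (.reg 0))
      (.mul (.mod (.reg 11) (.reg 0)) (.reg 0)))
      (.mul (.div (.reg 11) (.mul (.reg 0) (.reg 0))) (.mul (.reg 0) (.reg 0)))))))
  (.seq (fillProg 8 (.mul (.const 2) (.reg 4)) (.reg 2) (.reg 4)
    (.mul (.conj (.cell 0 (rowAddr (.reg 11) (.reg 12) (.reg 4)))) (.cell 6 (.reg 12))))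
  (.seq (fillProg 8 (.add (.mul (.const 2) (.reg 4)) (.reg 2)) (.reg 4) (.reg 4)
    (.mul (.cell 7 (rowAddr (.add (.reg 3) (.div (.reg 11) (.reg 5)))
      (.mod (.reg 12) (.reg 0)) (.reg 0)))
      (indEq (.div (.reg 12) (.reg 0)) (.mod (.reg 11) (.reg 5)))))
  (.seq (fillProg 8 (.add (.mul (.const 3) (.reg 4)) (.reg 2)) (.reg 4) (.reg 4)
    (indEq (.reg 12) (.reg 11)))
  (gsCall 8 (.add (.mul (.const 4) (.reg 4)) (.reg 2)) (.add (.mul (.const 4) (.reg 4)) (.reg 2))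
    (.reg 4) (.reg 4))))))

lemma runs_symProg (hB : 2 ≤ B) {n d p m : ℕ} {c t ω : ℕ → F} (hn : 0 < n) (hd : 2 ≤ d)
    (hNB : 4 * n ^ d + p ≤ B)
    (hσ : HasInput n d p m c t ω σ) (h6 : ∀ x < n ^ d, σ.mem 6 x = monoCode F n (d - 1) x)
    (h7 : HoldsRows (σ.mem 7) n (m + n) (spanGS n m t)) :
    Runs O B symProg σ fun σ' =>
      HoldsRows (σ'.mem 8) (n ^ d) (4 * n ^ d + p) (symGS n d p m c t) := by
  have hL : 0 < n ^ (d - 1) := Nat.pow_pos hn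
  have hN : n ^ d = n * n ^ (d - 1) := by rw [← pow_succ', Nat.sub_add_cancel (by omega)]
  have r4 : ∀ {σ σ' : MachineState F}, HasInput n d p m c t ω σ → AgreesOff 8 σ σ' →
      σ'.reg 4 = n ^ d := fun hσ h => (h.1 4 (by simp) (by simp)).trans hσ.r4
  have inp : ∀ {σ σ' : MachineState F}, HasInput n d p m c t ω σ → AgreesOff 8 σ σ' →
      HasInput n d p m c t ω σ' := fun hσ h =>
    ⟨(h.1 0 (by simp) (by simp)).trans hσ.r0, (h.1 1 (by simp) (by simp)).trans hσ.r1,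
      (h.1 2 (by simp) (by simp)).trans hσ.r2, (h.1 3 (by simp) (by simp)).trans hσ.r3,
      (h.1 4 (by simp) (by simp)).trans hσ.r4, (h.1 5 (by simp) (by simp)).trans hσ.r5,
      (h.2 0 (by simp)).trans hσ.m0, (h.2 1 (by simp)).trans hσ.m1, (h.2 2 (by simp)).trans hσ.m2,
      (h.2 5 (by simp)).trans hσ.m5⟩
  set g := spanGS n m t with hg
  set r := symRows n d p m c g with hr
  refine Runs.seq hB (runs_fillProg (r := r) (o := 0) (K := n ^ d) (L := n ^ d) hB (by omega)
    (by omega) (fun _ _ => rfl) (fun σ' h => r4 hσ h) (fun σ' h => r4 hσ h) ?_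
    (fun i hi => by omega)) ?_
  · intro i hi j hj σ' h h11 h12
    have hi' := inp hσ h
    simp only [FieldExp.val, val_indEq hi'.m5, NatExp.val, h11, h12, hi'.r0, hi'.r5,
      hr, zero_add, symRows_rot hi, rotCode]
    rfl
  intro σ1 hf1 hI
  have hσ1 := hσ.frame hf1 rfl
  refine Runs.seq hB (runs_fillProg (r := r) (o := n ^ d) (K := n ^ d) (L := n ^ d) hB (by omega)
    (by omega) (fun σ' h => r4 hσ1 h) (fun σ' h => r4 hσ1 h) (fun σ' h => r4 hσ1 h) ?_
    (by simpa using hI)) ?_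
  · intro i hi j hj σ' h h11 h12
    have hi' := inp hσ1 h
    simp only [FieldExp.val, val_indEq hi'.m5, NatExp.val, h11, h12, hi'.r0, hr,
      symRows_swap hi, swapCode]
    rfl
  intro σ2 hf2 hI
  have hσ2 := hσ1.frame hf2 rfl
  refine Runs.seq hB (runs_fillProg (r := r) (o := 2 * n ^ d) (K := p) (L := n ^ d) hB (by omega)
    (by omega) (fun σ' h => by simp only [NatExp.val, r4 hσ2 h]) (fun σ' h => (inp hσ2 h).r2)
    (fun σ' h => r4 hσ2 h) ?_ (by rwa [two_mul])) ?_
  · intro i hi j hj σ' h h11 h12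
    have hi' := inp hσ2 h
    have e6 : σ'.mem 6 j = monoCode F n (d - 1) j := by
      rw [h.2 6 (by simp), hf2.mem 6 rfl, hf1.mem 6 rfl, h6 j hj]
    simp only [FieldExp.val, NatExp.val, rowAddr, h11, h12, hi'.r4, hi'.m0, hr, symRows_form hi, e6]
  intro σ3 hf3 hI
  have hσ3 := hσ2.frame hf3 rfl
  refine Runs.seq hB (runs_fillProg (r := r) (o := 2 * n ^ d + p) (K := n ^ d) (L := n ^ d) hB
    (by omega) (by omega) (fun σ' h => by simp only [NatExp.val, r4 hσ3 h, (inp hσ3 h).r2])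
    (fun σ' h => r4 hσ3 h) (fun σ' h => r4 hσ3 h) ?_ hI) ?_
  · intro i hi j hj σ' h h11 h12
    have hi' := inp hσ3 h
    have e7 : σ'.mem 7 = σ.mem 7 := by
      rw [h.2 7 (by simp), hf3.mem 7 rfl, hf2.mem 7 rfl, hf1.mem 7 rfl]
    have hdiv : i / n ^ (d - 1) < n := Nat.div_lt_of_lt_mul (by rwa [mul_comm, ← hN])
    simp only [FieldExp.val, NatExp.val, rowAddr, val_indEq hi'.m5, h11, h12, hi'.r0, hi'.r3,
      hi'.r5, hr, symRows_span hi, e7]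
    rw [h7 _ (by omega) _ (Nat.mod_lt _ hn)]
  intro σ4 hf4 hI
  have hσ4 := hσ3.frame hf4 rfl
  refine Runs.seq hB (runs_fillProg (r := r) (o := 3 * n ^ d + p) (K := n ^ d) (L := n ^ d) hB
    (by omega) (by omega) (fun σ' h => by simp only [NatExp.val, r4 hσ4 h, (inp hσ4 h).r2])
    (fun σ' h => r4 hσ4 h) (fun σ' h => r4 hσ4 h) ?_
    (by rwa [show 3 * n ^ d + p = 2 * n ^ d + p + n ^ d by ring])) ?_
  · intro i hi j hj σ' h h11 h12
    have hi' := inp hσ4 h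
    simp only [val_indEq hi'.m5, NatExp.val, h11, h12, hr, symRows_basis]
  intro σ5 hf5 hI
  have hσ5 := hσ4.frame hf5 rfl
  rw [show 3 * n ^ d + p + n ^ d = 4 * n ^ d + p by ring] at hI
  refine runs_gsCall hB (by simp) le_rfl hNB hNB (by omega) (fun σ' h => ?_) (fun σ' h => ?_)
    (fun σ' h => (h 4 (by simp)).trans hσ5.r4) (fun σ' h => (h 4 (by simp)).trans hσ5.r4) hI
  all_goals simp only [NatExp.val, h 4 (by simp), h 2 (by simp), hσ5.r4, hσ5.r2]

/-! ### Two random linear combinations -/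

/-- Store the number of nonzero solutions in register 7 and the two random linear combinations in
arrays 10 and 11. -/
def sliceProg : MachineProgram :=
  .seq (.setReg 7 (.const 0))
  (forLoop 11 (.reg 4) (.seq
    (normProg 8 (.add (.add (.mul (.const 3) (.reg 4)) (.reg 2)) (.reg 11)) (.reg 4))
    (.ite (.isZero (.cell 9 (.const 0))) .skip
      (.seq (forLoop 13 (.reg 4) (.seq
        (.setCell 10 (.reg 13) (.add (.cell 10 (.reg 13)) (.mul (.cell 2 (.reg 7)) (.cell 8 (rowAddr
          (.add (.add (.mul (.const 3) (.reg 4)) (.reg 2)) (.reg 11)) (.reg 13) (.reg 4))))))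
        (.setCell 11 (.reg 13) (.add (.cell 11 (.reg 13)) (.mul (.cell 2 (.add (.reg 0) (.reg 7)))
          (.cell 8 (rowAddr
          (.add (.add (.mul (.const 3) (.reg 4)) (.reg 2)) (.reg 11)) (.reg 13) (.reg 4))))))))
      (.setReg 7 (.add (.reg 7) (.const 1)))))))

open Classical in
-- Register 7 is both the number of nonzero solutions met so far and the address of the next random
-- coefficient. The coefficients of the second combination are found n places later.
lemma runs_sliceProg (hB : 2 ≤ B) {n d p m : ℕ} {c t ω : ℕ → F}
    (hNB : 4 * n ^ d + p ≤ B) (hσ : HasInput n d p m c t ω σ)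
    (h8 : HoldsRows (σ.mem 8) (n ^ d) (4 * n ^ d + p) (symGS n d p m c t))
    (h10 : σ.mem 10 = 0) (h11 : σ.mem 11 = 0) :
    Runs O B sliceProg σ fun σ' =>
      σ'.reg 7 = Nat.count (SolRowNonzero n d p m c t) (n ^ d) ∧
      (∀ z < n ^ d, σ'.mem 10 z = sliceCode n d p m c t ω (n ^ d) z) ∧
      ∀ z < n ^ d, σ'.mem 11 z = sliceCode n d p m c t (fun x => ω (n + x)) (n ^ d) z := by
  refine Runs.seq hB (Q := fun σ' => σ'.reg 7 = 0)
    (Runs.setReg hB (by simp [NatExp.val]) (by simp [NatExp.val])) ?_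
  intro σ1 hf1 h7
  have hσ1 := hσ.frame hf1 rfl
  rw [← hf1.mem 8 rfl] at h8
  rw [← hf1.mem 10 rfl] at h10
  rw [← hf1.mem 11 rfl] at h11
  refine Runs.forLoop hB (n ^ d) (fun i σ' =>
      σ'.reg 7 = Nat.count (SolRowNonzero n d p m c t) i ∧
      (∀ z < n ^ d, σ'.mem 10 z = sliceCode n d p m c t ω i z) ∧
      ∀ z < n ^ d, σ'.mem 11 z = sliceCode n d p m c t (fun x => ω (n + x)) i z) (by omega) rfl rfl
    (fun σ' hf => (hf.reg 4 rfl).trans hσ1.r4)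
    ⟨by simpa using h7, by simp [sliceCode, h10], by simp [sliceCode, h11]⟩ ?_
  rintro i hi σ2 hf2 h2i ⟨h7, h10, h11⟩
  have hσ2 := hσ1.frame hf2 rfl
  rw [← hf2.mem 8 rfl] at h8
  refine Runs.seq hB (runs_normProg hB (K := 4 * n ^ d + p) (L := n ^ d) (i := 3 * n ^ d + p + i)
    (by simp) (by omega) (by omega) h8 (fun σ' h => ?_)
    (fun σ' h => (h 4 (by simp)).trans hσ2.r4)) ?_
  · simp only [NatExp.val, h 4 (by simp), h 2 (by simp), h 11 (by simp), h2i, hσ2.r4, hσ2.r2]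
  intro σ3 hf3 h9
  have hσ3 := hσ2.frame hf3 rfl
  rw [← hf3.mem 8 rfl] at h8
  rw [← hf3.mem 10 rfl] at h10
  rw [← hf3.mem 11 rfl] at h11
  rw [← hf3.reg 7 rfl] at h7
  rw [← hf3.reg 11 rfl] at h2i
  refine Runs.ite hB (fun h => Runs.skip ?_) (fun h => ?_)
  · simp only [MachineTest.holds, FieldExp.val, NatExp.val, h9] at h
    have h' : ¬ SolRowNonzero n d p m c t i := fun hn => hn h
    refine ⟨by simp [Nat.count_succ, h', h7], fun z hz => ?_, fun z hz => ?_⟩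
    · simp only [h10 z hz, sliceCode, Finset.sum_range_succ, if_neg h', add_zero]
    · simp only [h11 z hz, sliceCode, Finset.sum_range_succ, if_neg h', add_zero]
  simp only [MachineTest.holds, FieldExp.val, NatExp.val, h9] at h
  have h' : SolRowNonzero n d p m c t i := h
  have hs : ∀ w z, sliceCode n d p m c t w (i + 1) z = sliceCode n d p m c t w i z +
      w (Nat.count (SolRowNonzero n d p m c t) i) * solRows n d p m c t i z := fun w z => by
    simp only [sliceCode, Finset.sum_range_succ, if_pos h']
  refine Runs.seq hB (Q := fun σ' =>
      (∀ z < n ^ d, σ'.mem 10 z = sliceCode n d p m c t ω (i + 1) z) ∧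
      ∀ z < n ^ d, σ'.mem 11 z = sliceCode n d p m c t (fun x => ω (n + x)) (i + 1) z) ?_ ?_
  · refine Runs.imp_frame (Runs.forLoop hB (n ^ d) (fun x σ' =>
      (∀ z < n ^ d, σ'.mem 10 z =
        if z < x then sliceCode n d p m c t ω (i + 1) z else sliceCode n d p m c t ω i z) ∧
      ∀ z < n ^ d, σ'.mem 11 z = if z < x then sliceCode n d p m c t (fun x => ω (n + x)) (i + 1) z
        else sliceCode n d p m c t (fun x => ω (n + x)) i z) (by omega) rfl rfl
      (fun σ' hf => (hf.reg 4 rfl).trans hσ3.r4) ⟨by simpa using h10, by simpa using h11⟩ ?_) ?_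
    · rintro x hx σ4 hf4 h13 ⟨h10, h11⟩
      have hσ4 := hσ3.frame hf4 rfl
      have e8 := h8 (3 * n ^ d + p + i) (by omega) x hx
      rw [← hf4.mem 8 rfl] at e8
      have e7 := (hf4.reg 7 rfl).trans h7
      have e11 := (hf4.reg 11 rfl).trans h2i
      -- The accumulators are updated entry by entry, so they agree with the new sum below x and
      -- with the old one from x on.
      have step : ∀ f g : ℕ → F, ∀ z, (if z < x + 1 then f z else g z) =
          if z = x then f x else if z < x then f z else g z := fun f g z => by
        rcases lt_trichotomy z x with h | h | h
        · rw [if_pos (by omega), if_neg (by omega), if_pos h]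
        · rw [if_pos (by omega), if_pos h, h]
        · rw [if_neg (by omega), if_neg (by omega), if_neg (by omega)]
      refine Runs.seq hB (Q := fun σ' => σ'.reg = σ4.reg ∧ σ'.mem 8 = σ4.mem 8 ∧
        σ'.mem 2 = σ4.mem 2 ∧ σ'.mem 11 = σ4.mem 11 ∧
        ∀ z < n ^ d, σ'.mem 10 z = if z < x + 1 then sliceCode n d p m c t ω (i + 1) z
          else sliceCode n d p m c t ω i z)
        (Runs.setCell hB ⟨rfl, by simp, by simp, by simp, fun z hz => ?_⟩) ?_
      · rw [step]
        simp only [NatExp.val, FieldExp.val, rowAddr, h13, hσ4.r4, hσ4.r2, e11, e8, e7, hσ4.m2,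
          Function.update_self, Function.update_apply, h10 x hx, h10 z hz, lt_irrefl, if_false, hs]
        rfl
      · rintro σ5 - ⟨hr5, m8, m2, m11, h10⟩
        refine Runs.setCell hB ⟨fun z hz => by simpa using h10 z hz, fun z hz => ?_⟩
        rw [step]
        simp only [NatExp.val, FieldExp.val, rowAddr, hr5, h13, hσ4.r0, hσ4.r4, hσ4.r2, e11, m8, e8,
          e7, m2, hσ4.m2, m11,
          Function.update_self, Function.update_apply, h11 x hx, h11 z hz, lt_irrefl, if_false, hs]
        rfl
    · rintro σ4 _ ⟨a, b⟩
      exact ⟨fun z hz => by rw [a z hz, if_pos hz], fun z hz => by rw [b z hz, if_pos hz]⟩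
  · rintro σ4 hf4 ⟨a, b⟩
    have e7 := (hf4.reg 7 rfl).trans h7
    refine Runs.setReg hB ?_ ⟨by simp [Nat.count_succ, h', e7, NatExp.val], a, b⟩
    simp only [NatExp.val, e7]
    have := Nat.count_le (p := SolRowNonzero n d p m c t) (n := i)
    omega

end Subspaces


/-! ### Programs for the eigenvectors, the acceptance test and the vectors in W -/

section Diagonalization

variable {F : Type*} [RCLike F] {O : DiagFunction F} {B : ℕ} {σ : MachineState F}

lemma HasInput.agreesOff {n d p m : ℕ} {c t ω : ℕ → F} {σ σ' : MachineState F} {A : ℕ}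
    (hσ : HasInput n d p m c t ω σ) (h : AgreesOff A σ σ') (h0 : A ≠ 0) (h1 : A ≠ 1) (h2 : A ≠ 2)
    (h5 : A ≠ 5) : HasInput n d p m c t ω σ' :=
  ⟨(h.1 0 (by simp) (by simp)).trans hσ.r0, (h.1 1 (by simp) (by simp)).trans hσ.r1,
    (h.1 2 (by simp) (by simp)).trans hσ.r2, (h.1 3 (by simp) (by simp)).trans hσ.r3,
    (h.1 4 (by simp) (by simp)).trans hσ.r4, (h.1 5 (by simp) (by simp)).trans hσ.r5,
    (h.2 0 h0.symm).trans hσ.m0, (h.2 1 h1.symm).trans hσ.m1, (h.2 2 h2.symm).trans hσ.m2,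
    (h.2 5 h5.symm).trans hσ.m5⟩

/-! ### The matrix to be diagonalized -/

/-- The columns of the `n × L` matrix `ψ`, each followed by the column of `φ`, and the standard
basis of `F ^ n`. -/
def pairRows (n L : ℕ) (ψ φ : ℕ → F) (i x : ℕ) : F :=
  if i < L then if x < n then ψ (x + n * i) else φ (x - n + n * i)
  else if x = i - L then 1 else 0

/-- `pairRows` after reduction by the columns of `ψ`. -/
noncomputable def pairGS (n L : ℕ) (ψ φ : ℕ → F) : ℕ → ℕ → F :=
  gsRows L n (pairRows n L ψ φ) (L + n)

/-- Store the matrix to be diagonalized in array 13. -/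
def matProg : MachineProgram :=
  .seq (fillProg 12 (.const 0) (.reg 5) (.mul (.const 2) (.reg 0))
    (.add (.mul (indLe (.add (.reg 12) (.const 1)) (.reg 0))
        (.cell 11 (.add (.reg 12) (.mul (.reg 0) (.reg 11)))))
      (.mul (.sub (.const 1) (indLe (.add (.reg 12) (.const 1)) (.reg 0)))
        (.cell 10 (.add (.sub (.reg 12) (.reg 0)) (.mul (.reg 0) (.reg 11)))))))
  (.seq (fillProg 12 (.reg 5) (.reg 0) (.mul (.const 2) (.reg 0)) (indEq (.reg 12) (.reg 11)))
  (.seq (gsCall 12 (.add (.reg 5) (.reg 0)) (.reg 5) (.reg 0) (.mul (.const 2) (.reg 0)))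
  -- The second half of the j-th reduced unit row is minus the j-th column of the matrix, hence the
  -- sign and the exchange of indices.
  (fillProg 13 (.const 0) (.reg 0) (.reg 0) (.sub (.const 0) (.cell 12
    (rowAddr (.add (.reg 5) (.reg 12)) (.add (.reg 0) (.reg 11)) (.mul (.const 2) (.reg 0))))))))

/-- One orthogonalization takes the place of a pseudoinverse: the first halves project onto the
columns of ψ, and the second halves apply the same combinations to the columns of φ. -/
lemma runs_matProg (hB : 2 ≤ B) {n d p m : ℕ} {c t ω : ℕ → F} (hd : 2 ≤ d)
    (hnB : 2 * n ≤ B) (hLB : n ^ (d - 1) + n ≤ B) (hσ : HasInput n d p m c t ω σ) {φ ψ : ℕ → F}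
    (h10 : ∀ z < n ^ d, σ.mem 10 z = φ z) (h11 : ∀ z < n ^ d, σ.mem 11 z = ψ z) :
    Runs O B matProg σ fun σ' => HoldsRows (σ'.mem 13) n n
      (fun i j => - pairGS n (n ^ (d - 1)) ψ φ (n ^ (d - 1) + j) (n + i)) := by
  set L := n ^ (d - 1) with hL
  have hN : n ^ d = n * L := by rw [hL, ← pow_succ', Nat.sub_add_cancel (by omega)]
  have haddr : ∀ i < L, ∀ x < n, x + n * i < n ^ d := fun i hi x hx => by
    rw [hN]
    calc x + n * i < n + n * i := by omega
      _ = n * (i + 1) := by ring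
      _ ≤ n * L := Nat.mul_le_mul_left _ hi
  set r := pairRows n L ψ φ with hr
  refine Runs.seq hB (runs_fillProg (r := r) (o := 0) (K := L) (L := 2 * n) hB (by omega) hnB
    (fun _ _ => rfl) (fun σ' h => (hσ.agreesOff h (by simp) (by simp) (by simp) (by simp)).r5)
    (fun σ' h => ?_) ?_ (fun i hi => by omega)) ?_
  · simp only [NatExp.val, (hσ.agreesOff h (by simp) (by simp) (by simp) (by simp)).r0]
  · intro i hi j hj σ' h e11 e12
    have hi' := hσ.agreesOff h (by simp) (by simp) (by simp) (by simp)
    simp only [FieldExp.val, val_indLe hi'.m5, NatExp.val, e11, e12, hi'.r0, h.2 10 (by simp),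
      h.2 11 (by simp), hr, pairRows, zero_add, if_pos hi]
    by_cases hjn : j < n
    · simp [hjn, h11 _ (haddr i hi j hjn)]
    · rw [h10 _ (haddr i hi (j - n) (by omega))]
      simp [hjn]
  intro σ1 hf1 hI
  have hσ1 := hσ.frame hf1 rfl
  refine Runs.seq hB (runs_fillProg (r := r) (o := L) (K := n) (L := 2 * n) hB (by omega) hnB
    (fun σ' h => (hσ1.agreesOff h (by simp) (by simp) (by simp) (by simp)).r5)
    (fun σ' h => (hσ1.agreesOff h (by simp) (by simp) (by simp) (by simp)).r0)
    (fun σ' h => ?_) ?_ (by simpa using hI)) ?_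
  · simp only [NatExp.val, (hσ1.agreesOff h (by simp) (by simp) (by simp) (by simp)).r0]
  · intro i hi j hj σ' h e11 e12
    have hi' := hσ1.agreesOff h (by simp) (by simp) (by simp) (by simp)
    simp [val_indEq hi'.m5, NatExp.val, e11, e12, hr, pairRows]
  intro σ2 hf2 hI
  have hσ2 := hσ1.frame hf2 rfl
  refine Runs.seq hB (runs_gsCall hB (K := L + n) (k := L) (M := n) (L := 2 * n) (by simp)
    (by omega) hLB (by omega) hnB (fun σ' h => ?_) (fun σ' h => (h 5 (by simp)).trans hσ2.r5)
    (fun σ' h => (h 0 (by simp)).trans hσ2.r0) (fun σ' h => ?_) hI) ?_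
  · simp only [NatExp.val, h 5 (by simp), h 0 (by simp), hσ2.r5, hσ2.r0, hL]
  · simp only [NatExp.val, h 0 (by simp), hσ2.r0]
  intro σ3 hf3 hI
  have hσ3 := hσ2.frame hf3 rfl
  refine Runs.imp_frame (runs_fillProg
    (r := fun i j => - pairGS n L ψ φ (L + j) (n + i)) (o := 0) (K := n) (L := n) hB (by omega)
    (by omega) (fun _ _ => rfl)
    (fun σ' h => (hσ3.agreesOff h (by simp) (by simp) (by simp) (by simp)).r0)
    (fun σ' h => (hσ3.agreesOff h (by simp) (by simp) (by simp) (by simp)).r0) ?_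
    (fun i hi => by omega)) (fun σ' _ h => by simpa using h)
  intro i hi j hj σ' h e11 e12
  have hi' := hσ3.agreesOff h (by simp) (by simp) (by simp) (by simp)
  simp only [FieldExp.val, NatExp.val, rowAddr, e11, e12, hi'.r0, hi'.r5, h.2 12 (by simp), zero_add,
    Nat.cast_zero, zero_sub, ← hL]
  rw [hI (L + j) (by omega) (n + i) (by omega)]
  rfl

/-! ### Diagonalization -/

lemma runs_diagonalize (hB : 2 ≤ B) {n : ℕ} {M : Matrix (Fin n) (Fin n) F} (h0 : σ.reg 0 = n)
    (hM : loadMatrix n (σ.mem 13) = M) :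
    Runs O B (.diagonalize 10 13 14 15 (.reg 0)) σ fun σ' =>
      (∃ D Q, O n M = some (D, Q) ∧ σ'.reg 10 = 1 ∧ (∀ i : Fin n, σ'.mem 14 i = D i) ∧
        ∀ i j : Fin n, σ'.mem 15 (i * n + j) = Q i j) ∨ (O n M = none ∧ σ'.reg 10 = 0) := by
  subst h0
  subst hM
  refine Runs.diagonalize hB (fun D Q h => Or.inl ⟨D, Q, h, by simp, fun i => ?_, fun i j => ?_⟩)
    (fun h => Or.inr ⟨h, by simp⟩)
  · simp [storeVector, NatExp.val]
  · have hlt : (i : ℕ) * σ.reg 0 + j < σ.reg 0 * σ.reg 0 := by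
      calc (i : ℕ) * σ.reg 0 + j < i * σ.reg 0 + σ.reg 0 := by omega
        _ = (i + 1) * σ.reg 0 := by ring
        _ ≤ σ.reg 0 * σ.reg 0 := Nat.mul_le_mul_right _ i.isLt
    have e : (⟨(i : ℕ) * σ.reg 0 + j, hlt⟩ : Fin (σ.reg 0 * σ.reg 0)) = finProdFinEquiv (i, j) := by
      ext; simp [finProdFinEquiv]; ring
    have h1 : (Fin.divNat (finProdFinEquiv (i, j)), Fin.modNat (finProdFinEquiv (i, j))) = (i, j) :=
      finProdFinEquiv.symm_apply_apply (i, j)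
    rw [Prod.mk.injEq] at h1
    simp only [storeMatrix, NatExp.val, Function.update_self]
    rw [dif_pos hlt, e, h1.1, h1.2]

/-! ### Selection and checks -/

/-- Copy the eigenvectors with nonzero eigenvalues to the rows of array 3; count them in
register 8. -/
def selectProg : MachineProgram :=
  .seq (.setReg 8 (.const 0)) (forLoop 11 (.reg 0) (.ite (.isZero (.cell 14 (.reg 11))) .skip
    (.seq (forLoop 12 (.reg 0) (.setCell 3 (rowAddr (.reg 8) (.reg 12) (.reg 0))
      (.cell 15 (rowAddr (.reg 12) (.reg 11) (.reg 0)))))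
    (.setReg 8 (.add (.reg 8) (.const 1))))))

open Classical in
lemma runs_selectProg (hB : 2 ≤ B) {n : ℕ} {D Q : ℕ → F} (hnB : n ≤ B) (h0 : σ.reg 0 = n)
    (hD : σ.mem 14 = D) (hQ : σ.mem 15 = Q) :
    Runs O B selectProg σ fun σ' => σ'.reg 8 = Nat.count (fun i => D i ≠ 0) n ∧
      ∀ i < n, D i ≠ 0 → ∀ x < n,
        σ'.mem 3 (Nat.count (fun i => D i ≠ 0) i * n + x) = Q (x * n + i) := by
  refine Runs.seq hB (Q := fun σ' => σ'.reg 8 = 0)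
    (Runs.setReg hB (by simp [NatExp.val]) (by simp [NatExp.val])) ?_
  intro σ1 hf1 h8
  rw [← hf1.reg 0 rfl] at h0
  rw [← hf1.mem 14 rfl] at hD
  rw [← hf1.mem 15 rfl] at hQ
  refine Runs.forLoop hB n (fun i' σ' => σ'.reg 8 = Nat.count (fun i => D i ≠ 0) i' ∧
      ∀ i < i', D i ≠ 0 → ∀ x < n,
        σ'.mem 3 (Nat.count (fun i => D i ≠ 0) i * n + x) = Q (x * n + i)) hnB rfl rfl
    (fun σ' hf => (hf.reg 0 rfl).trans h0) ⟨by simpa using h8, by simp⟩ ?_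
  rintro i hi σ2 hf2 h11 ⟨h8, hI⟩
  rw [← hf2.reg 0 rfl] at h0
  rw [← hf2.mem 14 rfl] at hD
  rw [← hf2.mem 15 rfl] at hQ
  refine Runs.ite hB (fun h => Runs.skip ?_) (fun h => ?_)
  · simp only [MachineTest.holds, FieldExp.val, NatExp.val, h11, hD] at h
    refine ⟨by simp [Nat.count_succ, h, h8], fun i' hi' hne => hI i' ?_ hne⟩
    rcases Nat.lt_succ_iff_lt_or_eq.1 hi' with h' | rfl
    · exact h'
    · exact absurd h hne
  simp only [MachineTest.holds, FieldExp.val, NatExp.val, h11, hD] at h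
  refine Runs.seq hB (Runs.forLoop hB n (fun x σ' =>
      (∀ i' < i, D i' ≠ 0 → ∀ x < n,
        σ'.mem 3 (Nat.count (fun i => D i ≠ 0) i' * n + x) = Q (x * n + i')) ∧
      ∀ y < x, σ'.mem 3 (Nat.count (fun i => D i ≠ 0) i * n + y) = Q (y * n + i)) hnB rfl rfl
    (fun σ' hf => (hf.reg 0 rfl).trans h0) ⟨hI, by simp⟩ ?_) ?_
  · rintro x hx σ3 hf3 h12 ⟨hI, hJ⟩
    have e0 := (hf3.reg 0 rfl).trans h0
    have e8 := (hf3.reg 8 rfl).trans h8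
    have e11 := (hf3.reg 11 rfl).trans h11
    have e15 := (hf3.mem 15 rfl).trans hQ
    refine Runs.setCell hB ⟨fun i' hi' hne y hy => ?_, fun y hy => ?_⟩
    · simp only [NatExp.val, FieldExp.val, rowAddr, e0, e8, h12, Function.update_self]
      rw [Function.update_of_ne, hI i' hi' hne y hy]
      rw [Ne, row_address_inj hy hx]
      have := Nat.count_strict_mono (p := fun i => D i ≠ 0) hne hi'
      omega
    · simp only [NatExp.val, FieldExp.val, rowAddr, e0, e8, h12, e11, e15, Function.update_self]
      rcases Nat.lt_succ_iff_lt_or_eq.1 hy with h' | rfl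
      · rw [Function.update_of_ne (by omega), hJ y h']
      · simp
  · rintro σ3 hf3 ⟨hI, hJ⟩
    have e8 := (hf3.reg 8 rfl).trans h8
    refine Runs.setReg hB ?_ ⟨?_, ?_⟩
    · simp only [NatExp.val, e8]
      have := Nat.count_le (p := fun i => D i ≠ 0) (n := i)
      omega
    · simp [Nat.count_succ, h, e8, NatExp.val]
    · intro i' hi' hne x hx
      rcases Nat.lt_succ_iff_lt_or_eq.1 hi' with h' | rfl
      · exact hI i' h' hne x hx
      · exact hJ x hx

/-- Register 9 is a failure flag. If each round preserves a failure and adds one exactly when its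
test fails, a loop computes a conjunction, and loops can be nested. -/
lemma Runs.forall_loop (hB : 2 ≤ B) {r : ℕ} {e : NatExp} {c : MachineProgram} (N : ℕ)
    {P : ℕ → Prop} (hr9 : r ≠ 9) (hN : N ≤ B) (hc : c.calls = 0) (hr : c.writesReg r = false)
    (he : ∀ σ', Frame (_root_.forLoop r e c) σ σ' → e.val σ'.reg = N)
    (hstep : ∀ i < N, ∀ σ', Frame (_root_.forLoop r e c) σ σ' → σ'.reg r = i →
      Runs O B c σ' fun σ'' => σ''.reg 9 = 0 ↔ σ'.reg 9 = 0 ∧ P i) :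
    Runs O B (_root_.forLoop r e c) σ fun σ' => σ'.reg 9 = 0 ↔ σ.reg 9 = 0 ∧ ∀ i < N, P i := by
  refine Runs.forLoop hB N (fun i σ' => σ'.reg 9 = 0 ↔ σ.reg 9 = 0 ∧ ∀ j < i, P j) hN hc hr he
    (by simp [hr9.symm]) ?_
  intro i hi σ' hf hri hI
  refine Runs.imp_frame (hstep i hi σ' hf hri) fun σ'' _ h => ?_
  simp only [Function.update_of_ne hr9.symm, h, hI, Nat.forall_lt_succ_right, and_assoc]

/-- Set register 9 if a nonzero eigenvalue is repeated. -/
def distinctProg : MachineProgram :=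
  forLoop 11 (.reg 0) (forLoop 12 (.reg 0) (.ite
    (.isZero (.mul (.cell 14 (.reg 11)) (.sub (.const 1) (indEq (.reg 11) (.reg 12))))) .skip
    (.ite (.isZero (.sub (.cell 14 (.reg 11)) (.cell 14 (.reg 12)))) (.setReg 9 (.const 1)) .skip)))

lemma runs_distinctProg (hB : 2 ≤ B) {n d p m : ℕ} {c t ω : ℕ → F} {D : ℕ → F} (hnB : n ≤ B)
    (hσ : HasInput n d p m c t ω σ) (hD : σ.mem 14 = D) :
    Runs O B distinctProg σ fun σ' => σ'.reg 9 = 0 ↔ σ.reg 9 = 0 ∧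
      ∀ i < n, ∀ j < n, D i ≠ 0 → i ≠ j → D i ≠ D j := by
  refine Runs.forall_loop hB n (by simp) hnB rfl rfl (fun σ' hf => (hf.reg 0 rfl).trans hσ.r0) ?_
  intro i hi σ1 hf1 h11
  have hσ1 := hσ.frame hf1 rfl
  rw [← hf1.mem 14 rfl] at hD
  refine Runs.forall_loop hB n (by simp) hnB rfl rfl (fun σ' hf => (hf.reg 0 rfl).trans hσ1.r0) ?_
  intro j hj σ2 hf2 h12
  have hσ2 := hσ1.frame hf2 rfl
  rw [← hf2.mem 14 rfl] at hD
  rw [← hf2.reg 11 rfl] at h11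
  refine Runs.ite hB (fun h => Runs.skip ?_) (fun h => ?_)
  · simp only [MachineTest.holds, FieldExp.val, NatExp.val, val_indEq hσ2.m5, h11, h12, hD] at h
    by_cases hij : i = j
    · simp [hij]
    · have : D i = 0 := by simpa [hij] using h
      simp [this]
  · simp only [MachineTest.holds, FieldExp.val, NatExp.val, val_indEq hσ2.m5, h11, h12, hD] at h
    have hij : i ≠ j := by rintro rfl; simp at h
    have hDi : D i ≠ 0 := by rintro h'; simp [h'] at h
    refine Runs.ite hB (fun h' => Runs.setReg hB (by simp [NatExp.val]; omega) ?_)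
      (fun h' => Runs.skip ?_)
    · simp only [MachineTest.holds, FieldExp.val, NatExp.val, h11, h12, hD, sub_eq_zero] at h'
      simp [NatExp.val, hij, h', h' ▸ hDi]
    · simp only [MachineTest.holds, FieldExp.val, NatExp.val, h11, h12, hD, sub_eq_zero] at h'
      simp [hij, h', hDi]

/-- The entry at `x` of the `k`-th tensor power of `v`. -/
def powCode (n k : ℕ) (v : ℕ → F) (x : ℕ) : F := ∏ j ∈ Finset.range k, v (x / n ^ j % n)

/-- The value at `v` of the form number `l`. -/
def formCode (n d : ℕ) (c : ℕ → F) (l : ℕ) (v : ℕ → F) : F :=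
  ∑ x ∈ Finset.range (n ^ d), c (l * n ^ d + x) * monoCode F n (d - 1) x * powCode n d v x

/-- Store the tensor power of the eigenvector in register 11 in array 16. -/
def powProg : MachineProgram :=
  forLoop 12 (.reg 4) (.seq (.setCell 16 (.reg 12) (.const 1)) (.seq (.setReg 15 (.reg 12))
    (forLoop 13 (.reg 1) (.seq
      (.setCell 16 (.reg 12) (.mul (.cell 16 (.reg 12))
        (.cell 15 (rowAddr (.mod (.reg 15) (.reg 0)) (.reg 11) (.reg 0)))))
      (.setReg 15 (.div (.reg 15) (.reg 0)))))))

lemma runs_powProg (hB : 2 ≤ B) {n d p m a : ℕ} {c t ω : ℕ → F} {Q : ℕ → F} (hdB : d ≤ B)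
    (hσ : HasInput n d p m c t ω σ) (hQ : σ.mem 15 = Q) (h11 : σ.reg 11 = a) :
    Runs O B powProg σ fun σ' => ∀ x < n ^ d,
      σ'.mem 16 x = powCode n d (fun j => Q (j * n + a)) x := by
  refine Runs.of_bdd fun hbd => ?_
  have hNB : n ^ d ≤ B := hσ.r4 ▸ hbd 4
  set v : ℕ → F := fun j => Q (j * n + a) with hv
  refine Runs.forLoop hB (n ^ d) (fun i σ' => ∀ x < i, σ'.mem 16 x = powCode n d v x) hNB
    rfl rfl (fun σ' hf => (hf.reg 4 rfl).trans hσ.r4) (by simp) ?_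
  intro i hi σ1 hf1 h12 hI
  have hσ1 := hσ.frame hf1 rfl
  rw [← hf1.mem 15 rfl] at hQ
  rw [← hf1.reg 11 rfl] at h11
  refine Runs.seq hB (Q := fun σ' => σ'.reg = σ1.reg ∧ (∀ x < i, σ'.mem 16 x = powCode n d v x)
    ∧ σ'.mem 16 i = 1) (Runs.setCell hB ⟨rfl, ?_, by simp [NatExp.val, FieldExp.val, h12]⟩) ?_
  · intro x hx
    simp only [NatExp.val, h12, Function.update_self]
    rw [Function.update_of_ne (by omega), hI x hx]
  rintro σ2 hf2 ⟨hr2, hI2, h16⟩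
  have hσ2 := hσ1.frame hf2 rfl
  refine Runs.seq hB (Q := fun σ' => σ'.reg 15 = i)
    (Runs.setReg hB (by simp only [NatExp.val, hr2, h12]; omega) (by simp [NatExp.val, hr2, h12])) ?_
  intro σ3 hf3 h15
  have hσ3 := hσ2.frame hf3 rfl
  have e12 : σ3.reg 12 = i := (hf3.reg 12 rfl).trans (by rw [hr2, h12])
  have e11 : σ3.reg 11 = a := (hf3.reg 11 rfl).trans (by rw [hr2, h11])
  have e16 : σ3.mem 16 = σ2.mem 16 := hf3.mem 16 rfl
  have eQ : σ3.mem 15 = Q := (hf3.mem 15 rfl).trans ((hf2.mem 15 rfl).trans hQ)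
  refine Runs.imp_frame (Runs.forLoop hB d (fun j σ' => σ'.reg 15 = i / n ^ j ∧
    (∀ x < i, σ'.mem 16 x = powCode n d v x) ∧ σ'.mem 16 i = powCode n j v i) (by omega)
    rfl rfl (fun σ' hf => (hf.reg 1 rfl).trans hσ3.r1) ⟨by simpa using h15, by simpa [e16] using hI2,
      by simp [e16, h16, powCode]⟩ ?_) ?_
  · rintro j hj σ4 hf4 - ⟨h15, hI4, h64⟩
    have hσ4 := hσ3.frame hf4 rfl
    have e12 : σ4.reg 12 = i := (hf4.reg 12 rfl).trans e12
    have e11 : σ4.reg 11 = a := (hf4.reg 11 rfl).trans e11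
    have eQ : σ4.mem 15 = Q := (hf4.mem 15 rfl).trans eQ
    refine Runs.seq hB (Q := fun σ' => σ'.reg = σ4.reg ∧
      (∀ x < i, σ'.mem 16 x = powCode n d v x) ∧ σ'.mem 16 i = powCode n (j + 1) v i)
      (Runs.setCell hB ⟨rfl, ?_, ?_⟩) ?_
    · intro x hx
      simp only [NatExp.val, e12, Function.update_self]
      rw [Function.update_of_ne (by omega), hI4 x hx]
    · simp only [NatExp.val, FieldExp.val, rowAddr, e11, e12, eQ, Function.update_self, h64, h15,
        hσ4.r0, powCode, Finset.prod_range_succ, hv]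
    · rintro σ5 - ⟨hr5, hI5, h65⟩
      have e15 : (NatExp.div (.reg 15) (.reg 0)).val σ5.reg = i / n ^ (j + 1) := by
        simp only [NatExp.val, hr5, h15, hσ4.r0, Nat.div_div_eq_div_mul, ← pow_succ]
      refine Runs.setReg hB ?_ ⟨by simp [e15], by simpa using hI5, by simpa using h65⟩
      rw [e15]
      exact (Nat.div_le_self _ _).trans (by omega)
  · rintro σ4 _ ⟨-, h1, h2⟩ x hx
    rcases Nat.lt_succ_iff_lt_or_eq.1 hx with h | rfl
    · exact h1 x h
    · exact h2

/-- Set register 9 if a form does not vanish at an eigenvector with nonzero eigenvalue. -/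
def memberProg : MachineProgram :=
  forLoop 11 (.reg 0) (.seq powProg (forLoop 12 (.reg 2)
    (.seq (.setCell 9 (.const 0) (.const 0)) (.seq
      (forLoop 13 (.reg 4) (.setCell 9 (.const 0) (.add (.cell 9 (.const 0))
        (.mul (.mul (.cell 0 (rowAddr (.reg 12) (.reg 13) (.reg 4))) (.cell 6 (.reg 13)))
          (.cell 16 (.reg 13))))))
      -- The factor D_i switches the test off for eigenvectors with eigenvalue zero.
      (.ite (.isZero (.mul (.cell 14 (.reg 11)) (.cell 9 (.const 0)))) .skip
        (.setReg 9 (.const 1)))))))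

lemma runs_memberProg (hB : 2 ≤ B) {n d p m : ℕ} {c t ω : ℕ → F} {D Q : ℕ → F} (hnB : n ≤ B)
    (hdB : d ≤ B) (hσ : HasInput n d p m c t ω σ) (hD : σ.mem 14 = D) (hQ : σ.mem 15 = Q)
    (h6 : ∀ x < n ^ d, σ.mem 6 x = monoCode F n (d - 1) x) :
    Runs O B memberProg σ fun σ' => σ'.reg 9 = 0 ↔ σ.reg 9 = 0 ∧
      ∀ i < n, ∀ l < p, D i * formCode n d c l (fun j => Q (j * n + i)) = 0 := by
  refine Runs.of_bdd fun hbd => ?_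
  have hNB : n ^ d ≤ B := hσ.r4 ▸ hbd 4
  have hpB : p ≤ B := hσ.r2 ▸ hbd 2
  refine Runs.forall_loop hB n (by simp) hnB rfl rfl (fun σ' hf => (hf.reg 0 rfl).trans hσ.r0) ?_
  intro i hi σ1 hf1 h11
  have hσ1 := hσ.frame hf1 rfl
  rw [← hf1.mem 14 rfl] at hD
  rw [← hf1.mem 15 rfl] at hQ
  rw [← hf1.mem 6 rfl] at h6
  refine Runs.seq hB (runs_powProg hB hdB hσ1 hQ h11) ?_
  intro σ2 hf2 h16
  have hσ2 := hσ1.frame hf2 rfl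
  rw [← hf2.mem 14 rfl] at hD
  rw [← hf2.mem 6 rfl] at h6
  rw [← hf2.reg 11 rfl] at h11
  rw [← hf2.reg 9 rfl]
  refine Runs.forall_loop hB p (by simp) hpB rfl rfl (fun σ' hf => (hf.reg 2 rfl).trans hσ2.r2) ?_
  intro l hl σ3 hf3 h12
  have hσ3 := hσ2.frame hf3 rfl
  refine Runs.seq hB (Q := fun σ' => σ'.mem 9 0 = 0)
    (Runs.setCell hB (by simp [NatExp.val, FieldExp.val])) ?_
  intro σ4 hf4 h9
  have hσ4 := hσ3.frame hf4 rfl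
  have e12 := (hf4.reg 12 rfl).trans h12
  rw [← hf3.mem 14 rfl, ← hf4.mem 14 rfl] at hD
  rw [← hf3.mem 6 rfl, ← hf4.mem 6 rfl] at h6
  rw [← hf3.mem 16 rfl, ← hf4.mem 16 rfl] at h16
  rw [← hf3.reg 11 rfl, ← hf4.reg 11 rfl] at h11
  rw [← hf4.reg 9 rfl]
  refine Runs.seq hB (Runs.forLoop hB (n ^ d) (fun y σ' => σ'.mem 9 0 = ∑ x ∈ Finset.range y,
    c (l * n ^ d + x) * monoCode F n (d - 1) x * powCode n d (fun j => Q (j * n + i)) x) hNB rfl rfl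
    (fun σ' hf => (hf.reg 4 rfl).trans hσ4.r4) (by simpa using h9) ?_) ?_
  · intro x hx σ5 hf5 h13 hI
    have hσ5 := hσ4.frame hf5 rfl
    have e12 := (hf5.reg 12 rfl).trans e12
    have e6 := h6 x hx
    have e16 := h16 x hx
    rw [← hf5.mem 6 rfl] at e6
    rw [← hf5.mem 16 rfl] at e16
    refine Runs.setCell hB ?_
    simp [NatExp.val, FieldExp.val, rowAddr, e12, h13, hσ5.r4, hσ5.m0, e6, e16, hI,
      Finset.sum_range_succ]
  · intro σ5 hf5 h9
    rw [← hf5.mem 14 rfl] at hD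
    rw [← hf5.reg 11 rfl] at h11
    rw [← hf5.reg 9 rfl]
    change σ5.mem 9 0 = formCode n d c l (fun j => Q (j * n + i)) at h9
    refine Runs.ite hB (fun h => Runs.skip ?_)
      (fun h => Runs.setReg hB (by simp [NatExp.val]; omega) ?_)
    · simp only [MachineTest.holds, FieldExp.val, NatExp.val, h11, hD, h9] at h
      simp only [h, and_true]
    · simp only [MachineTest.holds, FieldExp.val, NatExp.val, h11, hD, h9] at h
      simp only [h, and_false, iff_false, NatExp.val, Function.update_self]
      simp

/-! ### The vectors in `W` and the output -/

/-- The rows `v_a`, extended by the standard basis of `F ^ k`, followed by the columns of `t`. -/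
def solveRows (n m k : ℕ) (v t : ℕ → F) (i x : ℕ) : F :=
  if i < k then (if x < n then 1 else 0) * v (i * n + x) + (if x = n + i then 1 else 0)
  else (if x < n then 1 else 0) * t (x * m + (i - k))

/-- `solveRows` after reduction by the first `k` rows. -/
noncomputable def solveGS (n m k : ℕ) (v t : ℕ → F) : ℕ → ℕ → F :=
  gsRows k n (solveRows n m k v t) (k + m)

/-- Store the coordinates of the vectors in `W` in array 4. -/
def solveProg : MachineProgram :=
  .seq (fillProg 17 (.const 0) (.reg 6) (.add (.reg 0) (.reg 6))
    (.add (.mul (indLe (.add (.reg 12) (.const 1)) (.reg 0))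
        (.cell 3 (rowAddr (.reg 11) (.reg 12) (.reg 0))))
      (indEq (.reg 12) (.add (.reg 0) (.reg 11)))))
  (.seq (fillProg 17 (.reg 6) (.reg 3) (.add (.reg 0) (.reg 6))
    (.mul (indLe (.add (.reg 12) (.const 1)) (.reg 0))
        (.cell 1 (rowAddr (.reg 12) (.reg 11) (.reg 3)))))
  (.seq (gsCall 17 (.add (.reg 6) (.reg 3)) (.reg 6) (.reg 0) (.add (.reg 0) (.reg 6)))
  (fillProg 4 (.const 0) (.reg 6) (.reg 3) (.sub (.const 0) (.cell 17
    (rowAddr (.add (.reg 6) (.reg 12)) (.add (.reg 0) (.reg 11)) (.add (.reg 0) (.reg 6))))))))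

/-- The row of v_a ends in the unit vector e_a, which labels it. Reducing a column of t followed by
zeros therefore leaves minus its coordinates in the last k entries. -/
lemma runs_solveProg (hB : 2 ≤ B) {n d p m k : ℕ} {c t ω v : ℕ → F} (hnB : n + k ≤ B)
    (hkB : k + m ≤ B) (hσ : HasInput n d p m c t ω σ) (h6 : σ.reg 6 = k) (h3 : σ.mem 3 = v) :
    Runs O B solveProg σ fun σ' => HoldsRows (σ'.mem 4) m k
      (fun i j => - solveGS n m k v t (k + j) (n + i)) := by
  set r := solveRows n m k v t with hr
  have r6 : ∀ {A} {σ σ' : MachineState F}, σ.reg 6 = k → AgreesOff A σ σ' → σ'.reg 6 = k :=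
    fun h6 h => (h.1 6 (by simp) (by simp)).trans h6
  refine Runs.seq hB (runs_fillProg (r := r) (o := 0) (K := k) (L := n + k) hB (by omega) hnB
    (fun _ _ => rfl) (fun σ' h => r6 h6 h) (fun σ' h => ?_) ?_ (fun i hi => by omega)) ?_
  · simp only [NatExp.val, (hσ.agreesOff h (by simp) (by simp) (by simp) (by simp)).r0, r6 h6 h]
  · intro i hi j hj σ' h e11 e12
    have hi' := hσ.agreesOff h (by simp) (by simp) (by simp) (by simp)
    simp [FieldExp.val, val_indLe hi'.m5, val_indEq hi'.m5, NatExp.val, rowAddr, e11, e12, hi'.r0,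
      h.2 3 (by simp), h3, hr, solveRows, hi]
  intro σ1 hf1 hI
  have hσ1 := hσ.frame hf1 rfl
  rw [← hf1.reg 6 rfl] at h6
  refine Runs.seq hB (runs_fillProg (r := r) (o := k) (K := m) (L := n + k) hB (by omega) hnB
    (fun σ' h => r6 h6 h) 
    (fun σ' h => (hσ1.agreesOff h (by simp) (by simp) (by simp) (by simp)).r3)
    (fun σ' h => ?_) ?_ (by simpa using hI)) ?_
  · simp only [NatExp.val, (hσ1.agreesOff h (by simp) (by simp) (by simp) (by simp)).r0, r6 h6 h]
  · intro i hi j hj σ' h e11 e12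
    have hi' := hσ1.agreesOff h (by simp) (by simp) (by simp) (by simp)
    simp [FieldExp.val, val_indLe hi'.m5, NatExp.val, rowAddr, e11, e12, hi'.r0, hi'.r3, hi'.m1, hr,
      solveRows]
  intro σ2 hf2 hI
  have hσ2 := hσ1.frame hf2 rfl
  rw [← hf2.reg 6 rfl] at h6
  refine Runs.seq hB (runs_gsCall hB (K := k + m) (k := k) (M := n) (L := n + k) (by simp)
    (by omega) hkB (by omega) hnB (fun σ' h => ?_) (fun σ' h => (h 6 (by simp)).trans h6)
    (fun σ' h => (h 0 (by simp)).trans hσ2.r0) (fun σ' h => ?_) hI) ?_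
  · simp only [NatExp.val, h 6 (by simp), h 3 (by simp), hσ2.r3, h6]
  · simp only [NatExp.val, h 0 (by simp), h 6 (by simp), hσ2.r0, h6]
  intro σ3 hf3 hI
  have hσ3 := hσ2.frame hf3 rfl
  rw [← hf3.reg 6 rfl] at h6
  refine Runs.imp_frame (runs_fillProg
    (r := fun i j => - solveGS n m k v t (k + j) (n + i)) (o := 0) (K := k) (L := m) hB (by omega)
    (by omega) (fun _ _ => rfl) (fun σ' h => r6 h6 h)
    (fun σ' h => (h.1 3 (by simp) (by simp)).trans hσ3.r3) ?_
    (fun i hi => by omega)) (fun σ' _ h => by simpa using h)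
  intro i hi j hj σ' h e11 e12
  have e0 : σ'.reg 0 = n := (h.1 0 (by simp) (by simp)).trans hσ3.r0
  simp only [FieldExp.val, NatExp.val, rowAddr, e11, e12, e0, r6 h6 h, h.2 17 (by simp), zero_add,
    Nat.cast_zero, zero_sub]
  rw [hI (k + j) (by omega) (n + i) (by omega)]
  rfl

/-- Accept or fail. -/
def outputProg : MachineProgram :=
  -- A sum of natural numbers is zero only if all the terms are; each equality of registers
  -- contributes two truncated differences.
  .ite (.le (.add (.add (.reg 9) (.sub (.const 1) (.reg 10)))
    (.add (.add (.sub (.reg 7) (.reg 6)) (.sub (.reg 6) (.reg 7)))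
      (.add (.sub (.reg 8) (.reg 6)) (.sub (.reg 6) (.reg 8))))) (.const 0))
    (.seq (.setReg 0 (.const 1)) (.setReg 1 (.reg 6))) (.setReg 0 (.const 0))

lemma runs_outputProg (hB : 2 ≤ B) :
    Runs O B outputProg σ fun σ' =>
      (σ'.reg 0 ≠ 0 ↔ σ.reg 9 = 0 ∧ σ.reg 10 ≠ 0 ∧ σ.reg 7 = σ.reg 6 ∧ σ.reg 8 = σ.reg 6) ∧
      (σ'.reg 0 ≠ 0 → σ'.reg 1 = σ.reg 6) := by
  refine Runs.of_bdd fun hbd => ?_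
  refine Runs.ite hB (fun h => ?_) (fun h => ?_)
  · simp only [MachineTest.holds, NatExp.val] at h
    refine Runs.seq hB (Q := fun σ' => σ'.reg 0 = 1 ∧ σ'.reg 6 = σ.reg 6)
      (Runs.setReg hB (by simp [NatExp.val]; omega) (by simp [NatExp.val])) ?_
    rintro σ1 - ⟨h0, h6⟩
    refine Runs.setReg hB (by simp only [NatExp.val, h6]; exact hbd 6) ⟨?_, fun _ => ?_⟩
    · simp [h0]; omega
    · simp [NatExp.val, h6]
  · simp only [MachineTest.holds, NatExp.val] at h
    refine Runs.setReg hB (by simp [NatExp.val]) ⟨?_, ?_⟩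
    · simp only [NatExp.val, Function.update_self, ne_eq, not_true_eq_false, false_iff]; omega
    · simp [NatExp.val]

end Diagonalization


/-! ### The whole program -/

section MainProgram

variable {F : Type*} [RCLike F] {O : DiagFunction F} {B : ℕ} {σ : MachineState F}

/-- The decomposition program. -/
def mainProg : MachineProgram :=
  .seq setupProg (.seq monoProg (.seq spanProg (.seq symProg (.seq sliceProg (.seq matProg
  (.seq (.diagonalize 10 13 14 15 (.reg 0)) (.seq selectProg (.seq distinctProg (.seq memberProg
  (.seq solveProg outputProg))))))))))

/-- Extend a vector by zeros. -/
def finExt {n : ℕ} (v : Fin n → F) (x : ℕ) : F := if h : x < n then v ⟨x, h⟩ else 0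

@[simp] lemma finExt_val {n : ℕ} (v : Fin n → F) (x : Fin n) : finExt v x = v x := by
  simp [finExt]

lemma finExt_of_lt {n : ℕ} (v : Fin n → F) {x : ℕ} (h : x < n) : finExt v x = v ⟨x, h⟩ := by
  simp [finExt, h]

/-- `e` enumerates the indices of the nonzero entries of `D`. -/
def EnumNonzero {n k : ℕ} (D : Fin n → F) (e : Fin k → Fin n) : Prop :=
  Function.Injective e ∧ ∀ i, D i ≠ 0 ↔ ∃ a, e a = i

lemma formCode_congr {n d : ℕ} (hn : 0 < n) (c : ℕ → F) (l : ℕ) {v v' : ℕ → F}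
    (h : ∀ x < n, v x = v' x) : formCode n d c l v = formCode n d c l v' := by
  refine Finset.sum_congr rfl fun x _ => ?_
  congr 1
  exact Finset.prod_congr rfl fun j _ => h _ (Nat.mod_lt _ hn)

/-- The matrix that is diagonalized. -/
noncomputable def mainMatrix (n d p m : ℕ) (c t ω : ℕ → F) : Matrix (Fin n) (Fin n) F := fun i j =>
  - pairGS n (n ^ (d - 1)) (sliceCode n d p m c t (fun x => ω (n + x)) (n ^ d))
    (sliceCode n d p m c t ω (n ^ d)) (n ^ (d - 1) + j) (n + i)

open Classical in
lemma exists_enumNonzero_iff {n k : ℕ} (D : Fin n → F) :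
    (∃ e : Fin k → Fin n, EnumNonzero D e) ↔ Nat.count (fun i => finExt D i ≠ 0) n = k := by
  have hcard : Nat.count (fun i => finExt D i ≠ 0) n = Fintype.card {i : Fin n // D i ≠ 0} := by
    rw [Nat.count_eq_card_filter_range, Fintype.card_subtype]
    symm
    refine Finset.card_bij (fun i _ => (i : ℕ)) ?_ ?_ ?_
    · intro i hi
      simpa using hi
    · intro i _ j _ h
      exact Fin.ext h
    · intro x hx
      simp only [Finset.mem_filter, Finset.mem_range] at hx
      exact ⟨⟨x, hx.1⟩, by simpa [finExt_of_lt D hx.1] using hx.2, rfl⟩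
  rw [hcard]
  constructor
  · rintro ⟨e, he, hD⟩
    rw [← Fintype.card_fin k]
    exact (Fintype.card_congr (Equiv.ofBijective (fun a : Fin k => (⟨e a, (hD _).2 ⟨a, rfl⟩⟩ :
      {i : Fin n // D i ≠ 0})) ⟨fun a b h => he (congrArg Subtype.val h), fun i => by
        obtain ⟨a, ha⟩ := (hD i).1 i.2
        exact ⟨a, Subtype.ext ha⟩⟩)).symm
  · intro h
    have eq := Fintype.equivFinOfCardEq h
    exact ⟨fun a => eq.symm a, fun a b hab => eq.symm.injective (Subtype.ext hab), fun i =>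
      ⟨fun hi => ⟨eq ⟨i, hi⟩, by simp⟩, by rintro ⟨a, rfl⟩; exact (eq.symm a).2⟩⟩

open Classical in
-- The increasing enumeration: its a-th value has exactly a nonzero entries before it, which matches
-- the row in which `selectProg` puts the eigenvector.
lemma exists_enumNonzero_count {n k : ℕ} (D : Fin n → F)
    (h : Nat.count (fun i => finExt D i ≠ 0) n = k) : ∃ e : Fin k → Fin n, EnumNonzero D e ∧
      ∀ a, Nat.count (fun i => finExt D i ≠ 0) (e a) = a := by
  set p : ℕ → Prop := fun i => finExt D i ≠ 0 with hp
  have hlt : ∀ a < k, Nat.nth p a < n := fun a ha =>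
    Nat.nth_lt_of_lt_count (h.symm ▸ ha)
  have hcount : ∀ a < k, Nat.count p (Nat.nth p a) = a := fun a ha =>
    Nat.count_nth fun hf => by
      rw [← h] at ha
      exact ha.trans_le (Nat.count_le_card hf n)
  refine ⟨fun a => ⟨Nat.nth p a, hlt a a.isLt⟩, ⟨fun a b hab => ?_, fun i => ⟨fun hi => ?_, ?_⟩⟩,
    fun a => hcount a a.isLt⟩
  · have := congrArg (fun x : Fin n => Nat.count p x) hab
    simp only [hcount a a.isLt, hcount b b.isLt] at this
    exact Fin.ext this
  · have hpi : p i := by simpa [hp] using hi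
    have h1 : Nat.count p i < k := h ▸ Nat.count_strict_mono hpi i.isLt
    exact ⟨⟨_, h1⟩, Fin.ext (Nat.nth_count hpi)⟩
  · rintro ⟨a, rfl⟩
    have hpa : p (Nat.nth p a) := Nat.nth_mem _ fun hf => by
      have := a.isLt
      conv_rhs at this => rw [← h]
      exact this.trans_le (Nat.count_le_card hf n)
    rwa [hp, finExt_of_lt D (hlt a a.isLt)] at hpa

open Classical in
-- Only bookkeeping; the algebraic meaning of the acceptance conditions is established separately.
-- The coordinates in W are computed in any case and are meaningful only after acceptance. The
-- factor 8 leaves room for the longest list, of 4 n^d + p rows.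
theorem runs_mainProg {n d p m : ℕ} {c t ω : ℕ → F} (hn : 0 < n) (hd : 2 ≤ d)
    (hdN : d ≤ n ^ d) (hpN : p ≤ n ^ d) (hBN : 8 * (n ^ d + m) ≤ B)
    (h0 : σ.reg 0 = n) (h1 : σ.reg 1 = d) (h2 : σ.reg 2 = p) (h3 : σ.reg 3 = m) (h9 : σ.reg 9 = 0)
    (m0 : σ.mem 0 = c) (m1 : σ.mem 1 = t) (m2 : σ.mem 2 = ω) (m5 : σ.mem 5 = 0)
    (m10 : σ.mem 10 = 0) (m11 : σ.mem 11 = 0) :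
    Runs O B mainProg σ fun σ' =>
      (O n (mainMatrix n d p m c t ω) = none ∧ σ'.reg 0 = 0) ∨
      ∃ D Q, O n (mainMatrix n d p m c t ω) = some (D, Q) ∧
        (σ'.reg 0 ≠ 0 ↔ Nat.count (SolRowNonzero n d p m c t) (n ^ d) = spanRank n m t ∧
          (∃ e : Fin (spanRank n m t) → Fin n, EnumNonzero D e) ∧
          (∀ i j, D i ≠ 0 → i ≠ j → D i ≠ D j) ∧
          ∀ i, D i ≠ 0 → ∀ l < p, formCode n d c l (finExt fun x => Q x i) = 0) ∧
        (σ'.reg 0 ≠ 0 → σ'.reg 1 = spanRank n m t ∧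
          ∃ e : Fin (spanRank n m t) → Fin n, EnumNonzero D e ∧
            (∀ (a : Fin (spanRank n m t)) (x : Fin n), σ'.mem 3 (a * n + x) = Q x (e a)) ∧
            ∀ a < spanRank n m t, ∀ j < m, σ'.mem 4 (a * m + j) =
              - solveGS n m (spanRank n m t) (σ'.mem 3) t (spanRank n m t + j) (n + a)) := by
  have hnN : n ≤ n ^ d := Nat.le_self_pow (by omega) n
  have hLN : n ^ (d - 1) ≤ n ^ d := Nat.pow_le_pow_right hn (by omega)
  have hN : 0 < n ^ d := Nat.pow_pos hn
  have hB : 2 ≤ B := by omega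
  have hkm := spanRank_le n m t
  set k := spanRank n m t with hk
  set φ := sliceCode n d p m c t ω (n ^ d) with hφ
  set ψ := sliceCode n d p m c t (fun x => ω (n + x)) (n ^ d) with hψ
  refine Runs.seq hB (runs_setupProg hB hd hn (by omega) (by omega) h0 h1 h2 h3 m0 m1 m2 m5) ?_
  intro σ1 f1 i1
  have r9 := (f1.reg 9 rfl).trans h9
  rw [← f1.mem 10 rfl] at m10
  rw [← f1.mem 11 rfl] at m11
  refine Runs.seq hB (runs_monoProg hB (by omega) i1) ?_
  intro σ2 f2 m6
  have i2 := i1.frame f2 rfl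
  replace r9 := (f2.reg 9 rfl).trans r9
  rw [← f2.mem 10 rfl] at m10
  rw [← f2.mem 11 rfl] at m11
  refine Runs.seq hB (runs_spanProg hB (by omega) i2) ?_
  rintro σ3 f3 ⟨m7, r6⟩
  have i3 := i2.frame f3 rfl
  replace r9 := (f3.reg 9 rfl).trans r9
  rw [← f3.mem 10 rfl] at m10
  rw [← f3.mem 11 rfl] at m11
  rw [← f3.mem 6 rfl] at m6
  refine Runs.seq hB (runs_symProg hB hn hd (by omega) i3 m6 m7) ?_
  intro σ4 f4 m8
  have i4 := i3.frame f4 rfl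
  replace r9 := (f4.reg 9 rfl).trans r9
  replace r6 := (f4.reg 6 rfl).trans r6
  rw [← f4.mem 10 rfl] at m10
  rw [← f4.mem 11 rfl] at m11
  rw [← f4.mem 6 rfl] at m6
  refine Runs.seq hB (runs_sliceProg hB (by omega) i4 m8 m10 m11) ?_
  rintro σ5 f5 ⟨r7, m10, m11⟩
  have i5 := i4.frame f5 rfl
  replace r9 := (f5.reg 9 rfl).trans r9
  replace r6 := (f5.reg 6 rfl).trans r6
  rw [← f5.mem 6 rfl] at m6
  refine Runs.seq hB (runs_matProg hB hd (by omega) (by omega) i5 m10 m11) ?_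
  intro σ6 f6 m13
  have i6 := i5.frame f6 rfl
  replace r9 := (f6.reg 9 rfl).trans r9
  replace r6 := (f6.reg 6 rfl).trans r6
  replace r7 := (f6.reg 7 rfl).trans r7
  rw [← f6.mem 6 rfl] at m6
  have hM : loadMatrix n (σ6.mem 13) = mainMatrix n d p m c t ω := by
    ext i j
    exact m13 i i.isLt j j.isLt
  refine Runs.seq hB (runs_diagonalize hB i6.r0 hM) ?_
  intro σ7 f7 hO
  have i7 := i6.frame f7 rfl
  replace r9 := (f7.reg 9 rfl).trans r9
  replace r6 := (f7.reg 6 rfl).trans r6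
  replace r7 := (f7.reg 7 rfl).trans r7
  rw [← f7.mem 6 rfl] at m6
  refine Runs.seq hB (runs_selectProg hB (by omega) i7.r0 rfl rfl) ?_
  rintro σ8 f8 ⟨r8, m3⟩
  have i8 := i7.frame f8 rfl
  replace r9 := (f8.reg 9 rfl).trans r9
  replace r6 := (f8.reg 6 rfl).trans r6
  replace r7 := (f8.reg 7 rfl).trans r7
  have r10 := f8.reg 10 rfl
  rw [← f8.mem 6 rfl] at m6
  refine Runs.seq hB (runs_distinctProg hB (by omega) i8 (f8.mem 14 rfl)) ?_
  intro σ9 f9 hdist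
  rw [r9] at hdist
  have i9 := i8.frame f9 rfl
  replace r6 := (f9.reg 6 rfl).trans r6
  replace r7 := (f9.reg 7 rfl).trans r7
  replace r8 := (f9.reg 8 rfl).trans r8
  replace r10 := (f9.reg 10 rfl).trans r10
  rw [← f9.mem 6 rfl] at m6
  rw [← f9.mem 3 rfl] at m3
  refine Runs.seq hB (runs_memberProg hB (by omega) (by omega) i9
    ((f9.mem 14 rfl).trans (f8.mem 14 rfl)) ((f9.mem 15 rfl).trans (f8.mem 15 rfl)) m6) ?_
  intro σ10 f10 hmem
  rw [hdist] at hmem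
  have i10 := i9.frame f10 rfl
  replace r6 := (f10.reg 6 rfl).trans r6
  replace r7 := (f10.reg 7 rfl).trans r7
  replace r8 := (f10.reg 8 rfl).trans r8
  replace r10 := (f10.reg 10 rfl).trans r10
  rw [← f10.mem 3 rfl] at m3
  refine Runs.seq hB (runs_solveProg hB (k := k) (by omega) (by omega) i10 r6 rfl) ?_
  intro σ11 f11 m4
  replace r6 := (f11.reg 6 rfl).trans r6
  replace r7 := (f11.reg 7 rfl).trans r7
  replace r8 := (f11.reg 8 rfl).trans r8
  replace r10 := (f11.reg 10 rfl).trans r10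
  have r9' := f11.reg 9 rfl
  rw [← f11.mem 3 rfl] at m3 m4
  refine Runs.imp_frame (runs_outputProg hB) ?_
  rintro σ12 f12 ⟨hout, hk1⟩
  rw [← f12.mem 3 rfl] at m3 m4
  rw [← f12.mem 4 rfl] at m4
  rw [r9', hmem, r10, r7, r6, r8] at hout
  rw [r6] at hk1
  rcases hO with ⟨D, Q, hO, hflag, hD, hQ⟩ | ⟨hO, hflag⟩
  swap
  · refine Or.inl ⟨hO, ?_⟩
    by_contra h
    exact (hout.1 h).2.1 hflag
  have hD' : ∀ i (hi : i < n), σ7.mem 14 i = finExt D i := fun i hi => by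
    rw [finExt_of_lt D hi, ← hD]
  have hcount : ∀ j ≤ n, Nat.count (fun i => σ7.mem 14 i ≠ 0) j =
      Nat.count (fun i => finExt D i ≠ 0) j := by
    intro j hj
    rw [Nat.count_eq_card_filter_range, Nat.count_eq_card_filter_range]
    congr 1
    refine Finset.filter_congr fun i hi => ?_
    rw [hD' i ((Finset.mem_range.1 hi).trans_le hj)]
  refine Or.inr ⟨D, Q, hO, ?_, fun h => ?_⟩
  · rw [hcount n le_rfl, hflag] at hout
    rw [exists_enumNonzero_iff]
    have e1 : (∀ i < n, ∀ j < n, σ7.mem 14 i ≠ 0 → i ≠ j → σ7.mem 14 i ≠ σ7.mem 14 j) ↔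
        ∀ i j, D i ≠ 0 → i ≠ j → D i ≠ D j := by
      constructor
      · intro h i j hi hij
        rw [← hD i, ← hD j]
        exact h i i.isLt j j.isLt (by rwa [hD i]) (fun h => hij (Fin.ext h))
      · intro h i hi j hj
        rw [show σ7.mem 14 i = D ⟨i, hi⟩ from hD ⟨i, hi⟩, show σ7.mem 14 j = D ⟨j, hj⟩ from hD ⟨j, hj⟩]
        intro h1 h2
        exact h _ _ h1 (fun h3 => h2 (congrArg Fin.val h3))
    have hcol : ∀ (i : Fin n) l, formCode n d c l (fun j => σ7.mem 15 (j * n + i)) =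
        formCode n d c l (finExt fun x => Q x i) := fun i l =>
      formCode_congr hn c l fun x hx => by
        rw [finExt_of_lt _ hx, ← hQ]
    have e2 : (∀ i < n, ∀ l < p,
        σ7.mem 14 i * formCode n d c l (fun j => σ7.mem 15 (j * n + i)) = 0) ↔
        ∀ i, D i ≠ 0 → ∀ l < p, formCode n d c l (finExt fun x => Q x i) = 0 := by
      constructor
      · intro h i hi l hl
        have := h i i.isLt l hl
        rw [hD i, hcol i] at this
        exact (mul_eq_zero.1 this).resolve_left hi
      · intro h i hi l hl
        rw [show σ7.mem 14 i = D ⟨i, hi⟩ from hD ⟨i, hi⟩]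
        by_cases h0 : D ⟨i, hi⟩ = 0
        · rw [h0, zero_mul]
        · rw [hcol ⟨i, hi⟩, h ⟨i, hi⟩ h0 l hl, mul_zero]
    refine hout.trans ⟨?_, ?_⟩
    · rintro ⟨⟨⟨-, a⟩, b⟩, -, c, e⟩
      exact ⟨c, e, e1.1 a, e2.1 b⟩
    · rintro ⟨c, e, a, b⟩
      exact ⟨⟨⟨rfl, e1.2 a⟩, e2.2 b⟩, one_ne_zero, c, e⟩
  · refine ⟨hk1 h, ?_⟩
    obtain ⟨e, he, hec⟩ := exists_enumNonzero_count D ((hcount n le_rfl).symm.trans (hout.1 h).2.2.2)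
    refine ⟨e, he, fun a x => ?_, m4⟩
    have h1 := m3 (e a) (e a).isLt (by rw [hD]; exact (he.2 _).2 ⟨a, rfl⟩) x x.isLt
    rw [hcount _ (e a).isLt.le, hec, hQ] at h1
    exact h1

end MainProgram


/-! ### Polynomials on irreducible sets -/

/-- The tuples of vectors of `X`, as points of affine space. -/
def tupleSet {F : Type*} {n : ℕ} (X : Set (Fin n → F)) (r : ℕ) : Set (Fin r × Fin n → F) :=
  {v | ∀ a, (fun i => v (a, i)) ∈ X}

theorem exists_mem_tupleSet {F : Type*} {n r : ℕ} {X : Set (Fin n → F)} {p : (Fin r × Fin n → F) → Prop} :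
    (∃ y ∈ tupleSet X r, p y) ↔ ∃ v : Fin r → Fin n → F, (∀ a, v a ∈ X) ∧ p (Function.uncurry v) :=
  ⟨fun ⟨y, hy, h⟩ => ⟨Function.curry y, hy, by simpa using h⟩,
    fun ⟨v, hv, h⟩ => ⟨Function.uncurry v, hv, h⟩⟩

section PolyPrime

variable {F : Type*} [Field F]

/-- `Y` is nonempty, and the polynomials that vanish on `Y` form a prime ideal. -/
def PolyPrime {σ : Type*} (Y : Set (σ → F)) : Prop :=
  Y.Nonempty ∧ ∀ g h : MvPolynomial σ F, (∃ y ∈ Y, MvPolynomial.eval y g ≠ 0) →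
    (∃ y ∈ Y, MvPolynomial.eval y h ≠ 0) →
    ∃ y ∈ Y, MvPolynomial.eval y g ≠ 0 ∧ MvPolynomial.eval y h ≠ 0

theorem isOpen_zariski_iff {σ : Type*} {O : Set (σ → F)} :
    @IsOpen _ (zariskiTopology F σ) O ↔ ∃ S : Set (MvPolynomial σ F), Oᶜ = polyZeros S := Iff.rfl

theorem isOpen_zariski_ne {σ : Type*} (g : MvPolynomial σ F) :
    @IsOpen _ (zariskiTopology F σ) {x | MvPolynomial.eval x g ≠ 0} :=
  isOpen_zariski_iff.2 ⟨{g}, by ext x; simp [polyZeros]⟩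

theorem ZariskiIrreducible.polyPrime {n : ℕ} {X : Set (Fin n → F)} (hX : ZariskiIrreducible X) :
    PolyPrime X := by
  refine ⟨hX.1, ?_⟩
  rintro g h ⟨y, hy, hg⟩ ⟨z, hz, hh⟩
  obtain ⟨x, hx, h1, h2⟩ := hX.2 _ _ (isOpen_zariski_ne g) (isOpen_zariski_ne h)
    ⟨y, hy, hg⟩ ⟨z, hz, hh⟩
  exact ⟨x, hx, h1, h2⟩

/-- Primality applied to a product. Used to find one point that satisfies finitely many generic
conditions. -/
theorem PolyPrime.forall_finset {σ ι : Type*} {Y : Set (σ → F)} (hY : PolyPrime Y)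
    (s : Finset ι) (g : ι → MvPolynomial σ F) (hg : ∀ i ∈ s, ∃ y ∈ Y, MvPolynomial.eval y (g i) ≠ 0) :
    ∃ y ∈ Y, ∀ i ∈ s, MvPolynomial.eval y (g i) ≠ 0 := by
  classical
  suffices h : ∃ y ∈ Y, MvPolynomial.eval y (∏ i ∈ s, g i) ≠ 0 by
    obtain ⟨y, hy, h⟩ := h
    rw [map_prod, Finset.prod_ne_zero_iff] at h
    exact ⟨y, hy, h⟩
  induction s using Finset.induction_on with
  | empty =>
    obtain ⟨y, hy⟩ := hY.1
    exact ⟨y, hy, by simp⟩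
  | insert a s ha ih =>
    obtain ⟨y, hy, h1, h2⟩ := hY.2 (g a) (∏ i ∈ s, g i) (hg a (by simp))
      (ih fun i hi => hg i (by simp [hi]))
    exact ⟨y, hy, by rw [Finset.prod_insert ha, map_mul]; exact mul_ne_zero h1 h2⟩

/-- Fix the first vector of a tuple in a polynomial. -/
noncomputable def fixHead {r n : ℕ} (x : Fin n → F) :
    MvPolynomial (Fin (r + 1) × Fin n) F →ₐ[F] MvPolynomial (Fin r × Fin n) F :=
  MvPolynomial.aeval fun ai =>
    Fin.cases (motive := fun _ => MvPolynomial (Fin r × Fin n) F)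
      (MvPolynomial.C (x ai.2)) (fun a => MvPolynomial.X (a, ai.2)) ai.1

/-- Fix the other vectors of a tuple in a polynomial. -/
noncomputable def fixTail {r n : ℕ} (y : Fin r → Fin n → F) :
    MvPolynomial (Fin (r + 1) × Fin n) F →ₐ[F] MvPolynomial (Fin n) F :=
  MvPolynomial.aeval fun ai =>
    Fin.cases (motive := fun _ => MvPolynomial (Fin n) F)
      (MvPolynomial.X ai.2) (fun a => MvPolynomial.C (y a ai.2)) ai.1

theorem eval_fixHead {r n : ℕ} (x : Fin n → F) (y : Fin r → Fin n → F)
    (g : MvPolynomial (Fin (r + 1) × Fin n) F) :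
    MvPolynomial.eval (Function.uncurry y) (fixHead x g) =
      MvPolynomial.eval (Function.uncurry (Fin.cons x y : Fin (r + 1) → Fin n → F)) g := by
  induction g using MvPolynomial.induction_on with
  | C a => simp [fixHead]
  | add p q hp hq => simp [hp, hq]
  | mul_X p i hp =>
    rw [map_mul, map_mul, hp, map_mul]
    congr 1
    obtain ⟨a, i⟩ := i
    cases a using Fin.cases <;> simp [fixHead]

theorem eval_fixTail {r n : ℕ} (x : Fin n → F) (y : Fin r → Fin n → F)
    (g : MvPolynomial (Fin (r + 1) × Fin n) F) :
    MvPolynomial.eval x (fixTail y g) =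
      MvPolynomial.eval (Function.uncurry (Fin.cons x y : Fin (r + 1) → Fin n → F)) g := by
  induction g using MvPolynomial.induction_on with
  | C a => simp [fixTail]
  | add p q hp hq => simp [hp, hq]
  | mul_X p i hp =>
    rw [map_mul, map_mul, hp, map_mul]
    congr 1
    obtain ⟨a, i⟩ := i
    cases a using Fin.cases <;> simp [fixTail]

/-- If g is nonzero at v and h at w, fix the tail of v in g and the tail of w in h. Primality of X
gives a common head x with both nonzero. Then fix x in both polynomials and use induction for the
tails. No algebraic closure is needed. -/
theorem PolyPrime.tupleSet {n : ℕ} {X : Set (Fin n → F)} (hX : PolyPrime X) (r : ℕ) :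
    PolyPrime (tupleSet X r) := by
  induction r with
  | zero =>
    refine ⟨⟨fun _ => 0, fun a => a.elim0⟩, ?_⟩
    rintro g h ⟨y, hy, hg⟩ ⟨z, hz, hh⟩
    obtain rfl : y = z := funext fun a => a.1.elim0
    exact ⟨y, hy, hg, hh⟩
  | succ r ih =>
    refine ⟨?_, ?_⟩
    · obtain ⟨x, hx⟩ := hX.1
      exact ⟨fun ai => x ai.2, fun _ => hx⟩
    · simp only [exists_mem_tupleSet]
      rintro g h ⟨v, hv, hg⟩ ⟨w, hw, hh⟩
      obtain ⟨x, hx, h1, h2⟩ := hX.2 (fixTail (Fin.tail v) g) (fixTail (Fin.tail w) h)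
        ⟨v 0, hv 0, by rwa [eval_fixTail, Fin.cons_self_tail]⟩
        ⟨w 0, hw 0, by rwa [eval_fixTail, Fin.cons_self_tail]⟩
      rw [eval_fixTail] at h1 h2
      obtain ⟨y, hy, h3, h4⟩ := exists_mem_tupleSet.1 (ih.2 (fixHead x g) (fixHead x h)
        ⟨Function.uncurry (Fin.tail v), fun a => hv a.succ, by rwa [eval_fixHead]⟩
        ⟨Function.uncurry (Fin.tail w), fun a => hw a.succ, by rwa [eval_fixHead]⟩)
      rw [eval_fixHead] at h3 h4
      refine ⟨Fin.cons x y, fun a => ?_, h3, h4⟩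
      cases a using Fin.cases with
      | zero => exact hx
      | succ a => exact hy a

/-- Density is primality of the product: an open neighbourhood of a point of X^{×R} contains the
locus where some h that is nonzero at this point does not vanish, and g and h are both nonzero
somewhere on X^{×R}. -/
theorem ForGenericTuple.of_polynomial {n R : ℕ} {X : Set (Fin n → F)} (hX : PolyPrime X)
    {P : (Fin R → Fin n → F) → Prop} (g : MvPolynomial (Fin R × Fin n) F)
    (hg : ∃ v : Fin R → Fin n → F, (∀ a, v a ∈ X) ∧ MvPolynomial.eval (Function.uncurry v) g ≠ 0)
    (hP : ∀ v : Fin R → Fin n → F, (∀ a, v a ∈ X) →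
      MvPolynomial.eval (Function.uncurry v) g ≠ 0 → P v) : ForGenericTuple X R P := by
  let t' := zariskiTopology F (Fin R × Fin n)
  let t := zariskiTuples F R n
  refine ⟨{v | MvPolynomial.eval (Function.uncurry v) g ≠ 0}, ?_, ?_, ?_⟩
  · exact isOpen_induced_iff.2 ⟨_, isOpen_zariski_ne g, rfl⟩
  · intro v hv
    rw [mem_closure_iff]
    rintro o ho hvo
    obtain ⟨o', ho', rfl⟩ := isOpen_induced_iff.1 ho
    obtain ⟨S, hS⟩ := isOpen_zariski_iff.1 ho'
    have hv' : Function.uncurry v ∉ polyZeros S := by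
      rw [← hS]; exact fun h => h hvo
    simp only [polyZeros, Set.mem_ofPred_eq, not_forall] at hv'
    obtain ⟨h, hhS, hh⟩ := hv'
    obtain ⟨y, hy, h1, h2⟩ := exists_mem_tupleSet.1 ((hX.tupleSet R).2 g h
      (exists_mem_tupleSet.2 hg) ⟨_, hv, hh⟩)
    refine ⟨y, ?_, h1, hy⟩
    by_contra hcon
    have : Function.uncurry y ∈ polyZeros S := by rw [← hS]; exact hcon
    exact h2 (this h hhS)
  · exact fun v hv => hP v hv.2 hv.1

/-- Surjectivity of a family of linear maps with polynomial coordinates is an open condition. -/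
theorem exists_polynomial_surjective {σ ι E : Type*} [Fintype ι] [DecidableEq ι] [AddCommGroup E]
    [Module F E] (J : Submodule F E) (P : ι → E → MvPolynomial σ F) (A : (σ → F) → E →ₗ[F] (ι → F))
    (hA : ∀ x q s, A x q s = MvPolynomial.eval x (P s q)) (x₀ : σ → F)
    (h₀ : ∀ c, ∃ q ∈ J, A x₀ q = c) :
    ∃ g : MvPolynomial σ F, MvPolynomial.eval x₀ g ≠ 0 ∧
      ∀ x, MvPolynomial.eval x g ≠ 0 → ∀ c, ∃ q ∈ J, A x q = c := by
  choose q hqJ hq using fun t : ι => h₀ (Pi.single t 1)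
  -- Preimages `q t` of the unit vectors at `x₀` are kept fixed while x varies. The determinant of
  -- their images is a polynomial in x with value 1 at `x₀`.
  let M : Matrix ι ι (MvPolynomial σ F) := fun s t => P s (q t)
  have hM : ∀ x, MvPolynomial.eval x M.det = (Matrix.of fun s t => A x (q t) s).det := by
    intro x
    rw [RingHom.map_det]
    congr 1
    ext s t
    rw [Matrix.of_apply, hA]
    rfl
  refine ⟨M.det, ?_, fun x hx c => ?_⟩
  · rw [hM]
    have : (Matrix.of fun s t => A x₀ (q t) s) = 1 := by
      ext s t
      simp [hq, Matrix.one_apply, Pi.single_apply]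
    simp [this]
  · rw [hM] at hx
    have hu := Ne.isUnit hx
    refine ⟨∑ t, ((Matrix.of fun s t => A x (q t) s)⁻¹.mulVec c) t • q t,
      J.sum_mem fun t _ => J.smul_mem _ (hqJ t), ?_⟩
    have := congrFun (congrArg Matrix.mulVec (Matrix.mul_nonsing_inv _ hu)) c
    rw [← Matrix.mulVec_mulVec, Matrix.one_mulVec] at this
    conv_rhs => rw [← this]
    ext s
    simp only [map_sum, map_smul, Finset.sum_apply, Pi.smul_apply, smul_eq_mul, Matrix.mulVec,
      dotProduct, Matrix.of_apply]
    exact Finset.sum_congr rfl fun t _ => mul_comm _ _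

end PolyPrime


/-! ### Directional derivatives of polynomials -/

section DirDeriv

variable {F : Type*} [Field F] {n : ℕ}

/-- The derivative of a polynomial in the direction `x`. -/
noncomputable def dirDeriv (x : Fin n → F) :
    Derivation F (MvPolynomial (Fin n) F) (MvPolynomial (Fin n) F) :=
  MvPolynomial.mkDerivation F fun i => MvPolynomial.C (x i)

theorem dirDeriv_eq_sum (x : Fin n → F) (q : MvPolynomial (Fin n) F) :
    dirDeriv x q = ∑ i, x i • MvPolynomial.pderiv i q := by
  induction q using MvPolynomial.induction_on with
  | C a => simp
  | add p q hp hq => simp [hp, hq, Finset.sum_add_distrib]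
  | mul_X p j hp =>
    simp only [Derivation.leibniz, hp, smul_add, Finset.sum_add_distrib, MvPolynomial.pderiv_X]
    congr 1
    · rw [Finset.sum_eq_single j]
      · simp [dirDeriv, MvPolynomial.smul_eq_C_mul, mul_comm]
      · intro i _ hi
        simp [hi.symm]
      · simp
    · rw [Finset.smul_sum]
      exact Finset.sum_congr rfl fun i _ => smul_comm _ _ _

/-- The `j`-th derivative of a polynomial in the direction `x`. -/
noncomputable def iterDeriv (j : ℕ) (x : Fin n → F) :
    MvPolynomial (Fin n) F →ₗ[F] MvPolynomial (Fin n) F :=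
  (dirDeriv x : MvPolynomial (Fin n) F →ₗ[F] MvPolynomial (Fin n) F) ^ j

@[simp] theorem iterDeriv_zero (x : Fin n → F) (q : MvPolynomial (Fin n) F) :
    iterDeriv 0 x q = q := by simp [iterDeriv]

theorem iterDeriv_succ (j : ℕ) (x : Fin n → F) (q : MvPolynomial (Fin n) F) :
    iterDeriv (j + 1) x q = dirDeriv x (iterDeriv j x q) := by
  simp [iterDeriv, pow_succ']

theorem iterDeriv_succ' (j : ℕ) (x : Fin n → F) (q : MvPolynomial (Fin n) F) :
    iterDeriv (j + 1) x q = iterDeriv j x (dirDeriv x q) := by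
  simp [iterDeriv, pow_succ]

theorem isHomogeneous_dirDeriv {k : ℕ} {q : MvPolynomial (Fin n) F} (hq : q.IsHomogeneous k)
    (x : Fin n → F) : (dirDeriv x q).IsHomogeneous (k - 1) := by
  rw [dirDeriv_eq_sum]
  refine MvPolynomial.IsHomogeneous.sum _ _ _ fun i _ => ?_
  rw [MvPolynomial.smul_eq_C_mul]
  simpa using (MvPolynomial.isHomogeneous_C _ (x i)).mul hq.pderiv

theorem isHomogeneous_iterDeriv {k : ℕ} {q : MvPolynomial (Fin n) F} (hq : q.IsHomogeneous k)
    (j : ℕ) (x : Fin n → F) : (iterDeriv j x q).IsHomogeneous (k - j) := by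
  induction j with
  | zero => simpa using hq
  | succ j ih =>
    rw [iterDeriv_succ, ← Nat.sub_sub]
    exact isHomogeneous_dirDeriv ih x

theorem dirDeriv_eq_zero_of_degree_zero {q : MvPolynomial (Fin n) F} (hq : q.IsHomogeneous 0)
    (x : Fin n → F) : dirDeriv x q = 0 := by
  rw [MvPolynomial.totalDegree_eq_zero_iff_eq_C.1 (Nat.le_zero.1 hq.totalDegree_le)]
  exact MvPolynomial.derivation_C _ _

theorem iterDeriv_eq_zero_of_lt {k j : ℕ} {q : MvPolynomial (Fin n) F} (hq : q.IsHomogeneous k)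
    (hkj : k < j) (x : Fin n → F) : iterDeriv j x q = 0 := by
  obtain ⟨i, rfl⟩ := Nat.exists_eq_add_of_lt hkj
  induction i with
  | zero =>
    rw [add_zero, iterDeriv_succ]
    exact dirDeriv_eq_zero_of_degree_zero (by simpa using isHomogeneous_iterDeriv hq k x) x
  | succ i ih =>
    rw [show k + (i + 1) + 1 = k + i + 1 + 1 by ring, iterDeriv_succ, ih (by omega), map_zero]

/-- Euler's identity. -/
theorem eval_dirDeriv_self {k : ℕ} {q : MvPolynomial (Fin n) F} (hq : q.IsHomogeneous k)
    (x : Fin n → F) : MvPolynomial.eval x (dirDeriv x q) = k * MvPolynomial.eval x q := by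
  have h := congrArg (MvPolynomial.eval x) hq.sum_X_mul_pderiv
  simpa [dirDeriv_eq_sum, MvPolynomial.smul_eval] using h

theorem eval_iterDeriv_self {k : ℕ} {q : MvPolynomial (Fin n) F} (hq : q.IsHomogeneous k)
    (j : ℕ) (x : Fin n → F) :
    MvPolynomial.eval x (iterDeriv j x q) = k.descFactorial j * MvPolynomial.eval x q := by
  induction j with
  | zero => simp
  | succ j ih =>
    rw [iterDeriv_succ, eval_dirDeriv_self (isHomogeneous_iterDeriv hq j x), ih,
      Nat.descFactorial_succ]
    push_cast
    ring

/-- `ℓ(D_x^j q)` as a form in `x`. -/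
noncomputable def derivForm (l : Module.Dual F (MvPolynomial (Fin n) F)) :
    ℕ → MvPolynomial (Fin n) F → MvPolynomial (Fin n) F
  | 0, q => MvPolynomial.C (l q)
  | j + 1, q => ∑ i, MvPolynomial.X i * derivForm l j (MvPolynomial.pderiv i q)

theorem eval_derivForm (l : Module.Dual F (MvPolynomial (Fin n) F)) (j : ℕ) (x : Fin n → F)
    (q : MvPolynomial (Fin n) F) :
    MvPolynomial.eval x (derivForm l j q) = l (iterDeriv j x q) := by
  induction j generalizing q with
  | zero => simp [derivForm]
  | succ j ih => simp [derivForm, iterDeriv_succ', dirDeriv_eq_sum, ih]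

theorem isHomogeneous_derivForm (l : Module.Dual F (MvPolynomial (Fin n) F)) (j : ℕ)
    (q : MvPolynomial (Fin n) F) : (derivForm l j q).IsHomogeneous j := by
  induction j generalizing q with
  | zero => exact MvPolynomial.isHomogeneous_C _ _
  | succ j ih =>
    refine MvPolynomial.IsHomogeneous.sum _ _ _ fun i _ => ?_
    rw [add_comm]
    exact (MvPolynomial.isHomogeneous_X _ i).mul (ih _)

instance finiteDimensional_homogeneousSubmodule (k : ℕ) :
    FiniteDimensional F (MvPolynomial.homogeneousSubmodule (Fin n) F k) :=
  Module.Finite.iff_fg.2 (MvPolynomial.homogeneousSubmodule_fg (Fin n) F k)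

theorem finrank_homogeneousSubmodule_le (k : ℕ) :
    Module.finrank F (MvPolynomial.homogeneousSubmodule (Fin n) F k) ≤ (n + k - 1).choose k := by
  classical
  let s := (Finset.univ : Finset (Fin n)).finsuppAntidiag k
  let A : MvPolynomial.homogeneousSubmodule (Fin n) F k →ₗ[F] (s → F) :=
    LinearMap.pi fun α => MvPolynomial.lcoeff F α.1 ∘ₗ Submodule.subtype _
  have hA : Function.Injective A := by
    rw [injective_iff_map_eq_zero]
    rintro ⟨q, hq⟩ h
    ext α
    by_cases hα : α.degree = k
    · exact congrFun h ⟨α, by simpa [s, Finset.mem_finsuppAntidiag, Finsupp.degree_eq_sum] using hα⟩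
    · simpa using ((MvPolynomial.mem_homogeneousSubmodule k q).1 hq).coeff_eq_zero hα
  refine (LinearMap.finrank_le_finrank_of_injective hA).trans ?_
  rw [Module.finrank_fintype_fun_eq_card, Fintype.card_coe, Finset.card_finsuppAntidiag_nat_eq_choose]
  simp

theorem le_finrank_homogeneousSubmodule_one :
    n ≤ Module.finrank F (MvPolynomial.homogeneousSubmodule (Fin n) F 1) := by
  let A : (Fin n → F) →ₗ[F] MvPolynomial.homogeneousSubmodule (Fin n) F 1 :=
    Fintype.linearCombination F fun i => ⟨MvPolynomial.X i, MvPolynomial.isHomogeneous_X F i⟩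
  have hA : Function.Injective A := by
    rw [injective_iff_map_eq_zero]
    intro c hc
    ext i
    have := congrArg (fun q => MvPolynomial.eval (Pi.single i 1) q) (congrArg Subtype.val hc)
    simpa [A, Fintype.linearCombination_apply, MvPolynomial.smul_eval, Pi.single_apply] using this
  simpa using LinearMap.finrank_le_finrank_of_injective hA

/-- Nondegeneracy in lower orders. -/
theorem NonDegenerateOfOrder.of_le {X : Set (Fin n → F)} {e j : ℕ} (hn : 0 < n)
    (hX : NonDegenerateOfOrder X e) (hj : j ≤ e) : NonDegenerateOfOrder X j := by
  intro g hg hv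
  have h := hX (g * MvPolynomial.X ⟨0, hn⟩ ^ (e - j)) (by
    have := hg.mul ((MvPolynomial.isHomogeneous_X F (⟨0, hn⟩ : Fin n)).pow (e - j))
    rwa [one_mul, Nat.add_sub_cancel' hj] at this) (fun v hvX => by simp [hv v hvX])
  rcases mul_eq_zero.1 h with h | h
  · exact h
  · exact absurd h (pow_ne_zero _ (MvPolynomial.X_ne_zero _))

/-- Points of `X` on which no form of degree `j` vanishes. -/
theorem exists_points_of_nonDegenerate {X : Set (Fin n → F)} {j : ℕ}
    (hX : NonDegenerateOfOrder X j) :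
    ∃ s : Finset (Fin n → F), ↑s ⊆ X ∧ s.card ≤ (n + j - 1).choose j ∧
      ∀ g : MvPolynomial (Fin n) F, g.IsHomogeneous j →
        (∀ v ∈ s, MvPolynomial.eval v g = 0) → g = 0 := by
  classical
  let H := MvPolynomial.homogeneousSubmodule (Fin n) F j
  let ev : (Fin n → F) → Module.Dual F H := fun v =>
    (MvPolynomial.aeval v : MvPolynomial (Fin n) F →ₐ[F] F).toLinearMap ∘ₗ H.subtype
  have hev : ∀ v (q : H), ev v q = MvPolynomial.eval v q.1 := fun v q => by
    simp [ev, MvPolynomial.aeval_eq_eval]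
  -- Evaluations at points of X that form a basis of the span of all of them in the dual of the
  -- space of forms; there are at most as many as its dimension.
  obtain ⟨t, htS, htspan, hti⟩ := exists_linearIndependent F (ev '' X)
  have htfin : t.Finite := hti.setFinite
  choose! pt hpt hpt' using htS
  refine ⟨htfin.toFinset.image pt, ?_, ?_, ?_⟩
  · intro v hv
    simp only [Finset.coe_image, Set.Finite.coe_toFinset, Set.mem_image] at hv
    obtain ⟨l, hl, rfl⟩ := hv
    exact hpt hl
  · refine Finset.card_image_le.trans ?_
    have := htfin.fintype
    have h1 := hti.fintype_card_le_finrank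
    rw [Subspace.dual_finrank_eq] at h1
    rw [Set.Finite.card_toFinset]
    exact h1.trans (finrank_homogeneousSubmodule_le j)
  · intro g hg hv
    refine hX g hg fun v hvX => ?_
    have hmem : ev v ∈ Submodule.span F t := by
      rw [htspan]; exact Submodule.subset_span ⟨v, hvX, rfl⟩
    have key : ∀ l ∈ Submodule.span F t, l ⟨g, hg⟩ = 0 := by
      intro l hl
      induction hl using Submodule.span_induction with
      | mem l hl =>
        rw [← hpt' hl, hev]
        exact hv _ (Finset.mem_image_of_mem _ (by simpa using hl))
      | zero => rfl
      | add l l' _ _ h h' => simp [h, h']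
      | smul c l _ h => simp [h]
    simpa [hev] using key _ hmem

end DirDeriv


/-! ### Rank of directional derivatives at generic points -/

section Rank

variable {F : Type*} [Field F] [CharZero F] {n : ℕ}

/-- At some point of `X` the `j`-th directional derivative has large rank on `J`. -/
theorem exists_rank_iterDeriv {X : Set (Fin n → F)} (hXne : X.Nonempty) {j k : ℕ} (hjk : j ≤ k)
    (hX : NonDegenerateOfOrder X j) (J : Submodule F (MvPolynomial (Fin n) F))
    (hJ : J ≤ MvPolynomial.homogeneousSubmodule (Fin n) F k) :
    ∃ x ∈ X, Module.finrank F J ≤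
      (n + j - 1).choose j * Module.finrank F (J.map (iterDeriv j x)) := by
  classical
  have : FiniteDimensional F J := Submodule.finiteDimensional_of_le hJ
  obtain ⟨s, hsX, hsc, hs⟩ := exists_points_of_nonDegenerate hX
  by_contra! hcon
  -- A form q is determined by its derivatives D_v^j q at the chosen points, so the target cannot be
  -- too small.
  let A : J →ₗ[F] ((v : s) → J.map (iterDeriv j v.1)) :=
    LinearMap.pi fun v => (iterDeriv j v.1).restrict fun q hq => Submodule.mem_map_of_mem hq
  have hA : Function.Injective A := by
    rw [injective_iff_map_eq_zero]
    rintro ⟨q, hq⟩ h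
    have h0 : ∀ v ∈ s, iterDeriv j v q = 0 := fun v hv =>
      congrArg Subtype.val (congrFun h ⟨v, hv⟩)
    -- For a functional l on polynomials, l(D_x^j q) is a form of degree j in x that vanishes at all
    -- the chosen points.
    have h1 : ∀ l, derivForm l j q = 0 := fun l =>
      hs _ (isHomogeneous_derivForm l j q) fun v hv => by rw [eval_derivForm, h0 v hv, map_zero]
    have h2 : ∀ x, MvPolynomial.eval x q = 0 := by
      intro x
      -- Here l is evaluation at the same point x, so Euler's identity turns D_x^j q into a nonzero
      -- multiple of q(x), as j ≤ k.
      have := eval_derivForm (MvPolynomial.aeval x : MvPolynomial (Fin n) F →ₐ[F] F).toLinearMap j x q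
      rw [h1, map_zero, AlgHom.toLinearMap_apply, MvPolynomial.aeval_eq_eval,
        eval_iterDeriv_self ((MvPolynomial.mem_homogeneousSubmodule k q).1 (hJ hq))] at this
      rcases mul_eq_zero.1 this.symm with h | h
      · rw [Nat.cast_eq_zero, Nat.descFactorial_eq_zero_iff_lt] at h
        omega
      · exact h
    exact Subtype.ext (MvPolynomial.funext fun x => by simpa using h2 x)
  have h1 := LinearMap.finrank_le_finrank_of_injective hA
  rw [Module.finrank_pi_fintype] at h1
  obtain ⟨x₀, hx₀⟩ := hXne
  have hpos : 0 < Module.finrank F J := lt_of_le_of_lt (Nat.zero_le _) (hcon x₀ hx₀)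
  have hle : ∀ v : s, (n + j - 1).choose j * Module.finrank F (J.map (iterDeriv j v.1)) <
    Module.finrank F J := fun v => hcon v (hsX v.2)
  have hne : s.Nonempty := by
    rw [Finset.nonempty_iff_ne_empty]
    rintro rfl
    rw [Finset.univ_eq_empty, Finset.sum_empty] at h1
    exact (hpos.trans_le h1).false
  -- Pigeonhole: if all the ranks were too small, then their sum over at most C(n+j-1, j) points
  -- would be less than dim J.
  have h2 : ∑ v : s, (n + j - 1).choose j * Module.finrank F (J.map (iterDeriv j v.1)) <
      ∑ _v : s, Module.finrank F J :=
    Finset.sum_lt_sum_of_nonempty (by simpa using hne) fun v _ => hle v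
  rw [← Finset.mul_sum] at h2
  simp only [Finset.sum_const, Finset.card_univ, Fintype.card_coe, smul_eq_mul] at h2
  have h3 := Nat.mul_le_mul_left ((n + j - 1).choose j) h1
  have h4 := Nat.mul_le_mul_right (Module.finrank F J) hsc
  omega

/-- At the points of `X` outside the zero set of a polynomial, the `j`-th directional derivative
has large rank on `J`. -/
theorem exists_polynomial_rank_iterDeriv {X : Set (Fin n → F)} (hXne : X.Nonempty) {j k : ℕ}
    (hjk : j ≤ k) (hX : NonDegenerateOfOrder X j) (J : Submodule F (MvPolynomial (Fin n) F))
    (hJ : J ≤ MvPolynomial.homogeneousSubmodule (Fin n) F k) :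
    ∃ g : MvPolynomial (Fin n) F, (∃ x ∈ X, MvPolynomial.eval x g ≠ 0) ∧
      ∀ x, MvPolynomial.eval x g ≠ 0 → Module.finrank F J ≤
        (n + j - 1).choose j * Module.finrank F (J.map (iterDeriv j x)) := by
  classical
  have : FiniteDimensional F J := Submodule.finiteDimensional_of_le hJ
  obtain ⟨x₀, hx₀, h⟩ := exists_rank_iterDeriv hXne hjk hX J hJ
  -- A bound on the rank from below is open: coordinates on the image at `x₀`, extended to all
  -- polynomials along a complement, stay jointly surjective on the images at nearby points x.
  let I := J.map (iterDeriv j x₀)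
  let b := Module.finBasis F I
  obtain ⟨π, hπ⟩ := I.exists_isCompl
  let pr : MvPolynomial (Fin n) F →ₗ[F] I := Submodule.projectionOnto I π hπ
  let l : Fin (Module.finrank F I) → Module.Dual F (MvPolynomial (Fin n) F) := fun a =>
    b.coord a ∘ₗ pr
  obtain ⟨g, hg, hg'⟩ := exists_polynomial_surjective J (fun a q => derivForm (l a) j q)
    (fun x => LinearMap.pi fun a => l a ∘ₗ iterDeriv j x)
    (fun x q a => (eval_derivForm (l a) j x q).symm) x₀ (by
      intro c
      obtain ⟨q, hq, hqe⟩ := (∑ a, c a • b a : I).2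
      refine ⟨q, hq, ?_⟩
      ext a
      simp only [LinearMap.pi_apply, LinearMap.comp_apply, l, hqe]
      rw [show pr ((∑ a, c a • b a : I) : MvPolynomial (Fin n) F) = ∑ a, c a • b a from
        Submodule.projectionOnto_apply_left hπ _]
      simp [Module.Basis.coord_apply, Finsupp.single_apply])
  refine ⟨g, ⟨x₀, hx₀, hg⟩, fun x hx => h.trans (Nat.mul_le_mul_left _ ?_)⟩
  have hsurj := hg' x hx
  let B : J.map (iterDeriv j x) →ₗ[F] (Fin (Module.finrank F I) → F) :=
    LinearMap.pi fun a => l a ∘ₗ Submodule.subtype _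
  have hB : Function.Surjective B := by
    intro c
    obtain ⟨q, hq, hqc⟩ := hsurj c
    exact ⟨⟨_, Submodule.mem_map_of_mem hq⟩, hqc⟩
  simpa using LinearMap.finrank_le_finrank_of_surjective hB

end Rank

/-! ### Inequalities for dimensions of spaces of forms -/

section Numeric

/-- Multiplied by factorials, the binomial coefficients become rising factorials of n, and the
product of those of lengths j and m is at most the one of length j + m. -/
theorem choose_mul_choose_le {n : ℕ} (hn : 0 < n) (j m : ℕ) :
    (n + j - 1).choose j * (n + m - 1).choose m ≤
      (j + m).choose j * (n + (j + m) - 1).choose (j + m) := by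
  obtain ⟨n, rfl⟩ := Nat.exists_eq_succ_of_ne_zero hn.ne'
  have e : ∀ i, i.factorial * (n.succ + i - 1).choose i = (n + 1).ascFactorial i := fun i => by
    rw [Nat.ascFactorial_eq_factorial_mul_choose]
    congr 2
    omega
  have h1 : (n + 1).ascFactorial j * (n + 1).ascFactorial m ≤ (n + 1).ascFactorial (j + m) := by
    rw [← Nat.ascFactorial_mul_ascFactorial]
    exact Nat.mul_le_mul_left _ (Nat.ascFactorial_le m (by omega))
  rw [← e, ← e, ← e, ← Nat.add_choose_mul_factorial_mul_factorial j m] at h1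
  rw [show (j + m).choose m = (j + m).choose j from Nat.choose_symm_add.symm] at h1
  refine Nat.le_of_mul_le_mul_left (c := j.factorial * m.factorial) ?_
    (Nat.mul_pos j.factorial_pos m.factorial_pos)
  calc _ = _ := by ring
    _ ≤ _ := h1
    _ = _ := by ring

theorem choose_mul_factorial_le (j m : ℕ) :
    (j + m).choose j * m.factorial ≤ (j + m).factorial := by
  rw [← Nat.add_choose_mul_factorial_mul_factorial j m,
    show (j + m).choose m = (j + m).choose j from Nat.choose_symm_add.symm]
  exact Nat.mul_le_mul_right _ (Nat.le_mul_of_pos_right _ j.factorial_pos)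

end Numeric


/-! ### Coefficients of forms restricted to the span of points -/

section Restr

variable {F : Type*} [Field F] {n : ℕ}

/-- The polynomial `q(∑ t_a v_a)` in the variables `t_a`. -/
noncomputable def restr {r : ℕ} (v : Fin r → Fin n → F) :
    MvPolynomial (Fin n) F →ₐ[F] MvPolynomial (Fin r) F :=
  MvPolynomial.aeval fun i => ∑ a, MvPolynomial.C (v a i) * MvPolynomial.X a

@[simp] theorem restr_X {r : ℕ} (v : Fin r → Fin n → F) (i : Fin n) :
    restr v (MvPolynomial.X i) = ∑ a, MvPolynomial.C (v a i) * MvPolynomial.X a :=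
  MvPolynomial.aeval_X _ _

theorem eval_restr {r : ℕ} (v : Fin r → Fin n → F) (t : Fin r → F) (q : MvPolynomial (Fin n) F) :
    MvPolynomial.eval t (restr v q) = MvPolynomial.eval (∑ a, t a • v a) q := by
  induction q using MvPolynomial.induction_on with
  | C a => simp
  | add p q hp hq => simp [hp, hq]
  | mul_X p i hp => simp [hp, mul_comm]

theorem isHomogeneous_restr {r k : ℕ} (v : Fin r → Fin n → F) {q : MvPolynomial (Fin n) F}
    (hq : q.IsHomogeneous k) : (restr v q).IsHomogeneous k := by
  have := hq.aeval (fun i => ∑ a, MvPolynomial.C (v a i) * MvPolynomial.X a : Fin n → MvPolynomial (Fin r) F)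
    (n := 1) (fun i => MvPolynomial.IsHomogeneous.sum _ _ _ fun a _ => by
      simpa using (MvPolynomial.isHomogeneous_C _ (v a i)).mul (MvPolynomial.isHomogeneous_X F a))
  simpa [restr] using this

/-- The chain rule for the derivative in t_0, with t_0 singled out by `finSuccEquiv`. -/
theorem derivative_restr {r : ℕ} (v : Fin (r + 1) → Fin n → F) (q : MvPolynomial (Fin n) F) :
    Polynomial.derivative (MvPolynomial.finSuccEquiv F r (restr v q)) =
      MvPolynomial.finSuccEquiv F r (restr v (dirDeriv (v 0) q)) := by
  induction q using MvPolynomial.induction_on with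
  | C a => simp [MvPolynomial.finSuccEquiv_apply]
  | add p q hp hq => simp [hp, hq]
  | mul_X p i hp =>
    have h : Polynomial.derivative (MvPolynomial.finSuccEquiv F r (restr v (MvPolynomial.X i))) =
        Polynomial.C (MvPolynomial.C (v 0 i)) := by
      simp [Fin.sum_univ_succ, MvPolynomial.finSuccEquiv_apply]
    have h' : MvPolynomial.finSuccEquiv F r (restr v (MvPolynomial.C (v 0 i))) =
        Polynomial.C (MvPolynomial.C (v 0 i)) := by
      simp [MvPolynomial.finSuccEquiv_apply]
    rw [map_mul, map_mul, Polynomial.derivative_mul, hp, h, Derivation.leibniz, map_add, map_add,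
      smul_eq_mul, smul_eq_mul, map_mul, map_mul, map_mul, map_mul,
      show dirDeriv (v 0) (MvPolynomial.X i) = MvPolynomial.C (v 0 i) from
        MvPolynomial.mkDerivation_X _ _ _, h']
    ring

theorem coeff_zero_restr {r : ℕ} (v : Fin (r + 1) → Fin n → F) (q : MvPolynomial (Fin n) F) :
    (MvPolynomial.finSuccEquiv F r (restr v q)).coeff 0 = restr (Fin.tail v) q := by
  induction q using MvPolynomial.induction_on with
  | C a => simp [MvPolynomial.finSuccEquiv_apply]
  | add p q hp hq => simp [hp, hq]
  | mul_X p i hp =>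
    rw [map_mul, map_mul, Polynomial.mul_coeff_zero, hp, map_mul]
    have h : MvPolynomial.finSuccEquiv F r (restr v (MvPolynomial.X i)) =
        Polynomial.C (MvPolynomial.C (v 0 i)) * Polynomial.X +
          Polynomial.C (restr (Fin.tail v) (MvPolynomial.X i)) := by
      simp [Fin.sum_univ_succ, MvPolynomial.finSuccEquiv_apply, Fin.tail]
    rw [h, Polynomial.coeff_add, Polynomial.mul_coeff_zero, Polynomial.coeff_X_zero, mul_zero,
      zero_add, Polynomial.coeff_C_zero]

/-- Taylor's formula in t_0; it moves a coefficient for r + 1 points to one for r points. -/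
theorem factorial_mul_coeff_restr {r : ℕ} (v : Fin (r + 1) → Fin n → F)
    (q : MvPolynomial (Fin n) F) (α : Fin (r + 1) →₀ ℕ) :
    ((α 0).factorial : F) * MvPolynomial.coeff α (restr v q) =
      MvPolynomial.coeff α.tail (restr (Fin.tail v) (iterDeriv (α 0) (v 0) q)) := by
  have h : ∀ j, Polynomial.derivative^[j] (MvPolynomial.finSuccEquiv F r (restr v q)) =
      MvPolynomial.finSuccEquiv F r (restr v (iterDeriv j (v 0) q)) := by
    intro j
    induction j with
    | zero => simp
    | succ j ih => rw [Function.iterate_succ_apply', ih, derivative_restr, ← iterDeriv_succ]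
  rw [← coeff_zero_restr, ← h, Polynomial.coeff_iterate_derivative, zero_add,
    Nat.descFactorial_self, MvPolynomial.coeff_smul, MvPolynomial.finSuccEquiv_coeff_coeff,
    Finsupp.cons_tail, nsmul_eq_mul]

/-- The coefficients of degree `k` of `q(∑ t_a v_a)`, `q ∈ J`, at the monomials whose exponents
are less than `d`, are arbitrary. -/
def SurjCoeff (d k : ℕ) {r : ℕ} (J : Submodule F (MvPolynomial (Fin n) F))
    (v : Fin r → Fin n → F) : Prop :=
  ∀ c : (Fin r →₀ ℕ) → F, ∃ q ∈ J, ∀ α : Fin r →₀ ℕ, α.degree = k → (∀ a, α a < d) →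
    MvPolynomial.coeff α (restr v q) = c α

/-- Triangular solution, with the highest power of t_0 first. A form in the kernel of D_x^{i+1} has
no terms with exponent of t_0 above i. Choose one with the right coefficients at exponent i, then
correct the lower exponents by a form in the kernel of D_x^i, which does not disturb exponent i. -/
theorem SurjCoeff.cons [CharZero F] {d k r : ℕ} {J : Submodule F (MvPolynomial (Fin n) F)}
    {x : Fin n → F} {y : Fin r → Fin n → F}
    (h : ∀ j, j ≤ k → j < d → SurjCoeff d (k - j)
      ((J ⊓ LinearMap.ker (iterDeriv (j + 1) x)).map (iterDeriv j x)) y) :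
    SurjCoeff d k J (Fin.cons x y : Fin (r + 1) → Fin n → F) := by
  have key : ∀ (i : ℕ) (c : (Fin (r + 1) →₀ ℕ) → F),
      ∃ q ∈ J ⊓ LinearMap.ker (iterDeriv i x), ∀ α : Fin (r + 1) →₀ ℕ, α.degree = k →
        (∀ a, α a < d) → α 0 < i →
        MvPolynomial.coeff α (restr (Fin.cons x y : Fin (r + 1) → Fin n → F) q) = c α := by
    intro i
    induction i with
    | zero => exact fun c => ⟨0, zero_mem _, fun α _ _ h => absurd h (Nat.not_lt_zero _)⟩
    | succ i ih =>
      intro c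
      have hker : ∀ q, iterDeriv i x q = 0 → iterDeriv (i + 1) x q = 0 := fun q hq => by
        rw [iterDeriv_succ, hq, map_zero]
      by_cases hi : i ≤ k ∧ i < d
      · obtain ⟨p, ⟨q₁, hq₁, rfl⟩, hp⟩ := h i hi.1 hi.2 fun β => i.factorial * c (β.cons i)
        obtain ⟨q₂, hq₂, hc⟩ := ih fun α =>
          c α - MvPolynomial.coeff α (restr (Fin.cons x y : Fin (r + 1) → Fin n → F) q₁)
        refine ⟨q₁ + q₂, ⟨J.add_mem hq₁.1 hq₂.1, ?_⟩, fun α hα hαd hαi => ?_⟩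
        · exact Submodule.add_mem _ hq₁.2 (hker _ hq₂.2)
        · rw [map_add, MvPolynomial.coeff_add]
          rcases Nat.lt_succ_iff_lt_or_eq.1 hαi with h' | h'
          · rw [hc α hα hαd h']
            ring
          · have h0 : (i.factorial : F) ≠ 0 := by exact_mod_cast i.factorial_ne_zero
            have e1 := factorial_mul_coeff_restr (Fin.cons x y : Fin (r + 1) → Fin n → F) q₁ α
            have e2 := factorial_mul_coeff_restr (Fin.cons x y : Fin (r + 1) → Fin n → F) q₂ α
            simp only [Fin.tail_cons, Fin.cons_zero] at e1 e2
            rw [h'] at e1 e2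
            rw [LinearMap.mem_ker.1 hq₂.2, map_zero, MvPolynomial.coeff_zero] at e2
            have hdeg : α.tail.degree = k - i := by
              have : α.degree = α 0 + α.tail.degree := by
                simp [Finsupp.degree_eq_sum, Fin.sum_univ_succ, Finsupp.tail_apply]
              omega
            rw [hp α.tail hdeg fun a => hαd a.succ] at e1
            rw [← h', Finsupp.cons_tail, h'] at e1
            rw [mul_left_cancel₀ h0 e1, (mul_eq_zero.1 e2).resolve_left h0, add_zero]
      · obtain ⟨q, hq, hc⟩ := ih c
        refine ⟨q, ⟨hq.1, hker _ hq.2⟩, fun α hα hαd hαi => hc α hα hαd ?_⟩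
        rcases Nat.lt_succ_iff_lt_or_eq.1 hαi with h' | h'
        · exact h'
        · refine absurd ⟨?_, h' ▸ hαd 0⟩ hi
          rw [← h', ← hα]
          exact Finsupp.le_degree 0 α
  intro c
  obtain ⟨q, hq, hc⟩ := key d c
  exact ⟨q, hq.1, fun α hα hαd => hc α hα hαd (hαd 0)⟩

/-- `q(∑ t_a v_a)` with indeterminate `v_a`. -/
noncomputable def genericRestr (r : ℕ) :
    MvPolynomial (Fin n) F →ₐ[F] MvPolynomial (Fin r) (MvPolynomial (Fin r × Fin n) F) :=
  MvPolynomial.aeval fun i => ∑ a, MvPolynomial.C (MvPolynomial.X (a, i)) * MvPolynomial.X a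

theorem map_genericRestr {r : ℕ} (v : Fin r → Fin n → F) (q : MvPolynomial (Fin n) F) :
    MvPolynomial.map (MvPolynomial.eval (Function.uncurry v)) (genericRestr r q) = restr v q := by
  induction q using MvPolynomial.induction_on with
  | C a => simp [restr, genericRestr, MvPolynomial.algebraMap_apply]
  | add p q hp hq => simp [hp, hq]
  | mul_X p i hp =>
    rw [map_mul, map_mul, hp, map_mul]
    congr 1
    simp [genericRestr]

/-- Finitely many monomials are concerned, and the coefficients of the restriction are polynomials
in the points, so surjectivity is an open condition. -/
theorem SurjCoeff.exists_polynomial {d k r : ℕ} {J : Submodule F (MvPolynomial (Fin n) F)}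
    {v : Fin r → Fin n → F} (hv : SurjCoeff d k J v) :
    ∃ g : MvPolynomial (Fin r × Fin n) F, MvPolynomial.eval (Function.uncurry v) g ≠ 0 ∧
      ∀ w : Fin r → Fin n → F, MvPolynomial.eval (Function.uncurry w) g ≠ 0 →
        SurjCoeff d k J w := by
  classical
  let S : Finset (Fin r →₀ ℕ) :=
    ((Finset.univ : Finset (Fin r)).finsuppAntidiag k).filter fun α => ∀ a, α a < d
  have hS : ∀ α, α ∈ S ↔ α.degree = k ∧ ∀ a, α a < d := fun α => by
    simp [S, Finset.mem_finsuppAntidiag, Finsupp.degree_eq_sum]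
  obtain ⟨g, hg, hg'⟩ := exists_polynomial_surjective (ι := S) J
    (fun α q => MvPolynomial.coeff α.1 (genericRestr r q))
    (fun x => LinearMap.pi fun α =>
      MvPolynomial.lcoeff F α.1 ∘ₗ (restr (Function.curry x)).toLinearMap)
    (fun x q α => by
      simp only [LinearMap.pi_apply, LinearMap.comp_apply, MvPolynomial.lcoeff_apply,
        AlgHom.toLinearMap_apply]
      rw [← map_genericRestr, MvPolynomial.coeff_map, Function.uncurry_curry])
    (Function.uncurry v) (fun c => by
      obtain ⟨q, hq, hc⟩ := hv fun α => if h : α ∈ S then c ⟨α, h⟩ else 0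
      refine ⟨q, hq, funext fun α => ?_⟩
      have := (hS α.1).1 α.2
      simpa [α.2] using hc α.1 this.1 this.2)
  refine ⟨g, hg, fun w hw c => ?_⟩
  obtain ⟨q, hq, hc⟩ := hg' _ hw fun α => c α.1
  exact ⟨q, hq, fun α hα hαd => congrFun hc ⟨α, (hS α).2 ⟨hα, hαd⟩⟩⟩

end Restr


/-! ### Restrictions to the span of generic points of X -/

section Generic

/-- Rank-nullity, with the kernel replaced by any space that contains it. -/
theorem finrank_le_finrank_map_add {F E E' : Type*} [Field F] [AddCommGroup E] [Module F E]
    [AddCommGroup E'] [Module F E'] (f : E →ₗ[F] E') (M : Submodule F E) [FiniteDimensional F M]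
    (N : Submodule F E) [FiniteDimensional F N] (h : M ⊓ LinearMap.ker f ≤ N) :
    Module.finrank F M ≤ Module.finrank F (M.map f) + Module.finrank F N := by
  let g : M →ₗ[F] M.map f := f.restrict fun q hq => Submodule.mem_map_of_mem hq
  have h1 := g.finrank_range_add_finrank_ker
  have h2 : Module.finrank F (LinearMap.range g) ≤ Module.finrank F (M.map f) :=
    Submodule.finrank_le _
  have h3 : Module.finrank F (LinearMap.ker g) ≤ Module.finrank F N := by
    let i : LinearMap.ker g →ₗ[F] N := (M.subtype ∘ₗ (LinearMap.ker g).subtype).codRestrict N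
      fun q => h ⟨q.1.2, congrArg Subtype.val (LinearMap.mem_ker.1 q.2)⟩
    refine LinearMap.finrank_le_finrank_of_injective (f := i) fun a b hab => ?_
    exact Subtype.ext (Subtype.ext (congrArg (fun q : N => (q : E)) hab))
  omega

variable {F : Type*} [Field F] [CharZero F] {n : ℕ}

/-- For a space of forms of degree `k` of this dimension, the coefficients of the restrictions to
the span of `r` generic points are arbitrary. -/
def coeffBound (n r k : ℕ) : ℕ :=
  if k = 0 then 1 else (k - 1).factorial * r * (n + (k - 1) - 1).choose (k - 1)

/-- Here ρ₀ and ρ₁ stand for the dimensions of D_x^j J and D_x^{j+1} J. The r + 1 in the bound for J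
splits into r, for the remaining points, and 1, which pays for ρ₁. -/
theorem coeffBound_step {n r k j N ρ₀ ρ₁ : ℕ} (hn : 0 < n) (hjk : j ≤ k) (hk : k ≠ 0)
    (hN : coeffBound n (r + 1) k ≤ N) (h₀ : N ≤ (n + j - 1).choose j * ρ₀)
    (h₁ : if j = k then ρ₁ = 0 else ρ₁ ≤ (n + (k - (j + 1)) - 1).choose (k - (j + 1))) :
    coeffBound n r (k - j) + ρ₁ ≤ ρ₀ := by
  have hD : ∀ i, 0 < (n + i - 1).choose i := fun i => Nat.choose_pos (by omega)
  rw [coeffBound, if_neg hk] at hN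
  -- For j = k the derivatives are constants and ρ₀ ≠ 0 is enough.
  by_cases hjk' : j = k
  · subst hjk'
    simp only [if_true] at h₁
    simp only [coeffBound, Nat.sub_self, if_true, h₁, add_zero]
    by_contra! hρ
    obtain rfl : ρ₀ = 0 := by omega
    have : 0 < (j - 1).factorial * (r + 1) * (n + (j - 1) - 1).choose (j - 1) :=
      Nat.mul_pos (Nat.mul_pos (Nat.factorial_pos _) (by omega)) (hD _)
    omega
  · rw [if_neg hjk'] at h₁
    obtain ⟨m, rfl⟩ := Nat.exists_eq_add_of_le (show j + 1 ≤ k by omega)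
    rw [coeffBound, if_neg (by omega), show j + 1 + m - j - 1 = m by omega]
    rw [show j + 1 + m - (j + 1) = m by omega] at h₁
    rw [show j + 1 + m - 1 = j + m by omega] at hN
    have key : (n + j - 1).choose j * (m.factorial * (r + 1) * (n + m - 1).choose m) ≤
        (j + m).factorial * (r + 1) * (n + (j + m) - 1).choose (j + m) :=
      calc _ = m.factorial * (r + 1) * ((n + j - 1).choose j * (n + m - 1).choose m) := by ring
        _ ≤ m.factorial * (r + 1) * ((j + m).choose j * (n + (j + m) - 1).choose (j + m)) :=
          Nat.mul_le_mul_left _ (choose_mul_choose_le hn j m)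
        _ = ((j + m).choose j * m.factorial) * ((r + 1) * (n + (j + m) - 1).choose (j + m)) := by
          ring
        _ ≤ (j + m).factorial * ((r + 1) * (n + (j + m) - 1).choose (j + m)) :=
          Nat.mul_le_mul_right _ (choose_mul_factorial_le j m)
        _ = _ := by ring
    have h2 : m.factorial * (r + 1) * (n + m - 1).choose m ≤ ρ₀ :=
      Nat.le_of_mul_le_mul_left (key.trans (hN.trans h₀)) (hD j)
    have h3 := Nat.le_mul_of_pos_left ((n + m - 1).choose m) m.factorial_pos
    calc _ ≤ m.factorial * r * (n + m - 1).choose m + m.factorial * (n + m - 1).choose m := by omega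
      _ = m.factorial * (r + 1) * (n + m - 1).choose m := by ring
      _ ≤ _ := h2

/-- Induction on the number of points. The first point x is generic for the ranks of all D_x^j, j <
d, and the other points come from the induction hypothesis for the spaces D_x^j(J ∩ ker D_x^{j+1}).
-/
theorem exists_surjCoeff {X : Set (Fin n → F)} (hX : PolyPrime X) (hn : 0 < n) {d : ℕ} (hd : 1 ≤ d)
    (hnd : NonDegenerateOfOrder X (d - 1)) (r k : ℕ) (hk : k ≤ d)
    (J : Submodule F (MvPolynomial (Fin n) F))
    (hJ : J ≤ MvPolynomial.homogeneousSubmodule (Fin n) F k)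
    (hb : coeffBound n r k ≤ Module.finrank F J) :
    ∃ v : Fin r → Fin n → F, (∀ a, v a ∈ X) ∧ SurjCoeff d k J v := by
  classical
  induction r generalizing k J with
  | zero =>
    refine ⟨Fin.elim0, fun a => a.elim0, fun c => ?_⟩
    -- Without points the only monomial is 1. It has degree k only for k = 0, and then J contains a
    -- nonzero constant.
    by_cases hk0 : k = 0
    · subst hk0
      simp only [coeffBound, if_true] at hb
      obtain ⟨⟨q, hq⟩, hq0⟩ : ∃ q : J, q ≠ 0 := by
        by_contra! hcon
        have : Subsingleton J := ⟨fun a b => (hcon a).trans (hcon b).symm⟩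
        rw [Module.finrank_zero_of_subsingleton] at hb
        omega
      have hC := MvPolynomial.totalDegree_eq_zero_iff_eq_C.1 (Nat.le_zero.1
        ((MvPolynomial.mem_homogeneousSubmodule 0 q).1 (hJ hq)).totalDegree_le)
      have h0 : MvPolynomial.coeff 0 q ≠ 0 := by
        intro h
        rw [h, map_zero] at hC
        exact hq0 (Subtype.ext hC)
      refine ⟨(c 0 / MvPolynomial.coeff 0 q) • q, J.smul_mem _ hq, fun α _ _ => ?_⟩
      obtain rfl : α = 0 := Subsingleton.elim _ _
      rw [hC]
      simp [h0]
    · refine ⟨0, J.zero_mem, fun α hα _ => ?_⟩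
      obtain rfl : α = 0 := Subsingleton.elim _ _
      simp at hα
      omega
  | succ r ih =>
    have hfin : ∀ k (J : Submodule F (MvPolynomial (Fin n) F)),
        J ≤ MvPolynomial.homogeneousSubmodule (Fin n) F k → FiniteDimensional F J :=
      fun k J hJ => Submodule.finiteDimensional_of_le hJ
    have := hfin k J hJ
    have hmap : ∀ j x, J.map (iterDeriv j x) ≤
        MvPolynomial.homogeneousSubmodule (Fin n) F (k - j) := by
      rintro j x _ ⟨q, hq, rfl⟩
      exact isHomogeneous_iterDeriv (hJ hq) j x
    let s := (Finset.range (k + 1)).filter (· < d)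
    have hs : ∀ j, j ∈ s ↔ j ≤ k ∧ j < d := fun j => by simp [s]
    have hg : ∀ j : ℕ, ∃ g : MvPolynomial (Fin n) F, j ∈ s →
        (∃ x ∈ X, MvPolynomial.eval x g ≠ 0) ∧ ∀ x, MvPolynomial.eval x g ≠ 0 →
          Module.finrank F J ≤
            (n + j - 1).choose j * Module.finrank F (J.map (iterDeriv j x)) := by
      intro j
      by_cases hj : j ∈ s
      · obtain ⟨hjk, hjd⟩ := (hs j).1 hj
        obtain ⟨g, hg⟩ := exists_polynomial_rank_iterDeriv hX.1 hjk
          (hnd.of_le hn (show j ≤ d - 1 by omega)) J hJ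
        exact ⟨g, fun _ => hg⟩
      · exact ⟨0, fun h => absurd h hj⟩
    choose g hg using hg
    -- One point x for all orders j at once.
    obtain ⟨x, hx, hxg⟩ := hX.forall_finset s g fun j hj => (hg j hj).1
    have hrank := fun j hj => (hg j hj).2 x (hxg j hj)
    let K : ℕ → Submodule F (MvPolynomial (Fin n) F) := fun j =>
      (J ⊓ LinearMap.ker (iterDeriv (j + 1) x)).map (iterDeriv j x)
    have hK : ∀ j, K j ≤ MvPolynomial.homogeneousSubmodule (Fin n) F (k - j) := fun j =>
      (Submodule.map_mono inf_le_left).trans (hmap j x)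
    have hy : ∀ j ∈ s, ∃ y : Fin r → Fin n → F, (∀ a, y a ∈ X) ∧ SurjCoeff d (k - j) (K j) y := by
      intro j hj
      obtain ⟨hjk, hjd⟩ := (hs j).1 hj
      refine ih (k - j) (by omega) (K j) (hK j) ?_
      have f1 := hfin _ _ (hK j)
      have f2 := hfin _ _ (hmap j x)
      -- The kernel of D_x on D_x^j J lies in `K j`, so dim `K j` is at least the drop in dimension
      -- from D_x^j J to D_x^{j+1} J.
      have h1 := finrank_le_finrank_map_add
        (dirDeriv x : MvPolynomial (Fin n) F →ₗ[F] MvPolynomial (Fin n) F)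
        (J.map (iterDeriv j x)) (K j) (by
          rintro _ ⟨⟨q, hq, rfl⟩, hq'⟩
          refine ⟨q, ⟨hq, ?_⟩, rfl⟩
          rw [SetLike.mem_coe, LinearMap.mem_ker, iterDeriv_succ]
          exact hq')
      have h2 : (J.map (iterDeriv j x)).map
          (dirDeriv x : MvPolynomial (Fin n) F →ₗ[F] MvPolynomial (Fin n) F) =
          J.map (iterDeriv (j + 1) x) := by
        rw [← Submodule.map_comp]
        congr 1
        refine LinearMap.ext fun q => ?_
        exact (iterDeriv_succ j x q).symm
      rw [h2] at h1
      by_cases hk0 : k = 0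
      · subst hk0
        obtain rfl : j = 0 := by omega
        have h3 : Module.finrank F (J.map (iterDeriv 1 x)) = 0 := by
          have : J.map (iterDeriv 1 x) = ⊥ := by
            rw [eq_bot_iff]
            rintro _ ⟨q, hq, rfl⟩
            exact iterDeriv_eq_zero_of_lt (hJ hq) Nat.one_pos x
          rw [this, finrank_bot]
        have h4 := hrank 0 hj
        simp only [Nat.choose_zero_right, one_mul] at h4
        simp only [coeffBound, if_true, Nat.sub_zero] at hb ⊢
        rw [zero_add] at h1
        omega
      · have h3 := coeffBound_step (ρ₁ := Module.finrank F (J.map (iterDeriv (j + 1) x))) hn hjk hk0 hb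
          (hrank j hj) (by
            split_ifs with hjk'
            · have : J.map (iterDeriv (j + 1) x) = ⊥ := by
                rw [eq_bot_iff]
                rintro _ ⟨q, hq, rfl⟩
                exact iterDeriv_eq_zero_of_lt (hJ hq) (by omega) x
              rw [this, finrank_bot]
            · exact (Submodule.finrank_mono (hmap (j + 1) x)).trans
                (finrank_homogeneousSubmodule_le _))
        omega
    -- So far each order has its own tuple y. Openness and primality of the set of tuples allow a
    -- common one.
    have hG : ∀ j : ℕ, ∃ G : MvPolynomial (Fin r × Fin n) F, j ∈ s →
        (∃ y ∈ tupleSet X r, MvPolynomial.eval y G ≠ 0) ∧ ∀ w : Fin r → Fin n → F,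
          MvPolynomial.eval (Function.uncurry w) G ≠ 0 → SurjCoeff d (k - j) (K j) w := by
      intro j
      by_cases hj : j ∈ s
      · obtain ⟨y, hy, hyK⟩ := hy j hj
        obtain ⟨G, hG, hG'⟩ := hyK.exists_polynomial
        exact ⟨G, fun _ => ⟨exists_mem_tupleSet.2 ⟨y, hy, hG⟩, hG'⟩⟩
      · exact ⟨0, fun h => absurd h hj⟩
    choose G hG using hG
    obtain ⟨y, hy, hyG⟩ := exists_mem_tupleSet.1
      ((hX.tupleSet r).forall_finset s G fun j hj => (hG j hj).1)
    refine ⟨Fin.cons x y, fun a => ?_, SurjCoeff.cons fun j hjk hjd => ?_⟩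
    · cases a using Fin.cases with
      | zero => exact hx
      | succ a => exact hy a
    · have hj := (hs j).2 ⟨hjk, hjd⟩
      exact (hG j hj).2 y (hyG j hj)

/-- Generic tuples of points of `X` are linearly independent, and the restrictions to their span of
the forms in `J` have arbitrary coefficients at the monomials that are not pure powers. -/
theorem exists_polynomial_generic {X : Set (Fin n → F)} (hX : PolyPrime X) (hn : 0 < n) {d : ℕ}
    (hd : 2 ≤ d) (hnd : NonDegenerateOfOrder X (d - 1)) (R : ℕ) (hR : R ≤ n)
    (J : Submodule F (MvPolynomial (Fin n) F))
    (hJ : J ≤ MvPolynomial.homogeneousSubmodule (Fin n) F d)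
    (hb : (d - 1).factorial * R * (n + (d - 1) - 1).choose (d - 1) ≤ Module.finrank F J) :
    ∃ g : MvPolynomial (Fin R × Fin n) F,
      (∃ v : Fin R → Fin n → F, (∀ a, v a ∈ X) ∧
        MvPolynomial.eval (Function.uncurry v) g ≠ 0) ∧
      ∀ v : Fin R → Fin n → F, MvPolynomial.eval (Function.uncurry v) g ≠ 0 →
        LinearIndependent F v ∧ SurjCoeff d d J v := by
  obtain ⟨v, hv, hvJ⟩ := exists_surjCoeff hX hn (by omega) hnd R d le_rfl J hJ
    (by rwa [coeffBound, if_neg (by omega)])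
  -- For linear forms the same statement gives linear independence: the bound for k = 1 is R ≤ n,
  -- and since d ≥ 2 no exponent is excluded.
  obtain ⟨w, hw, hw1⟩ := exists_surjCoeff hX hn (by omega) hnd R 1 (by omega)
    (MvPolynomial.homogeneousSubmodule (Fin n) F 1) le_rfl
    (by simpa [coeffBound] using hR.trans le_finrank_homogeneousSubmodule_one)
  obtain ⟨g, hg, hg'⟩ := hvJ.exists_polynomial
  obtain ⟨h, hh, hh'⟩ := hw1.exists_polynomial
  obtain ⟨u, hu, h1, h2⟩ := exists_mem_tupleSet.1 ((hX.tupleSet R).2 g h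
    (exists_mem_tupleSet.2 ⟨v, hv, hg⟩) (exists_mem_tupleSet.2 ⟨w, hw, hh⟩))
  refine ⟨g * h, ⟨u, hu, by rw [map_mul]; exact mul_ne_zero h1 h2⟩, fun v hv => ?_⟩
  rw [map_mul] at hv
  refine ⟨?_, hg' v (left_ne_zero_of_mul hv)⟩
  rw [Fintype.linearIndependent_iff]
  intro t ht a
  -- A linear form that is 1 at v_a and 0 at the other points; it reads off the a-th coefficient of
  -- a relation.
  obtain ⟨q, hq, hc⟩ := hh' v (right_ne_zero_of_mul hv) fun α =>
    MvPolynomial.coeff α (MvPolynomial.X a)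
  have hq1 : q.IsHomogeneous 1 := hq
  have h3 : restr v q = MvPolynomial.X a := by
    ext α
    by_cases hα : α.degree = 1
    · exact hc _ hα fun b' => (Finsupp.le_degree b' _).trans_lt (by omega)
    · rw [(isHomogeneous_restr v hq1).coeff_eq_zero hα,
        (MvPolynomial.isHomogeneous_X F a).coeff_eq_zero hα]
  have h4 := eval_restr v t q
  rw [ht, h3, MvPolynomial.eval_X] at h4
  rw [h4, MvPolynomial.eval_zero]
  exact hq1.coeff_eq_zero (by simp)

end Generic


/-! ### Symmetric tensors and forms -/

section SymmetricTensors

variable {F : Type*} [Field F] {n : ℕ}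

/-- `t` is invariant under permuting the factors. -/
def TensorSymmetric {d : ℕ} (t : TensorPow F n d) : Prop :=
  ∀ (τ : Equiv.Perm (Fin d)) (i : Fin d → Fin n), t (i ∘ τ) = t i

theorem monomialExponent_comp_perm {d : ℕ} (i : Fin d → Fin n) (τ : Equiv.Perm (Fin d)) :
    monomialExponent (i ∘ τ) = monomialExponent i :=
  Equiv.sum_comp τ fun k => Finsupp.single (i k) 1

/-- The exponents are the sizes of the fibres, and bijections between the fibres glue to a
permutation. -/
theorem exists_perm_of_monomialExponent_eq {d : ℕ} {i j : Fin d → Fin n}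
    (h : monomialExponent i = monomialExponent j) : ∃ τ : Equiv.Perm (Fin d), i = j ∘ τ := by
  have hc : ∀ (i : Fin d → Fin n) (a : Fin n),
      monomialExponent i a = Fintype.card {k // i k = a} := by
    intro i a
    simp [monomialExponent, Finsupp.finsetSum_apply, Finsupp.single_apply, Fintype.card_subtype]
  have e : ∀ a, Nonempty ({k // i k = a} ≃ {k // j k = a}) := fun a =>
    Fintype.card_eq.1 (by rw [← hc, ← hc, h])
  have e := fun a => (e a).some
  exact ⟨Equiv.ofFiberEquiv e, funext fun k => (Equiv.ofFiberEquiv_map e k).symm⟩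

theorem exists_monomialExponent_eq {d : ℕ} (α : Fin n →₀ ℕ) (hα : α.degree = d) :
    ∃ i : Fin d → Fin n, monomialExponent i = α := by
  induction d generalizing α with
  | zero =>
    refine ⟨Fin.elim0, ?_⟩
    rw [Finsupp.degree_eq_zero_iff] at hα
    simp [hα, monomialExponent]
  | succ d ih =>
    obtain ⟨a, ha⟩ : ∃ a, α a ≠ 0 := by
      by_contra! h
      have : α = 0 := Finsupp.ext h
      simp [this] at hα
    have hle : Finsupp.single a 1 ≤ α := by
      rw [Finsupp.single_le_iff]; omega
    have hsub := tsub_add_cancel_of_le hle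
    obtain ⟨i, hi⟩ := ih (α - Finsupp.single a 1) (by
      have := congrArg Finsupp.degree hsub
      rw [map_add, Finsupp.degree_single] at this
      omega)
    refine ⟨Fin.cons a i, ?_⟩
    rw [monomialExponent, Fin.sum_univ_succ]
    simp only [Fin.cons_zero, Fin.cons_succ]
    rw [add_comm, ← hsub]
    exact congrArg (· + Finsupp.single a 1) hi

theorem exists_monotone_monomialExponent_eq {d : ℕ} (α : Fin n →₀ ℕ) (hα : α.degree = d) :
    ∃ i : Fin d → Fin n, Monotone i ∧ monomialExponent i = α := by
  obtain ⟨i, hi⟩ := exists_monomialExponent_eq α hα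
  exact ⟨i ∘ Tuple.sort i, Tuple.monotone_sort i, by rw [monomialExponent_comp_perm, hi]⟩

theorem degree_monomialExponent {d : ℕ} (i : Fin d → Fin n) : (monomialExponent i).degree = d := by
  simp [monomialExponent, map_sum, Finsupp.degree_single]

theorem monotone_eq_of_monomialExponent_eq {d : ℕ} {i j : Fin d → Fin n} (hi : Monotone i)
    (hj : Monotone j) (h : monomialExponent i = monomialExponent j) : i = j := by
  obtain ⟨τ, rfl⟩ := exists_perm_of_monomialExponent_eq h
  exact Tuple.unique_monotone (f := j) (σ := τ) (τ := 1) hi hj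

theorem prod_X_eq_monomial {d : ℕ} (i : Fin d → Fin n) :
    ∏ k, (MvPolynomial.X (i k) : MvPolynomial (Fin n) F) =
      MvPolynomial.monomial (monomialExponent i) 1 := by
  rw [monomialExponent, MvPolynomial.monomial_sum_one]
  rfl

open Classical in
/-- A form as a combination of monomials. -/
theorem MvPolynomial.IsHomogeneous.eq_sum_monotone {d : ℕ} {q : MvPolynomial (Fin n) F}
    (hq : q.IsHomogeneous d) :
    q = ∑ i ∈ Finset.univ.filter (fun i : Fin d → Fin n => Monotone i),
      q.coeff (monomialExponent i) • ∏ k, MvPolynomial.X (i k) := by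
  ext α
  simp only [prod_X_eq_monomial, MvPolynomial.coeff_sum, MvPolynomial.coeff_smul,
    MvPolynomial.coeff_monomial, smul_eq_mul, mul_ite, mul_one, mul_zero]
  by_cases hα : α.degree = d
  · obtain ⟨i, hi, rfl⟩ := exists_monotone_monomialExponent_eq α hα
    rw [Finset.sum_eq_single_of_mem i (by simpa using hi), if_pos rfl]
    intro j hj hji
    rw [if_neg]
    exact fun h => hji (monotone_eq_of_monomialExponent_eq (by simpa using hj) hi h)
  · rw [hq.coeff_eq_zero hα, Finset.sum_eq_zero]
    intro i _
    rw [if_neg]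
    rintro rfl
    exact hα (degree_monomialExponent i)

/-- The pairing with a tensor as a functional on polynomials. -/
noncomputable def formPairingHom {d : ℕ} (t : TensorPow F n d) : Module.Dual F (MvPolynomial (Fin n) F) where
  toFun g := formPairing g t
  map_add' g h := by simp [formPairing, add_mul, Finset.sum_add_distrib]
  map_smul' c g := by simp [formPairing, mul_assoc, Finset.mul_sum]

theorem formPairingHom_apply {d : ℕ} (t : TensorPow F n d) (g : MvPolynomial (Fin n) F) :
    formPairingHom t g = formPairing g t := rfl

/-- The pairing is defined through sorted indices only; symmetry of t makes the order irrelevant. -/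
theorem TensorSymmetric.formPairing_prod_X {d : ℕ} {t : TensorPow F n d} (ht : TensorSymmetric t)
    (i : Fin d → Fin n) : formPairing (∏ k, MvPolynomial.X (i k)) t = t i := by
  classical
  rw [formPairing, prod_X_eq_monomial]
  simp only [MvPolynomial.coeff_monomial]
  rw [Finset.sum_eq_single_of_mem (i ∘ Tuple.sort i)
    (by simpa using Tuple.monotone_sort i), monomialExponent_comp_perm, if_pos rfl, one_mul, ht]
  intro j hj hji
  rw [if_neg, zero_mul]
  intro h
  exact hji (monotone_eq_of_monomialExponent_eq (by simpa using hj) (Tuple.monotone_sort i)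
    (by rw [monomialExponent_comp_perm, h]))

theorem tensorSymmetric_tensorPower (d : ℕ) (v : Fin n → F) : TensorSymmetric (tensorPower d v) :=
  fun τ i => Equiv.prod_comp τ fun k => v (i k)

theorem formPairing_tensorPower {d : ℕ} {q : MvPolynomial (Fin n) F} (hq : q.IsHomogeneous d)
    (v : Fin n → F) : formPairing q (tensorPower d v) = MvPolynomial.eval v q := by
  conv_rhs => rw [hq.eq_sum_monotone]
  rw [formPairing, map_sum]
  refine Finset.sum_congr rfl fun i _ => ?_
  rw [MvPolynomial.smul_eval, map_prod]
  simp [tensorPower, pureTensor]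

/-- The image of a tensor in `(F^R)^{⊗d}` under the linear map `F^R → F^n` with columns `v_a`. -/
def mapTensor {d R : ℕ} (v : Fin R → Fin n → F) (c : TensorPow F R d) : TensorPow F n d :=
  fun i => ∑ j, c j * ∏ k, v (j k) (i k)

theorem mapTensor_symmetric {d R : ℕ} (v : Fin R → Fin n → F) {c : TensorPow F R d}
    (hc : TensorSymmetric c) : TensorSymmetric (mapTensor v c) := by
  intro τ i
  rw [mapTensor, mapTensor]
  refine (Equiv.sum_comp (Equiv.arrowCongr τ.symm (Equiv.refl (Fin R))) _).symm.trans ?_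
  refine Finset.sum_congr rfl fun j _ => ?_
  have : (Equiv.arrowCongr τ.symm (Equiv.refl (Fin R))) j = j ∘ τ := by
    ext k; simp [Equiv.arrowCongr]
  rw [this, hc]
  congr 1
  exact Equiv.prod_comp τ fun k => v (j k) (i k)

/-- On symmetric tensors, `mapTensor v` is the transpose of restricting forms; it suffices to check
monomials. -/
theorem formPairing_mapTensor {d R : ℕ} (v : Fin R → Fin n → F) {c : TensorPow F R d}
    (hc : TensorSymmetric c) {q : MvPolynomial (Fin n) F} (hq : q.IsHomogeneous d) :
    formPairing q (mapTensor v c) = formPairing (restr v q) c := by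
  have hq' := hq.eq_sum_monotone
  rw [hq', ← formPairingHom_apply, ← formPairingHom_apply, map_sum, map_sum, map_sum]
  refine Finset.sum_congr rfl fun i _ => ?_
  rw [map_smul, map_smul, map_smul, formPairingHom_apply,
    (mapTensor_symmetric v hc).formPairing_prod_X, map_prod]
  congr 1
  simp only [restr_X]
  rw [Finset.prod_univ_sum, Fintype.piFinset_univ, map_sum, mapTensor]
  refine Finset.sum_congr rfl fun j _ => ?_
  rw [Finset.prod_mul_distrib, ← map_prod, ← MvPolynomial.smul_eq_C_mul, map_smul,
    formPairingHom_apply, hc.formPairing_prod_X, smul_eq_mul, mul_comm]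

/-- The tensors `u_1 ⊗ ⋯ ⊗ u_d` with `u_k ∈ U` span the tensors that have the slices in each
direction in `U`. -/
theorem mem_span_pureTensor {d : ℕ} (U : Submodule F (Fin n → F)) (t : TensorPow F n d)
    (ht : ∀ k i, (fun x => t (Function.update i k x)) ∈ U) :
    t ∈ Submodule.span F {t | ∃ u : Fin d → Fin n → F, (∀ k, u k ∈ U) ∧ t = pureTensor u} := by
  induction d with
  | zero =>
    have : t = t (Fin.elim0) • pureTensor (fun k : Fin 0 => k.elim0) := by
      ext i
      rw [Subsingleton.elim i Fin.elim0]
      simp [pureTensor]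
    rw [this]
    exact Submodule.smul_mem _ _ (Submodule.subset_span ⟨_, fun k => k.elim0, rfl⟩)
  | succ d ih =>
    let b := Module.finBasis F U
    have hφ : ∀ a, ∃ φ : (Fin n → F) →ₗ[F] F, φ ∘ₗ U.subtype = b.coord a := fun a =>
      LinearMap.exists_extend (b.coord a)
    choose φ hφ using hφ
    -- Expand t in the first direction in a basis of U. The coefficients are obtained by extending
    -- coordinate functionals from U to F^n, and their slices, being combinations of slices of t,
    -- are again in U.
    let s : Fin (Module.finrank F U) → TensorPow F n d := fun a y => φ a fun x => t (Fin.cons x y)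
    let cons : (Fin n → F) → TensorPow F n d →ₗ[F] TensorPow F n (d + 1) := fun u =>
      { toFun := fun s i => u (i 0) * s (Fin.tail i)
        map_add' := fun s s' => by ext i; simp [mul_add]
        map_smul' := fun c s => by ext i; simp [mul_left_comm] }
    have h0 : ∀ y : Fin d → Fin n, (fun x => t (Fin.cons x y)) ∈ U := by
      intro y
      by_cases hn : Nonempty (Fin n)
      · obtain ⟨x₀⟩ := hn
        have := ht 0 (Fin.cons x₀ y)
        simpa using this
      · rw [not_nonempty_iff] at hn
        rw [Subsingleton.elim (fun x => t (Fin.cons x y)) 0]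
        exact U.zero_mem
    have h1 : t = ∑ a, cons (b a) (s a) := by
      ext i
      have e := congrArg (fun w : U => (w : Fin n → F) (i 0)) (b.sum_repr ⟨_, h0 (Fin.tail i)⟩)
      simp only [Submodule.coe_sum, Submodule.coe_smul, Finset.sum_apply, Pi.smul_apply,
        smul_eq_mul, Fin.cons_self_tail] at e
      rw [← e, Finset.sum_apply]
      refine Finset.sum_congr rfl fun a _ => ?_
      have := LinearMap.congr_fun (hφ a) ⟨_, h0 (Fin.tail i)⟩
      simp only [LinearMap.comp_apply, Submodule.subtype_apply, Module.Basis.coord_apply] at this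
      rw [← this]
      exact mul_comm _ _
    rw [h1]
    refine Submodule.sum_mem _ fun a _ => ?_
    have h2 := ih (s a) fun k i => by
      have e : (fun x => s a (Function.update i k x)) =
          ∑ x', φ a (Pi.single x' 1) • fun x => t (Function.update (Fin.cons x' i) k.succ x) := by
        ext x
        simp only [s, Finset.sum_apply, Pi.smul_apply, smul_eq_mul]
        rw [LinearMap.pi_apply_eq_sum_univ (φ a)]
        refine Finset.sum_congr rfl fun x' _ => ?_
        rw [Fin.cons_update, smul_eq_mul, mul_comm]
        congr 2
        ext y
        simp [Pi.single_apply, eq_comm]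
      rw [e]
      exact Submodule.sum_mem _ fun x' _ => U.smul_mem _ (ht k.succ _)
    have h3 := Submodule.mem_map_of_mem (f := cons (b a)) h2
    rw [Submodule.map_span] at h3
    refine Submodule.span_mono ?_ h3
    rintro _ ⟨_, ⟨u, hu, rfl⟩, rfl⟩
    refine ⟨Fin.cons (b a) u, fun k => ?_, ?_⟩
    · cases k using Fin.cases with
      | zero => exact (b a).2
      | succ k => exact hu k
    · ext i
      simp [cons, pureTensor, Fin.prod_univ_succ, Fin.tail]

/-- By symmetry the slices in the first direction control those in all directions. This turns
membership into linear equations that the program can write down. -/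
theorem mem_symPower_iff {d : ℕ} (hd : 0 < d) (U : Submodule F (Fin n → F)) (t : TensorPow F n d) :
    t ∈ symPower d U ↔ TensorSymmetric t ∧
      ∀ i, (fun x => t (Function.update i ⟨0, hd⟩ x)) ∈ U := by
  constructor
  · rintro ⟨h1, h2⟩
    refine ⟨h2, fun i => ?_⟩
    clear h2
    induction h1 using Submodule.span_induction with
    | mem t ht =>
      obtain ⟨u, hu, rfl⟩ := ht
      have : (fun x => pureTensor u (Function.update i ⟨0, hd⟩ x)) =
          (∏ k ∈ Finset.univ.erase ⟨0, hd⟩, u k (i k)) • u ⟨0, hd⟩ := by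
        ext x
        rw [pureTensor, ← Finset.mul_prod_erase _ _ (Finset.mem_univ (⟨0, hd⟩ : Fin d)), mul_comm]
        simp only [Function.update_self, Pi.smul_apply, smul_eq_mul]
        congr 1
        refine Finset.prod_congr rfl fun k hk => ?_
        rw [Function.update_of_ne (Finset.ne_of_mem_erase hk)]
      rw [this]
      exact U.smul_mem _ (hu _)
    | zero => exact U.zero_mem
    | add t t' _ _ h h' => exact U.add_mem h h'
    | smul c t _ h => exact U.smul_mem c h
  · rintro ⟨h1, h2⟩
    refine ⟨mem_span_pureTensor U t fun k i => ?_, h1⟩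
    have : (fun x => t (Function.update i k x)) =
        fun x => t (Function.update (i ∘ Equiv.swap ⟨0, hd⟩ k) ⟨0, hd⟩ x) := by
      ext x
      rw [← h1 (Equiv.swap ⟨0, hd⟩ k) (Function.update i k x)]
      congr 1
      ext l
      simp only [Function.comp_apply, Function.update_apply, Equiv.swap_apply_def]
      split_ifs <;> simp_all
    rw [this]
    exact h2 _

theorem tensorPower_mem_symPower {d : ℕ} {U : Submodule F (Fin n → F)} {v : Fin n → F}
    (hv : v ∈ U) : tensorPower d v ∈ symPower d U :=
  ⟨Submodule.subset_span ⟨_, fun _ => hv, rfl⟩, tensorSymmetric_tensorPower d v⟩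

theorem tensorPower_mem_formAnnihilator {d p : ℕ} {f : Fin p → MvPolynomial (Fin n) F}
    (hf : ∀ l, (f l).IsHomogeneous d) {v : Fin n → F} (hv : ∀ l, MvPolynomial.eval v (f l) = 0) :
    tensorPower d v ∈ formAnnihilator d f := fun l => by rw [formPairing_tensorPower (hf l), hv]

/-- Functionals dual to linearly independent vectors. -/
theorem exists_dual_vectors {R : ℕ} {v : Fin R → Fin n → F} (hv : LinearIndependent F v) :
    ∃ g : Fin R → Fin n → F, ∀ a b, ∑ i, g a i * v b i = if a = b then 1 else 0 := by
  have : ∀ a, ∃ φ : (Fin n → F) →ₗ[F] F, ∀ b, φ (v b) = if a = b then 1 else 0 := by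
    intro a
    obtain ⟨φ, hφ⟩ := LinearMap.exists_extend ((Module.Basis.span hv).coord a)
    refine ⟨φ, fun b => ?_⟩
    have := LinearMap.congr_fun hφ (Module.Basis.span hv b)
    rw [Module.Basis.coord_apply, Module.Basis.repr_self, LinearMap.comp_apply,
      Submodule.subtype_apply, Module.Basis.span_apply, Finsupp.single_apply] at this
    simp [this, eq_comm]
  choose φ hφ using this
  refine ⟨fun a i => φ a (Pi.single i 1), fun a b => ?_⟩
  rw [← hφ a b, LinearMap.pi_apply_eq_sum_univ (φ a) (v b)]
  refine Finset.sum_congr rfl fun i _ => ?_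
  rw [smul_eq_mul, mul_comm]
  congr 1
  exact congrArg _ (funext fun y => by simp [Pi.single_apply, eq_comm])

/-- The coordinates of a tensor in `span(v_1, …, v_R)^{⊗d}`. -/
def contractTensor {d R : ℕ} (g : Fin R → Fin n → F) (t : TensorPow F n d) : TensorPow F R d :=
  fun j => ∑ i, t i * ∏ k, g (j k) (i k)

theorem contractTensor_symmetric {d R : ℕ} (g : Fin R → Fin n → F) {t : TensorPow F n d}
    (ht : TensorSymmetric t) : TensorSymmetric (contractTensor g t) :=
  mapTensor_symmetric (fun i a => g a i) ht

theorem mapTensor_contractTensor {d R : ℕ} {v g : Fin R → Fin n → F}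
    (hg : ∀ a b, ∑ i, g a i * v b i = if a = b then 1 else 0) {t : TensorPow F n d}
    (ht : t ∈ Submodule.span F {t | ∃ u : Fin d → Fin n → F,
      (∀ k, u k ∈ Submodule.span F (Set.range v)) ∧ t = pureTensor u}) :
    mapTensor v (contractTensor g t) = t := by
  induction ht using Submodule.span_induction with
  | mem t ht =>
    obtain ⟨u, hu, rfl⟩ := ht
    have h1 : ∀ w ∈ Submodule.span F (Set.range v), ∀ x,
        ∑ a, (∑ i, w i * g a i) * v a x = w x := by
      intro w hw x
      obtain ⟨c, rfl⟩ := (Submodule.mem_span_range_iff_exists_fun F).1 hw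
      have : ∀ a, ∑ i, (∑ b, c b • v b) i * g a i = c a := by
        intro a
        simp only [Finset.sum_apply, Pi.smul_apply, smul_eq_mul, Finset.sum_mul]
        rw [Finset.sum_comm]
        calc _ = ∑ b, c b * ∑ i, g a i * v b i := by
              refine Finset.sum_congr rfl fun b _ => ?_
              rw [Finset.mul_sum]
              exact Finset.sum_congr rfl fun i _ => by ring
          _ = c a := by simp [hg]
      simp only [this]
      simp [Finset.sum_apply]
    ext i
    rw [pureTensor]
    simp only [← h1 _ (hu _) (i _)]
    rw [Finset.prod_univ_sum, Fintype.piFinset_univ, mapTensor]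
    refine Finset.sum_congr rfl fun j _ => ?_
    rw [Finset.prod_mul_distrib, Finset.prod_univ_sum, Fintype.piFinset_univ, contractTensor]
    congr 1
    refine Finset.sum_congr rfl fun l _ => ?_
    rw [Finset.prod_mul_distrib, pureTensor]
  | zero => ext i; simp [mapTensor, contractTensor]
  | add t t' _ _ h h' =>
    conv_rhs => rw [← h, ← h']
    ext i
    simp [mapTensor, contractTensor, add_mul, Finset.sum_add_distrib]
  | smul c t _ h =>
    conv_rhs => rw [← h]
    ext i
    simp only [mapTensor, contractTensor, mul_assoc, Finset.mul_sum, Finset.sum_mul, Pi.smul_apply,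
      smul_eq_mul]

/-- Contraction with d copies of the functional dual to v_b extracts the coefficient of v_b^{⊗d}. -/
theorem linearIndependent_tensorPower {d R : ℕ} (hd : 0 < d) {v : Fin R → Fin n → F}
    (hv : LinearIndependent F v) : LinearIndependent F fun a => tensorPower d (v a) := by
  obtain ⟨g, hg⟩ := exists_dual_vectors hv
  rw [Fintype.linearIndependent_iff]
  intro c hc b
  have h := congrFun (congrArg (contractTensor g) hc) fun _ => b
  have e : contractTensor g (∑ a, c a • tensorPower d (v a)) (fun _ => b) =
      ∑ a, c a * (∑ i, g b i * v a i) ^ d := by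
    rw [contractTensor]
    simp only [Finset.sum_apply, Pi.smul_apply, smul_eq_mul, Finset.sum_mul]
    rw [Finset.sum_comm]
    refine Finset.sum_congr rfl fun a _ => ?_
    rw [← Fin.prod_const, Finset.prod_univ_sum, Fintype.piFinset_univ, Finset.mul_sum]
    refine Finset.sum_congr rfl fun i _ => ?_
    rw [tensorPower, pureTensor, mul_assoc, ← Finset.prod_mul_distrib]
    simp only [mul_comm]
  rw [e] at h
  simpa [hg, hd.ne', contractTensor] using h

/-- Under the genericity condition, the intersection of `S^d(U)` and `I_d^⊥` is spanned by the
powers of the given points. -/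
theorem symPower_inf_formAnnihilator_eq {d p R : ℕ} (hd : 0 < d)
    {f : Fin p → MvPolynomial (Fin n) F} (hf : ∀ l, (f l).IsHomogeneous d)
    {v : Fin R → Fin n → F} (hv : LinearIndependent F v)
    (hvX : ∀ a l, MvPolynomial.eval (v a) (f l) = 0)
    (hs : SurjCoeff d d (Submodule.span F (Set.range f)) v) :
    symPower d (Submodule.span F (Set.range v)) ⊓ formAnnihilator d f =
      Submodule.span F (Set.range fun a => tensorPower d (v a)) := by
  classical
  refine le_antisymm ?_ (Submodule.span_le.2 ?_)
  · rintro t ⟨⟨ht1, ht2⟩, ht3⟩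
    obtain ⟨g, hg⟩ := exists_dual_vectors hv
    have hmap := mapTensor_contractTensor hg ht1
    have hsym : TensorSymmetric (contractTensor g t) := contractTensor_symmetric g ht2
    set c := contractTensor g t with hc
    have hspan : ∀ q ∈ Submodule.span F (Set.range f), q.IsHomogeneous d ∧
        formPairing q t = 0 ∧ ∀ a, MvPolynomial.eval (v a) q = 0 := by
      intro q hq
      induction hq using Submodule.span_induction with
      | mem q hq =>
        obtain ⟨l, rfl⟩ := hq
        exact ⟨hf l, ht3 l, fun a => hvX a l⟩
      | zero => exact ⟨MvPolynomial.isHomogeneous_zero _ _ _, (formPairingHom t).map_zero, by simp⟩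
      | add q q' _ _ h h' =>
        refine ⟨h.1.add h'.1, ?_, fun a => by simp [h.2.2, h'.2.2]⟩
        rw [← formPairingHom_apply, map_add, formPairingHom_apply, formPairingHom_apply, h.2.1,
          h'.2.1, add_zero]
      | smul r q _ h =>
        refine ⟨(MvPolynomial.homogeneousSubmodule (Fin n) F d).smul_mem r h.1, ?_,
          fun a => by simp [h.2.2]⟩
        rw [← formPairingHom_apply, map_smul, formPairingHom_apply, h.2.1, smul_zero]
    have hpure : ∀ a, (fun _ => a : Fin d → Fin R) = fun _ => a := fun _ => rfl
    -- Choose q in I_d whose restriction is exactly the monomial of j. Pairing q with t gives 0 on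
    -- one side and, by transposition, the coordinate `c j` on the other.
    have hzero : ∀ j : Fin d → Fin R, (¬ ∃ a, j = fun _ => a) → c j = 0 := by
      intro j hj
      obtain ⟨q, hq, hqc⟩ := hs fun α => if α = monomialExponent j then 1 else 0
      obtain ⟨hq1, hq2, hq3⟩ := hspan q hq
      have hr : restr v q = ∏ k, MvPolynomial.X (j k) := by
        rw [prod_X_eq_monomial]
        ext α
        rw [MvPolynomial.coeff_monomial]
        by_cases hα : α.degree = d
        · by_cases hαd : ∀ a, α a < d
          · rw [hqc α hα hαd]
            simp [eq_comm]
          · obtain ⟨a, ha⟩ := not_forall.1 hαd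
            have hαa : α = Finsupp.single a d := by
              have h1 : Finsupp.single a d ≤ α := Finsupp.single_le_iff.2 (not_lt.1 ha)
              have h2 := tsub_add_cancel_of_le h1
              have h3 := congrArg Finsupp.degree h2
              rw [map_add, Finsupp.degree_single, hα, Nat.add_eq_right,
                Finsupp.degree_eq_zero_iff] at h3
              rw [← h2, h3, zero_add]
            subst hαa
            -- The coefficient at t_a^d is the value of q at v_a, which vanishes because v_a is a
            -- zero of the forms. Surjectivity says nothing about these coefficients.
            have h1 : MvPolynomial.coeff (Finsupp.single a d) (restr v q) = 0 := by
              have h2 := eval_restr v (Pi.single a 1) q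
              have h3 : ∑ b, (Pi.single a 1 : Fin R → F) b • v b = v a := by
                simp [Pi.single_apply]
              rw [h3, hq3, (isHomogeneous_restr v hq1).eq_sum_monotone, map_sum,
                Finset.sum_eq_single_of_mem (fun _ => a)
                  (by simpa using monotone_const)] at h2
              · rw [MvPolynomial.smul_eval, map_prod] at h2
                simpa [monomialExponent] using h2
              · intro i _ hi
                obtain ⟨k, hk⟩ : ∃ k, i k ≠ a := by
                  by_contra! h
                  exact hi (funext h)
                rw [MvPolynomial.smul_eval, map_prod, Finset.prod_eq_zero (Finset.mem_univ k),
                  mul_zero]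
                simp [hk]
            rw [h1, if_neg]
            intro h
            apply hj
            have h3 : monomialExponent j = monomialExponent (fun _ : Fin d => a) := by
              rw [h]; simp [monomialExponent]
            obtain ⟨τ, hτ⟩ := exists_perm_of_monomialExponent_eq h3
            exact ⟨a, hτ⟩
        · rw [(isHomogeneous_restr v hq1).coeff_eq_zero hα, if_neg]
          rintro rfl
          exact hα (degree_monomialExponent j)
      have h1 := formPairing_mapTensor v hsym hq1
      rwa [hmap, hq2, hr, hsym.formPairing_prod_X, eq_comm] at h1
    have ht : t = ∑ a, c (fun _ => a) • tensorPower d (v a) := by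
      rw [← hmap]
      ext i
      rw [mapTensor, Finset.sum_apply]
      have hinj : Function.Injective fun (a : Fin R) (_ : Fin d) => a := fun a b h =>
        congrFun h ⟨0, hd⟩
      refine Eq.symm (Finset.sum_of_injOn _ hinj.injOn (by simp) ?_ ?_)
      · intro j _ hj
        rw [hzero j fun ⟨a, ha⟩ => hj ⟨a, by simp, ha.symm⟩, zero_mul]
      · intro a _
        rfl
    rw [ht]
    exact Submodule.sum_mem _ fun a _ => Submodule.smul_mem _ _ (Submodule.subset_span ⟨a, rfl⟩)
  · rintro _ ⟨a, rfl⟩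
    exact ⟨tensorPower_mem_symPower (Submodule.subset_span ⟨a, rfl⟩),
      tensorPower_mem_formAnnihilator hf (hvX a)⟩

end SymmetricTensors


/-! ### The second step of the algorithm -/

section StepTwo

variable {F : Type*} [RCLike F]

open scoped ComplexOrder in
/-- A matrix with linearly independent columns has a left inverse `B` such that `A B` is
Hermitian. -/
theorem exists_left_inverse_hermitian {ι κ : Type*} [Fintype ι] [Fintype κ] [DecidableEq κ]
    (A : Matrix ι κ F) (hA : Function.Injective A.mulVec) :
    ∃ B : Matrix κ ι F, B * A = 1 ∧ (A * B).IsHermitian := by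
  have hu : IsUnit (A.conjTranspose * A) := (Matrix.PosDef.conjTranspose_mul_self A hA).isUnit
  have hd := (Matrix.isUnit_iff_isUnit_det _).1 hu
  refine ⟨(A.conjTranspose * A)⁻¹ * A.conjTranspose, ?_, ?_⟩
  · rw [Matrix.mul_assoc, Matrix.nonsing_inv_mul _ hd]
  · rw [Matrix.IsHermitian, Matrix.conjTranspose_mul, Matrix.conjTranspose_mul,
      Matrix.conjTranspose_nonsing_inv, Matrix.conjTranspose_mul,
      Matrix.conjTranspose_conjTranspose, Matrix.mul_assoc]

theorem exists_right_inverse_hermitian {ι κ : Type*} [Fintype ι] [Fintype κ] [DecidableEq κ]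
    (A : Matrix ι κ F) (hA : Function.Injective A.mulVec) :
    ∃ B : Matrix ι κ F, A.transpose * B = 1 ∧ (B * A.transpose).IsHermitian := by
  obtain ⟨B, h1, h2⟩ := exists_left_inverse_hermitian A hA
  refine ⟨B.transpose, ?_, ?_⟩
  · rw [← Matrix.transpose_mul, h1, Matrix.transpose_one]
  · rw [← Matrix.transpose_mul]
    exact h2.transpose

theorem mulVec_injective_of_linearIndependent {ι : Type*} [Fintype ι] {s : ℕ}
    {v : Fin s → ι → F} (hv : LinearIndependent F v) :
    Function.Injective (Matrix.of fun i a => v a i : Matrix ι (Fin s) F).mulVec := by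
  intro c c' h
  have h0 : ∑ a, (c - c') a • v a = 0 := by
    ext i
    have := congrFun h i
    simp only [Matrix.mulVec, dotProduct, Matrix.of_apply] at this
    simp only [Pi.sub_apply, sub_smul, Finset.sum_sub_distrib, Finset.sum_apply, Pi.smul_apply,
      smul_eq_mul, Pi.zero_apply, mul_comm _ (v _ i), this, sub_self]
  exact funext fun a => sub_eq_zero.1 (Fintype.linearIndependent_iff.1 hv _ h0 a)

variable {n : ℕ}

/-- The `P_l` are combinations of the `v_a^{⊗d}`, and `φ`, `ψ` separate the coefficient vectors. -/
def SeparatesPowers {d s : ℕ} (P : Fin s → TensorPow F n d) (φ ψ : Fin s → F)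
    (v : Fin s → Fin n → F) : Prop :=
  LinearIndependent F v ∧ ∃ z : Fin s → Fin s → F, LinearIndependent F z ∧
    (∀ l, P l = ∑ a, z a l • tensorPower d (v a)) ∧
    (∀ a, φ ⬝ᵥ z a ≠ 0) ∧ (∀ a, ψ ⬝ᵥ z a ≠ 0) ∧
    Function.Injective fun a => (φ ⬝ᵥ z a) / (ψ ⬝ᵥ z a)

theorem splitFirst_tensorPower {d : ℕ} (hd : 1 ≤ d) (v : Fin n → F) (i : Fin n)
    (j : Fin (d - 1) → Fin n) :
    splitFirst (tensorPower d v) i j = v i * tensorPower (d - 1) v j := by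
  obtain ⟨d, rfl⟩ := Nat.exists_eq_add_of_le' hd
  simp only [splitFirst, tensorPower, pureTensor]
  rw [Fin.prod_univ_succ]
  rfl

/-- The factorization V diag(φ·z_a) Yᵀ, where the columns of V and Y are the v_a and their powers of
order d - 1. All facts about T(φ) and T(ψ) come from it, as V and Y have left inverses. -/
theorem sliceCombination_eq {d s : ℕ} (hd : 1 ≤ d) {P : Fin s → TensorPow F n d}
    {v : Fin s → Fin n → F} {z : Fin s → Fin s → F}
    (hP : ∀ l, P l = ∑ a, z a l • tensorPower d (v a)) (φ : Fin s → F) :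
    sliceCombination (fun l => splitFirst (P l)) φ =
      (Matrix.of fun i a => v a i : Matrix (Fin n) (Fin s) F) *
        Matrix.diagonal (fun a => φ ⬝ᵥ z a) *
        (Matrix.of fun j a => tensorPower (d - 1) (v a) j :
          Matrix (Fin (d - 1) → Fin n) (Fin s) F).transpose := by
  have h : ∀ l i j, splitFirst (P l) i j = ∑ a, z a l * (v a i * tensorPower (d - 1) (v a) j) := by
    intro l i j
    simp only [← splitFirst_tensorPower hd, hP]
    simp [splitFirst]
  ext i j
  simp only [sliceCombination, Matrix.sum_apply, Matrix.smul_apply, smul_eq_mul, h]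
  rw [Matrix.mul_apply]
  simp only [Matrix.mul_diagonal, Matrix.of_apply, Matrix.transpose_apply, dotProduct,
    Finset.mul_sum, Finset.sum_mul]
  rw [Finset.sum_comm]
  exact Finset.sum_congr rfl fun a _ => Finset.sum_congr rfl fun l _ => by ring

theorem exists_dual_family {ι : Type*} [Fintype ι] {s : ℕ} {v : Fin s → ι → F}
    (hv : LinearIndependent F v) :
    ∃ g : Fin s → ι → F, ∀ a b, ∑ i, g a i * v b i = if a = b then 1 else 0 := by
  obtain ⟨B, hB, -⟩ := exists_left_inverse_hermitian _ (mulVec_injective_of_linearIndependent hv)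
  refine ⟨B, fun a b => ?_⟩
  have := congrFun (congrFun hB a) b
  rwa [Matrix.mul_apply, Matrix.one_apply] at this

/-- With nonzero diagonal entries the factorization can be inverted factor by factor. T(φ)T(ψ)⁺ then
has the v_a as eigenvectors, with the ratios (φ·z_a)/(ψ·z_a) as eigenvalues. -/
theorem SeparatesPowers.stepTwoAccepts {d s : ℕ} (hd : 2 ≤ d) {P : Fin s → TensorPow F n d}
    {φ ψ : Fin s → F} {v : Fin s → Fin n → F} (h : SeparatesPowers P φ ψ v) :
    StepTwoAccepts P φ ψ v := by
  obtain ⟨hv, z, hz, hP, hφ, hψ, hinj⟩ := h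
  have hy : LinearIndependent F fun a => tensorPower (d - 1) (v a) :=
    linearIndependent_tensorPower (by omega) hv
  obtain ⟨V', hV1, hV2⟩ := exists_left_inverse_hermitian _ (mulVec_injective_of_linearIndependent hv)
  obtain ⟨Y', hY1, hY2⟩ := exists_right_inverse_hermitian _ (mulVec_injective_of_linearIndependent hy)
  obtain ⟨g, hg⟩ := exists_dual_family hv
  obtain ⟨k, hk⟩ := exists_dual_family hy
  have hTφ := sliceCombination_eq (by omega) hP φ
  have hTψ := sliceCombination_eq (by omega) hP ψ
  set V : Matrix (Fin n) (Fin s) F := Matrix.of fun i a => v a i with hV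
  set Y : Matrix (Fin (d - 1) → Fin n) (Fin s) F :=
    Matrix.of fun j a => tensorPower (d - 1) (v a) j with hY
  -- The one-sided inverses V' and Y' were chosen with V V' and Y' Yᵀ Hermitian, and these are the
  -- two products in the Penrose equations.
  have hpinv : ∀ θ : Fin s → F, (∀ a, θ a ≠ 0) →
      IsPseudoinverse (V * Matrix.diagonal θ * Y.transpose)
        (Y' * Matrix.diagonal (fun a => (θ a)⁻¹) * V') := by
    intro θ hθ
    have hD : Matrix.diagonal θ * Matrix.diagonal (fun a => (θ a)⁻¹) = 1 := by
      rw [Matrix.diagonal_mul_diagonal]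
      simp [hθ]
    have hD' : Matrix.diagonal (fun a => (θ a)⁻¹) * Matrix.diagonal θ = 1 := by
      rw [Matrix.diagonal_mul_diagonal]
      simp [hθ]
    have e1 : V * Matrix.diagonal θ * Y.transpose *
        (Y' * Matrix.diagonal (fun a => (θ a)⁻¹) * V') = V * V' := by
      calc _ = V * (Matrix.diagonal θ * ((Y.transpose * Y') *
            Matrix.diagonal (fun a => (θ a)⁻¹))) * V' := by simp only [Matrix.mul_assoc]
        _ = V * V' := by rw [hY1, Matrix.one_mul, hD, Matrix.mul_one]
    have e2 : Y' * Matrix.diagonal (fun a => (θ a)⁻¹) * V' *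
        (V * Matrix.diagonal θ * Y.transpose) = Y' * Y.transpose := by
      calc _ = Y' * (Matrix.diagonal (fun a => (θ a)⁻¹) * ((V' * V) *
            Matrix.diagonal θ)) * Y.transpose := by simp only [Matrix.mul_assoc]
        _ = Y' * Y.transpose := by rw [hV1, Matrix.one_mul, hD', Matrix.mul_one]
    refine ⟨?_, ?_, ?_, ?_⟩
    · rw [e1]
      calc _ = V * (V' * V) * (Matrix.diagonal θ * Y.transpose) := by simp only [Matrix.mul_assoc]
        _ = _ := by rw [hV1, Matrix.mul_one, Matrix.mul_assoc]
    · rw [e2]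
      calc _ = Y' * (Y.transpose * Y') * (Matrix.diagonal (fun a => (θ a)⁻¹) * V') := by
            simp only [Matrix.mul_assoc]
        _ = _ := by rw [hY1, Matrix.mul_one, Matrix.mul_assoc]
    · rw [e1]; exact hV2
    · rw [e2]; exact hY2
  set lam : Fin s → F := fun a => (φ ⬝ᵥ z a) / (ψ ⬝ᵥ z a) with hlam
  have hlam0 : ∀ a, lam a ≠ 0 := fun a => div_ne_zero (hφ a) (hψ a)
  have hM : V * Matrix.diagonal (fun a => φ ⬝ᵥ z a) * Y.transpose *
      (Y' * Matrix.diagonal (fun a => (ψ ⬝ᵥ z a)⁻¹) * V') = V * Matrix.diagonal lam * V' := by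
    calc _ = V * (Matrix.diagonal (fun a => φ ⬝ᵥ z a) * ((Y.transpose * Y') *
          Matrix.diagonal (fun a => (ψ ⬝ᵥ z a)⁻¹))) * V' := by simp only [Matrix.mul_assoc]
      _ = _ := by
        rw [hY1, Matrix.one_mul, Matrix.diagonal_mul_diagonal]
        simp only [hlam, div_eq_mul_inv]
  have hN : Y' * Matrix.diagonal (fun a => (φ ⬝ᵥ z a)⁻¹) * V' *
      (V * Matrix.diagonal (fun a => ψ ⬝ᵥ z a) * Y.transpose) =
      Y' * (Matrix.diagonal (fun a => (lam a)⁻¹) * Y.transpose) := by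
    calc _ = Y' * (Matrix.diagonal (fun a => (φ ⬝ᵥ z a)⁻¹) * ((V' * V) *
          Matrix.diagonal (fun a => ψ ⬝ᵥ z a))) * Y.transpose := by simp only [Matrix.mul_assoc]
      _ = _ := by
        rw [hV1, Matrix.one_mul, Matrix.diagonal_mul_diagonal, Matrix.mul_assoc]
        congr 3
        ext a
        simp only [hlam]
        rw [inv_div, div_eq_mul_inv, mul_comm]
  refine ⟨z, v, fun a => tensorPower (d - 1) (v a), z, ⟨_, _, lam, fun a i j => g a i * k a j,
    hTφ ▸ hpinv _ hφ, hTψ ▸ hpinv _ hψ, ?_, hinj, hlam0, ?_, ?_, ?_, ?_, ?_, ?_⟩,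
    fun _ _ _ _ => rfl, hP, hz, hv⟩
  · rw [hTφ, hM]
    refine le_antisymm ?_ ?_
    · exact (Matrix.rank_mul_le_right _ _).trans ((Matrix.rank_le_height _))
    · have h1 : V' * (V * Matrix.diagonal lam * V') * V = Matrix.diagonal lam := by
        calc _ = (V' * V) * Matrix.diagonal lam * (V' * V) := by simp only [Matrix.mul_assoc]
          _ = _ := by rw [hV1, Matrix.one_mul, Matrix.mul_one]
      have h2 : (Matrix.diagonal lam).rank = s := by
        rw [Matrix.rank_diagonal]
        simp [hlam0]
      refine h2.symm.le.trans ?_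
      have h3 := (Matrix.rank_mul_le_left (V' * (V * Matrix.diagonal lam * V')) V).trans
        (Matrix.rank_mul_le_right _ _)
      rwa [h1] at h3
  · intro a
    refine ⟨hv.ne_zero a, ?_⟩
    have hva : v a = V.mulVec (Pi.single a 1) := by
      ext i
      simp [hV]
    rw [hTφ, hM]
    conv_lhs => rw [hva]
    rw [Matrix.mulVec_mulVec, Matrix.mul_assoc, hV1, Matrix.mul_one, ← Matrix.mulVec_mulVec,
      Matrix.diagonal_mulVec_single, hva, ← Matrix.mulVec_smul, mul_one]
    congr 1
    ext b
    simp [Pi.single_apply]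
  · rw [hTψ, hN]
    have hle : Fintype.card (Fin s) ≤ Fintype.card (Fin (d - 1) → Fin n) := by
      have := hy.fintype_card_le_finrank
      rwa [Module.finrank_fintype_fun_eq_card] at this
    rw [Matrix.charpoly_mul_comm_of_le _ _ hle, Matrix.mul_assoc, hY1, Matrix.mul_one,
      Matrix.charpoly_diagonal, Fintype.card_fin]
  · intro a
    refine ⟨hy.ne_zero a, ?_⟩
    have hya : tensorPower (d - 1) (v a) = Y.mulVec (Pi.single a 1) := by
      ext j
      simp [hY]
    have hYY : Y'.transpose * Y = 1 := by
      rw [← Matrix.transpose_transpose Y, ← Matrix.transpose_mul, hY1, Matrix.transpose_one]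
    rw [hTψ, hN, Matrix.transpose_mul, Matrix.transpose_mul, Matrix.transpose_transpose,
      Matrix.diagonal_transpose]
    beta_reduce
    conv_lhs => rw [hya]
    rw [Matrix.mulVec_mulVec, Matrix.mul_assoc, hYY, Matrix.mul_one, ← Matrix.mulVec_mulVec,
      Matrix.diagonal_mulVec_single, hya, ← Matrix.mulVec_smul, mul_one]
    congr 1
    ext b
    simp [Pi.single_apply]
  · intro a b
    calc _ = (∑ i, g a i * v b i) * ∑ j, k a j * tensorPower (d - 1) (v b) j := by
          rw [Finset.sum_mul_sum]
          exact Finset.sum_congr rfl fun i _ => Finset.sum_congr rfl fun j _ => by ring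
      _ = _ := by
          rw [hg, hk]
          split_ifs <;> simp
  · intro a l
    have h1 : ∀ i j, splitFirst (P l) i j =
        ∑ b, z b l * (v b i * tensorPower (d - 1) (v b) j) := by
      intro i j
      simp only [← splitFirst_tensorPower (show 1 ≤ d by omega), hP]
      simp [splitFirst]
    have h2 : ∀ b, ∑ i, ∑ j, g a i * k a j * (v b i * tensorPower (d - 1) (v b) j) =
        if a = b then 1 else 0 := by
      intro b
      calc _ = (∑ i, g a i * v b i) * ∑ j, k a j * tensorPower (d - 1) (v b) j := by
            rw [Finset.sum_mul_sum]
            exact Finset.sum_congr rfl fun i _ => Finset.sum_congr rfl fun j _ => by ring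
        _ = _ := by
            rw [hg, hk]
            split_ifs <;> simp
    simp only [h1, Finset.mul_sum]
    calc z a l = ∑ b, z b l * if a = b then 1 else 0 := by simp
      _ = ∑ b, ∑ i, ∑ j, g a i * k a j * (z b l * (v b i * tensorPower (d - 1) (v b) j)) := by
        refine Finset.sum_congr rfl fun b _ => ?_
        rw [← h2, Finset.mul_sum]
        refine Finset.sum_congr rfl fun i _ => ?_
        rw [Finset.mul_sum]
        exact Finset.sum_congr rfl fun j _ => by ring
      _ = _ := by
        rw [Finset.sum_comm]
        exact Finset.sum_congr rfl fun i _ => Finset.sum_comm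
  · intro a b hab hmem
    exact hz.notMem_span_image (s := {b}) (by simpa using hab) (by simpa using hmem)

/-- Rank s of T(φ)T(ψ)⁺ forces both diagonal factors to be invertible. The eigenvalues must be the
ratios, because each y_a is a multiple of v_a; they are distinct by assumption. -/
theorem StepTwoAccepts.separatesPowers {d s : ℕ} (hd : 2 ≤ d) {P : Fin s → TensorPow F n d}
    {φ ψ : Fin s → F} {v : Fin s → Fin n → F} (h : StepTwoAccepts P φ ψ v) :
    SeparatesPowers P φ ψ v := by
  obtain ⟨x, y, c, z, ⟨A, B, lam, -, -, hB, hrank, hinj, hlam0, hlam, -⟩, hxyz, hP, hz, hv⟩ := h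
  have hy : LinearIndependent F fun a => tensorPower (d - 1) (v a) :=
    linearIndependent_tensorPower (by omega) hv
  obtain ⟨V', hV1, -⟩ := exists_left_inverse_hermitian _ (mulVec_injective_of_linearIndependent hv)
  obtain ⟨Y', hY1, -⟩ := exists_right_inverse_hermitian _ (mulVec_injective_of_linearIndependent hy)
  have hTφ := sliceCombination_eq (by omega) hP φ
  have hTψ := sliceCombination_eq (by omega) hP ψ
  set V : Matrix (Fin n) (Fin s) F := Matrix.of fun i a => v a i with hV
  set Y : Matrix (Fin (d - 1) → Fin n) (Fin s) F :=
    Matrix.of fun j a => tensorPower (d - 1) (v a) j with hY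
  have hdiag : ∀ θ : Fin s → F, s ≤ (Matrix.diagonal θ).rank → ∀ a, θ a ≠ 0 := by
    intro θ hθ a ha
    rw [Matrix.rank_diagonal] at hθ
    have h1 : Fintype.card {i // θ i ≠ 0} < Fintype.card (Fin s) :=
      Fintype.card_subtype_lt (x := a) (by simpa using ha)
    rw [Fintype.card_fin] at h1
    omega
  have hφ : ∀ a, φ ⬝ᵥ z a ≠ 0 := hdiag _ <| by
    have h1 := hrank.symm.le
    rw [hTφ] at h1
    exact h1.trans <| (Matrix.rank_mul_le_left _ _).trans ((Matrix.rank_mul_le_left _ _).trans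
      (Matrix.rank_mul_le_right _ _))
  -- The rank of B is bounded by that of T(ψ), since B = B T(ψ) B.
  have hψ : ∀ a, ψ ⬝ᵥ z a ≠ 0 := hdiag _ <| by
    have h1 : s ≤ B.rank := hrank.symm.le.trans (Matrix.rank_mul_le_right _ _)
    rw [← hB.right, hTψ] at h1
    exact h1.trans ((Matrix.rank_mul_le_left _ _).trans ((Matrix.rank_mul_le_right _ _).trans
      ((Matrix.rank_mul_le_left _ _).trans (Matrix.rank_mul_le_right _ _))))
  have hD : Matrix.diagonal (fun a => (ψ ⬝ᵥ z a)⁻¹) * Matrix.diagonal (fun a => ψ ⬝ᵥ z a) = 1 := by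
    rw [Matrix.diagonal_mul_diagonal]
    simp [hψ]
  -- Cancel V and Yᵀ in T(ψ) B T(ψ) = T(ψ).
  have hYBV : Y.transpose * B * V = Matrix.diagonal (fun a => (ψ ⬝ᵥ z a)⁻¹) := by
    have h1 := hB.left
    rw [hTψ] at h1
    have h2 := congrArg (fun N => Matrix.diagonal (fun a => (ψ ⬝ᵥ z a)⁻¹) * (V' * N * Y')) h1
    have e1 : Matrix.diagonal (fun a => (ψ ⬝ᵥ z a)⁻¹) * (V' * (V *
        Matrix.diagonal (fun a => ψ ⬝ᵥ z a) * Y.transpose) * Y') = 1 := by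
      calc _ = Matrix.diagonal (fun a => (ψ ⬝ᵥ z a)⁻¹) * ((V' * V) *
            Matrix.diagonal (fun a => ψ ⬝ᵥ z a)) * (Y.transpose * Y') := by
              simp only [Matrix.mul_assoc]
        _ = 1 := by rw [hV1, hY1, Matrix.one_mul, Matrix.mul_one, hD]
    have e2 : Matrix.diagonal (fun a => (ψ ⬝ᵥ z a)⁻¹) * (V' * (V *
        Matrix.diagonal (fun a => ψ ⬝ᵥ z a) * Y.transpose * B *
        (V * Matrix.diagonal (fun a => ψ ⬝ᵥ z a) * Y.transpose)) * Y') =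
        Y.transpose * B * V * Matrix.diagonal (fun a => ψ ⬝ᵥ z a) := by
      calc _ = Matrix.diagonal (fun a => (ψ ⬝ᵥ z a)⁻¹) * ((V' * V) *
            Matrix.diagonal (fun a => ψ ⬝ᵥ z a)) * (Y.transpose * B * V *
            (Matrix.diagonal (fun a => ψ ⬝ᵥ z a) * (Y.transpose * Y'))) := by
              simp only [Matrix.mul_assoc]
        _ = _ := by rw [hV1, hY1, Matrix.one_mul, Matrix.mul_one, hD, Matrix.one_mul]
    rw [e1, e2] at h2
    exact left_inv_eq_right_inv h2 (mul_eq_one_comm.1 hD)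
  have hMV : sliceCombination (fun l => splitFirst (P l)) φ * B * V =
      V * Matrix.diagonal fun a => (φ ⬝ᵥ z a) / (ψ ⬝ᵥ z a) := by
    rw [hTφ]
    calc _ = V * (Matrix.diagonal (fun a => φ ⬝ᵥ z a) * (Y.transpose * B * V)) := by
          simp only [Matrix.mul_assoc]
      _ = _ := by
          rw [hYBV, Matrix.diagonal_mul_diagonal]
          simp only [div_eq_mul_inv]
  have hratio : ∀ a, lam a = (φ ⬝ᵥ z a) / (ψ ⬝ᵥ z a) := by
    intro a
    obtain ⟨l, hl⟩ := Function.ne_iff.1 (hz.ne_zero a)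
    obtain ⟨i₀, hi₀⟩ := Function.ne_iff.1 (hv.ne_zero a)
    obtain ⟨j, hj⟩ := Function.ne_iff.1 (hy.ne_zero a)
    have hne : x a l * c a j ≠ 0 := by
      intro h0
      have := hxyz a l i₀ j
      rw [mul_right_comm, h0, zero_mul] at this
      exact mul_ne_zero (mul_ne_zero hl hi₀) hj this.symm
    have hva : y a = (z a l * tensorPower (d - 1) (v a) j / (x a l * c a j)) • v a := by
      ext i
      rw [Pi.smul_apply, smul_eq_mul, div_mul_eq_mul_div, eq_div_iff hne]
      have := hxyz a l i j
      linear_combination this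
    set r := z a l * tensorPower (d - 1) (v a) j / (x a l * c a j) with hr
    have hMv : (sliceCombination (fun l => splitFirst (P l)) φ * B).mulVec (v a) =
        ((φ ⬝ᵥ z a) / (ψ ⬝ᵥ z a)) • v a := by
      have h1 := congrArg (fun N : Matrix _ _ F => N.mulVec (Pi.single a 1)) hMV
      simp only [← Matrix.mulVec_mulVec] at h1
      have h2 : V.mulVec (Pi.single a 1) = v a := by
        ext i
        simp [hV]
      rw [h2, Matrix.diagonal_mulVec_single, mul_one] at h1
      rw [← Matrix.mulVec_mulVec, h1]
      ext i
      simp [hV, mul_comm, div_eq_mul_inv]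
    obtain ⟨hy0, hyl⟩ := hlam a
    have h3 : (lam a - (φ ⬝ᵥ z a) / (ψ ⬝ᵥ z a)) • y a = 0 := by
      rw [sub_smul, ← hyl, hva, Matrix.mulVec_smul, hMv, smul_comm, sub_self]
    exact sub_eq_zero.1 ((smul_eq_zero.1 h3).resolve_right hy0)
  refine ⟨hv, z, hz, hP, hφ, hψ, ?_⟩
  rwa [show (fun a => (φ ⬝ᵥ z a) / (ψ ⬝ᵥ z a)) = lam from funext fun a => (hratio a).symm]

theorem stepTwoAccepts_iff {d s : ℕ} (hd : 2 ≤ d) {P : Fin s → TensorPow F n d}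
    {φ ψ : Fin s → F} {v : Fin s → Fin n → F} :
    StepTwoAccepts P φ ψ v ↔ SeparatesPowers P φ ψ v :=
  ⟨fun h => h.separatesPowers hd, fun h => h.stepTwoAccepts hd⟩

end StepTwo


/-! ### The eigenvectors found by the program -/

section PairMatrix

variable {F : Type*} [RCLike F] {n : ℕ}

/-- `M` is `A B'` for a generalized inverse `B'` of `B` such that `M` vanishes where `B B'` does. -/
def IsPairMatrix {κ : Type*} [Fintype κ] (B A : Matrix (Fin n) κ F) (M : Matrix (Fin n) (Fin n) F) :
    Prop :=
  ∃ C : Matrix κ (Fin n) F, M = A * C ∧ B * C * B = B ∧ ∀ x, (B * C).mulVec x = 0 → M.mulVec x = 0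

/-- The program numbers the columns by integers, whereas the tensors number them by tuples. -/
theorem IsPairMatrix.reindex {κ κ' : Type*} [Fintype κ] [Fintype κ'] (e : κ' ≃ κ)
    {B A : Matrix (Fin n) κ F} {M : Matrix (Fin n) (Fin n) F}
    (h : IsPairMatrix (B.submatrix id e) (A.submatrix id e) M) : IsPairMatrix B A M := by
  obtain ⟨C, h1, h2, h3⟩ := h
  have e1 : ∀ N : Matrix (Fin n) κ F, N.submatrix id e * C = N * C.submatrix e.symm id := by
    intro N
    ext i j
    rw [Matrix.mul_apply, Matrix.mul_apply]
    exact (Equiv.sum_comp e.symm _).symm.trans (by simp)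
  rw [e1] at h1 h2
  refine ⟨C.submatrix e.symm id, h1, ?_, fun x hx => h3 x (by rwa [e1])⟩
  ext i j
  have := congrFun (congrFun h2 i) (e.symm j)
  simpa [Matrix.mul_apply] using this

theorem Matrix.of_mulVec_single {ι : Type*} {s : ℕ} (v : Fin s → ι → F) (a : Fin s) (c : F) :
    (Matrix.of fun i a => v a i : Matrix ι (Fin s) F).mulVec (Pi.single a c) = c • v a := by
  ext i
  simp [mul_comm]

theorem Diagonalizes.mulVec_col {k : ℕ} {M Q : Matrix (Fin k) (Fin k) F} {D : Fin k → F}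
    (h : Diagonalizes M D Q) (i : Fin k) : M.mulVec (fun x => Q x i) = D i • fun x => Q x i := by
  ext x
  have := congrFun (congrFun h.2 x) i
  rw [Matrix.mul_apply, Matrix.mul_diagonal] at this
  simpa [Matrix.mulVec, dotProduct, mul_comm] using this

theorem Diagonalizes.linearIndependent {k : ℕ} {M Q : Matrix (Fin k) (Fin k) F} {D : Fin k → F}
    (h : Diagonalizes M D Q) : LinearIndependent F fun i x => Q x i :=
  Matrix.linearIndependent_cols_of_det_ne_zero h.1.ne_zero

theorem eval_smul_of_isHomogeneous {d : ℕ} {q : MvPolynomial (Fin n) F} (hq : q.IsHomogeneous d)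
    (c : F) (v : Fin n → F) : MvPolynomial.eval (c • v) q = c ^ d * MvPolynomial.eval v q := by
  rw [← formPairing_tensorPower hq, ← formPairing_tensorPower hq, formPairing, formPairing,
    Finset.mul_sum]
  refine Finset.sum_congr rfl fun i _ => ?_
  simp [tensorPower, pureTensor, Finset.prod_mul_distrib]
  ring

/-- If `u` is a combination of linearly independent `v_a` and `u^{⊗d}` is a combination of the
`v_a^{⊗d}`, `d ≥ 2`, then `u` is a multiple of some `v_a`. -/
theorem exists_eq_smul_of_tensorPower_mem_span {d R : ℕ} (hd : 2 ≤ d) {v : Fin R → Fin n → F}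
    (hv : LinearIndependent F v) {u : Fin n → F} (hu : u ∈ Submodule.span F (Set.range v))
    (hu0 : u ≠ 0)
    (hud : tensorPower d u ∈ Submodule.span F (Set.range fun a => tensorPower d (v a))) :
    ∃ (a : Fin R) (c : F), c ≠ 0 ∧ u = c • v a := by
  classical
  obtain ⟨c, rfl⟩ := (Submodule.mem_span_range_iff_exists_fun F).1 hu
  obtain ⟨e, he⟩ := (Submodule.mem_span_range_iff_exists_fun F).1 hud
  obtain ⟨a, ha⟩ : ∃ a, c a ≠ 0 := by
    by_contra! h
    exact hu0 (by simp [h])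
  refine ⟨a, c a, ha, Finset.sum_eq_single_of_mem a (Finset.mem_univ _) fun b _ hba => ?_⟩
  obtain ⟨g, hg⟩ := exists_dual_vectors hv
  have hpow : ∀ (w : Fin n → F) (j : Fin d → Fin R),
      contractTensor g (tensorPower d w) j = ∏ k, ∑ i, g (j k) i * w i := by
    intro w j
    rw [contractTensor, Finset.prod_univ_sum, Fintype.piFinset_univ]
    refine Finset.sum_congr rfl fun i _ => ?_
    rw [tensorPower, pureTensor, ← Finset.prod_mul_distrib]
    simp only [mul_comm]
  have hgc : ∀ x, ∑ i, g x i * (∑ a, c a • v a) i = c x := by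
    intro x
    simp only [Finset.sum_apply, Pi.smul_apply, smul_eq_mul, Finset.mul_sum]
    rw [Finset.sum_comm]
    calc _ = ∑ b, c b * ∑ i, g x i * v b i := by
          refine Finset.sum_congr rfl fun b _ => ?_
          rw [Finset.mul_sum]
          exact Finset.sum_congr rfl fun i _ => by ring
      _ = c x := by simp [hg]
  -- The mixed coordinate (a, b, …, b) is c_a c_b^{d-1} for u^{⊗d} and zero for each v_x^{⊗d}, so
  -- c_b = 0.
  let j : Fin d → Fin R := fun k => if (k : ℕ) = 0 then a else b
  have h1 := congrFun (congrArg (contractTensor g) he) j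
  have h2 : contractTensor g (∑ x, e x • tensorPower d (v x)) j =
      ∑ x, e x * contractTensor g (tensorPower d (v x)) j := by
    rw [contractTensor]
    simp only [Finset.sum_apply, Pi.smul_apply, smul_eq_mul, Finset.sum_mul]
    rw [Finset.sum_comm]
    refine Finset.sum_congr rfl fun x _ => ?_
    rw [contractTensor, Finset.mul_sum]
    exact Finset.sum_congr rfl fun i _ => by ring
  rw [h2, hpow] at h1
  simp only [hgc, hpow, hg] at h1
  have h3 : ∀ x, ∏ k, (if j k = x then (1 : F) else 0) = 0 := by
    intro x
    rw [Finset.prod_eq_zero_iff]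
    by_cases hx : x = a
    · exact ⟨⟨1, by omega⟩, Finset.mem_univ _, by simp [j, hx, hba]⟩
    · exact ⟨⟨0, by omega⟩, Finset.mem_univ _, by simp [j, Ne.symm hx]⟩
  simp only [h3, mul_zero, Finset.sum_const_zero] at h1
  obtain ⟨k, -, hk⟩ := Finset.prod_eq_zero_iff.1 h1.symm
  by_cases hk0 : (k : ℕ) = 0
  · simp [j, hk0, ha] at hk
  · simp only [j, hk0, if_false] at hk
    rw [hk, zero_smul]

/-- The square coefficient matrix z is invertible, so the powers are combinations of the P_l. -/
theorem SeparatesPowers.tensorPower_mem_span {d s : ℕ} {P : Fin s → TensorPow F n d}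
    {φ ψ : Fin s → F} {v : Fin s → Fin n → F} (h : SeparatesPowers P φ ψ v) (a : Fin s) :
    tensorPower d (v a) ∈ Submodule.span F (Set.range P) := by
  obtain ⟨-, z, hz, hP, -⟩ := h
  obtain ⟨g, hg⟩ := exists_dual_family hz
  have hg' : (Matrix.of fun a l => g a l : Matrix (Fin s) (Fin s) F) *
      (Matrix.of fun l a => z a l) = 1 := by
    ext a b
    simp [Matrix.mul_apply, hg, Matrix.one_apply]
  have : tensorPower d (v a) = ∑ l, g a l • P l := by
    simp only [hP, Finset.smul_sum, smul_smul]
    rw [Finset.sum_comm]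
    simp only [← Finset.sum_smul, hg]
    simp
  rw [this]
  exact Submodule.sum_mem _ fun l _ => Submodule.smul_mem _ _ (Submodule.subset_span ⟨l, rfl⟩)

variable {d s : ℕ} {P : Fin s → TensorPow F n d} {φ ψ : Fin s → F}
  {M : Matrix (Fin n) (Fin n) F}

/-- If the `P_l` have a decomposition that is separated by `φ`, `ψ`, then `M` has the vectors of
the decomposition as eigenvectors, and vanishes on a complement of their span. -/
theorem SeparatesPowers.pairMatrix (hd : 2 ≤ d) {v : Fin s → Fin n → F}
    (h : SeparatesPowers P φ ψ v)
    (hM : IsPairMatrix (sliceCombination (fun l => splitFirst (P l)) ψ)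
      (sliceCombination (fun l => splitFirst (P l)) φ) M) :
    ∃ lam : Fin s → F, Function.Injective lam ∧ (∀ a, lam a ≠ 0) ∧
      (∀ a, M.mulVec (v a) = lam a • v a) ∧
      ∀ x, ∃ y ∈ Submodule.span F (Set.range v), M.mulVec (x - y) = 0 := by
  obtain ⟨hv, z, hz, hP, hφ, hψ, hinj⟩ := h
  obtain ⟨C, hMC, hBCB, hker⟩ := hM
  have hy : LinearIndependent F fun a => tensorPower (d - 1) (v a) :=
    linearIndependent_tensorPower (by omega) hv
  obtain ⟨V', hV1, -⟩ := exists_left_inverse_hermitian _ (mulVec_injective_of_linearIndependent hv)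
  obtain ⟨Y', hY1, -⟩ := exists_right_inverse_hermitian _ (mulVec_injective_of_linearIndependent hy)
  rw [sliceCombination_eq (by omega) hP φ] at hMC
  rw [sliceCombination_eq (by omega) hP ψ] at hBCB hker
  have hVs := Matrix.of_mulVec_single v
  have hVspan : ∀ c, (Matrix.of fun i a => v a i : Matrix (Fin n) (Fin s) F).mulVec c ∈
      Submodule.span F (Set.range v) := by
    intro c
    rw [Submodule.mem_span_range_iff_exists_fun]
    refine ⟨c, ?_⟩
    ext i
    simp [Matrix.mulVec, dotProduct, mul_comm]
  set V : Matrix (Fin n) (Fin s) F := Matrix.of fun i a => v a i with hV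
  set Y : Matrix (Fin (d - 1) → Fin n) (Fin s) F :=
    Matrix.of fun j a => tensorPower (d - 1) (v a) j with hY
  have hD : Matrix.diagonal (fun a => (ψ ⬝ᵥ z a)⁻¹) * Matrix.diagonal (fun a => ψ ⬝ᵥ z a) = 1 := by
    rw [Matrix.diagonal_mul_diagonal]
    simp [hψ]
  -- Only B C B = B is used, so any generalized inverse acts on the span of the v_a as the
  -- pseudoinverse does.
  have hYCV : Y.transpose * C * V = Matrix.diagonal (fun a => (ψ ⬝ᵥ z a)⁻¹) := by
    have h2 := congrArg (fun N => Matrix.diagonal (fun a => (ψ ⬝ᵥ z a)⁻¹) * (V' * N * Y')) hBCB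
    have e1 : Matrix.diagonal (fun a => (ψ ⬝ᵥ z a)⁻¹) * (V' * (V *
        Matrix.diagonal (fun a => ψ ⬝ᵥ z a) * Y.transpose) * Y') = 1 := by
      calc _ = Matrix.diagonal (fun a => (ψ ⬝ᵥ z a)⁻¹) * ((V' * V) *
            Matrix.diagonal (fun a => ψ ⬝ᵥ z a)) * (Y.transpose * Y') := by
              simp only [Matrix.mul_assoc]
        _ = 1 := by rw [hV1, hY1, Matrix.one_mul, Matrix.mul_one, hD]
    have e2 : Matrix.diagonal (fun a => (ψ ⬝ᵥ z a)⁻¹) * (V' * (V *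
        Matrix.diagonal (fun a => ψ ⬝ᵥ z a) * Y.transpose * C *
        (V * Matrix.diagonal (fun a => ψ ⬝ᵥ z a) * Y.transpose)) * Y') =
        Y.transpose * C * V * Matrix.diagonal (fun a => ψ ⬝ᵥ z a) := by
      calc _ = Matrix.diagonal (fun a => (ψ ⬝ᵥ z a)⁻¹) * ((V' * V) *
            Matrix.diagonal (fun a => ψ ⬝ᵥ z a)) * (Y.transpose * C * V *
            (Matrix.diagonal (fun a => ψ ⬝ᵥ z a) * (Y.transpose * Y'))) := by
              simp only [Matrix.mul_assoc]
        _ = _ := by rw [hV1, hY1, Matrix.one_mul, Matrix.mul_one, hD, Matrix.one_mul]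
    rw [e1, e2] at h2
    exact left_inv_eq_right_inv h2 (mul_eq_one_comm.1 hD)
  have hMV : M * V = V * Matrix.diagonal fun a => (φ ⬝ᵥ z a) / (ψ ⬝ᵥ z a) := by
    rw [hMC]
    calc _ = V * (Matrix.diagonal (fun a => φ ⬝ᵥ z a) * (Y.transpose * C * V)) := by
          simp only [Matrix.mul_assoc]
      _ = _ := by
          rw [hYCV, Matrix.diagonal_mul_diagonal]
          simp only [div_eq_mul_inv]
  refine ⟨_, hinj, fun a => div_ne_zero (hφ a) (hψ a), fun a => ?_, fun x => ?_⟩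
  · have h1 := congrArg (fun N : Matrix _ _ F => N.mulVec (Pi.single a 1)) hMV
    simp only [← Matrix.mulVec_mulVec, hVs, Matrix.diagonal_mulVec_single, one_smul, mul_one] at h1
    exact h1
  -- The part of x in the span is N C x; the remainder is killed by N C, hence by M.
  · set N := V * Matrix.diagonal (fun a => ψ ⬝ᵥ z a) * Y.transpose with hN
    refine ⟨(N * C).mulVec x, ?_, hker _ ?_⟩
    · rw [hN, Matrix.mul_assoc, Matrix.mul_assoc, ← Matrix.mulVec_mulVec]
      exact hVspan _
    · rw [Matrix.mulVec_sub, Matrix.mulVec_mulVec, ← Matrix.mul_assoc, hBCB, sub_self]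

theorem diagonalizes_of_eigenvectors {k : ℕ} {M : Matrix (Fin k) (Fin k) F} {D : Fin k → F}
    {q : Fin k → Fin k → F} (hq : LinearIndependent F q) (h : ∀ i, M.mulVec (q i) = D i • q i) :
    Diagonalizes M D (Matrix.of fun x i => q i x) := by
  refine ⟨?_, ?_⟩
  · rw [← Matrix.isUnit_iff_isUnit_det, ← Matrix.mulVec_injective_iff_isUnit]
    exact mulVec_injective_of_linearIndependent hq
  · ext x i
    rw [Matrix.mul_apply, Matrix.mul_diagonal]
    have := congrFun (h i) x
    simpa [Matrix.mulVec, dotProduct, mul_comm] using this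

/-- The eigenvectors v_a with nonzero eigenvalues are independent of the kernel, and together with a
basis of the kernel they span the whole space. -/
theorem exists_diagonalizes {k : ℕ} {M : Matrix (Fin k) (Fin k) F} {s : ℕ} {v : Fin s → Fin k → F}
    (hv : LinearIndependent F v) {lam : Fin s → F} (hlam : ∀ a, lam a ≠ 0)
    (h : ∀ a, M.mulVec (v a) = lam a • v a)
    (hc : ∀ x, ∃ y ∈ Submodule.span F (Set.range v), M.mulVec (x - y) = 0) :
    ∃ D Q, Diagonalizes M D Q := by
  let K := LinearMap.ker M.mulVecLin
  let b := Module.finBasis F K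
  let q : Fin s ⊕ Fin (Module.finrank F K) → Fin k → F := Sum.elim v fun i => b i
  have hbK : Submodule.span F (Set.range fun i => (b i : Fin k → F)) = K := by
    have := congrArg (Submodule.map K.subtype) b.span_eq
    rw [Submodule.map_span, ← Set.range_comp, Submodule.map_top, Submodule.range_subtype] at this
    exact this
  have hbi : LinearIndependent F fun i => (b i : Fin k → F) :=
    b.linearIndependent.map' K.subtype (Submodule.ker_subtype K)
  have hdis : Disjoint (Submodule.span F (Set.range v))
      (Submodule.span F (Set.range fun i => (b i : Fin k → F))) := by
    rw [hbK, Submodule.disjoint_def]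
    intro x hx hxK
    obtain ⟨c, rfl⟩ := (Submodule.mem_span_range_iff_exists_fun F).1 hx
    have h1 : M.mulVecLin (∑ a, c a • v a) = 0 := hxK
    simp only [map_sum, map_smul, Matrix.mulVecLin_apply, h, smul_smul] at h1
    have h2 := Fintype.linearIndependent_iff.1 hv _ h1
    refine Finset.sum_eq_zero fun a _ => ?_
    rw [(mul_eq_zero.1 (h2 a)).resolve_right (hlam a), zero_smul]
  have hq : LinearIndependent F q := hv.sum_type hbi hdis
  have hspan : ⊤ ≤ Submodule.span F (Set.range q) := by
    intro x _
    obtain ⟨y, hy, hxy⟩ := hc x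
    have h1 : x - y ∈ K := hxy
    rw [Set.Sum.elim_range, Submodule.span_union, hbK]
    rw [← add_sub_cancel y x]
    exact Submodule.add_mem_sup hy h1
  let B := Module.Basis.mk hq hspan
  let e : Fin k ≃ Fin s ⊕ Fin (Module.finrank F K) :=
    Fintype.equivOfCardEq (by
      rw [← Module.finrank_eq_card_basis B, Module.finrank_fintype_fun_eq_card])
  refine ⟨_, _, diagonalizes_of_eigenvectors (q := q ∘ e) (D := Sum.elim lam (fun _ => 0) ∘ e)
    (hq.comp e e.injective) fun i => ?_⟩
  simp only [Function.comp_apply]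
  rcases e i with a | a
  · exact h a
  · simp only [q, Sum.elim_inr, zero_smul]
    exact (b a).2

theorem LinearIndependent.eq_of_smul_eq {ι E : Type*} [AddCommGroup E] [Module F E] {v : ι → E}
    (hv : LinearIndependent F v) {i j : ι} {c c' : F} (hc : c ≠ 0) (h : c • v i = c' • v j) :
    i = j := by
  by_contra hij
  refine hv.notMem_span_image (s := {j}) (x := i) (by simpa using hij) ?_
  rw [Set.image_singleton, Submodule.mem_span_singleton]
  exact ⟨c⁻¹ * c', by rw [mul_smul, ← h, smul_smul, inv_mul_cancel₀ hc, one_smul]⟩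

/-- Completeness of the acceptance test. -/
theorem SeparatesPowers.accept (hd : 2 ≤ d) {v : Fin s → Fin n → F}
    (h : SeparatesPowers P φ ψ v)
    (hM : IsPairMatrix (sliceCombination (fun l => splitFirst (P l)) ψ)
      (sliceCombination (fun l => splitFirst (P l)) φ) M) {p : ℕ}
    {f : Fin p → MvPolynomial (Fin n) F} (hf : ∀ l, (f l).IsHomogeneous d)
    (hP : ∀ l, P l ∈ formAnnihilator d f) :
    (∃ D Q, Diagonalizes M D Q) ∧ ∀ D Q, Diagonalizes M D Q →
      (∃ e : Fin s → Fin n, EnumNonzero D e) ∧ (∀ i j, D i ≠ 0 → i ≠ j → D i ≠ D j) ∧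
      ∀ i, D i ≠ 0 → ∀ l, MvPolynomial.eval (fun x => Q x i) (f l) = 0 := by
  obtain ⟨lam, hinj, hlam, hMv, hc⟩ := h.pairMatrix hd hM
  have hv := h.1
  refine ⟨exists_diagonalizes hv hlam hMv hc, fun D Q hDQ => ?_⟩
  have hq := hDQ.linearIndependent
  have hMspan : ∀ y ∈ Submodule.span F (Set.range v), M.mulVec y ∈ Submodule.span F (Set.range v) := by
    intro y hy
    obtain ⟨c, rfl⟩ := (Submodule.mem_span_range_iff_exists_fun F).1 hy
    rw [Matrix.mulVec_sum]
    refine Submodule.sum_mem _ fun a _ => ?_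
    rw [Matrix.mulVec_smul, hMv]
    exact Submodule.smul_mem _ _ (Submodule.smul_mem _ _ (Submodule.subset_span ⟨a, rfl⟩))
  -- An eigenvector with nonzero eigenvalue lies in the image of the span of the v_a, and since the
  -- eigenvalues `lam` are distinct it involves only one v_a.
  have key : ∀ i, D i ≠ 0 → ∃ (a : Fin s) (c : F), c ≠ 0 ∧ (fun x => Q x i) = c • v a ∧ D i = lam a := by
    intro i hi
    have h1 := hDQ.mulVec_col i
    obtain ⟨y, hy, hxy⟩ := hc fun x => Q x i
    rw [Matrix.mulVec_sub, sub_eq_zero, h1] at hxy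
    have h2 : (fun x => Q x i) ∈ Submodule.span F (Set.range v) := by
      have := Submodule.smul_mem _ (D i)⁻¹ (hMspan y hy)
      rwa [← hxy, smul_smul, inv_mul_cancel₀ hi, one_smul] at this
    obtain ⟨c, hc'⟩ := (Submodule.mem_span_range_iff_exists_fun F).1 h2
    rw [← hc', Matrix.mulVec_sum, Finset.smul_sum, ← sub_eq_zero, ← Finset.sum_sub_distrib] at h1
    have h3 : ∑ a, (c a * (lam a - D i)) • v a = 0 := by
      rw [← h1]
      refine Finset.sum_congr rfl fun a _ => ?_
      rw [Matrix.mulVec_smul, hMv, smul_smul, smul_smul, ← sub_smul]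
      congr 1
      ring
    have h4 := Fintype.linearIndependent_iff.1 hv _ h3
    obtain ⟨a, ha⟩ : ∃ a, c a ≠ 0 := by
      by_contra! h0
      exact hq.ne_zero i (by rw [← hc']; simp [h0])
    have hDa : lam a = D i := sub_eq_zero.1 ((mul_eq_zero.1 (h4 a)).resolve_left ha)
    refine ⟨a, c a, ha, ?_, hDa.symm⟩
    rw [← hc']
    refine Finset.sum_eq_single_of_mem a (Finset.mem_univ _) fun b _ hb => ?_
    rcases mul_eq_zero.1 (h4 b) with h5 | h5
    · rw [h5, zero_smul]
    · exact absurd (hinj ((sub_eq_zero.1 h5).trans hDa.symm)) hb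
  have hne : ∀ i j, D i ≠ 0 → i ≠ j → D i ≠ D j := by
    intro i j hi hij hD
    obtain ⟨a, c, hc0, hqa, hDa⟩ := key i hi
    obtain ⟨a', c', hc0', hqa', hDa'⟩ := key j (hD ▸ hi)
    obtain rfl : a = a' := hinj (hDa.symm.trans (hD.trans hDa'))
    exact hij (hq.eq_of_smul_eq (i := i) (j := j) (c := c') (c' := c) hc0'
      (by rw [hqa, hqa', smul_comm]))
  -- The columns of Q span, so v_a has a nonzero component along some column, whose eigenvalue must
  -- be `lam a`.
  have hex : ∀ a, ∃ i, D i = lam a := by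
    intro a
    have hspan : v a ∈ Submodule.span F (Set.range fun i x => Q x i) := by
      rw [hq.span_eq_top_of_card_eq_finrank' (by simp)]
      trivial
    obtain ⟨c, hc'⟩ := (Submodule.mem_span_range_iff_exists_fun F).1 hspan
    have h1 := hMv a
    rw [← hc', Matrix.mulVec_sum, Finset.smul_sum, ← sub_eq_zero, ← Finset.sum_sub_distrib] at h1
    have h3 : ∑ i, (c i * (D i - lam a)) • (fun x => Q x i) = 0 := by
      rw [← h1]
      refine Finset.sum_congr rfl fun i _ => ?_
      rw [Matrix.mulVec_smul, hDQ.mulVec_col, smul_smul, smul_smul, ← sub_smul]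
      congr 1
      ring
    have h4 := Fintype.linearIndependent_iff.1 hq _ h3
    obtain ⟨i, hi⟩ : ∃ i, c i ≠ 0 := by
      by_contra! h0
      exact hv.ne_zero a (by rw [← hc']; simp [h0])
    exact ⟨i, sub_eq_zero.1 ((mul_eq_zero.1 (h4 i)).resolve_left hi)⟩
  choose e he using hex
  refine ⟨⟨e, fun a b hab => hinj (by rw [← he, ← he, hab]), fun i => ⟨fun hi => ?_, ?_⟩⟩, hne, ?_⟩
  · obtain ⟨a, -, -, -, hDa⟩ := key i hi
    refine ⟨a, ?_⟩
    by_contra hcon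
    exact hne i (e a) hi (Ne.symm hcon) (hDa.trans (he a).symm)
  · rintro ⟨a, rfl⟩
    rw [he]
    exact hlam a
  · intro i hi l
    obtain ⟨a, c, -, hqa, -⟩ := key i hi
    rw [hqa, eval_smul_of_isHomogeneous (hf l), ← formPairing_tensorPower (hf l)]
    have h1 : tensorPower d (v a) ∈ formAnnihilator d f :=
      Submodule.span_le.2 (by rintro _ ⟨l, rfl⟩; exact hP l) (h.tensorPower_mem_span a)
    rw [h1 l, mul_zero]

/-- Used to see that the range of T(φ), and with it each eigenvector of M with nonzero eigenvalue,
lies in U. -/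
theorem splitFirst_col_mem (hd : 0 < d) {U : Submodule F (Fin n → F)} {t : TensorPow F n d}
    (ht : t ∈ symPower d U) (j : Fin (d - 1) → Fin n) : (fun i => splitFirst t i j) ∈ U := by
  have h := ((mem_symPower_iff hd U t).1 ht).2
  by_cases hn : Nonempty (Fin n)
  · obtain ⟨x₀⟩ := hn
    convert h (fun k => if h : (k : ℕ) = 0 then x₀ else j ⟨k - 1, by have := k.isLt; omega⟩) using 2
    rename_i x
    rw [splitFirst]
    congr 1
    ext k
    by_cases hk : k = ⟨0, hd⟩
    · subst hk; simp
    · have : (k : ℕ) ≠ 0 := fun h => hk (Fin.ext h)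
      rw [Function.update_of_ne hk]
      simp [this]
  · rw [not_nonempty_iff] at hn
    rw [Subsingleton.elim (fun i => splitFirst t i j) 0]
    exact U.zero_mem

open scoped Matrix in
/-- Soundness of the acceptance test. -/
theorem separatesPowers_of_accept (hd : 2 ≤ d) {U : Submodule F (Fin n → F)} {p : ℕ}
    {f : Fin p → MvPolynomial (Fin n) F} (hf : ∀ l, (f l).IsHomogeneous d)
    (hP : IsBasisOf P (symPower d U ⊓ formAnnihilator d f))
    (hM : IsPairMatrix (sliceCombination (fun l => splitFirst (P l)) ψ)
      (sliceCombination (fun l => splitFirst (P l)) φ) M)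
    {D : Fin n → F} {Q : Matrix (Fin n) (Fin n) F} (hDQ : Diagonalizes M D Q)
    {e : Fin s → Fin n} (he : EnumNonzero D e) (hne : ∀ i j, D i ≠ 0 → i ≠ j → D i ≠ D j)
    (hX : ∀ i, D i ≠ 0 → ∀ l, MvPolynomial.eval (fun x => Q x i) (f l) = 0) :
    SeparatesPowers P φ ψ (fun a x => Q x (e a)) ∧ ∀ a, (fun x => Q x (e a)) ∈ U := by
  obtain ⟨C, hMC, hBCB, hker⟩ := hM
  set v : Fin s → Fin n → F := fun a x => Q x (e a) with hvdef
  have hD0 : ∀ a, D (e a) ≠ 0 := fun a => (he.2 _).2 ⟨a, rfl⟩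
  have hv : LinearIndependent F v := hDQ.linearIndependent.comp e he.1
  have hMv : ∀ a, M.mulVec (v a) = D (e a) • v a := fun a => hDQ.mulVec_col (e a)
  have hPS : ∀ l, P l ∈ symPower d U ⊓ formAnnihilator d f := fun l => by
    rw [← hP.2]; exact Submodule.subset_span ⟨l, rfl⟩
  have hvU : ∀ a, v a ∈ U := by
    intro a
    have h1 : M.mulVec (v a) ∈ U := by
      rw [hMC, ← Matrix.mulVec_mulVec, Matrix.mulVec_eq_sum]
      refine Submodule.sum_mem _ fun j _ => ?_
      rw [op_smul_eq_smul]
      refine U.smul_mem _ ?_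
      have : (sliceCombination (fun l => splitFirst (P l)) φ).transpose j =
          ∑ l, φ l • fun i => splitFirst (P l) i j := by
        ext i
        simp [sliceCombination, Matrix.sum_apply]
      rw [this]
      exact Submodule.sum_mem _ fun l _ =>
        U.smul_mem _ (splitFirst_col_mem (by omega) (hPS l).1 j)
    have h2 := U.smul_mem (D (e a))⁻¹ h1
    rwa [hMv, smul_smul, inv_mul_cancel₀ (hD0 a), one_smul] at h2
  refine ⟨?_, hvU⟩
  have hwS : ∀ a, tensorPower d (v a) ∈ symPower d U ⊓ formAnnihilator d f := fun a =>
    ⟨tensorPower_mem_symPower (hvU a), tensorPower_mem_formAnnihilator hf (hX _ (hD0 a))⟩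
  have hw := linearIndependent_tensorPower (show 0 < d by omega) hv
  -- The s powers lie in the space with basis P and are independent, so they span it: here it
  -- matters that the number of nonzero eigenvalues equals the length of P.
  have hspan : Submodule.span F (Set.range fun a => tensorPower d (v a)) =
      Submodule.span F (Set.range P) := by
    refine Submodule.eq_of_le_of_finrank_eq ?_ ?_
    · rw [hP.2, Submodule.span_le]
      rintro _ ⟨a, rfl⟩
      exact hwS a
    · rw [finrank_span_eq_card hw, finrank_span_eq_card hP.1]
  have hz : ∀ l, ∃ c : Fin s → F, ∑ a, c a • tensorPower d (v a) = P l := fun l =>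
    (Submodule.mem_span_range_iff_exists_fun F).1 (by
      rw [hspan]; exact Submodule.subset_span ⟨l, rfl⟩)
  have hg : ∀ a, ∃ c : Fin s → F, ∑ l, c l • P l = tensorPower d (v a) := fun a =>
    (Submodule.mem_span_range_iff_exists_fun F).1 (by
      rw [← hspan]; exact Submodule.subset_span ⟨a, rfl⟩)
  choose z' hz' using hz
  choose g hg using hg
  have hgz : ∀ a b, ∑ l, g a l * z' l b = if a = b then 1 else 0 := by
    intro a
    have h1 : ∑ b, (∑ l, g a l * z' l b - if a = b then 1 else 0) • tensorPower d (v b) = 0 := by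
      simp only [sub_smul, Finset.sum_sub_distrib, ite_smul, one_smul, zero_smul,
        Finset.sum_ite_eq, Finset.mem_univ, if_true]
      rw [sub_eq_zero, ← hg a]
      simp only [Finset.sum_smul, mul_smul]
      rw [Finset.sum_comm]
      refine Finset.sum_congr rfl fun l _ => ?_
      rw [← Finset.smul_sum, hz']
    intro b
    exact sub_eq_zero.1 (Fintype.linearIndependent_iff.1 hw _ h1 b)
  let z : Fin s → Fin s → F := fun a l => z' l a
  have hzi : LinearIndependent F z := by
    rw [Fintype.linearIndependent_iff]
    intro c hc a
    have h1 : ∑ l, g a l * (∑ b, c b • z b) l = c a := by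
      simp only [Finset.sum_apply, Pi.smul_apply, smul_eq_mul, Finset.mul_sum]
      rw [Finset.sum_comm]
      calc _ = ∑ b, c b * ∑ l, g a l * z' l b := by
            refine Finset.sum_congr rfl fun b _ => ?_
            rw [Finset.mul_sum]
            exact Finset.sum_congr rfl fun l _ => by simp only [z]; ring
        _ = c a := by simp [hgz]
    rw [← h1, hc]
    simp
  have hPz : ∀ l, P l = ∑ a, z a l • tensorPower d (v a) := fun l => (hz' l).symm
  obtain ⟨V', hV1, -⟩ := exists_left_inverse_hermitian _ (mulVec_injective_of_linearIndependent hv)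
  rw [sliceCombination_eq (by omega) hPz φ] at hMC
  rw [sliceCombination_eq (by omega) hPz ψ] at hBCB hker
  have hy : LinearIndependent F fun a => tensorPower (d - 1) (v a) :=
    linearIndependent_tensorPower (by omega) hv
  obtain ⟨Y', hY1, -⟩ := exists_right_inverse_hermitian _ (mulVec_injective_of_linearIndependent hy)
  have hVs := Matrix.of_mulVec_single v
  set V : Matrix (Fin n) (Fin s) F := Matrix.of fun i a => v a i with hV
  set Y : Matrix (Fin (d - 1) → Fin n) (Fin s) F :=
    Matrix.of fun j a => tensorPower (d - 1) (v a) j with hY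
  have hVinj : Function.Injective V.mulVec := mulVec_injective_of_linearIndependent hv
  have hEq : ∀ a, Matrix.diagonal (fun a => φ ⬝ᵥ z a) *ᵥ ((Y.transpose * C) *ᵥ v a) =
      Pi.single a (D (e a)) := by
    intro a
    apply hVinj
    rw [hVs, ← hMv, hMC, Matrix.mulVec_mulVec, Matrix.mulVec_mulVec]
    simp only [Matrix.mul_assoc]
  have hφ : ∀ a, φ ⬝ᵥ z a ≠ 0 := by
    intro a h0
    have h1 := congrFun (hEq a) a
    rw [Matrix.mulVec_diagonal, h0, zero_mul, Pi.single_eq_same] at h1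
    exact hD0 a h1.symm
  have hYC : ∀ a, (Y.transpose * C) *ᵥ v a = Pi.single a (D (e a) / (φ ⬝ᵥ z a)) := by
    intro a
    ext b
    have h1 := congrFun (hEq a) b
    rw [Matrix.mulVec_diagonal] at h1
    rw [← mul_right_inj' (hφ b), h1]
    by_cases hab : b = a
    · subst hab
      simp [mul_div_cancel₀, hφ b]
    · simp [Pi.single_eq_of_ne hab]
  have hBCv : ∀ a, (V * Matrix.diagonal (fun a => ψ ⬝ᵥ z a) * Y.transpose * C) *ᵥ v a =
      ((ψ ⬝ᵥ z a) * (D (e a) / (φ ⬝ᵥ z a))) • v a := by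
    intro a
    rw [Matrix.mul_assoc, ← Matrix.mulVec_mulVec, hYC, ← Matrix.mulVec_mulVec,
      Matrix.diagonal_mulVec_single, hVs]
  -- Otherwise B C would kill v_a and so would M, by the last condition in `IsPairMatrix`, although
  -- its eigenvalue is nonzero. This is the purpose of that condition.
  have hψ : ∀ a, ψ ⬝ᵥ z a ≠ 0 := by
    intro a h0
    have h1 := hker (v a) (by rw [hBCv, h0, zero_mul, zero_smul])
    rw [hMv] at h1
    exact (smul_ne_zero (hD0 a) (hv.ne_zero a)) h1
  -- Since ψ·z_a ≠ 0, the vector v_a is in the image of B, where B C acts as the identity.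
  have hratio : ∀ a, (φ ⬝ᵥ z a) / (ψ ⬝ᵥ z a) = D (e a) := by
    intro a
    have h1 : (V * Matrix.diagonal (fun a => ψ ⬝ᵥ z a) * Y.transpose) *ᵥ
        (Y' *ᵥ Pi.single a (ψ ⬝ᵥ z a)⁻¹) = v a := by
      rw [Matrix.mulVec_mulVec, Matrix.mul_assoc, hY1, Matrix.mul_one, ← Matrix.mulVec_mulVec,
        Matrix.diagonal_mulVec_single, mul_inv_cancel₀ (hψ a), hVs, one_smul]
    have h2 := hBCv a
    rw [← h1, Matrix.mulVec_mulVec, hBCB, h1] at h2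
    have h3 : (1 - (ψ ⬝ᵥ z a) * (D (e a) / (φ ⬝ᵥ z a))) • v a = 0 := by
      rw [sub_smul, one_smul, ← h2, sub_self]
    have h4 := (smul_eq_zero.1 h3).resolve_right (hv.ne_zero a)
    have hφa := hφ a
    have hψa := hψ a
    rw [div_eq_iff hψa]
    rw [sub_eq_zero, mul_div_assoc', eq_div_iff hφa, one_mul] at h4
    rw [h4, mul_comm]
  refine ⟨hv, z, hzi, hPz, hφ, hψ, fun a b hab => ?_⟩
  simp only [hratio] at hab
  by_contra hcon
  exact hne (e a) (e b) (hD0 a) (fun h => hcon (he.1 h)) hab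

end PairMatrix


/-! ### Uniqueness of decompositions -/

section Uniqueness

variable {F : Type*} [RCLike F] {n : ℕ} {W : Type*} [AddCommGroup W] [Module F W]

theorem tensorToV_tmul (x : Fin n → F) (y : W) (g : Module.Dual F W) :
    tensorToV (x ⊗ₜ[F] y) g = g y • x := by
  simp [tensorToV]

theorem tensorToV_sum {R : ℕ} (v : Fin R → Fin n → F) (w : Fin R → W) (g : Module.Dual F W) :
    tensorToV (∑ a, v a ⊗ₜ[F] w a) g = ∑ a, g (w a) • v a := by
  simp [tensorToV]

theorem tensorToW_sum {R : ℕ} (v : Fin R → Fin n → F) (w : Fin R → W)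
    (g : Module.Dual F (Fin n → F)) :
    tensorToW (∑ a, v a ⊗ₜ[F] w a) g = ∑ a, g (v a) • w a := by
  simp [tensorToW]

theorem range_tensorToV_sum_le {R : ℕ} (v : Fin R → Fin n → F) (w : Fin R → W) :
    LinearMap.range (tensorToV (∑ a, v a ⊗ₜ[F] w a)) ≤ Submodule.span F (Set.range v) := by
  rintro _ ⟨g, rfl⟩
  rw [tensorToV_sum]
  exact Submodule.sum_mem _ fun a _ => Submodule.smul_mem _ _ (Submodule.subset_span ⟨a, rfl⟩)

/-- Functionals dual to linearly independent vectors. -/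
theorem exists_dual_functionals {E : Type*} [AddCommGroup E] [Module F E] {R : ℕ} {v : Fin R → E}
    (hv : LinearIndependent F v) :
    ∃ g : Fin R → Module.Dual F E, ∀ a b, g a (v b) = if a = b then 1 else 0 := by
  have : ∀ a, ∃ φ : E →ₗ[F] F, ∀ b, φ (v b) = if a = b then 1 else 0 := by
    intro a
    obtain ⟨φ, hφ⟩ := LinearMap.exists_extend ((Module.Basis.span hv).coord a)
    refine ⟨φ, fun b => ?_⟩
    have := LinearMap.congr_fun hφ (Module.Basis.span hv b)
    rw [Module.Basis.coord_apply, Module.Basis.repr_self, LinearMap.comp_apply,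
      Submodule.subtype_apply, Module.Basis.span_apply, Finsupp.single_apply] at this
    simp [this, eq_comm]
  choose g hg using this
  exact ⟨g, hg⟩

theorem range_tensorToV_sum {R : ℕ} (v : Fin R → Fin n → F) {w : Fin R → W}
    (hw : LinearIndependent F w) :
    LinearMap.range (tensorToV (∑ a, v a ⊗ₜ[F] w a)) = Submodule.span F (Set.range v) := by
  refine le_antisymm (range_tensorToV_sum_le v w) (Submodule.span_le.2 ?_)
  rintro _ ⟨a, rfl⟩
  obtain ⟨g, hg⟩ := exists_dual_functionals hw
  refine ⟨g a, ?_⟩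
  rw [tensorToV_sum]
  simp [hg]

/-- If T(W*) contains v_b, then some functional on W takes the values δ_{ab} on the w_a. -/
theorem linearIndependent_of_range_tensorToV {R : ℕ} {v : Fin R → Fin n → F} {w : Fin R → W}
    (hv : LinearIndependent F v)
    (h : Submodule.span F (Set.range v) ≤ LinearMap.range (tensorToV (∑ a, v a ⊗ₜ[F] w a))) :
    LinearIndependent F w := by
  rw [Fintype.linearIndependent_iff]
  intro c hc b
  obtain ⟨g, hg⟩ := h (Submodule.subset_span ⟨b, rfl⟩)
  rw [tensorToV_sum] at hg
  have h1 : ∑ a, (g (w a) - if a = b then 1 else 0) • v a = 0 := by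
    simp [sub_smul, Finset.sum_sub_distrib, hg]
  have h2 := Fintype.linearIndependent_iff.1 hv _ h1
  have h3 := congrArg g hc
  simp only [map_sum, map_smul, map_zero] at h3
  simpa [sub_eq_zero.1 (h2 _)] using h3

theorem tensor_eq_sum_basis {m : ℕ} (b : Module.Basis (Fin m) F W) (T : (Fin n → F) ⊗[F] W) :
    T = ∑ j, tensorToV T (b.coord j) ⊗ₜ[F] b j := by
  induction T using TensorProduct.induction_on with
  | zero => simp [tensorToV]
  | tmul x y =>
    conv_lhs => rw [← b.sum_repr y, TensorProduct.tmul_sum]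
    refine Finset.sum_congr rfl fun j _ => ?_
    rw [tensorToV_tmul, TensorProduct.tmul_smul, TensorProduct.smul_tmul', Module.Basis.coord_apply]
  | add T T' h h' =>
    have : ∀ g, tensorToV (T + T') g = tensorToV T g + tensorToV T' g := fun g => by
      simp [tensorToV]
    simp only [this, TensorProduct.add_tmul, Finset.sum_add_distrib]
    rw [← h, ← h']

theorem range_tensorToV_eq_span {m : ℕ} (b : Module.Basis (Fin m) F W) (T : (Fin n → F) ⊗[F] W) :
    LinearMap.range (tensorToV T) = Submodule.span F (Set.range fun j => tensorToV T (b.coord j)) := by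
  have h := tensor_eq_sum_basis b T
  refine le_antisymm ?_ (Submodule.span_le.2 ?_)
  · conv_lhs => rw [h]
    exact range_tensorToV_sum_le _ _
  · rintro _ ⟨j, rfl⟩
    exact ⟨_, rfl⟩

/-- Expand the columns of T in the v_a. The coefficients are the values of the g_a, which do not
depend on how the functionals are extended beyond the span. -/
theorem tensor_eq_sum_dual {m : ℕ} (b : Module.Basis (Fin m) F W) {T : (Fin n → F) ⊗[F] W} {R : ℕ}
    {v : Fin R → Fin n → F} (hv : LinearMap.range (tensorToV T) ≤ Submodule.span F (Set.range v))
    {g : Fin R → Module.Dual F (Fin n → F)} (hg : ∀ a b, g a (v b) = if a = b then 1 else 0) :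
    T = ∑ a, v a ⊗ₜ[F] tensorToW T (g a) := by
  have h := tensor_eq_sum_basis b T
  set t := fun j => tensorToV T (b.coord j) with ht
  have ht' : ∀ j, t j = ∑ a, g a (t j) • v a := by
    intro j
    obtain ⟨c, hc⟩ := (Submodule.mem_span_range_iff_exists_fun F).1 (hv ⟨b.coord j, rfl⟩)
    have hc' : ∑ a, c a • v a = t j := hc
    rw [← hc']
    refine Finset.sum_congr rfl fun a _ => ?_
    simp [hg]
  have hW : ∀ a, tensorToW T (g a) = ∑ j, g a (t j) • b j := by
    intro a
    conv_lhs => rw [h]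
    exact tensorToW_sum t b (g a)
  simp only [hW, TensorProduct.tmul_sum]
  rw [Finset.sum_comm]
  conv_lhs => rw [h]
  refine Finset.sum_congr rfl fun j _ => ?_
  change t j ⊗ₜ[F] b j = _
  conv_lhs => rw [ht' j, TensorProduct.sum_tmul]
  refine Finset.sum_congr rfl fun a _ => ?_
  rw [TensorProduct.tmul_smul, TensorProduct.smul_tmul']

/-- If the intersection of `S^d(U)` and `I_d^⊥` is spanned by the `v_a^{⊗d}`, then `∑ v_a ⊗ w_a` is
the unique decomposition of minimal length. -/
theorem isUniqueXWRankDecomposition_of_span {d p R : ℕ} (hd : 2 ≤ d)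
    {f : Fin p → MvPolynomial (Fin n) F} (hf : ∀ l, (f l).IsHomogeneous d) {X : Set (Fin n → F)}
    (hX : X = {v | ∀ l, MvPolynomial.eval v (f l) = 0}) {v : Fin R → Fin n → F} {w : Fin R → W}
    (hv : LinearIndependent F v) (hw : LinearIndependent F w) (hvX : ∀ a, v a ∈ X)
    (hS : symPower d (Submodule.span F (Set.range v)) ⊓ formAnnihilator d f ≤
      Submodule.span F (Set.range fun a => tensorPower d (v a)))
    {T : (Fin n → F) ⊗[F] W} (hT : T = ∑ a, v a ⊗ₜ[F] w a) :
    IsUniqueXWRankDecomposition X T v w := by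
  have hrange : LinearMap.range (tensorToV T) = Submodule.span F (Set.range v) := by
    rw [hT, range_tensorToV_sum v hw]
  have hfin : Module.finrank F (Submodule.span F (Set.range v)) = R := by
    rw [finrank_span_eq_card hv, Fintype.card_fin]
  have hle : ∀ (R' : ℕ) (v' : Fin R' → Fin n → F) (w' : Fin R' → W), IsXWDecomposition X T v' w' →
      Submodule.span F (Set.range v) ≤ Submodule.span F (Set.range v') := by
    intro R' v' w' h
    rw [← hrange, h.sum]
    exact range_tensorToV_sum_le v' w'
  have hcard : ∀ (R' : ℕ) (v' : Fin R' → Fin n → F),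
      Module.finrank F (Submodule.span F (Set.range v')) ≤ R' := fun R' v' => by
    exact (finrank_range_le_card (R := F) v').trans_eq (Fintype.card_fin _)
  refine ⟨⟨hvX, hT⟩, fun R' v' w' h => ?_, fun v' w' h => ?_⟩
  · have := Submodule.finrank_mono (hle R' v' w' h)
    rw [hfin] at this
    exact this.trans (hcard R' v')
  · have hspan : Submodule.span F (Set.range v) = Submodule.span F (Set.range v') :=
      Submodule.eq_of_le_of_finrank_le (hle R v' w' h) (by rw [hfin]; exact hcard R v')
    have hv' : LinearIndependent F v' := by
      rw [linearIndependent_iff_card_eq_finrank_span, Set.finrank, ← hspan, hfin, Fintype.card_fin]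
    -- A second decomposition of length R spans the same U, so its vectors are points of X in U.
    have key : ∀ b, ∃ (a : Fin R) (c : F), c ≠ 0 ∧ v' b = c • v a := by
      intro b
      have hb : v' b ∈ Submodule.span F (Set.range v) := by
        rw [hspan]; exact Submodule.subset_span ⟨b, rfl⟩
      refine exists_eq_smul_of_tensorPower_mem_span hd hv hb (hv'.ne_zero b) (hS ⟨?_, ?_⟩)
      · exact tensorPower_mem_symPower hb
      · have := h.mem b
        rw [hX] at this
        exact tensorPower_mem_formAnnihilator hf this
    choose τ c hc hτ using key
    have hinj : Function.Injective τ := by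
      intro b b' hbb
      refine hv'.eq_of_smul_eq (c := c b') (c' := c b) (hc b') ?_
      rw [hτ b, hτ b', hbb, smul_comm]
    obtain ⟨g, hg⟩ := exists_dual_functionals hv
    refine ⟨Equiv.ofBijective τ (Finite.injective_iff_bijective.1 hinj), fun b => ?_⟩
    -- The scalar relating the vectors of V is compensated in W: applying a dual functional to both
    -- decompositions gives w_{τ b} = c_b w'_b.
    have e1 := tensorToW_sum v w (g (τ b))
    have e2 := tensorToW_sum v' w' (g (τ b))
    rw [← hT] at e1
    rw [← h.sum, e1] at e2
    simp only [hg, hτ, map_smul, smul_eq_mul, ite_smul, one_smul, zero_smul, Finset.sum_ite_eq,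
      Finset.mem_univ, if_true, mul_ite, mul_one, mul_zero, hinj.eq_iff] at e2
    rw [Equiv.ofBijective_apply, e2, hτ, TensorProduct.tmul_smul, TensorProduct.smul_tmul']

end Uniqueness


/-! ### Subspaces computed by orthogonalization -/

section RowSpaces

variable {F : Type*} [RCLike F]

/-- The first `L` entries of a row. -/
def rowFin (L : ℕ) : (ℕ → F) →ₗ[F] (Fin L → F) where
  toFun u := fun x => u x
  map_add' _ _ := rfl
  map_smul' _ _ := rfl

@[simp] theorem rowFin_apply (L : ℕ) (u : ℕ → F) (x : Fin L) : rowFin L u x = u x := rfl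

theorem rowFin_eq_iff {L : ℕ} {u v : ℕ → F} : rowFin L u = rowFin L v ↔ ∀ x < L, u x = v x :=
  ⟨fun h x hx => congrFun h ⟨x, hx⟩, fun h => funext fun x => h x x.2⟩

theorem rowInner_congr_right {L : ℕ} {u v w : ℕ → F} (h : rowFin L v = rowFin L w) :
    rowInner L u v = rowInner L u w :=
  Finset.sum_congr rfl fun x hx => by rw [rowFin_eq_iff.1 h x (Finset.mem_range.1 hx)]

theorem rowInner_self_eq_zero_iff {L : ℕ} {u : ℕ → F} : rowInner L u u = 0 ↔ rowFin L u = 0 := by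
  rw [rowInner_self_eq_zero, ← map_zero (rowFin L), rowFin_eq_iff]
  rfl

theorem rowInner_right_of_mem_span {L : ℕ} {u v : ℕ → F} {S : Set (ℕ → F)}
    (h : ∀ w ∈ S, rowInner L u w = 0) (hv : v ∈ Submodule.span F S) : rowInner L u v = 0 :=
  (Submodule.span_le (p := LinearMap.ker (rowInnerHom L u))).2 h hv

theorem rowInner_left_of_mem_span {L : ℕ} {u v : ℕ → F} {S : Set (ℕ → F)}
    (h : ∀ w ∈ S, rowInner L w u = 0) (hv : v ∈ Submodule.span F S) : rowInner L v u = 0 :=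
  rowInner_comm_zero (rowInner_right_of_mem_span (fun w hw => rowInner_comm_zero (h w hw)) hv)

/-- If `w = p + q` with `p`, `q` orthogonal and `w` is orthogonal to `p`, then `w = q`. -/
theorem rowFin_eq_of_orthogonal {L : ℕ} {w p q : ℕ → F} (h : rowFin L w = rowFin L (p + q))
    (hpq : rowInner L p q = 0) (hpw : rowInner L p w = 0) : rowFin L w = rowFin L q := by
  have h1 : rowFin L p = 0 := by
    rw [← rowInner_self_eq_zero_iff]
    rw [rowInner_congr_right h, rowInner_add, hpq, add_zero] at hpw
    exact hpw
  rw [h, map_add, h1, zero_add]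

/-- The nonzero members of an orthogonal list are a basis of its span. -/
theorem exists_basis_of_orthogonal {L K : ℕ} {G : ℕ → ℕ → F} {p : ℕ → Prop} [DecidablePred p]
    (hp : ∀ x, p x ↔ rowInner L (G x) (G x) ≠ 0)
    (hG : ∀ i < K, ∀ j < i, rowInner L (G j) (G i) = 0) :
    ∃ e : Fin (Nat.count p K) → ℕ, (∀ f : ℕ → ℕ → F,
      ∑ x ∈ Finset.range K, (if p x then f (Nat.count p x) x else 0) = ∑ a, f (a : Fin _).val (e a)) ∧
      IsBasisOf (fun a : Fin _ => rowFin L (G (e a)))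
        (Submodule.span F {v | ∃ j < K, v = rowFin L (G j)}) := by
  classical
  let D : Fin K → F := fun x => rowInner L (G x) (G x)
  have hD : ∀ x ≤ K, Nat.count (fun i => finExt D i ≠ 0) x = Nat.count p x := by
    intro x hx
    rw [Nat.count_eq_card_filter_range, Nat.count_eq_card_filter_range]
    congr 1
    refine Finset.filter_congr fun i hi => ?_
    rw [finExt_of_lt D ((Finset.mem_range.1 hi).trans_le hx), hp]
  -- The increasing enumeration of the nonzero rows, so that the running count in the sum becomes
  -- the index a.
  obtain ⟨e, ⟨he, heD⟩, hcount⟩ := exists_enumNonzero_count D (hD K le_rfl)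
  have hpe : ∀ a, p (e a) := fun a => (hp _).2 ((heD _).2 ⟨a, rfl⟩)
  refine ⟨fun a => e a, fun f => ?_, ?_, ?_⟩
  · rw [← Finset.sum_filter]
    symm
    refine Finset.sum_bij (fun a _ => (e a : ℕ)) ?_ ?_ ?_ ?_
    · intro a _
      exact Finset.mem_filter.2 ⟨Finset.mem_range.2 (e a).2, hpe a⟩
    · intro a _ b _ hab
      exact he (Fin.ext hab)
    · intro x hx
      simp only [Finset.mem_filter, Finset.mem_range] at hx
      obtain ⟨a, ha⟩ := (heD ⟨x, hx.1⟩).1 ((hp x).1 hx.2)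
      exact ⟨a, Finset.mem_univ _, by rw [ha]⟩
    · intro a _
      rw [← hD _ (e a).2.le, hcount]
  · have horth : ∀ a b : Fin (Nat.count p K), a ≠ b → rowInner L (G (e a)) (G (e b)) = 0 := by
      intro a b hab
      rcases lt_trichotomy (e a : ℕ) (e b) with h | h | h
      · exact hG _ (e b).2 _ h
      · exact absurd (he (Fin.ext h)) hab
      · exact rowInner_comm_zero (hG _ (e a).2 _ h)
    rw [Fintype.linearIndependent_iff]
    intro c hc a
    have h1 : rowFin L (∑ b, c b • G (e b)) = rowFin L 0 := by
      rw [map_sum, map_zero, ← hc]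
      rfl
    have h2 := rowInner_congr_right (u := G (e a)) h1
    change rowInnerHom L _ _ = rowInnerHom L _ _ at h2
    rw [map_sum, map_zero, Finset.sum_eq_single_of_mem a (Finset.mem_univ _)] at h2
    · rw [map_smul, smul_eq_mul] at h2
      exact (mul_eq_zero.1 h2).resolve_right ((hp _).1 (hpe a))
    · intro b _ hb
      rw [map_smul]
      exact (congrArg (c b • ·) (horth a b hb.symm)).trans (smul_zero _)
  · refine le_antisymm (Submodule.span_le.2 ?_) (Submodule.span_le.2 ?_)
    · rintro _ ⟨a, rfl⟩
      exact Submodule.subset_span ⟨e a, (e a).2, rfl⟩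
    · rintro _ ⟨j, hj, rfl⟩
      by_cases hpj : p j
      · obtain ⟨a, ha⟩ := (heD ⟨j, hj⟩).1 ((hp j).1 hpj)
        exact Submodule.subset_span ⟨a, by simp only [ha]⟩
      · rw [rowInner_self_eq_zero_iff.1 (not_not.1 (mt (hp j).2 hpj))]
        exact Submodule.zero_mem _

theorem rowFin_eq_sum_basis {L K₀ : ℕ} {a : ℕ → ℕ → F}
    (ha : ∀ x < L, ∀ y < L, a (K₀ + x) y = if y = x then 1 else 0) (w : ℕ → F) :
    rowFin L w = rowFin L (∑ x ∈ Finset.range L, w x • a (K₀ + x)) := by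
  rw [rowFin_eq_iff]
  intro y hy
  rw [Finset.sum_apply, Finset.sum_eq_single_of_mem y (Finset.mem_range.2 hy)]
  · simp [ha y hy y hy]
  · intro x hx hxy
    simp [ha x (Finset.mem_range.1 hx) y hy, hxy.symm]

theorem map_rowFin_span (L : ℕ) (p : ℕ → Prop) (G : ℕ → ℕ → F) :
    (Submodule.span F {v | ∃ j, p j ∧ v = G j}).map (rowFin L) =
      Submodule.span F {v | ∃ j, p j ∧ v = rowFin L (G j)} := by
  rw [Submodule.map_span]
  congr 1
  ext v
  constructor
  · rintro ⟨_, ⟨j, hj, rfl⟩, rfl⟩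
    exact ⟨j, hj, rfl⟩
  · rintro ⟨j, hj, rfl⟩
    exact ⟨_, ⟨j, hj, rfl⟩, rfl⟩

/-- The last rows of a complete orthogonalization span the orthogonal complement of the first. -/
theorem orthogonal_iff_mem_span_gsRows {L K₀ : ℕ} {a : ℕ → ℕ → F}
    (ha : ∀ x < L, ∀ y < L, a (K₀ + x) y = if y = x then 1 else 0) (s : ℕ → F) :
    (∀ y < K₀, rowInner L (a y) s = 0) ↔ rowFin L s ∈ Submodule.span F
      {v | ∃ x < L, v = rowFin L (gsRows (K₀ + L) L a (K₀ + L) (K₀ + x))} := by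
  set g := gsRows (K₀ + L) L a (K₀ + L) with hg
  have horth : ∀ i < K₀ + L, ∀ j < i, rowInner L (g j) (g i) = 0 := fun i hi j hj =>
    rowInner_gsRows i hi j (by omega)
  constructor
  · intro hs
    have hs' : ∀ y < K₀, rowInner L (g y) s = 0 := by
      intro y hy
      refine rowInner_left_of_mem_span ?_ (gsRows_mem_span y (by omega))
      rintro _ ⟨j, hj, rfl⟩
      exact hs j (by omega)
    -- Write s as p + q with p in the span of the first rows and q in that of the last. As p is
    -- orthogonal to both q and s, it vanishes.
    have hmem : ∑ x ∈ Finset.range L, s x • a (K₀ + x) ∈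
        Submodule.span F {v | ∃ j, j < K₀ ∧ v = g j} ⊔
          Submodule.span F {v | ∃ j, j < L ∧ v = g (K₀ + j)} := by
      rw [← Submodule.span_union]
      refine Submodule.sum_mem _ fun x hx => Submodule.smul_mem _ _ ?_
      have hx' := Finset.mem_range.1 hx
      refine Submodule.span_mono ?_ (mem_span_gsRows (k := K₀ + L) (L := L) (K := K₀ + L)
        (a := a) (i := K₀ + x) (by omega))
      rintro _ ⟨j, hj, rfl⟩
      by_cases hj' : j < K₀
      · exact Or.inl ⟨j, hj', rfl⟩
      · exact Or.inr ⟨j - K₀, by omega, by rw [Nat.add_sub_cancel' (by omega)]⟩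
    obtain ⟨p, hp, q, hq, hpq⟩ := Submodule.mem_sup.1 hmem
    have h1 := rowFin_eq_sum_basis ha s
    rw [← hpq] at h1
    have h2 := rowFin_eq_of_orthogonal h1
      (rowInner_left_of_mem_span (by
        rintro _ ⟨j, hj, rfl⟩
        refine rowInner_right_of_mem_span ?_ hq
        rintro _ ⟨x, hx, rfl⟩
        exact horth _ (by omega) _ (by omega)) hp)
      (rowInner_left_of_mem_span (by rintro _ ⟨j, hj, rfl⟩; exact hs' j hj) hp)
    rw [h2, ← map_rowFin_span L (fun j => j < L) fun j => g (K₀ + j)]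
    exact Submodule.mem_map_of_mem hq
  · intro hs y hy
    rw [← map_rowFin_span L (fun j => j < L) fun j => g (K₀ + j)] at hs
    obtain ⟨q, hq, hqs⟩ := hs
    rw [← rowInner_congr_right hqs]
    refine rowInner_right_of_mem_span ?_ hq
    rintro _ ⟨x, hx, rfl⟩
    refine rowInner_left_of_mem_span ?_ (mem_span_gsRows (k := K₀ + L) (L := L) (K := K₀ + L)
        (a := a) (i := y) (by omega))
    rintro _ ⟨j, hj, rfl⟩
    exact horth _ (by omega) _ (by omega)

/-- Triangularity in both directions. The equality holds for the whole rows, including entries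
beyond those used in inner products. -/
theorem span_gsRows_eq {L K k : ℕ} {a : ℕ → ℕ → F} {m : ℕ} (hm : m ≤ K) :
    Submodule.span F {v | ∃ j, j < m ∧ v = gsRows k L a K j} =
      Submodule.span F {v | ∃ j, j < m ∧ v = a j} := by
  refine le_antisymm (Submodule.span_le.2 ?_) (Submodule.span_le.2 ?_)
  · rintro _ ⟨j, hj, rfl⟩
    refine Submodule.span_mono ?_ (gsRows_mem_span j (by omega))
    rintro _ ⟨i, hi, rfl⟩
    exact ⟨i, by omega, rfl⟩
  · rintro _ ⟨j, hj, rfl⟩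
    refine Submodule.span_mono ?_ (mem_span_gsRows (k := k) (L := L) (a := a) (K := K)
      (i := j) (by omega))
    rintro _ ⟨i, hi, rfl⟩
    exact ⟨i, by omega, rfl⟩

/-- The unit vectors reduced by the first `m` rows span the orthogonal complement of these rows. -/
theorem mem_span_iff_orthogonal_gsRows {L m : ℕ} {a : ℕ → ℕ → F}
    (ha : ∀ x < L, ∀ y < L, a (m + x) y = if y = x then 1 else 0) (w : ℕ → F) :
    (∀ i < L, rowInner L (gsRows m L a (m + L) (m + i)) w = 0) ↔
      rowFin L w ∈ Submodule.span F {v | ∃ j < m, v = rowFin L (a j)} := by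
  set g := gsRows m L a (m + L) with hg
  have horth : ∀ i < L, ∀ j < m, rowInner L (g j) (g (m + i)) = 0 := fun i hi j hj =>
    rowInner_gsRows _ (by omega) j (by omega)
  rw [← map_rowFin_span L (fun j => j < m) a, ← span_gsRows_eq (L := L) (k := m) (K := m + L)
    (a := a) (m := m) (by omega), ← hg]
  constructor
  · intro h
    -- The unit vectors split into the reduced rows, collected in q, and what was subtracted,
    -- collected in p. If w is orthogonal to the reduced rows then q vanishes.
    let q := ∑ x ∈ Finset.range L, w x • g (m + x)
    let p := ∑ x ∈ Finset.range L, w x • (a (m + x) - g (m + x))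
    have hp : p ∈ Submodule.span F {v | ∃ j, j < m ∧ v = g j} := by
      refine Submodule.sum_mem _ fun x hx => Submodule.smul_mem _ _ ?_
      have hx' := Finset.mem_range.1 hx
      refine Submodule.span_mono ?_ (sub_gsRows_mem (k := m) (L := L) (a := a) (K := m + L)
        (i := m + x) (by omega))
      rintro _ ⟨j, hj, -, rfl⟩
      exact ⟨j, by omega, rfl⟩
    have h1 : rowFin L w = rowFin L (q + p) := by
      rw [rowFin_eq_sum_basis ha w]
      congr 1
      simp only [q, p, ← Finset.sum_add_distrib, ← smul_add, add_sub_cancel]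
    have hqmem : q ∈ Submodule.span F {v | ∃ i, i < L ∧ v = g (m + i)} :=
      Submodule.sum_mem _ fun x hx => Submodule.smul_mem _ _
        (Submodule.subset_span ⟨x, Finset.mem_range.1 hx, rfl⟩)
    rw [rowFin_eq_of_orthogonal h1
      (rowInner_left_of_mem_span (by
        rintro _ ⟨i, hi, rfl⟩
        refine rowInner_right_of_mem_span ?_ hp
        rintro _ ⟨j, hj, rfl⟩
        exact rowInner_comm_zero (horth i hi j hj)) hqmem)
      (rowInner_left_of_mem_span (by rintro _ ⟨i, hi, rfl⟩; exact h i hi) hqmem)]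
    exact Submodule.mem_map_of_mem hp
  · rintro ⟨p, hp, hpw⟩ i hi
    rw [← rowInner_congr_right hpw]
    refine rowInner_right_of_mem_span ?_ hp
    rintro _ ⟨j, hj, rfl⟩
    exact rowInner_comm_zero (horth i hi j hj)

end RowSpaces


/-! ### Tensors stored in arrays -/

section Codes

/-- The address of the entry `i` of a tensor. -/
def tupleCode {n d : ℕ} (i : Fin d → Fin n) : ℕ := finFunctionFinEquiv i

theorem tupleCode_lt {n d : ℕ} (i : Fin d → Fin n) : tupleCode i < n ^ d := Fin.isLt _

theorem tupleCode_eq_sum {n d : ℕ} (i : Fin d → Fin n) :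
    tupleCode i = ∑ k, (i k : ℕ) * n ^ (k : ℕ) := rfl

theorem tupleCode_digit {n d : ℕ} (i : Fin d → Fin n) (k : Fin d) :
    tupleCode i / n ^ (k : ℕ) % n = i k :=
  congrArg (fun j : Fin d → Fin n => (j k : ℕ)) (finFunctionFinEquiv.symm_apply_apply i)

theorem tupleCode_cons {n d : ℕ} (a : Fin n) (j : Fin d → Fin n) :
    tupleCode (Fin.cons a j : Fin (d + 1) → Fin n) = a + n * tupleCode j := by
  simp only [tupleCode_eq_sum, Fin.sum_univ_succ, Fin.cons_zero, Fin.cons_succ, Fin.val_zero,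
    pow_zero, mul_one, Fin.val_succ, Finset.mul_sum]
  congr 1
  exact Finset.sum_congr rfl fun k _ => by ring

theorem tupleCode_snoc {n d : ℕ} (a : Fin n) (j : Fin d → Fin n) :
    tupleCode (Fin.snoc j a : Fin (d + 1) → Fin n) = tupleCode j + a * n ^ d := by
  simp [tupleCode_eq_sum, Fin.sum_univ_castSucc]

theorem exists_tupleCode_eq {n d x : ℕ} (hx : x < n ^ d) : ∃ i : Fin d → Fin n, tupleCode i = x :=
  ⟨finFunctionFinEquiv.symm ⟨x, hx⟩, by rw [tupleCode, Equiv.apply_symm_apply]⟩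

theorem sum_tupleCode {M : Type*} [AddCommMonoid M] {n d : ℕ} (g : ℕ → M) :
    ∑ i : Fin d → Fin n, g (tupleCode i) = ∑ x ∈ Finset.range (n ^ d), g x := by
  rw [Finset.sum_range]
  exact Equiv.sum_comp finFunctionFinEquiv fun x : Fin (n ^ d) => g x

theorem rotCode_tupleCode {n e : ℕ} (i : Fin (e + 1) → Fin n) :
    rotCode n (n ^ e) (tupleCode i) = tupleCode (i ∘ finRotate (e + 1)) := by
  have h : i ∘ finRotate (e + 1) = Fin.snoc (Fin.tail i) (i 0) := by
    rw [Fin.snoc_eq_cons_rotate, Fin.cons_self_tail]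
    rfl
  have hn : 0 < n := (i 0).pos
  rw [h, tupleCode_snoc, rotCode]
  conv_lhs => rw [← Fin.cons_self_tail i, tupleCode_cons]
  rw [Nat.add_mul_div_left _ _ hn, Nat.div_eq_of_lt (i 0).2, Nat.add_mul_mod_self_left,
    Nat.mod_eq_of_lt (i 0).2, zero_add]

theorem swapCode_tupleCode {n e : ℕ} (i : Fin (e + 2) → Fin n) :
    swapCode n (tupleCode i) = tupleCode (i ∘ Equiv.swap 0 1) := by
  have hn : 0 < n := (i 0).pos
  have h : i ∘ Equiv.swap 0 1 = Fin.cons (i 1) (Fin.cons (i 0) (Fin.tail (Fin.tail i))) := by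
    funext k
    refine Fin.cases ?_ (fun k => Fin.cases ?_ (fun k => ?_) k) k
    · simp
    · simp
    · simp only [Function.comp_apply, Fin.cons_succ, Fin.tail]
      rw [Equiv.swap_apply_of_ne_of_ne (Fin.succ_ne_zero _)]
      exact fun h => Fin.succ_ne_zero k (Fin.succ_injective _ h)
  have h' : i = Fin.cons (i 0) (Fin.cons (i 1) (Fin.tail (Fin.tail i))) := by
    rw [show i 1 = Fin.tail i 0 from rfl, Fin.cons_self_tail, Fin.cons_self_tail]
  have hcode : tupleCode i = i 0 + n * (i 1 + n * tupleCode (Fin.tail (Fin.tail i))) := by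
    conv_lhs => rw [h', tupleCode_cons, tupleCode_cons]
  have e1 : tupleCode i / n = i 1 + n * tupleCode (Fin.tail (Fin.tail i)) := by
    rw [hcode, Nat.add_mul_div_left _ _ hn, Nat.div_eq_of_lt (i 0).2, zero_add]
  rw [h, tupleCode_cons, tupleCode_cons, swapCode, ← Nat.div_div_eq_div_mul, e1,
    Nat.add_mul_div_left _ _ hn, Nat.div_eq_of_lt (i 1).2, Nat.add_mul_mod_self_left,
    Nat.mod_eq_of_lt (i 1).2, hcode, Nat.add_mul_mod_self_left, Nat.mod_eq_of_lt (i 0).2]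
  ring

end Codes

/-! ### Membership in S^d(U) ∩ I_d^⊥ as orthogonality to stored rows -/

section TensorCodes

variable {F : Type*} [RCLike F] {n : ℕ}

open Classical in
theorem monoCode_tupleCode {e : ℕ} (i : Fin (e + 1) → Fin n) :
    monoCode F n e (tupleCode i) = if Monotone i then 1 else 0 := by
  have h : monoCode F n e (tupleCode i) =
      ∏ j : Fin e, if i j.castSucc ≤ i j.succ then (1 : F) else 0 := by
    rw [monoCode, Finset.prod_range]
    refine Finset.prod_congr rfl fun j _ => ?_
    have h1 := tupleCode_digit i j.castSucc
    have h2 := tupleCode_digit i j.succ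
    rw [Fin.val_castSucc] at h1
    rw [Fin.val_succ] at h2
    rw [h1, h2]
    rfl
  rw [h]
  split_ifs with hi
  · exact Finset.prod_eq_one fun j _ => if_pos (hi (Fin.castSucc_le_succ j))
  · rw [Fin.monotone_iff_le_succ, not_forall] at hi
    obtain ⟨j, hj⟩ := hi
    exact Finset.prod_eq_zero (Finset.mem_univ j) (if_neg hj)

theorem powCode_tupleCode {d : ℕ} (v : Fin n → F) (i : Fin d → Fin n) :
    powCode n d (finExt v) (tupleCode i) = tensorPower d v i := by
  rw [powCode, Finset.prod_range]
  refine Finset.prod_congr rfl fun k _ => ?_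
  rw [tupleCode_digit, finExt_of_lt v (i k).2]

/-- The tensor stored in an array. -/
def tensorOfArray (n d : ℕ) : (Fin (n ^ d) → F) ≃ₗ[F] TensorPow F n d :=
  LinearEquiv.funCongrLeft F F finFunctionFinEquiv

theorem tensorOfArray_rowFin (d : ℕ) (s : ℕ → F) (i : Fin d → Fin n) :
    tensorOfArray n d (rowFin (n ^ d) s) i = s (tupleCode i) := rfl

/-- The array `c` holds the coefficients of the forms `f`. -/
def HoldsForms {p d : ℕ} (f : Fin p → MvPolynomial (Fin n) F) (c : ℕ → F) : Prop :=
  ∀ (l : Fin p) (i : Fin d → Fin n), c (l * n ^ d + tupleCode i) = (f l).coeff (monomialExponent i)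

theorem HoldsForms.formPairing {p d : ℕ} (hd : 2 ≤ d) {f : Fin p → MvPolynomial (Fin n) F}
    {c : ℕ → F} (hc : HoldsForms (d := d) f c) (l : Fin p) (s : ℕ → F) :
    formPairing (f l) (tensorOfArray n d (rowFin (n ^ d) s)) =
      ∑ x ∈ Finset.range (n ^ d), c (l * n ^ d + x) * monoCode F n (d - 1) x * s x := by
  classical
  obtain ⟨e, rfl⟩ := Nat.exists_eq_add_of_le' hd
  rw [_root_.formPairing, Finset.sum_filter,
    ← sum_tupleCode fun x => c (l * n ^ (e + 2) + x) * monoCode F n (e + 2 - 1) x * s x]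
  refine Finset.sum_congr rfl fun i _ => ?_
  rw [show e + 2 - 1 = e + 1 from rfl, monoCode_tupleCode, hc]
  split_ifs <;> simp [tensorOfArray_rowFin]

theorem HoldsForms.formCode {p d : ℕ} (hd : 2 ≤ d) {f : Fin p → MvPolynomial (Fin n) F}
    {c : ℕ → F} (hc : HoldsForms (d := d) f c) (hf : ∀ l, (f l).IsHomogeneous d) (l : Fin p)
    (v : Fin n → F) : formCode n d c l (finExt v) = MvPolynomial.eval v (f l) := by
  rw [← formPairing_tensorPower (hf l), _root_.formCode, ← hc.formPairing hd]
  congr 1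
  funext i
  exact (powCode_tupleCode v i).symm ▸ rfl

/-- The rotation and the swap of the first two factors generate the symmetric group, so invariance
takes 2 n^d equations instead of d! n^d. -/
theorem tensorSymmetric_iff {F : Type*} [Field F] {n e : ℕ} (t : TensorPow F n (e + 2)) :
    TensorSymmetric t ↔ (∀ i, t (i ∘ finRotate (e + 2)) = t i) ∧
      ∀ i, t (i ∘ Equiv.swap 0 1) = t i := by
  refine ⟨fun h => ⟨h _, h _⟩, fun ⟨h1, h2⟩ => ?_⟩
  let H : Subgroup (Equiv.Perm (Fin (e + 2))) :=
    { carrier := {τ | ∀ i, t (i ∘ τ) = t i}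
      mul_mem' := fun {a b} ha hb i => (hb (i ∘ a)).trans (ha i)
      one_mem' := fun i => rfl
      inv_mem' := fun {a} ha i => by
        rw [← ha (i ∘ ⇑a⁻¹)]
        congr 1
        funext k
        simp }
  have hH : Subgroup.closure {finRotate (e + 2), Equiv.swap 0 (finRotate (e + 2) 0)} ≤ H := by
    rw [Subgroup.closure_le]
    rintro τ (rfl | rfl)
    · exact h1
    · intro i
      have : finRotate (e + 2) 0 = 1 := finRotate_apply_zero
      rw [this]
      exact h2 i
  rw [Equiv.Perm.closure_cycle_adjacent_swap isCycle_finRotate support_finRotate 0] at hH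
  exact fun τ => hH (Subgroup.mem_top τ)

theorem rowInner_sub_single {L : ℕ} {y z : ℕ} (hy : y < L) (hz : z < L) (u s : ℕ → F)
    (hu : ∀ x, u x = (if x = y then 1 else 0) - (if x = z then 1 else 0)) :
    rowInner L u s = s y - s z := by
  simp only [rowInner, hu, star_sub, sub_mul, Finset.sum_sub_distrib]
  congr 1
  · rw [Finset.sum_eq_single_of_mem y (Finset.mem_range.2 hy)]
    · simp
    · intro b _ hb; simp [hb]
  · rw [Finset.sum_eq_single_of_mem z (Finset.mem_range.2 hz)]
    · simp
    · intro b _ hb; simp [hb]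

theorem star_monoCode (k x : ℕ) : star (monoCode F n k x) = monoCode F n k x := by
  rw [monoCode, star_prod]
  refine Finset.prod_congr rfl fun j _ => ?_
  split_ifs <;> simp

/-- A row supported on one slice has as its inner product that of the slice; the first tensor index
is the lowest digit of the address. -/
theorem rowInner_slice {L z : ℕ} (hn : 0 < n) (hz : z < L) (g s u : ℕ → F)
    (hu : ∀ x, u x = g (x % n) * (if x / n = z then 1 else 0)) :
    rowInner (n * L) u s = rowInner n g fun y => s (y + n * z) := by
  simp only [rowInner]
  symm
  refine Finset.sum_of_injOn (fun y => y + n * z) ?_ ?_ ?_ ?_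
  · intro a _ b _ h
    exact Nat.add_right_cancel h
  · intro y hy
    have hy' : y < n := by simpa using hy
    simp only [Finset.coe_range, Set.mem_Iio]
    calc y + n * z < n * (z + 1) := by rw [mul_add]; omega
      _ ≤ n * L := Nat.mul_le_mul_left _ hz
  · intro x _ hx
    rw [hu, if_neg, mul_zero, star_zero, zero_mul]
    rintro rfl
    exact hx ⟨x % n, by simpa using Nat.mod_lt _ hn, Nat.mod_add_div x n⟩
  · intro y hy
    have hy' : y < n := Finset.mem_range.1 hy
    rw [hu, Nat.add_mul_mod_self_left, Nat.mod_eq_of_lt hy', Nat.add_mul_div_left _ _ hn,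
      Nat.div_eq_of_lt hy', zero_add, if_pos rfl, mul_one]

/-- Each block of `symRows` expresses one condition: the two generators of the permutations, the
slices, and the forms. -/
theorem mem_symPower_inf_iff_orthogonal {d p m : ℕ} (hn : 0 < n) (hd : 2 ≤ d)
    {f : Fin p → MvPolynomial (Fin n) F} {c t : ℕ → F} (hc : HoldsForms (d := d) f c) (s : ℕ → F) :
    (∀ y < 3 * n ^ d + p, rowInner (n ^ d) (symRows n d p m c (spanGS n m t) y) s = 0) ↔
      tensorOfArray n d (rowFin (n ^ d) s) ∈
        symPower d (Submodule.span F {v | ∃ j < m, v = rowFin n (spanRows m t j)}) ⊓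
          formAnnihilator d f := by
  set T := tensorOfArray n d (rowFin (n ^ d) s) with hT
  set U := Submodule.span F {v | ∃ j < m, v = rowFin n (spanRows m t j)} with hU
  have hform : T ∈ formAnnihilator d f ↔ ∀ l < p,
      rowInner (n ^ d) (symRows n d p m c (spanGS n m t) (2 * n ^ d + l)) s = 0 := by
    have h : ∀ l : Fin p, formPairing (f l) T =
        rowInner (n ^ d) (symRows n d p m c (spanGS n m t) (2 * n ^ d + l)) s := by
      intro l
      rw [hc.formPairing hd, rowInner]
      refine Finset.sum_congr rfl fun x _ => ?_
      rw [symRows_form l.2, star_mul', star_star, star_monoCode]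
    constructor
    · intro hm l hl
      rw [← h ⟨l, hl⟩]
      exact hm _
    · intro hm l
      rw [h l]
      exact hm l l.2
  obtain ⟨e, rfl⟩ := Nat.exists_eq_add_of_le' hd
  have hrot : (∀ i, T (i ∘ finRotate (e + 2)) = T i) ↔ ∀ y < n ^ (e + 2),
      rowInner (n ^ (e + 2)) (symRows n (e + 2) p m c (spanGS n m t) y) s = 0 := by
    have h : ∀ i : Fin (e + 2) → Fin n, rowInner (n ^ (e + 2))
        (symRows n (e + 2) p m c (spanGS n m t) (tupleCode i)) s =
          T i - T (i ∘ finRotate (e + 2)) := fun i =>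
      rowInner_sub_single (tupleCode_lt i) (tupleCode_lt _) _ _ fun x => by
        rw [symRows_rot (tupleCode_lt i)]
        exact congrArg (fun z => (if x = tupleCode i then (1 : F) else 0) -
          if x = z then 1 else 0) (rotCode_tupleCode i)
    constructor
    · intro hm y hy
      obtain ⟨i, rfl⟩ := exists_tupleCode_eq hy
      rw [h, hm, sub_self]
    · intro hm i
      have := hm _ (tupleCode_lt i)
      rw [h, sub_eq_zero] at this
      exact this.symm
  have hswap : (∀ i, T (i ∘ Equiv.swap 0 1) = T i) ↔ ∀ y < n ^ (e + 2), rowInner (n ^ (e + 2))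
      (symRows n (e + 2) p m c (spanGS n m t) (n ^ (e + 2) + y)) s = 0 := by
    have h : ∀ i : Fin (e + 2) → Fin n, rowInner (n ^ (e + 2))
        (symRows n (e + 2) p m c (spanGS n m t) (n ^ (e + 2) + tupleCode i)) s =
          T i - T (i ∘ Equiv.swap 0 1) := fun i =>
      rowInner_sub_single (tupleCode_lt i) (tupleCode_lt _) _ _ fun x => by
        rw [symRows_swap (tupleCode_lt i), swapCode_tupleCode]
    constructor
    · intro hm y hy
      obtain ⟨i, rfl⟩ := exists_tupleCode_eq hy
      rw [h, hm, sub_self]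
    · intro hm i
      have := hm _ (tupleCode_lt i)
      rw [h, sub_eq_zero] at this
      exact this.symm
  have hspan : (∀ i, (fun x => T (Function.update i 0 x)) ∈ U) ↔ ∀ y < n ^ (e + 2),
      rowInner (n ^ (e + 2))
        (symRows n (e + 2) p m c (spanGS n m t) (2 * n ^ (e + 2) + p + y)) s = 0 := by
    have h : ∀ r < n, ∀ z < n ^ (e + 1), rowInner (n ^ (e + 2))
        (symRows n (e + 2) p m c (spanGS n m t) (2 * n ^ (e + 2) + p + (z + n ^ (e + 1) * r))) s =
          rowInner n (spanGS n m t (m + r)) fun y => s (y + n * z) := by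
      intro r hr z hz
      rw [pow_succ' n (e + 1)]
      refine rowInner_slice hn hz _ _ _ fun x => ?_
      have hlt : z + n ^ (e + 1) * r < n ^ (e + 2) := by
        calc z + n ^ (e + 1) * r < n ^ (e + 1) * (r + 1) := by rw [mul_add]; omega
          _ ≤ n ^ (e + 1) * n := Nat.mul_le_mul_left _ hr
          _ = n ^ (e + 2) := (pow_succ _ _).symm
      rw [← pow_succ' n (e + 1), symRows_span hlt]
      change spanGS n m t (m + (z + n ^ (e + 1) * r) / n ^ (e + 1)) (x % n) *
        (if x / n = (z + n ^ (e + 1) * r) % n ^ (e + 1) then 1 else 0) = _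
      rw [Nat.add_mul_div_left _ _ (pow_pos hn _), Nat.div_eq_of_lt hz, zero_add,
        Nat.add_mul_mod_self_left, Nat.mod_eq_of_lt hz]
    have hslice : ∀ i : Fin (e + 2) → Fin n, (fun x => T (Function.update i 0 x)) =
        rowFin n fun y => s (y + n * tupleCode (Fin.tail i)) := by
      intro i
      funext x
      rw [rowFin_apply, ← tupleCode_cons]
      conv_lhs => rw [← Fin.cons_self_tail i, Fin.update_cons_zero]
      rfl
    have hbasis : ∀ x < n, ∀ y < n, spanRows m t (m + x) y = if y = x then 1 else 0 := by
      intro x _ y _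
      rw [spanRows, if_neg (by omega), Nat.add_sub_cancel_left]
    -- The reduced unit vectors are a system of equations for the range, one of which is applied to
    -- each slice.
    have hU' := fun w => mem_span_iff_orthogonal_gsRows (a := spanRows m t) hbasis w
    constructor
    · intro hm y hy
      obtain ⟨j, hj⟩ := exists_tupleCode_eq (Nat.mod_lt y (pow_pos hn (e + 1)))
      have hr : y / n ^ (e + 1) < n := by
        rw [Nat.div_lt_iff_lt_mul (pow_pos hn _), ← pow_succ']
        exact hy
      have h1 := hm (Fin.cons ⟨0, hn⟩ j)
      rw [hslice, Fin.tail_cons, hj, hU, ← hU'] at h1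
      have h2 := h _ hr _ (Nat.mod_lt y (pow_pos hn (e + 1)))
      rw [Nat.mod_add_div] at h2
      rw [h2]
      exact h1 _ hr
    · intro hm i
      rw [hslice, hU, ← hU']
      intro r hr
      refine (h r hr _ (tupleCode_lt _)).symm.trans (hm _ ?_)
      calc tupleCode (Fin.tail i) + n ^ (e + 1) * r < n ^ (e + 1) * (r + 1) := by
            rw [mul_add]; have := tupleCode_lt (Fin.tail i); omega
        _ ≤ n ^ (e + 1) * n := Nat.mul_le_mul_left _ hr
        _ = n ^ (e + 2) := (pow_succ _ _).symm
  rw [Submodule.mem_inf, mem_symPower_iff (by omega), tensorSymmetric_iff, hrot, hswap, hform]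
  change _ ↔ (_ ∧ ∀ i, (fun x => T (Function.update i 0 x)) ∈ U) ∧ _
  rw [hspan]
  constructor
  · intro h
    exact ⟨⟨⟨fun y hy => h y (by omega), fun y hy => h _ (by omega)⟩, fun y hy => h _ (by omega)⟩,
      fun y hy => h _ (by omega)⟩
  · rintro ⟨⟨⟨h1, h2⟩, h3⟩, h4⟩ y hy
    by_cases hy1 : y < n ^ (e + 2)
    · exact h1 y hy1
    by_cases hy2 : y < 2 * n ^ (e + 2)
    · have := h2 (y - n ^ (e + 2)) (by omega)
      rwa [Nat.add_sub_cancel' (by omega)] at this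
    by_cases hy3 : y < 2 * n ^ (e + 2) + p
    · have := h4 (y - 2 * n ^ (e + 2)) (by omega)
      rwa [Nat.add_sub_cancel' (by omega)] at this
    · have := h3 (y - (2 * n ^ (e + 2) + p)) (by omega)
      rwa [Nat.add_sub_cancel' (by omega)] at this

end TensorCodes


/-! ### The matrices computed by orthogonalization -/

section ComputedMatrices

variable {F : Type*} [RCLike F]

/-- The orthogonal expansion holds for whole rows although the inner products see only the first L
entries, because both sides are linear and agree on the spanning rows. -/
theorem eq_sum_of_mem_span_orthogonal {L K : ℕ} {G : ℕ → ℕ → F}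
    (hG : ∀ i < K, ∀ j < i, rowInner L (G j) (G i) = 0) {u : ℕ → F}
    (hu : u ∈ Submodule.span F {v | ∃ j < K, rowInner L (G j) (G j) ≠ 0 ∧ v = G j}) :
    u = ∑ y ∈ Finset.range K, (rowInner L (G y) u / rowInner L (G y) (G y)) • G y := by
  let Φ : (ℕ → F) →ₗ[F] (ℕ → F) := ∑ y ∈ Finset.range K,
    ((rowInner L (G y) (G y))⁻¹ • rowInnerHom L (G y)).smulRight (G y)
  have hΦ : ∀ u, Φ u = ∑ y ∈ Finset.range K,
      (rowInner L (G y) u / rowInner L (G y) (G y)) • G y := by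
    intro u
    rw [LinearMap.sum_apply]
    refine Finset.sum_congr rfl fun y _ => ?_
    rw [LinearMap.smulRight_apply, div_eq_inv_mul]
    rfl
  have h : Set.EqOn (LinearMap.id : (ℕ → F) →ₗ[F] (ℕ → F)) Φ
      {v | ∃ j < K, rowInner L (G j) (G j) ≠ 0 ∧ v = G j} := by
    rintro _ ⟨j, hj, hne, rfl⟩
    rw [hΦ, Finset.sum_eq_single_of_mem j (Finset.mem_range.2 hj), div_self hne, one_smul]
    · rfl
    · intro y hy hyj
      have : rowInner L (G y) (G j) = 0 := by
        rcases lt_or_gt_of_ne hyj with h | h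
        · exact hG j hj y h
        · exact rowInner_comm_zero (hG y (Finset.mem_range.1 hy) j h)
      rw [this, zero_div, zero_smul]
  have := LinearMap.eqOn_span h hu
  rwa [hΦ] at this

/-- Rows that are orthogonal and nonzero in the first L entries are independent there, so those
entries determine a combination of them. -/
theorem eq_zero_of_mem_span_orthogonal {L K : ℕ} {G : ℕ → ℕ → F}
    (hG : ∀ i < K, ∀ j < i, rowInner L (G j) (G i) = 0) {u : ℕ → F}
    (hu : u ∈ Submodule.span F {v | ∃ j < K, rowInner L (G j) (G j) ≠ 0 ∧ v = G j})
    (h0 : rowFin L u = 0) : u = 0 := by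
  rw [eq_sum_of_mem_span_orthogonal hG hu]
  refine Finset.sum_eq_zero fun y _ => ?_
  rw [rowInner_congr_right (h0.trans (map_zero (rowFin L)).symm)]
  change (rowInnerHom L (G y) 0 / _) • _ = (0 : ℕ → F)
  rw [map_zero, zero_div, zero_smul]

/-- The entries of a row after the first `n`. -/
def rowTail (n : ℕ) : (ℕ → F) →ₗ[F] (Fin n → F) where
  toFun u := fun x => u (n + x)
  map_add' _ _ := rfl
  map_smul' _ _ := rfl

/-- Reducing the j-th unit vector subtracts a combination, with coefficients h_j, of the columns of
B, and the same combination of the columns of A in the second half. With C = (h_j), the product B C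
is the orthogonal projection to the columns of B, and A C is read off from the second halves. -/
theorem isPairMatrix_pairGS (n L : ℕ) (ψ φ : ℕ → F) :
    IsPairMatrix (n := n) (fun i (y : Fin L) => ψ (i + n * y)) (fun i (y : Fin L) => φ (i + n * y))
      (fun i j => - pairGS n L ψ φ (L + j) (n + i)) := by
  set B : Matrix (Fin n) (Fin L) F := fun i y => ψ (i + n * y) with hB
  set A : Matrix (Fin n) (Fin L) F := fun i y => φ (i + n * y) with hA
  set r := pairRows n L ψ φ with hr
  set g := pairGS n L ψ φ with hg
  have horth : ∀ i < L + n, ∀ j < min i L, rowInner n (g j) (g i) = 0 := rowInner_gsRows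
  have hG : ∀ i < L, ∀ j < i, rowInner n (g j) (g i) = 0 := fun i hi j hj =>
    horth i (by omega) j (by omega)
  -- Rows whose halves come from one coefficient vector h; this is stable under the reduction.
  let S : Submodule F (ℕ → F) :=
    { carrier := {u | ∃ h : Fin L → F, rowFin n u = B.mulVec h ∧ rowTail n u = A.mulVec h}
      add_mem' := by
        rintro u u' ⟨h, h1, h2⟩ ⟨h', h1', h2'⟩
        exact ⟨h + h', by rw [map_add, h1, h1', Matrix.mulVec_add],
          by rw [map_add, h2, h2', Matrix.mulVec_add]⟩
      zero_mem' := ⟨0, by simp, by simp⟩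
      smul_mem' := by
        rintro c u ⟨h, h1, h2⟩
        exact ⟨c • h, by rw [map_smul, h1, Matrix.mulVec_smul],
          by rw [map_smul, h2, Matrix.mulVec_smul]⟩ }
  have hrS : ∀ y < L, r y ∈ S := by
    intro y hy
    refine ⟨Pi.single ⟨y, hy⟩ 1, ?_, ?_⟩
    · rw [Matrix.mulVec_single_one]
      funext x
      simp [hr, pairRows, hy, hB]
      rfl
    · rw [Matrix.mulVec_single_one]
      funext x
      simp [hr, pairRows, hy, hA, rowTail]
      rfl
  have hgS : ∀ y < L, g y ∈ S := fun y hy => by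
    refine Submodule.span_le.2 ?_ (gsRows_mem_span (K := L + n) y (by omega))
    rintro _ ⟨j, hj, rfl⟩
    exact hrS j (by omega)
  have hrange : ∀ h : Fin L → F, ∃ u ∈ Submodule.span F {v | ∃ j, j < L ∧ v = g j},
      rowFin n u = B.mulVec h := by
    intro h
    rw [hg, pairGS, span_gsRows_eq (by omega)]
    refine ⟨∑ y, h y • r y, Submodule.sum_mem _ fun y _ => Submodule.smul_mem _ _
      (Submodule.subset_span ⟨y, y.2, rfl⟩), ?_⟩
    funext x
    simp [hr, pairRows, Matrix.mulVec, dotProduct, hB, mul_comm, Finset.sum_apply]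
  have hp : ∀ j < n, r (L + j) - g (L + j) ∈
      Submodule.span F {v | ∃ j < L, rowInner n (g j) (g j) ≠ 0 ∧ v = g j} := by
    intro j hj
    refine Submodule.span_mono ?_ (sub_gsRows_mem (K := L + n) (i := L + j) (by omega))
    rintro _ ⟨y, hy, h⟩
    exact ⟨y, by omega, h⟩
  have hpS : ∀ j : Fin n, r (L + j) - g (L + j) ∈ S := fun j => by
    refine Submodule.span_le.2 ?_ (hp j j.2)
    rintro _ ⟨y, hy, -, rfl⟩
    exact hgS y hy
  choose h h1 h2 using hpS
  have hbasis : ∀ x : Fin n → F, rowFin n (∑ j, x j • r (L + j)) = x := by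
    intro x
    funext i
    simp only [rowFin_apply, Finset.sum_apply, Pi.smul_apply, smul_eq_mul, hr, pairRows]
    rw [Finset.sum_eq_single_of_mem i (Finset.mem_univ _)]
    · simp
    · intro j _ hj
      have : (i : ℕ) ≠ j := fun h => hj (Fin.ext h.symm)
      simp [this]
  have hcol : ∀ (N : Matrix (Fin n) (Fin L) F) (x : Fin n → F),
      (N * Matrix.of (fun y j => h j y)).mulVec x = ∑ j, x j • N.mulVec (h j) := by
    intro N x
    funext i
    rw [Finset.sum_apply]
    change ∑ j, (∑ y, N i y * h j y) * x j = ∑ j, x j * ∑ y, N i y * h j y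
    exact Finset.sum_congr rfl fun j _ => mul_comm _ _
  have hBC : ∀ x, (B * Matrix.of (fun y j => h j y)).mulVec x =
      rowFin n (∑ j, x j • (r (L + j) - g (L + j))) := by
    intro x
    rw [hcol, map_sum]
    exact Finset.sum_congr rfl fun j _ => by rw [map_smul, h1]
  refine ⟨Matrix.of fun y j => h j y, ?_, ?_, ?_⟩
  · funext i j
    have := congrFun (h2 j) i
    change r (L + j) (n + i) - g (L + j) (n + i) = _ at this
    rw [hr, pairRows, if_neg (by omega), if_neg (by omega), zero_sub] at this
    rw [this]
    rfl
  · refine Matrix.ext_iff_mulVec.2 fun x => ?_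
    rw [← Matrix.mulVec_mulVec, hBC]
    obtain ⟨u, hu, hux⟩ := hrange x
    set y := B.mulVec x with hy
    have e1 : rowFin n u = rowFin n ((∑ j, y j • g (L + j)) +
        ∑ j, y j • (r (L + j) - g (L + j))) := by
      rw [hux, ← Finset.sum_add_distrib]
      conv_lhs => rw [← hbasis y]
      simp only [← smul_add, add_sub_cancel]
    have horth' : ∀ u ∈ Submodule.span F {v | ∃ j, j < L ∧ v = g j},
        rowInner n (∑ j : Fin n, y j • g (L + j)) u = 0 := by
      intro u hu
      refine rowInner_comm_zero (rowInner_left_of_mem_span ?_ hu)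
      rintro _ ⟨k, hk, rfl⟩
      refine rowInner_right_of_mem_span (S := Set.range fun j : Fin n => g (L + j)) ?_
        (Submodule.sum_mem _ fun j _ => Submodule.smul_mem _ _ (Submodule.subset_span ⟨j, rfl⟩))
      rintro _ ⟨j, rfl⟩
      exact horth _ (by omega) _ (by omega)
    refine (rowFin_eq_of_orthogonal e1 (horth' _ ?_) (horth' _ hu)).symm.trans hux
    refine Submodule.sum_mem _ fun j _ => Submodule.smul_mem _ _ (Submodule.span_mono ?_ (hp j j.2))
    rintro _ ⟨k, hk, -, rfl⟩
    exact ⟨k, hk, rfl⟩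
  · intro x hx
    rw [hBC] at hx
    -- Only rows with nonzero first half are ever subtracted, so if the first half of a combination
    -- of the subtracted parts vanishes, its second half does too.
    have h0 := eq_zero_of_mem_span_orthogonal hG (Submodule.sum_mem _ fun j _ =>
      Submodule.smul_mem _ (x j) (hp j j.2)) hx
    have h3 := congrArg (rowTail n) h0
    rw [map_sum, map_zero] at h3
    funext i
    have h4 := congrFun h3 i
    rw [Finset.sum_apply] at h4
    refine (Finset.sum_congr rfl fun j _ => ?_).trans h4
    change (- g (L + j) (n + i)) * x j = x j * (r (L + j) (n + i) - g (L + j) (n + i))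
    rw [hr, pairRows, if_neg (by omega), if_neg (by omega), zero_sub, mul_comm]

/-- The coordinates of the columns of `t` with respect to `v`. -/
theorem neg_solveGS_eq {n m k : ℕ} {v : Fin k → Fin n → F} (hv : LinearIndependent F v)
    {vv t : ℕ → F} (hvv : ∀ (a : Fin k) (x : Fin n), vv (a * n + x) = v a x) {j : ℕ} (hj : j < m)
    (w : Fin k → F) (ht : ∀ x : Fin n, t (x * m + j) = ∑ a, w a * v a x) (a : Fin k) :
    - solveGS n m k vv t (k + j) (n + a) = w a := by
  set r := solveRows n m k vv t with hr
  set g := solveGS n m k vv t with hg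
  have hrv : ∀ a : Fin k, rowFin n (r a) = v a := by
    intro a
    funext x
    have : (x : ℕ) ≠ n + a := by omega
    simp [hr, solveRows, hvv, this]
  have hp : r (k + j) - g (k + j) ∈ Submodule.span F {v | ∃ j, j < k ∧ v = r j} := by
    rw [← span_gsRows_eq (L := n) (k := k) (K := k + m) (by omega)]
    refine Submodule.span_mono ?_ (sub_gsRows_mem (K := k + m) (i := k + j) (by omega))
    rintro _ ⟨y, hy, -, h⟩
    exact ⟨y, by omega, h⟩
  have hset : {v | ∃ j, j < k ∧ v = r j} = Set.range fun a : Fin k => r a := by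
    ext u
    constructor
    · rintro ⟨j, hj, rfl⟩; exact ⟨⟨j, hj⟩, rfl⟩
    · rintro ⟨a, rfl⟩; exact ⟨a, a.2, rfl⟩
  have hp' := hp
  rw [hset, Submodule.mem_span_range_iff_exists_fun] at hp'
  obtain ⟨c, hc⟩ := hp'
  -- Read in the label entry n + a, where only the row of v_a is nonzero.
  have hca : ∀ a : Fin k, c a = - g (k + j) (n + a) := by
    intro a
    have := congrFun hc (n + a)
    simp only [Finset.sum_apply, Pi.smul_apply, Pi.sub_apply, smul_eq_mul] at this
    rw [Finset.sum_eq_single_of_mem a (Finset.mem_univ _)] at this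
    · simpa [hr, solveRows] using this
    · intro b _ hb
      have : (a : ℕ) ≠ b := fun h => hb (Fin.ext h.symm)
      simp [hr, solveRows, this]
  have hrw : rowFin n (r (k + j)) = rowFin n (∑ a, w a • r a) := by
    funext x
    have h1 : r (k + j) x = t (x * m + j) := by simp [hr, solveRows]
    rw [rowFin_apply, h1, ht, map_sum]
    simp only [map_smul, hrv]
    simp
  have horth : ∀ u ∈ Submodule.span F {v | ∃ j, j < k ∧ v = r j},
      rowInner n (g (k + j)) u = 0 := by
    rw [← span_gsRows_eq (L := n) (k := k) (K := k + m) (by omega)]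
    intro u hu
    refine rowInner_right_of_mem_span ?_ hu
    rintro _ ⟨y, hy, rfl⟩
    exact rowInner_comm_zero (rowInner_gsRows (k + j) (by omega) y (by omega))
  have hfin := rowFin_eq_of_orthogonal (L := n) (w := ∑ a, w a • r a) (p := g (k + j))
    (q := r (k + j) - g (k + j)) (by rw [add_sub_cancel, hrw]) (horth _ hp)
    (horth _ (Submodule.sum_mem _ fun a _ => Submodule.smul_mem _ _
      (Submodule.subset_span ⟨a, a.2, rfl⟩)))
  rw [← hc, map_sum, map_sum] at hfin
  simp only [map_smul, hrv] at hfin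
  rw [← hca]
  symm
  exact sub_eq_zero.1 (Fintype.linearIndependent_iff.1 hv (fun a => w a - c a)
    (by simp only [sub_smul, Finset.sum_sub_distrib, hfin, sub_self]) a)

end ComputedMatrices

/-! ### The basis and the matrix that the program computes -/

section StepOne

variable {F : Type*} [RCLike F] {n : ℕ}

theorem IsBasisOf.map_equiv {E E' : Type*} [AddCommGroup E] [Module F E] [AddCommGroup E']
    [Module F E'] {R : ℕ} {u : Fin R → E} {U : Submodule F E} (h : IsBasisOf u U) (φ : E ≃ₗ[F] E') :
    IsBasisOf (fun a => φ (u a)) (U.map (φ : E →ₗ[F] E')) := by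
  refine ⟨h.1.map' (φ : E →ₗ[F] E') φ.ker, ?_⟩
  rw [← h.2, Submodule.map_span, ← Set.range_comp]
  rfl

open Classical in
/-- The basis of the first step of the algorithm that the program computes. -/
theorem exists_stepOneBasis {d p m : ℕ} (hn : 0 < n) (hd : 2 ≤ d)
    {f : Fin p → MvPolynomial (Fin n) F} {c : ℕ → F} (hc : HoldsForms (d := d) f c) (t : ℕ → F) :
    ∃ P : Fin (Nat.count (SolRowNonzero n d p m c t) (n ^ d)) → TensorPow F n d,
      IsBasisOf P (symPower d (Submodule.span F {v | ∃ j < m, v = rowFin n (spanRows m t j)}) ⊓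
        formAnnihilator d f) ∧
      ∀ w i, sliceCode n d p m c t w (n ^ d) (tupleCode i) = ∑ a, w (a : Fin _).val * P a i := by
  have horth : ∀ i < n ^ d, ∀ j < i,
      rowInner (n ^ d) (solRows n d p m c t j) (solRows n d p m c t i) = 0 := fun i hi j hj =>
    rowInner_gsRows (3 * n ^ d + p + i) (by omega) (3 * n ^ d + p + j) (by omega)
  obtain ⟨e, he, hbasis⟩ := exists_basis_of_orthogonal
    (p := SolRowNonzero n d p m c t) (fun _ => Iff.rfl) horth
  refine ⟨fun a => tensorOfArray n d (rowFin (n ^ d) (solRows n d p m c t (e a))), ?_, ?_⟩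
  · refine ⟨(hbasis.map_equiv (tensorOfArray n d)).1, (hbasis.map_equiv (tensorOfArray n d)).2.trans ?_⟩
    have hK : 4 * n ^ d + p = 3 * n ^ d + p + n ^ d := by ring
    ext T
    rw [Submodule.mem_map_equiv]
    -- The nonzero solution rows are a basis of the complement of the conditions; that this
    -- complement is the space of the first step is checked on an array holding T.
    obtain ⟨s, hs⟩ : ∃ s : ℕ → F, rowFin (n ^ d) s = (tensorOfArray n d).symm T :=
      ⟨finExt ((tensorOfArray n d).symm T), funext fun x => finExt_of_lt _ x.2⟩
    have hT : T = tensorOfArray n d (rowFin (n ^ d) s) := by rw [hs, LinearEquiv.apply_symm_apply]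
    rw [← hs, hT, ← mem_symPower_inf_iff_orthogonal hn hd hc s, orthogonal_iff_mem_span_gsRows
      (fun x _ y _ => symRows_basis x y)]
    simp only [solRows, symGS, hK]
  · intro w i
    exact (he fun a x => w a * solRows n d p m c t x (tupleCode i))

/-- The address of a tuple with first entry i and remaining code y is i + n y, so the stored arrays
are the matrices T(φ), T(ψ) column by column. -/
theorem isPairMatrix_mainMatrix {d p m s : ℕ} (hd : 2 ≤ d) {c t ω : ℕ → F}
    {P : Fin s → TensorPow F n d} {φ ψ : Fin s → F}
    (hP : ∀ w i, sliceCode n d p m c t w (n ^ d) (tupleCode i) = ∑ a, w (a : Fin s).val * P a i)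
    (hφ : ∀ a, φ a = ω a) (hψ : ∀ a : Fin s, ψ a = ω (n + a)) :
    IsPairMatrix (sliceCombination (fun l => splitFirst (P l)) ψ)
      (sliceCombination (fun l => splitFirst (P l)) φ) (mainMatrix n d p m c t ω) := by
  refine IsPairMatrix.reindex finFunctionFinEquiv.symm ?_
  have h := isPairMatrix_pairGS n (n ^ (d - 1))
    (sliceCode n d p m c t (fun x => ω (n + x)) (n ^ d)) (sliceCode n d p m c t ω (n ^ d))
  obtain ⟨e, rfl⟩ := Nat.exists_eq_add_of_le' hd
  have key : ∀ (w : ℕ → F) (χ : Fin s → F), (∀ a, χ a = w a) →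
      (sliceCombination (fun l => splitFirst (P l)) χ).submatrix id
        (finFunctionFinEquiv (m := n) (n := e + 1)).symm =
      fun (i : Fin n) (y : Fin (n ^ (e + 1))) =>
        sliceCode n (e + 2) p m c t w (n ^ (e + 2)) (i + n * y) := by
    intro w χ hχ
    funext i y
    have hy : (y : ℕ) = tupleCode (finFunctionFinEquiv.symm y) := by
      rw [tupleCode, Equiv.apply_symm_apply]
    rw [hy, ← tupleCode_cons, hP, Matrix.submatrix_apply, sliceCombination, Matrix.sum_apply]
    refine Finset.sum_congr rfl fun a _ => ?_
    rw [Matrix.smul_apply, smul_eq_mul, hχ]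
    congr 1
    rw [splitFirst]
    congr 1
    funext k
    refine Fin.cases ?_ (fun k => ?_) k
    · simp
    · simp
  rw [show e + 2 - 1 = e + 1 from rfl] at *
  exact (key (fun x => ω (n + x)) _ hψ).symm ▸ (key _ _ hφ).symm ▸ h

end StepOne


/-! ### The result of the program -/

section ProgramResult

variable {F : Type*} [RCLike F] {n : ℕ} {W : Type*} [AddCommGroup W] [Module F W]

theorem basis_repr_eq_tensorToV {m : ℕ} (b : Module.Basis (Fin m) F W) (T : (Fin n → F) ⊗[F] W)
    (x : Fin n) (j : Fin m) :
    ((Pi.basisFun F (Fin n)).tensorProduct b).repr T (x, j) = tensorToV T (b.coord j) x := by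
  induction T using TensorProduct.induction_on with
  | zero => simp [tensorToV]
  | tmul v w =>
    rw [tensorToV_tmul]
    simp [Module.Basis.tensorProduct_repr_tmul_apply, mul_comm]
  | add T T' h h' =>
    rw [map_add, Finsupp.add_apply, h, h']
    simp [tensorToV]

section Input

variable {d p m : ℕ} (f : Fin p → MvPolynomial (Fin n) F) (b : Module.Basis (Fin m) F W)
  (T : (Fin n → F) ⊗[F] W) (ω : Fin 2 → Fin n → F)

theorem holdsForms_inputState : HoldsForms (d := d) f ((inputState d f b T ω).mem 0) := by
  intro l i
  have hi := tupleCode_lt i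
  have hlt : (l : ℕ) * n ^ d + tupleCode i < p * n ^ d :=
    calc (l : ℕ) * n ^ d + tupleCode i < (l + 1) * n ^ d := by rw [add_mul]; omega
      _ ≤ p * n ^ d := Nat.mul_le_mul_right _ l.2
  have hN : 0 < n ^ d := by omega
  have h1 : Fin.divNat (⟨_, hlt⟩ : Fin (p * n ^ d)) = l := Fin.ext (by
    simp only [Fin.coe_divNat]
    rw [mul_comm, Nat.mul_add_div hN, Nat.div_eq_of_lt hi, add_zero])
  have h2 : Fin.modNat (⟨_, hlt⟩ : Fin (p * n ^ d)) = finFunctionFinEquiv i := Fin.ext (by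
    simp only [Fin.coe_modNat]
    rw [mul_comm, Nat.mul_add_mod, Nat.mod_eq_of_lt hi]
    rfl)
  simp only [inputState, if_true, dif_pos hlt, h1, h2, Equiv.symm_apply_apply]

theorem inputState_mem_one (x : Fin n) (j : Fin m) :
    (inputState d f b T ω).mem 1 (x * m + j) = tensorToV T (b.coord j) x := by
  have hlt : (x : ℕ) * m + j < n * m :=
    calc (x : ℕ) * m + j < (x + 1) * m := by rw [add_mul]; omega
      _ ≤ n * m := Nat.mul_le_mul_right _ x.2
  have hm : 0 < m := j.pos
  have h1 : Fin.divNat (⟨_, hlt⟩ : Fin (n * m)) = x := Fin.ext (by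
    simp only [Fin.coe_divNat]
    rw [mul_comm, Nat.mul_add_div hm, Nat.div_eq_of_lt j.2, add_zero])
  have h2 : Fin.modNat (⟨_, hlt⟩ : Fin (n * m)) = j := Fin.ext (by
    simp only [Fin.coe_modNat]
    rw [mul_comm, Nat.mul_add_mod, Nat.mod_eq_of_lt j.2])
  simp only [inputState, if_true, dif_pos hlt, h1, h2, one_ne_zero, if_false,
    basis_repr_eq_tensorToV]

theorem inputState_mem_two (i : Fin 2) (x : Fin n) :
    (inputState d f b T ω).mem 2 (i * n + x) = ω i x := by
  have hlt : (i : ℕ) * n + x < 2 * n :=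
    calc (i : ℕ) * n + x < (i + 1) * n := by rw [add_mul]; omega
      _ ≤ 2 * n := Nat.mul_le_mul_right _ i.2
  have hm : 0 < n := x.pos
  have h1 : Fin.divNat (⟨_, hlt⟩ : Fin (2 * n)) = i := Fin.ext (by
    simp only [Fin.coe_divNat]
    rw [mul_comm, Nat.mul_add_div hm, Nat.div_eq_of_lt x.2, add_zero])
  have h2 : Fin.modNat (⟨_, hlt⟩ : Fin (2 * n)) = x := Fin.ext (by
    simp only [Fin.coe_modNat]
    rw [mul_comm, Nat.mul_add_mod, Nat.mod_eq_of_lt x.2])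
  simp only [inputState, if_true, dif_pos hlt, h1, h2, OfNat.ofNat_ne_zero, OfNat.ofNat_ne_one,
    if_false]

theorem span_spanRows_inputState :
    Submodule.span F {v | ∃ j < m, v = rowFin n (spanRows m ((inputState d f b T ω).mem 1) j)} =
      LinearMap.range (tensorToV T) := by
  rw [range_tensorToV_eq_span b]
  congr 1
  have h : ∀ j : Fin m, rowFin n (spanRows m ((inputState d f b T ω).mem 1) j) =
      tensorToV T (b.coord j) := by
    intro j
    funext x
    rw [rowFin_apply, spanRows, if_pos j.2, inputState_mem_one]
  ext v
  constructor
  · rintro ⟨j, hj, rfl⟩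
    exact ⟨⟨j, hj⟩, (h ⟨j, hj⟩).symm⟩
  · rintro ⟨j, rfl⟩
    exact ⟨j, j.2, (h j).symm⟩

end Input

/-- The nonzero ones among the orthogonalized columns are a basis of the range, and `spanRank`
counts them. -/
theorem exists_basis_spanRank (n m : ℕ) (t : ℕ → F) :
    ∃ u : Fin (spanRank n m t) → Fin n → F,
      IsBasisOf u (Submodule.span F {v | ∃ j < m, v = rowFin n (spanRows m t j)}) := by
  classical
  obtain ⟨e, -, he⟩ := exists_basis_of_orthogonal (L := n) (K := m) (G := spanGS n m t)
    (p := fun j => rowInner n (spanGS n m t j) (spanGS n m t j) ≠ 0) (fun _ => Iff.rfl)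
    fun i hi j hj => rowInner_gsRows i (by omega) j (by omega)
  unfold spanRank
  refine ⟨fun a => rowFin n (spanGS n m t (e a)), ?_⟩
  convert he using 1
  rw [← map_rowFin_span n (fun j => j < m), ← map_rowFin_span n (fun j => j < m), spanGS,
    span_gsRows_eq (by omega)]

theorem IsBasisOf.finrank_eq {E : Type*} [AddCommGroup E] [Module F E] {R : ℕ} {u : Fin R → E}
    {U : Submodule F E} (h : IsBasisOf u U) : Module.finrank F U = R := by
  rw [← h.2, finrank_span_eq_card h.1, Fintype.card_fin]

/-- Linearly independent vectors of `U`, as many as the dimension, span `U`. -/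
theorem IsBasisOf.span_eq {R : ℕ} {u v : Fin R → Fin n → F} {U : Submodule F (Fin n → F)}
    (h : IsBasisOf u U) (hv : LinearIndependent F v) (hvU : ∀ a, v a ∈ U) :
    Submodule.span F (Set.range v) = U := by
  refine Submodule.eq_of_le_of_finrank_eq (Submodule.span_le.2 ?_) ?_
  · rintro _ ⟨a, rfl⟩
    exact hvU a
  · rw [h.finrank_eq, finrank_span_eq_card hv, Fintype.card_fin]

theorem eq_sum_dual_smul {E : Type*} [AddCommGroup E] [Module F E] {R : ℕ} {v : Fin R → E}
    {g : Fin R → Module.Dual F E} (hg : ∀ a b, g a (v b) = if a = b then 1 else 0) {x : E}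
    (hx : x ∈ Submodule.span F (Set.range v)) : x = ∑ a, g a x • v a := by
  obtain ⟨c, rfl⟩ := (Submodule.mem_span_range_iff_exists_fun F).1 hx
  refine Finset.sum_congr rfl fun a _ => ?_
  rw [map_sum]
  simp [hg]

/-- What the program does on the input `(f, T)`. -/
theorem exists_exec_mainProg {d p m : ℕ} (hn : 0 < n) (hd : 2 ≤ d) (hdN : d ≤ n ^ d)
    (hpN : p ≤ n ^ d) {f : Fin p → MvPolynomial (Fin n) F} (hf : ∀ l, (f l).IsHomogeneous d)
    (b : Module.Basis (Fin m) F W) (T : (Fin n → F) ⊗[F] W) :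
    -- The bases u and P are fixed before the random vectors. Otherwise P could depend on φ and ψ,
    -- and nothing could be said with probability one.
    ∃ (k s : ℕ) (u : Fin k → Fin n → F) (P : Fin s → TensorPow F n d),
      IsBasisOf u (LinearMap.range (tensorToV T)) ∧ IsStepOneBasis d f u P ∧
      ∀ (ω : Fin 2 → Fin n → F) (O : DiagFunction F), IsDiagOracle O →
        ∃ (σ : MachineState F) (t q : ℕ), Exec O mainProg (inputState d f b T ω) σ t q ∧
          t ≤ (8 * (n ^ d + m)) ^ mainProg.deg ∧ q ≤ mainProg.calls ∧
          ((outputOf n b σ = none ∧ ¬ (s = k ∧ ∃ v, SeparatesPowers P (firstEntries s (ω 0))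
              (firstEntries s (ω 1)) v)) ∨
            ∃ (v : Fin s → Fin n → F) (w : Fin s → W) (g : Fin s → Module.Dual F (Fin n → F)),
              outputOf n b σ = some ⟨s, v, w⟩ ∧ s = k ∧
              SeparatesPowers P (firstEntries s (ω 0)) (firstEntries s (ω 1)) v ∧
              (∀ a, v a ∈ LinearMap.range (tensorToV T)) ∧
              (∀ a l, MvPolynomial.eval (v a) (f l) = 0) ∧
              (∀ a b, g a (v b) = if a = b then 1 else 0) ∧ ∀ a, w a = tensorToW T (g a)) := by
  classical
  set U := LinearMap.range (tensorToV T) with hU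
  set c := (inputState d f b T 0).mem 0 with hc
  set t := (inputState d f b T 0).mem 1 with ht
  have hcf : HoldsForms (d := d) f c := holdsForms_inputState f b T 0
  obtain ⟨k, hk, u, hu⟩ : ∃ k, spanRank n m t = k ∧ ∃ u : Fin k → Fin n → F, IsBasisOf u U :=
    ⟨_, rfl, by rw [hU, ← span_spanRows_inputState f b T 0]; exact exists_basis_spanRank n m t⟩
  obtain ⟨s, hs, P, hP, hPs⟩ : ∃ s, Nat.count (SolRowNonzero n d p m c t) (n ^ d) = s ∧
      ∃ P : Fin s → TensorPow F n d, IsBasisOf P (symPower d U ⊓ formAnnihilator d f) ∧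
        ∀ w i, sliceCode n d p m c t w (n ^ d) (tupleCode i) = ∑ a, w (a : Fin s).val * P a i :=
    ⟨_, rfl, by rw [hU, ← span_spanRows_inputState f b T 0]; exact exists_stepOneBasis hn hd hcf t⟩
  have hkn : k ≤ n := by
    rw [← hu.finrank_eq]
    simpa using Submodule.finrank_le U
  refine ⟨k, s, u, P, hu, by rw [IsStepOneBasis, hu.2]; exact hP, fun ω O hO => ?_⟩
  -- The equality s = k ≤ n ensures that the program has n random entries at its disposal for each
  -- combination. For s ≠ k the matrix plays no role, as the program rejects.
  have hpair : s = k → IsPairMatrix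
      (sliceCombination (fun l => splitFirst (P l)) (firstEntries s (ω 1)))
      (sliceCombination (fun l => splitFirst (P l)) (firstEntries s (ω 0)))
      (mainMatrix n d p m c t ((inputState d f b T ω).mem 2)) := by
    intro hsk
    refine isPairMatrix_mainMatrix hd hPs (fun a => ?_) (fun a => ?_)
    · have := inputState_mem_two (d := d) f b T ω 0 ⟨a, by omega⟩
      simp only [Fin.val_zero, zero_mul, zero_add] at this
      rw [this, firstEntries, dif_pos]
    · have := inputState_mem_two (d := d) f b T ω 1 ⟨a, by omega⟩
      simp only [Fin.val_one, one_mul] at this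
      rw [this, firstEntries, dif_pos]
  have hreg : ∀ r, (inputState d f b T ω).reg r ≤ 8 * (n ^ d + m) := by
    intro r
    have hnN : n ≤ n ^ d := Nat.le_self_pow (by omega) n
    simp only [inputState]
    split_ifs <;> omega
  obtain ⟨σ, τ, q, hexec, hτ, hq, -, hpost⟩ := runs_mainProg (O := O) (B := 8 * (n ^ d + m))
    (σ := inputState d f b T ω) (c := c) (t := t)
    (ω := (inputState d f b T ω).mem 2) hn hd hdN hpN le_rfl rfl rfl rfl rfl rfl rfl rfl rfl rfl
    rfl rfl hreg
  refine ⟨σ, τ, q, hexec, hτ, hq, ?_⟩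
  rw [hk, hs] at hpost
  rcases hpost with ⟨hnone, h0⟩ | ⟨D, Q, hsome, hiff, hout⟩
  -- If the oracle cannot diagonalize, there is no separated decomposition, because one would make
  -- the matrix diagonalizable.
  · refine Or.inl ⟨by rw [outputOf, if_pos h0], ?_⟩
    rintro ⟨hsk, v, hv⟩
    exact (hO _ _).2 hnone (hv.accept hd (hpair hsk) hf fun l => (hP.2 ▸ Submodule.subset_span
      ⟨l, rfl⟩ : P l ∈ symPower d U ⊓ formAnnihilator d f).2).1
  have hDQ := (hO _ _).1 D Q hsome
  have hforms : ∀ i, (∀ l < p, formCode n d c l (finExt fun x => Q x i) = 0) ↔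
      ∀ l, MvPolynomial.eval (fun x => Q x i) (f l) = 0 := by
    intro i
    constructor
    · intro h l
      rw [← hcf.formCode hd hf]
      exact h l l.2
    · intro h l hl
      exact (hcf.formCode hd hf ⟨l, hl⟩ _).trans (h _)
  simp only [hforms] at hiff
  by_cases h0 : σ.reg 0 = 0
  · refine Or.inl ⟨by rw [outputOf, if_pos h0], ?_⟩
    rintro ⟨hsk, v, hv⟩
    have h1 := (hv.accept hd (hpair hsk) hf fun l => (hP.2 ▸ Submodule.subset_span
      ⟨l, rfl⟩ : P l ∈ symPower d U ⊓ formAnnihilator d f).2).2 D Q hDQ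
    subst hsk
    exact hiff.2 ⟨rfl, h1⟩ h0
  · right
    obtain ⟨hsk, -, hne, hX⟩ := hiff.1 h0
    obtain ⟨hr1, e, he, hm3, hm4⟩ := hout h0
    subst hsk
    obtain ⟨hsep, hvU⟩ := separatesPowers_of_accept hd hf hP (hpair rfl) hDQ he hne hX
    set v : Fin s → Fin n → F := fun a x => Q x (e a) with hv
    obtain ⟨g, hg⟩ := exists_dual_functionals hsep.1
    have hspan := hu.span_eq hsep.1 hvU
    refine ⟨v, fun a => tensorToW T (g a), g, ?_, rfl, hsep, hvU,
      fun a l => hX _ ((he.2 _).2 ⟨a, rfl⟩) l, hg, fun _ => rfl⟩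
    have hw : ∀ (a : Fin s) (j : Fin m),
        σ.mem 4 (a * m + j) = g a (tensorToV T (b.coord j)) := by
      intro a j
      rw [hm4 a a.2 j j.2]
      refine neg_solveGS_eq hsep.1 hm3 j.2 (fun a => g a (tensorToV T (b.coord j))) ?_ a
      intro x
      rw [ht, inputState_mem_one]
      have hx : tensorToV T (b.coord j) ∈ Submodule.span F (Set.range v) := by
        rw [hspan]
        exact ⟨_, rfl⟩
      conv_lhs => rw [eq_sum_dual_smul hg hx]
      simp
    rw [outputOf, if_neg h0, hr1]
    have e1 : (fun (a : Fin s) (i : Fin n) => σ.mem 3 (a * n + i)) = v := by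
      funext a i
      exact hm3 a i
    have e2 : (fun a : Fin s => ∑ j : Fin m, σ.mem 4 (a * m + j) • b j) =
        fun a => tensorToW T (g a) := by
      funext a
      conv_rhs => rw [tensor_eq_sum_basis b T, tensorToW_sum]
      exact Finset.sum_congr rfl fun j _ => by rw [hw]
    rw [e1, e2]

end ProgramResult


/-! ### Outputs are results of the algorithm and are certified to be unique -/

section Certification

variable {F : Type*} [RCLike F] {n : ℕ} {W : Type*} [AddCommGroup W] [Module F W]

/-- A result that is certified by `SeparatesPowers` is the result of the algorithm. -/
theorem decompositionResult_of_separatesPowers {d p k s : ℕ} (hd : 2 ≤ d)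
    {f : Fin p → MvPolynomial (Fin n) F} {T : (Fin n → F) ⊗[F] W} {u : Fin k → Fin n → F}
    {P : Fin s → TensorPow F n d} {ω : Fin 2 → Fin n → F}
    (hu : IsBasisOf u (LinearMap.range (tensorToV T))) (hP : IsStepOneBasis d f u P)
    {v : Fin s → Fin n → F} {w : Fin s → W} {g : Fin s → Module.Dual F (Fin n → F)} (hsk : s = k)
    (hv : SeparatesPowers P (firstEntries s (ω 0)) (firstEntries s (ω 1)) v)
    (hg : ∀ a b, g a (v b) = if a = b then 1 else 0) (hw : ∀ a, w a = tensorToW T (g a)) :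
    DecompositionResult d f T ω (some ⟨s, v, w⟩) := by
  subst hsk
  by_cases hs : s = 0
  · exact ⟨s, s, u, P, .trivial, hu, ⟨hP, Or.inl ⟨hs, rfl⟩⟩,
      Or.inl ⟨v, w, g, Or.inl ⟨hs, rfl⟩, hg, hw, rfl⟩⟩
  · exact ⟨s, s, u, P, .only s v, hu, ⟨hP, Or.inr (Or.inr ⟨hs, le_rfl,
      Or.inl ⟨v, (stepTwoAccepts_iff hd).2 hv, rfl⟩⟩)⟩, Or.inl ⟨v, w, g, Or.inr rfl, hg, hw, rfl⟩⟩

/-- The cases s = 0, s > k and s ≤ k of the algorithm; in the last one the algorithm may succeed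
with fewer vectors than the dimension of the range, which also counts as failure. -/
theorem decompositionResult_none {d p k s : ℕ} (hd : 2 ≤ d)
    {f : Fin p → MvPolynomial (Fin n) F} {T : (Fin n → F) ⊗[F] W} {u : Fin k → Fin n → F}
    {P : Fin s → TensorPow F n d} {ω : Fin 2 → Fin n → F}
    (hu : IsBasisOf u (LinearMap.range (tensorToV T))) (hP : IsStepOneBasis d f u P)
    (h : ¬ (s = k ∧ ∃ v, SeparatesPowers P (firstEntries s (ω 0)) (firstEntries s (ω 1)) v)) :
    DecompositionResult d f T ω none := by
  by_cases hs : s = 0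
  · refine ⟨k, s, u, P, .trivial, hu, ⟨hP, Or.inl ⟨hs, rfl⟩⟩,
      Or.inr ⟨Or.inr (Or.inl ⟨fun hk => h ?_, rfl⟩), rfl⟩⟩
    -- For k = s = 0 the empty decomposition is separated, so this case is excluded by `h`.
    subst hs
    exact ⟨hk.symm, Fin.elim0, linearIndependent_empty_type, Fin.elim0,
      linearIndependent_empty_type, fun a => a.elim0, fun a => a.elim0, fun a => a.elim0,
      fun a => a.elim0⟩
  by_cases hks : k < s
  · exact ⟨k, s, u, P, .fail, hu, ⟨hP, Or.inr (Or.inl ⟨hs, hks, rfl⟩)⟩,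
      Or.inr ⟨Or.inl rfl, rfl⟩⟩
  by_cases hv : ∃ v, StepTwoAccepts P (firstEntries s (ω 0)) (firstEntries s (ω 1)) v
  · obtain ⟨v, hv⟩ := hv
    exact ⟨k, s, u, P, .only s v, hu, ⟨hP, Or.inr (Or.inr ⟨hs, not_lt.1 hks,
      Or.inl ⟨v, hv, rfl⟩⟩)⟩, Or.inr ⟨Or.inr (Or.inr ⟨s, v,
        fun hsk => h ⟨hsk, v, (stepTwoAccepts_iff hd).1 hv⟩, rfl⟩), rfl⟩⟩
  · exact ⟨k, s, u, P, .fail, hu, ⟨hP, Or.inr (Or.inr ⟨hs, not_lt.1 hks, Or.inr ⟨hv, rfl⟩⟩)⟩,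
      Or.inr ⟨Or.inl rfl, rfl⟩⟩

/-- The P_l span S^d(U) ∩ I_d^⊥ and are combinations of the v_a^{⊗d}, so the identity behind
uniqueness holds without any genericity assumption. -/
theorem SeparatesPowers.isUnique {d p k s m : ℕ} (hd : 2 ≤ d)
    {f : Fin p → MvPolynomial (Fin n) F} (hf : ∀ l, (f l).IsHomogeneous d)
    {X : Set (Fin n → F)} (hX : X = {v | ∀ l, MvPolynomial.eval v (f l) = 0})
    (b : Module.Basis (Fin m) F W) {T : (Fin n → F) ⊗[F] W} {u : Fin k → Fin n → F}
    {P : Fin s → TensorPow F n d} {φ ψ : Fin s → F}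
    (hu : IsBasisOf u (LinearMap.range (tensorToV T))) (hP : IsStepOneBasis d f u P)
    {v : Fin s → Fin n → F} {w : Fin s → W} {g : Fin s → Module.Dual F (Fin n → F)} (hsk : s = k)
    (hv : SeparatesPowers P φ ψ v) (hvU : ∀ a, v a ∈ LinearMap.range (tensorToV T))
    (hvX : ∀ a l, MvPolynomial.eval (v a) (f l) = 0)
    (hg : ∀ a b, g a (v b) = if a = b then 1 else 0) (hw : ∀ a, w a = tensorToW T (g a)) :
    IsUniqueXWRankDecomposition X T v w := by
  subst hsk
  have hspan := hu.span_eq hv.1 hvU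
  have hT : T = ∑ a, v a ⊗ₜ[F] w a := by
    simp only [hw]
    exact tensor_eq_sum_dual b hspan.ge hg
  refine isUniqueXWRankDecomposition_of_span hd hf hX hv.1
    (linearIndependent_of_range_tensorToV hv.1 (by rw [← hT, hspan]))
    (fun a => by rw [hX]; exact hvX a) ?_ hT
  rw [hspan, ← hu.2, ← hP.2, Submodule.span_le]
  rintro _ ⟨l, rfl⟩
  obtain ⟨-, z, -, hz, -⟩ := hv
  rw [hz]
  exact Submodule.sum_mem _ fun a _ => Submodule.smul_mem _ _ (Submodule.subset_span ⟨a, rfl⟩)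

end Certification

/-! ### Random functionals -/

section Random

open MeasureTheory

variable {F : Type*} [RCLike F] [MeasurableSpace F] [BorelSpace F] {n : ℕ}

/-- The bad vectors form the kernel of a nonzero functional, which has measure zero. Scalars are
restricted to ℝ to treat both fields as real vector spaces. -/
theorem ae_firstEntries_dotProduct_ne {s : ℕ} (hs : s ≤ n) {y : Fin s → F} (hy : y ≠ 0)
    (μ : Measure (Fin n → F)) [μ.IsAddHaarMeasure] : ∀ᵐ x ∂μ, firstEntries s x ⬝ᵥ y ≠ 0 := by
  let Φ : (Fin n → F) →ₗ[F] F :=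
    { toFun := fun x => firstEntries s x ⬝ᵥ y
      map_add' := fun x x' => by
        rw [← add_dotProduct]
        congr 1
        funext i
        simp only [firstEntries, Pi.add_apply]
        split_ifs <;> simp
      map_smul' := fun c x => by
        rw [RingHom.id_apply, ← smul_dotProduct]
        congr 1
        funext i
        simp only [firstEntries, Pi.smul_apply]
        split_ifs <;> simp }
  obtain ⟨a, ha⟩ := Function.ne_iff.1 hy
  have hne : LinearMap.ker (Φ.restrictScalars ℝ) ≠ ⊤ := by
    intro h
    refine ha ?_
    have h1 : (Pi.single ⟨a, by omega⟩ 1 : Fin n → F) ∈ LinearMap.ker (Φ.restrictScalars ℝ) := by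
      rw [h]; trivial
    have h2 : firstEntries s (Pi.single ⟨a, by omega⟩ 1 : Fin n → F) = Pi.single a 1 := by
      funext i
      rw [firstEntries, dif_pos (by omega)]
      by_cases hia : i = a
      · subst hia; simp
      · rw [Pi.single_eq_of_ne hia, Pi.single_eq_of_ne]
        exact fun h => hia (Fin.ext (Fin.mk.inj h))
    have h3 : firstEntries s (Pi.single ⟨a, by omega⟩ 1 : Fin n → F) ⬝ᵥ y = 0 := h1
    rwa [h2, single_one_dotProduct] at h3
  have := Measure.addHaar_submodule μ (LinearMap.ker (Φ.restrictScalars ℝ)) hne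
  rw [ae_iff]
  convert this using 2
  ext x
  simp [Φ]

/-- Fubini's theorem; Haar measure on the pairs is absolutely continuous with respect to the product
measure. -/
theorem ae_addHaar_of_ae_ae {p : (Fin 2 → Fin n → F) → Prop} (hp : MeasurableSet {ω | p ω})
    (h : ∀ᵐ x ∂(Measure.addHaar : Measure (Fin n → F)),
      ∀ᵐ y ∂(Measure.addHaar : Measure (Fin n → F)), p ![x, y]) :
    ∀ᵐ ω ∂(Measure.addHaar : Measure (Fin 2 → Fin n → F)), p ω := by
  set μ : Measure (Fin n → F) := Measure.addHaar
  have hpres := measurePreserving_finTwoArrow μ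
  have h1 : ∀ᵐ z ∂(μ.prod μ), p (MeasurableEquiv.finTwoArrow.symm z) := by
    rw [Measure.ae_prod_iff_ae_ae]
    · exact h
    · exact MeasurableEquiv.finTwoArrow.symm.measurable hp
  have h2 : ∀ᵐ ω ∂(Measure.pi fun _ : Fin 2 => μ), p ω := by
    have := hpres.quasiMeasurePreserving.ae h1
    filter_upwards [this] with ω hω
    convert hω using 1
    funext i
    fin_cases i <;> rfl
  exact (Measure.absolutelyContinuous_isAddHaarMeasure _ _).ae_le h2

theorem continuous_firstEntries_dotProduct {F : Type*} [RCLike F] {n s : ℕ} (y : Fin s → F) :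
    Continuous fun x : Fin n → F => firstEntries s x ⬝ᵥ y := by
  refine continuous_finsetSum _ fun i _ => Continuous.mul ?_ continuous_const
  unfold firstEntries
  by_cases h : (i : ℕ) < n
  · simp only [dif_pos h]; fun_prop
  · simp only [dif_neg h]; fun_prop

/-- Random functionals separate the terms of a decomposition. -/
theorem ae_separatesPowers {d s : ℕ} (hs : s ≤ n) {P : Fin s → TensorPow F n d}
    {v : Fin s → Fin n → F} (hv : LinearIndependent F v) {z : Fin s → Fin s → F}
    (hz : LinearIndependent F z) (hP : ∀ l, P l = ∑ a, z a l • tensorPower d (v a)) :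
    ∀ᵐ ω ∂(Measure.addHaar : Measure (Fin 2 → Fin n → F)),
      SeparatesPowers P (firstEntries s (ω 0)) (firstEntries s (ω 1)) v := by
  -- Distinctness of the ratios is stated as non-vanishing cross products. For fixed φ with all
  -- φ·z_a ≠ 0 these are nonzero functionals of ψ, since z_a and z_b are independent.
  have key : ∀ᵐ ω ∂(Measure.addHaar : Measure (Fin 2 → Fin n → F)),
      (∀ a, firstEntries s (ω 0) ⬝ᵥ z a ≠ 0) ∧ (∀ a, firstEntries s (ω 1) ⬝ᵥ z a ≠ 0) ∧
      ∀ a b, a ≠ b → (firstEntries s (ω 0) ⬝ᵥ z a) * (firstEntries s (ω 1) ⬝ᵥ z b) -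
        (firstEntries s (ω 0) ⬝ᵥ z b) * (firstEntries s (ω 1) ⬝ᵥ z a) ≠ 0 := by
    refine ae_addHaar_of_ae_ae ?_ ?_
    · have hc : ∀ (i : Fin 2) (a : Fin s), Measurable fun ω : Fin 2 → Fin n → F =>
          firstEntries s (ω i) ⬝ᵥ z a := fun i a =>
        ((continuous_firstEntries_dotProduct (z a)).comp (continuous_apply i)).measurable
      have hm : ∀ {g : (Fin 2 → Fin n → F) → F}, Measurable g → MeasurableSet {ω | g ω ≠ 0} :=
        fun hg => (measurableSet_eq_fun hg measurable_const).compl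
      simp only [Set.ofPred_and, Set.ofPred_forall]
      refine (MeasurableSet.iInter fun a => hm (hc 0 a)).inter
        ((MeasurableSet.iInter fun a => hm (hc 1 a)).inter
        (MeasurableSet.iInter fun a => MeasurableSet.iInter fun b => MeasurableSet.iInter fun _ =>
          hm (((hc 0 a).mul (hc 1 b)).sub ((hc 0 b).mul (hc 1 a)))))
    · have h1 := ae_all_iff.2 fun a => ae_firstEntries_dotProduct_ne hs (hz.ne_zero a)
        (Measure.addHaar : Measure (Fin n → F))
      filter_upwards [h1] with x hx
      have h2 : ∀ᵐ y ∂(Measure.addHaar : Measure (Fin n → F)), ∀ a b, a ≠ b →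
          firstEntries s y ⬝ᵥ ((firstEntries s x ⬝ᵥ z a) • z b -
            (firstEntries s x ⬝ᵥ z b) • z a) ≠ 0 := by
        refine ae_all_iff.2 fun a => ae_all_iff.2 fun b => ae_all_iff.2 fun hab => ?_
        refine ae_firstEntries_dotProduct_ne hs ?_ _
        intro h0
        have := Fintype.linearIndependent_iff.1 hz
          (fun c => if c = b then firstEntries s x ⬝ᵥ z a else
            if c = a then - (firstEntries s x ⬝ᵥ z b) else 0) ?_ b
        · simp only [if_true] at this
          exact hx a this
        · rw [← h0, ← Finset.add_sum_erase _ _ (Finset.mem_univ b), if_pos rfl,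
            ← Finset.add_sum_erase _ _ (Finset.mem_erase.2 ⟨hab, Finset.mem_univ a⟩),
            if_neg hab, if_pos rfl, Finset.sum_eq_zero, add_zero, neg_smul, sub_eq_add_neg]
          intro c hc
          simp only [Finset.mem_erase] at hc
          rw [if_neg hc.2.1, if_neg hc.1, zero_smul]
      filter_upwards [h1, h2] with y hy1 hy2
      refine ⟨hx, hy1, fun a b hab => ?_⟩
      have := hy2 a b hab
      rwa [dotProduct_sub, dotProduct_smul, dotProduct_smul, smul_eq_mul, smul_eq_mul] at this
  filter_upwards [key] with ω ⟨h1, h2, h3⟩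
  refine ⟨hv, z, hz, hP, h1, h2, fun a b hab => ?_⟩
  by_contra hne
  refine h3 a b hne ?_
  have := (div_eq_div_iff (h2 a) (h2 b)).1 hab
  rw [this, sub_self]

end Random


/-! ### Generic decompositions -/

section Generic

open MeasureTheory

variable {F : Type*} [RCLike F] {n : ℕ}

/-- A slice of v^{⊗d} at a coordinate where v is nonzero is a nonzero multiple of v. -/
theorem mem_of_tensorPower_mem_symPower {d : ℕ} (hd : 2 ≤ d) {U : Submodule F (Fin n → F)}
    {v : Fin n → F} (h : tensorPower d v ∈ symPower d U) : v ∈ U := by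
  by_cases hv : v = 0
  · rw [hv]; exact U.zero_mem
  obtain ⟨x, hx⟩ := Function.ne_iff.1 hv
  have h1 := splitFirst_col_mem (by omega) h fun _ => x
  have h2 : (fun i => splitFirst (tensorPower d v) i fun _ => x) = v x ^ (d - 1) • v := by
    funext i
    rw [splitFirst_tensorPower (by omega)]
    simp [tensorPower, pureTensor, mul_comm]
  rw [h2] at h1
  exact (U.smul_mem_iff (pow_ne_zero _ hx)).1 h1

/-- The coefficients that express one basis in another are linearly independent. -/
theorem exists_linearIndependent_coefficients {E : Type*} [AddCommGroup E] [Module F E] {R : ℕ}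
    {P q : Fin R → E} (hq : LinearIndependent F q)
    (h : Submodule.span F (Set.range P) = Submodule.span F (Set.range q)) :
    ∃ z : Fin R → Fin R → F, LinearIndependent F z ∧ ∀ l, P l = ∑ a, z a l • q a := by
  have h1 : ∀ l, ∃ c : Fin R → F, ∑ a, c a • q a = P l := fun l =>
    (Submodule.mem_span_range_iff_exists_fun F).1 (h ▸ Submodule.subset_span ⟨l, rfl⟩)
  have h2 : ∀ a, ∃ c : Fin R → F, ∑ l, c l • P l = q a := fun a =>
    (Submodule.mem_span_range_iff_exists_fun F).1 (h ▸ Submodule.subset_span ⟨a, rfl⟩)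
  choose z hz using h1
  choose y hy using h2
  refine ⟨fun a l => z l a, ?_, fun l => (hz l).symm⟩
  have hyz : ∀ a b, ∑ l, y a l * z l b = if b = a then 1 else 0 := by
    intro a b
    have h3 : ∑ b, (∑ l, y a l * z l b) • q b = ∑ b, (if b = a then (1 : F) else 0) • q b := by
      rw [show ∑ b, (if b = a then (1 : F) else 0) • q b = q a by simp]
      conv_rhs => rw [← hy a]
      simp only [← hz, Finset.smul_sum, Finset.sum_smul, smul_smul]
      rw [Finset.sum_comm]
    exact sub_eq_zero.1 (Fintype.linearIndependent_iff.1 hq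
      (fun b => (∑ l, y a l * z l b) - if b = a then (1 : F) else 0)
      (by simp only [sub_smul, Finset.sum_sub_distrib, h3, sub_self]) b)
  rw [Fintype.linearIndependent_iff]
  intro c hc a
  have h4 : ∑ l, y a l * (∑ b, c b • fun l => z l b) l = c a := by
    simp only [Finset.sum_apply, Pi.smul_apply, smul_eq_mul, Finset.mul_sum]
    rw [Finset.sum_comm]
    simp only [mul_left_comm _ (c _), ← Finset.mul_sum, hyz]
    simp
  rw [← h4, hc]
  simp

variable {W : Type*} [AddCommGroup W] [Module F W] {d p R : ℕ} {f : Fin p → MvPolynomial (Fin n) F}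
  {v : Fin R → Fin n → F}

/-- In the first step the algorithm finds a basis of the span of the powers of the `v_a`. -/
theorem IsStepOneBasis.length_eq (hd : 2 ≤ d) (hv : LinearIndependent F v)
    (hS : symPower d (Submodule.span F (Set.range v)) ⊓ formAnnihilator d f =
      Submodule.span F (Set.range fun a => tensorPower d (v a)))
    {k s : ℕ} {u : Fin k → Fin n → F} (hu : IsBasisOf u (Submodule.span F (Set.range v)))
    {P : Fin s → TensorPow F n d} (hP : IsStepOneBasis d f u P) :
    s = R ∧ Submodule.span F (Set.range P) =
      Submodule.span F (Set.range fun a => tensorPower d (v a)) := by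
  rw [IsStepOneBasis, hu.2, hS] at hP
  refine ⟨?_, hP.2⟩
  rw [← hP.finrank_eq, finrank_span_eq_card (linearIndependent_tensorPower (by omega) hv),
    Fintype.card_fin]

/-- The vectors found by the algorithm are the `v_a` up to order and scale. -/
theorem SeparatesPowers.exists_perm (hd : 2 ≤ d) (hv : LinearIndependent F v)
    (hS : symPower d (Submodule.span F (Set.range v)) ⊓ formAnnihilator d f =
      Submodule.span F (Set.range fun a => tensorPower d (v a)))
    {P : Fin R → TensorPow F n d} (hP : Submodule.span F (Set.range P) =
      Submodule.span F (Set.range fun a => tensorPower d (v a)))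
    {φ ψ : Fin R → F} {v' : Fin R → Fin n → F} (h : SeparatesPowers P φ ψ v') :
    ∃ (τ : Equiv.Perm (Fin R)) (c : Fin R → F), ∀ a, c a ≠ 0 ∧ v' a = c a • v (τ a) := by
  have h1 : ∀ a, ∃ (b : Fin R) (c : F), c ≠ 0 ∧ v' a = c • v b := by
    intro a
    have h2 := h.tensorPower_mem_span a
    rw [hP] at h2
    exact exists_eq_smul_of_tensorPower_mem_span hd hv
      (mem_of_tensorPower_mem_symPower hd (hS.ge h2).1) (h.1.ne_zero a) h2
  choose τ c hc h2 using h1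
  have hinj : Function.Injective τ := by
    intro a b hab
    refine h.1.eq_of_smul_eq (c := c b) (c' := c a) (hc b) ?_
    rw [h2, h2, hab, smul_smul, smul_smul, mul_comm]
  exact ⟨Equiv.ofBijective τ (Finite.injective_iff_bijective.1 hinj), c, fun a => ⟨hc a, h2 a⟩⟩

/-- On a subspace spanned by the `v_a`, with separating functionals, the algorithm returns the
`v_a` up to order and scale. -/
theorem intersectionAlgorithm_recovers (hd : 2 ≤ d) (hv : LinearIndependent F v)
    (hS : symPower d (Submodule.span F (Set.range v)) ⊓ formAnnihilator d f =
      Submodule.span F (Set.range fun a => tensorPower d (v a)))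
    {u : Fin R → Fin n → F} {P : Fin R → TensorPow F n d} (hP : IsStepOneBasis d f u P)
    (hPv : Submodule.span F (Set.range P) =
      Submodule.span F (Set.range fun a => tensorPower d (v a)))
    {ω : Fin 2 → Fin n → F}
    (hω : SeparatesPowers P (firstEntries R (ω 0)) (firstEntries R (ω 1)) v) :
    (∃ o, IntersectionAlgorithm f u P ω o) ∧ ∀ o, IntersectionAlgorithm f u P ω o →
      (R = 0 ∧ o = .trivial) ∨
      (0 < R ∧ ∃ (v' : Fin R → Fin n → F) (τ : Equiv.Perm (Fin R)) (c : Fin R → F),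
        o = .only R v' ∧ ∀ a, c a ≠ 0 ∧ v' a = c a • v (τ a)) := by
  constructor
  · by_cases hR : R = 0
    · exact ⟨.trivial, hP, Or.inl ⟨hR, rfl⟩⟩
    · exact ⟨.only R v, hP, Or.inr (Or.inr ⟨hR, le_rfl,
        Or.inl ⟨v, (stepTwoAccepts_iff hd).2 hω, rfl⟩⟩)⟩
  · rintro o ⟨-, ⟨hR, rfl⟩ | ⟨-, h, -⟩ | ⟨hR, -, ⟨v', hv', rfl⟩ | ⟨h, -⟩⟩⟩
    · exact Or.inl ⟨hR, rfl⟩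
    · exact absurd h (lt_irrefl _)
    · obtain ⟨τ, c, h⟩ := ((stepTwoAccepts_iff hd).1 hv').exists_perm hd hv hS hPv
      exact Or.inr ⟨Nat.pos_of_ne_zero hR, v', τ, c, rfl, h⟩
    · exact absurd ⟨v, (stepTwoAccepts_iff hd).2 hω⟩ h

end Generic

/-! ### Numerical estimates -/

section Numerical

theorem Nat.multichoose_le_pow (n k : ℕ) : n.multichoose k ≤ n ^ k := by
  induction k generalizing n with
  | zero => simp
  | succ k ih =>
    induction n with
    | zero => simp
    | succ n ihn =>
      rw [Nat.multichoose_succ_succ, pow_succ, mul_add, mul_one]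
      refine add_le_add (ihn.trans ?_) (ih _)
      rw [pow_succ]
      exact Nat.mul_le_mul_right _ (Nat.pow_le_pow_left n.le_succ _)

variable {n d p R : ℕ} {δ : ℝ}

theorem formCount_le_pow (hδ : δ < 1) (hp : (p : ℝ) = δ * ((n + d - 1).choose d : ℝ)) :
    p ≤ n ^ d := by
  have h1 : p ≤ (n + d - 1).choose d := by
    have : (p : ℝ) ≤ ((n + d - 1).choose d : ℝ) := by
      rw [hp]
      exact mul_le_of_le_one_left (Nat.cast_nonneg _) hδ.le
    exact_mod_cast this
  rw [← Nat.multichoose_eq] at h1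
  exact h1.trans (Nat.multichoose_le_pow n d)

/-- There are no forms as required on a line. -/
theorem two_le_dim (hn : 0 < n) (hδ0 : 0 < δ) (hδ : δ < 1)
    (hp : (p : ℝ) = δ * ((n + d - 1).choose d : ℝ)) : 2 ≤ n := by
  by_contra h
  obtain rfl : n = 1 := by omega
  rw [Nat.add_sub_cancel_left, Nat.choose_self, Nat.cast_one, mul_one] at hp
  rw [← hp] at hδ0 hδ
  have h1 : 0 < p := by exact_mod_cast hδ0
  have h2 : p < 1 := by exact_mod_cast hδ
  omega

/-- R d! ≤ n + d - 1 ≤ n d ≤ n d!. -/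
theorem rank_le_dim (hn : 0 < n) (hd : 2 ≤ d) (hδ : δ < 1)
    (hR : (R : ℝ) ≤ δ / (d.factorial : ℝ) * ((n : ℝ) + d - 1)) : R ≤ n := by
  have hn' : (1 : ℝ) ≤ n := by exact_mod_cast hn
  have hd' : (2 : ℝ) ≤ d := by exact_mod_cast hd
  have hdf : (d : ℝ) ≤ d.factorial := by exact_mod_cast Nat.self_le_factorial d
  have hf0 : (0 : ℝ) < d.factorial := by linarith
  have h1 : (R : ℝ) * d.factorial ≤ n * d.factorial := by
    have h2 : (R : ℝ) * d.factorial ≤ δ * ((n : ℝ) + d - 1) := by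
      calc (R : ℝ) * d.factorial ≤ δ / (d.factorial : ℝ) * ((n : ℝ) + d - 1) * d.factorial :=
            mul_le_mul_of_nonneg_right hR hf0.le
        _ = δ * ((n : ℝ) + d - 1) := by field_simp
    calc (R : ℝ) * d.factorial ≤ δ * ((n : ℝ) + d - 1) := h2
      _ ≤ 1 * ((n : ℝ) + d - 1) := mul_le_mul_of_nonneg_right hδ.le (by linarith)
      _ ≤ n * d := by nlinarith
      _ ≤ n * d.factorial := by gcongr
  exact_mod_cast le_of_mul_le_mul_right h1 hf0

/-- The identity d C(n+d-1, d) = (n+d-1) C(n+d-2, d-1) turns the assumption on R into the dimension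
that `exists_surjCoeff` needs for k = d. -/
theorem rank_bound (hd : 2 ≤ d) (hn : 0 < n) (hp : (p : ℝ) = δ * ((n + d - 1).choose d : ℝ))
    (hR : (R : ℝ) ≤ δ / (d.factorial : ℝ) * ((n : ℝ) + d - 1)) :
    (d - 1).factorial * R * (n + (d - 1) - 1).choose (d - 1) ≤ p := by
  obtain ⟨e, rfl⟩ := Nat.exists_eq_add_of_le' (show 1 ≤ d by omega)
  obtain ⟨l, rfl⟩ := Nat.exists_eq_add_of_le' hn
  have hc : ((l + 1 + e).choose (e + 1) : ℝ) * (e + 1) = (l + 1 + e) * ((l + e).choose e : ℝ) := by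
    have := Nat.add_one_mul_choose_eq (l + e) e
    have h' : (((l + e + 1) * (l + e).choose e : ℕ) : ℝ) =
        (((l + e + 1).choose (e + 1) * (e + 1) : ℕ) : ℝ) := by exact_mod_cast this
    push_cast at h'
    rw [show l + 1 + e = l + e + 1 by ring]
    linarith
  have hfac : ((e + 1).factorial : ℝ) = (e + 1) * e.factorial := by
    rw [Nat.factorial_succ]; push_cast; ring
  have he : (0 : ℝ) < e.factorial := by exact_mod_cast e.factorial_pos
  rw [show l + 1 + (e + 1) - 1 = l + 1 + e by omega] at hp
  rw [show l + 1 + (e + 1 - 1) - 1 = l + e by omega, Nat.add_sub_cancel]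
  have key : ((e.factorial * R * (l + e).choose e : ℕ) : ℝ) ≤ p := by
    push_cast at hR ⊢
    rw [hfac] at hR
    calc (e.factorial : ℝ) * R * (l + e).choose e
        ≤ e.factorial * (δ / ((e + 1) * e.factorial) * (l + 1 + (e + 1) - 1)) *
          (l + e).choose e := by gcongr
      _ = δ / (e + 1) * ((l + 1 + e) * (l + e).choose e) := by field_simp; ring
      _ = p := by rw [← hc, hp]; field_simp
  exact_mod_cast key

/-- If m ≤ n^d then 8(n^d + m) ≤ 16 n^d ≤ n^{3d}, as n, d ≥ 2. Otherwise m > n^d ≥ 4 and 8(n^d + m)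
≤ 16 m ≤ m^3. -/
theorem time_bound (hn : 2 ≤ n) (hd : 2 ≤ d) (m D : ℕ) :
    (8 * (n ^ d + m)) ^ D ≤ n ^ ((3 * D + 1) * d) + m ^ (3 * D + 1) := by
  rcases le_or_gt m (n ^ d) with h | h
  · have h1 : 8 * (n ^ d + m) ≤ n ^ (3 * d) := by
      have h2 : 16 ≤ n ^ (2 * d) :=
        calc 16 = 2 ^ 4 := by norm_num
          _ ≤ n ^ 4 := Nat.pow_le_pow_left hn 4
          _ ≤ n ^ (2 * d) := Nat.pow_le_pow_right (by omega) (by omega)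
      calc 8 * (n ^ d + m) ≤ 16 * n ^ d := by omega
        _ ≤ n ^ (2 * d) * n ^ d := Nat.mul_le_mul_right _ h2
        _ = n ^ (3 * d) := by rw [← pow_add]; congr 1; ring
    calc (8 * (n ^ d + m)) ^ D ≤ (n ^ (3 * d)) ^ D := Nat.pow_le_pow_left h1 D
      _ = n ^ (3 * d * D) := (pow_mul _ _ _).symm
      _ ≤ n ^ ((3 * D + 1) * d) := Nat.pow_le_pow_right (by omega) (by nlinarith)
      _ ≤ _ := Nat.le_add_right _ _
  · have h4 : 4 ≤ m :=
      calc 4 = 2 ^ 2 := by norm_num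
        _ ≤ n ^ 2 := Nat.pow_le_pow_left hn 2
        _ ≤ n ^ d := Nat.pow_le_pow_right (by omega) hd
        _ ≤ m := h.le
    have h1 : 8 * (n ^ d + m) ≤ m ^ 3 := by
      calc 8 * (n ^ d + m) ≤ 4 * 4 * m := by omega
        _ ≤ m * m * m := by gcongr
        _ = m ^ 3 := by ring
    calc (8 * (n ^ d + m)) ^ D ≤ (m ^ 3) ^ D := Nat.pow_le_pow_left h1 D
      _ = m ^ (3 * D) := (pow_mul _ _ _).symm
      _ ≤ m ^ (3 * D + 1) := Nat.pow_le_pow_right (by omega) (by omega)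
      _ ≤ _ := Nat.le_add_left _ _

end Numerical


/-! ### The main theorem -/

theorem theorem1p4 {F : Type*} [RCLike F] [MeasurableSpace F] [BorelSpace F] :
    ∃ (prog : MachineProgram) (C : ℕ),
      ∀ (n d p : ℕ) (δ : ℝ) (f : Fin p → MvPolynomial (Fin n) F) (X : Set (Fin n → F)),
        0 < n → 2 ≤ d → 0 < δ → δ < 1 →
        (p : ℝ) = δ * ((n + d - 1).choose d : ℝ) →
        (∀ l, (f l).IsHomogeneous d) → LinearIndependent F f →
        X = {v | ∀ l, MvPolynomial.eval v (f l) = 0} →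
        ZariskiIrreducible X → NonDegenerateOfOrder X (d - 1) →
        -- running time and correctness, on every input
        (∀ (W : Type*) [AddCommGroup W] [Module F W] (m : ℕ) (b : Module.Basis (Fin m) F W)
          (T : (Fin n → F) ⊗[F] W) (ω : Fin 2 → Fin n → F) (O : DiagFunction F),
          IsDiagOracle O →
          ∃ (σ : MachineState F) (t q : ℕ),
            Exec O prog (inputState d f b T ω) σ t q ∧
            t ≤ n ^ (C * d) + m ^ C ∧ q ≤ C ∧
            -- the program runs the intersection algorithm on `T(W*)`
            DecompositionResult d f T ω (outputOf n b σ) ∧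
            -- an output other than "Fail" is certified to be unique
            (∀ (r : ℕ) (v : Fin r → Fin n → F) (w : Fin r → W),
              outputOf n b σ = some ⟨r, v, w⟩ → IsUniqueXWRankDecomposition X T v w)) ∧
        -- uniqueness and recovery, for generic `v_1, …, v_R` and linearly independent `w_1, …, w_R`
        (∀ R : ℕ, (R : ℝ) ≤ δ / (d.factorial : ℝ) * ((n : ℝ) + d - 1) →
          ForGenericTuple X R fun v =>
            ∀ (W : Type*) [AddCommGroup W] [Module F W] (m : ℕ) (b : Module.Basis (Fin m) F W)
              (w : Fin R → W) (T : (Fin n → F) ⊗[F] W),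
              R ≤ Module.finrank F W → LinearIndependent F w → T = ∑ a, v a ⊗ₜ[F] w a →
              IsUniqueXWRankDecomposition X T v w ∧
              -- on any basis of `T(W*)`, and whichever basis it chooses in its first step, the
              -- intersection algorithm almost surely returns `v_1, …, v_R` up to order and scale
              (∀ u : Fin R → Fin n → F, IsBasisOf u (LinearMap.range (tensorToV T)) →
                ∀ (s : ℕ) (P : Fin s → TensorPow F n d), IsStepOneBasis d f u P →
                ∀ᵐ ω ∂(MeasureTheory.Measure.addHaar :
                    MeasureTheory.Measure (Fin 2 → Fin n → F)),
                  (∃ o, IntersectionAlgorithm f u P ω o) ∧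
                  ∀ o, IntersectionAlgorithm f u P ω o →
                    (R = 0 ∧ o = .trivial) ∨
                    (0 < R ∧ ∃ (v' : Fin R → Fin n → F) (τ : Equiv.Perm (Fin R)) (c : Fin R → F),
                      o = .only R v' ∧ ∀ a, c a ≠ 0 ∧ v' a = c a • v (τ a))) ∧
              -- the program almost surely outputs the decomposition
              (∀ O : DiagFunction F, IsDiagOracle O →
                ∀ᵐ ω ∂(MeasureTheory.Measure.addHaar :
                    MeasureTheory.Measure (Fin 2 → Fin n → F)),
                  ∃ (σ : MachineState F) (t q : ℕ) (v' : Fin R → Fin n → F) (w' : Fin R → W),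
                    Exec O prog (inputState d f b T ω) σ t q ∧
                    outputOf n b σ = some ⟨R, v', w'⟩ ∧ SameSummands v w v' w')) := by
  have hcalls : mainProg.calls = 1 := rfl
  -- The exponent is an explicit but large number; naming it keeps it from being computed. The
  -- summand 1 in 3 D + 1 covers the oracle call.
  obtain ⟨D, hD⟩ : ∃ D, mainProg.deg = D := ⟨_, rfl⟩
  refine ⟨mainProg, 3 * D + 1, ?_⟩
  intro n d p δ f X hn hd hδ0 hδ hp hf hfli hX hirr hnd
  have hn2 := two_le_dim hn hδ0 hδ hp
  have hdN : d ≤ n ^ d := (Nat.lt_pow_self (by omega)).le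
  have hpN := formCount_le_pow hδ hp
  refine ⟨?_, ?_⟩
  · intro W _ _ m b T ω O hO
    obtain ⟨k, s, u, P, hu, hP, hrun⟩ := exists_exec_mainProg hn hd hdN hpN hf b T
    obtain ⟨σ, t, q, hexec, ht, hq, hres⟩ := hrun ω O hO
    rw [hD] at ht
    rw [hcalls] at hq
    refine ⟨σ, t, q, hexec, ht.trans (time_bound hn2 hd m D), by omega, ?_⟩
    rcases hres with ⟨hnone, hne⟩ | ⟨v, w, g, hout, hsk, hv, hvU, hvX, hg, hw⟩
    · rw [hnone]
      exact ⟨decompositionResult_none hd hu hP hne, fun r v w h => by cases h⟩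
    · rw [hout]
      refine ⟨decompositionResult_of_separatesPowers hd hu hP hsk hv hg hw, ?_⟩
      rintro r v' w' ⟨⟩
      exact hv.isUnique hd hf hX b hu hP hsk hvU hvX hg hw
  · intro R hR
    have hRn := rank_le_dim hn hd hδ hR
    obtain ⟨G, hG, hGv⟩ := exists_polynomial_generic hirr.polyPrime hn hd hnd R hRn
      (Submodule.span F (Set.range f))
      (Submodule.span_le.2 (by rintro _ ⟨l, rfl⟩; exact hf l))
      (by rw [finrank_span_eq_card hfli, Fintype.card_fin]; exact rank_bound hd hn hp hR)
    -- The open set is given by a polynomial chosen before W, the w_a and T, so one generic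
    -- condition serves for all of them.
    refine ForGenericTuple.of_polynomial hirr.polyPrime G hG fun v hvX hv => ?_
    obtain ⟨hvli, hsurj⟩ := hGv v hv
    have hvX' : ∀ a l, MvPolynomial.eval (v a) (f l) = 0 := fun a l => by
      have := hvX a
      rw [hX] at this
      exact this l
    have hS := symPower_inf_formAnnihilator_eq (by omega) hf hvli hvX' hsurj
    intro W _ _ m b w T _ hw hT
    have hrange : LinearMap.range (tensorToV T) = Submodule.span F (Set.range v) := by
      rw [hT, range_tensorToV_sum v hw]
    have huniq := isUniqueXWRankDecomposition_of_span hd hf hX hvli hw hvX hS.le hT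
    -- Every basis P of the span of the powers has an invertible coefficient matrix, hence is
    -- separated by almost all φ, ψ. The exceptional null set depends on P, so P is fixed first.
    have hsep : ∀ {P : Fin R → TensorPow F n d}, Submodule.span F (Set.range P) =
        Submodule.span F (Set.range fun a => tensorPower d (v a)) →
        ∀ᵐ ω ∂(MeasureTheory.Measure.addHaar : MeasureTheory.Measure (Fin 2 → Fin n → F)),
          SeparatesPowers P (firstEntries R (ω 0)) (firstEntries R (ω 1)) v := by
      intro P hP
      have hpow := linearIndependent_tensorPower (d := d) (by omega) hvli
      obtain ⟨z, hz, hPz⟩ := exists_linearIndependent_coefficients hpow hP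
      exact ae_separatesPowers hRn hvli hz hPz
    refine ⟨huniq, ?_, ?_⟩
    · intro u hu s P hP
      rw [hrange] at hu
      obtain ⟨rfl, hPv⟩ := hP.length_eq hd hvli hS hu
      filter_upwards [hsep hPv] with ω hω
      exact intersectionAlgorithm_recovers hd hvli hS hP hPv hω
    · intro O hO
      obtain ⟨k, s, u, P, hu, hP, hrun⟩ := exists_exec_mainProg hn hd hdN hpN hf b T
      have hu' := hu
      rw [hrange] at hu'
      obtain ⟨rfl, hPv⟩ := hP.length_eq hd hvli hS hu'
      have hsk : s = k := by
        rw [← hu'.finrank_eq, finrank_span_eq_card hvli, Fintype.card_fin]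
      filter_upwards [hsep hPv] with ω hω
      obtain ⟨σ, t, q, hexec, -, -, hres⟩ := hrun ω O hO
      rcases hres with ⟨-, hne⟩ | ⟨v', w', g, hout, -, hv', hvU, hvX', hg, hw'⟩
      · exact absurd ⟨hsk, v, hω⟩ hne
      -- What the program outputs is a decomposition of length R, so uniqueness identifies it with
      -- the given one.
      · exact ⟨σ, t, q, v', w', hexec, hout, huniq.unique v' w'
          (hv'.isUnique hd hf hX b hu hP hsk hvU hvX' hg hw').isDecomposition⟩
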